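/- Let $R_{p}(\varphi)\in SO(3)$ be the rotation about the axis $p$ by the angle $\varphi$, let $x,z$ be the first and third coordinate axes, $k=\frac1{\sqrt3}(-1,-1,-1)^T$, $p=\frac1{\sqrt3}(1,1,1)^T$, and $g=\frac{1}{\sqrt{\tau^2-2\tau+2}}(\tau-1,0,1)^T$ with $\tau=\frac{1+\sqrt5}{2}$. Consider the following subgroups of $O(3)$, each given by generators. - $\mathcal C_1:1$; $\mathcal C_i:-1$. - $\mathcal C_2:R_z(\pi)$; $\mathcal C_{1h}:-R_z(\pi)$; $\mathcal C_{2h}:-1,R_z(\pi)$. - $\mathcal D_2:R_z(\pi),R_x(\pi)$; $\mathcal C_{2v}:R_z(\pi),-R_x(\pi)$; $\mathcal D_{2h}:-1,R_z(\pi),R_x(\pi)$. - $\mathcal C_4:R_z(\frac\pi2)$; $\mathcal C_{2i}:-R_z(\frac\pi2)$; $\mathcal C_{4h}:-1,R_z(\frac\pi2)$. - $\mathcal D_4:R_z(\frac\pi2),R_x(\pi)$; $\mathcal C_{4v}:R_z(\frac\pi2),-R_x(\pi)$; $\mathcal D_{2d}:-R_z(\frac\pi2),-R_x(\pi)$; $\mathcal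 D_{4h}:-1,R_z(\frac\pi2),R_x(\pi)$. - $\mathcal C_3:R_z(\frac{2\pi}3)$; $\mathcal C_{3i}:-R_z(\frac{2\pi}3)$. - $\mathcal D_3:R_z(\frac{2\pi}3),R_x(\pi)$; $\mathcal C_{3v}:R_z(\frac{2\pi}3),-R_x(\pi)$; $\mathcal D_{3d}:-R_z(\frac{2\pi}3),R_x(\pi)$. - $\mathcal C_6:R_z(\frac\pi3)$; $\mathcal C_{3h}:-R_z(\frac\pi3)$; $\mathcal C_{6h}:-1,R_z(\frac\pi3)$. - $\mathcal D_6:R_z(\frac\pi3),R_x(\pi)$; $\mathcal C_{6v}:R_z(\frac\pi3),-R_x(\pi)$; $\mathcal D_{3h}:-R_z(\frac\pi3),-R_x(\pi)$; $\mathcal D_{6h}:-1,R_z(\frac\pi3),R_x(\pi)$. - $\mathcal T:R_z(\pi),R_k(\frac{2\pi}3)$; $\mathcal T_h:R_z(\pi),-R_k(\frac{2\pi}3)$. - $\mathcal O:R_z(\frac\pi2),R_x(\frac\pi2)$; $\mathcal T_d:-R_z(\frac\pi2),-R_x(\frac\pi2)$; $\mathcal O_h:R_z(\frac\pi2),-R_k(\frac{2\pi}3)$.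 - $\mathcal C_\infty$: all $R_z(\gamma)$; $\mathcal C_{\infty h}$: $-1$ and all $R_z(\gamma)$. - $\mathcal D_\infty$: all $R_z(\gamma)$ and $R_x(\pi)$; $\mathcal C_{\infty v}$: all $R_z(\gamma)$ and $-R_x(\pi)$; $\mathcal D_{\infty h}$: $-1$, all $R_z(\gamma)$ and $R_x(\pi)$. - $\mathcal K=SO(3)$: all $R_z(\gamma),R_x(\alpha)$; $\mathcal K_h=O(3)$: $-1$ and all $R_z(\gamma),R_x(\alpha)$. - $\mathcal I:R_g(\frac{2\pi}5),R_p(\frac{2\pi}3)$; $\mathcal I_h:R_g(\frac{2\pi}5),-R_p(\frac{2\pi}3)$. Each group $\mathcal G$ acts on symmetric second order tensors by $C\mapsto QCQ^T$. Let $\Phi(Q)\in\mathbb R^{6\times6}$ be the matrix of this map in the Kelvin–Mandel coordinates $(C_{11},C_{22},C_{33},\sqrt2C_{23},\sqrt2C_{13},\sqrt2C_{12})$. Let $A=\mathbb R[x_1,\dots,x_6]^{\mathcal G}$ be the ring of polynomials $f$ in these coordinates with $f\circ\Phi(Q)=f$ for all $Q\in\mathcal G$, and $A_d$ its homogeneous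 part of degree $d$. The Molien series of $\mathcal G$ is, for $t\in(-1,1)$, $$\mathscr M_{\mathcal G}(t)=\frac1{|\mathcal G|}\sum_{Q\in\mathcal G}\frac1{\det(1-t\Phi(Q))}\ (\mathcal G\text{ finite}),\qquad \mathscr M_{\mathcal G}(t)=\int_{\mathcal G}\frac{d\mu(Q)}{\det(1-t\Phi(Q))}\ (\mathcal G\text{ infinite}),$$ with $\mu$ the Haar probability measure of the compact group $\mathcal G$. A finite set of homogeneous elements of $A$ is a set of *fundamental invariants* if it generates the algebra $A$ and none of its elements is a polynomial in the others. *Primary invariants* are the elements of a largest algebraically independent subset of some set of fundamental invariants. Given primary invariants $I_1,\dots,I_P$, a set of *secondary invariants* is a finite set of homogeneous $S_j\in A$ such that $A=\bigoplus_j S_j\,\mathbb R[I_1,\dots,I_P]$, each element of $A$ being $\sum_j S_jc_j$ with unique $c_j\in\mathbb R[I_1,\dots,I_P]$. Then all groups in the cylindrical and spherical rows ($\mathcal C_\infty$, $\mathcal D_\infty$, $\mathcal K$) of the following table are infinite and compact, all others are finite, and for every group $\mathcal G$ in a row with rational function $N(t)/D(t)$, list $(b_0,\dots,b_7)$ and numbers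 $(P,S,F)$ the assertions (a)–(c) below hold. | Groups | $N(t)/D(t)$ | $b_0,\dots,b_7$ | $(P,S,F)$ | |---|---|---|---| | $\mathcal C_1,\mathcal C_i$ | $\frac{1}{(1-t)^6}$ | 1,6,21,56,126,252,462,792 | (6,1,6) | | $\mathcal C_2,\mathcal C_{1h},\mathcal C_{2h}$ | $\frac{1+t^2}{(1-t)^4(1-t^2)^2}$ | 1,4,13,32,70,136,246,416 | (6,2,7) | | $\mathcal D_2,\mathcal C_{2v},\mathcal D_{2h}$ | $\frac{1+t^3}{(1-t)^3(1-t^2)^3}$ | 1,3,9,20,42,78,138,228 | (6,2,7) | | $\mathcal C_4,\mathcal C_{2i},\mathcal C_{4h}$ | $\frac{1+t^2+4t^3+t^4+t^6}{(1-t)^2(1-t^2)^3(1-t^4)}$ | 1,2,7,16,36,68,124,208 | (6,8,12) | | $\mathcal D_4,\mathcal C_{4v},\mathcal D_{2d},\mathcal D_{4h}$ | $\frac{1+2t^3+t^6}{(1-t)^2(1-t^2)^3(1-t^4)}$ | 1,2,6,12,25,44,77,124 | (6,4,8) | | $\mathcal C_3,\mathcal C_{3i}$ | $\frac{1+2t^2+6t^3+2t^4+t^6}{(1-t)^2(1-t^2)^2(1-t^3)^2}$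 | 1,2,7,20,42,84,156,264 | (6,12,14) | | $\mathcal D_3,\mathcal C_{3v},\mathcal D_{3d}$ | $\frac{1+t^2+2t^3+t^4+t^6}{(1-t)^2(1-t^2)^2(1-t^3)^2}$ | 1,2,6,14,28,52,93,152 | (6,6,9) | | $\mathcal C_6,\mathcal C_{3h},\mathcal C_{6h}$ | $\frac{1+3t^3+2t^4+2t^5+3t^6+t^9}{(1-t)^2(1-t^2)^2(1-t^3)(1-t^6)}$ | 1,2,5,12,24,46,84,140 | (6,12,14) | | $\mathcal D_6,\mathcal C_{6v},\mathcal D_{3h},\mathcal D_{6h}$ | $\frac{1+t^3+t^4+t^5+t^6+t^9}{(1-t)^2(1-t^2)^2(1-t^3)(1-t^6)}$ | 1,2,5,10,19,33,57,90 | (6,6,9) | | $\mathcal T,\mathcal T_h$ | $\frac{1+3t^3+2t^4+2t^5+3t^6+t^9}{(1-t)(1-t^2)^2(1-t^3)^2(1-t^4)}$ | 1,1,3,8,14,26,48,76 | (6,12,14) | | $\mathcal O,\mathcal T_d,\mathcal O_h$ | $\frac{1+t^3+t^4+t^5+t^6+t^9}{(1-t)(1-t^2)^2(1-t^3)^2(1-t^4)}$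 | 1,1,3,6,11,18,32,48 | (6,6,9) | | $\mathcal C_\infty,\mathcal C_{\infty h}$ | $\frac{1+t^3}{(1-t)^2(1-t^2)^2(1-t^3)}$ | 1,2,5,10,18,30,48,72 | (5,2,6) | | $\mathcal D_\infty,\mathcal C_{\infty v},\mathcal D_{\infty h}$ | $\frac{1}{(1-t)^2(1-t^2)^2(1-t^3)}$ | 1,2,5,9,16,25,39,56 | (5,1,5) | | $\mathcal K,\mathcal K_h$ | $\frac{1}{(1-t)(1-t^2)(1-t^3)}$ | 1,1,2,3,4,5,7,8 | (3,1,3) | | $\mathcal I,\mathcal I_h$ | $\frac{1+t^5+2t^6+t^7+t^{12}}{(1-t)(1-t^2)(1-t^3)^2(1-t^4)(1-t^5)}$ | 1,1,2,4,6,10,17,24 | (6,6,10) | (a) For all $t\in(-1,1)$, $\mathscr M_{\mathcal G}(t)=N(t)/D(t)$; for infinite $\mathcal G$ the integrand is integrable. (b) The Hilbert series $\sum_d\dim(A_d)\,t^d$ of $A$ equals $N(t)/D(t)$, both as a formal power series and as a convergent series for $t\in(-1,1)$, and $\dim A_d=b_d$ for $0\le d\le7$. (c) Every set of fundamental invariants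 has $F$ elements, and every set of primary invariants has $P$ elements. There are primary invariants whose degrees are the exponents $\mu$ of the factors $(1-t^\mu)$ of $D$ (with multiplicity) and which admit a set of secondary invariants containing $1$. Whenever primary invariants of these degrees admit a set of secondary invariants, that set has $S$ elements, the number of those of degree $\lambda$ being the coefficient of $t^\lambda$ in $N$. -/

import Mathlib

namespace TensorInvariants

open MvPolynomial Matrix MeasureTheory

noncomputable section

/-! ### Rotations and point groups -/

/-- The orthogonal group `O(3)`. -/
abbrev O3 : Type := Matrix.orthogonalGroup (Fin 3) ℝ

/-- The rotation about the unit axis `p` by the angle `φ` (Rodrigues' formula):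
`cos φ • 1 + sin φ • [p]ₓ + (1 - cos φ) • p pᵀ`. -/
def rotMatrix (p : Fin 3 → ℝ) (φ : ℝ) : Matrix (Fin 3) (Fin 3) ℝ :=
  Real.cos φ • (1 : Matrix (Fin 3) (Fin 3) ℝ)
    + Real.sin φ • !![0, -p 2, p 1; p 2, 0, -p 0; -p 1, p 0, 0]
    + (1 - Real.cos φ) • vecMulVec p p

theorem rotMatrix_mem (p : Fin 3 → ℝ) (hp : p 0 ^ 2 + p 1 ^ 2 + p 2 ^ 2 = 1) (φ : ℝ) :
    rotMatrix p φ ∈ Matrix.orthogonalGroup (Fin 3) ℝ := by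
  rw [Matrix.mem_orthogonalGroup_iff]
  have hc := Real.sin_sq_add_cos_sq φ
  unfold rotMatrix
  generalize Real.sin φ = s at *
  generalize Real.cos φ = c at *
  have key (i j : Fin 3) (d x : ℝ)
      (h : x - d = (d - p i * p j) * (s ^ 2 + c ^ 2 - 1)
        + (d * s ^ 2 + (1 - c) ^ 2 * (p i * p j)) * (p 0 ^ 2 + p 1 ^ 2 + p 2 ^ 2 - 1)) :
      x = d := by
    rw [hc, hp] at h
    linarith
  ext i j
  apply key i j
  fin_cases i <;> fin_cases j <;>
    simp [Matrix.mul_apply, Fin.sum_univ_three, vecMulVec_apply] <;> ring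

/-- The rotation `R(p, φ)` as an element of `O(3)`. -/
def rot (p : Fin 3 → ℝ) (hp : p 0 ^ 2 + p 1 ^ 2 + p 2 ^ 2 = 1) (φ : ℝ) : O3 :=
  ⟨rotMatrix p φ, rotMatrix_mem p hp φ⟩

/-- Rotation about the `x`-axis. -/
def rotX (φ : ℝ) : O3 := rot ![1, 0, 0] (by simp) φ

/-- Rotation about the `z`-axis. -/
def rotZ (φ : ℝ) : O3 := rot ![0, 0, 1] (by simp) φ

/-- Rotation about the axis `(-1, -1, -1) / √3`. -/
def rotK (φ : ℝ) : O3 :=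
  rot ![-1 / √3, -1 / √3, -1 / √3] (by simp [div_pow]; norm_num) φ

/-- Rotation about the axis `(1, 1, 1) / √3`. -/
def rotP (φ : ℝ) : O3 :=
  rot ![1 / √3, 1 / √3, 1 / √3] (by simp; norm_num) φ

theorem axis_unit (t : ℝ) :
    ((t - 1) / √(t ^ 2 - 2 * t + 2)) ^ 2 + 0 ^ 2 + (1 / √(t ^ 2 - 2 * t + 2)) ^ 2 = 1 := by
  have h : 0 < t ^ 2 - 2 * t + 2 := by nlinarith [sq_nonneg (t - 1)]
  rw [div_pow, div_pow, Real.sq_sqrt h.le, zero_pow two_ne_zero, add_zero, ← add_div,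
    div_eq_one_iff_eq h.ne']
  ring

/-- Rotation about the axis `(τ - 1, 0, 1) / √(τ² - 2τ + 2)`, with `τ` the golden ratio. -/
def rotG (φ : ℝ) : O3 :=
  rot ![(Real.goldenRatio - 1) / √(Real.goldenRatio ^ 2 - 2 * Real.goldenRatio + 2), 0,
      1 / √(Real.goldenRatio ^ 2 - 2 * Real.goldenRatio + 2)] (axis_unit Real.goldenRatio) φ

/-- The group generated by a set of orthogonal transformations. -/
abbrev grp (S : Set O3) : Subgroup O3 := Subgroup.closure S

/-- All rotations about the `z`-axis. -/
def allZ : Set O3 := rotZ '' Set.Ico 0 (2 * Real.pi)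

/-- All rotations about the `x`-axis. -/
def allX : Set O3 := rotX '' Set.Ico 0 (2 * Real.pi)

section PointGroups

open Real

/-! Triclinic. -/
def C1 : Subgroup O3 := grp {1}
def Ci : Subgroup O3 := grp {-1}

/-! Monoclinic. -/
def C2 : Subgroup O3 := grp {rotZ π}
def C1h : Subgroup O3 := grp {-rotZ π}
def C2h : Subgroup O3 := grp {-1, rotZ π}

/-! Rhombic. -/
def D2 : Subgroup O3 := grp {rotZ π, rotX π}
def C2v : Subgroup O3 := grp {rotZ π, -rotX π}
def D2h : Subgroup O3 := grp {-1, rotZ π, rotX π}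

/-! Tetragonal. -/
def C4 : Subgroup O3 := grp {rotZ (π / 2)}
def C2i : Subgroup O3 := grp {-rotZ (π / 2)}
def C4h : Subgroup O3 := grp {-1, rotZ (π / 2)}
def D4 : Subgroup O3 := grp {rotZ (π / 2), rotX π}
def C4v : Subgroup O3 := grp {rotZ (π / 2), -rotX π}
def D2d : Subgroup O3 := grp {-rotZ (π / 2), -rotX π}
def D4h : Subgroup O3 := grp {-1, rotZ (π / 2), rotX π}

/-! Trigonal. -/
def C3 : Subgroup O3 := grp {rotZ (2 * π / 3)}
def C3i : Subgroup O3 := grp {-rotZ (2 * π / 3)}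
def D3 : Subgroup O3 := grp {rotZ (2 * π / 3), rotX π}
def C3v : Subgroup O3 := grp {rotZ (2 * π / 3), -rotX π}
def D3d : Subgroup O3 := grp {-rotZ (2 * π / 3), rotX π}

/-! Hexagonal. -/
def C6 : Subgroup O3 := grp {rotZ (π / 3)}
def C3h : Subgroup O3 := grp {-rotZ (π / 3)}
def C6h : Subgroup O3 := grp {-1, rotZ (π / 3)}
def D6 : Subgroup O3 := grp {rotZ (π / 3), rotX π}
def C6v : Subgroup O3 := grp {rotZ (π / 3), -rotX π}
def D3h : Subgroup O3 := grp {-rotZ (π / 3), -rotX π}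
def D6h : Subgroup O3 := grp {-1, rotZ (π / 3), rotX π}

/-! Cubic. -/
def T : Subgroup O3 := grp {rotZ π, rotK (2 * π / 3)}
def Th : Subgroup O3 := grp {rotZ π, -rotK (2 * π / 3)}
def O : Subgroup O3 := grp {rotZ (π / 2), rotX (π / 2)}
def Td : Subgroup O3 := grp {-rotZ (π / 2), -rotX (π / 2)}
def Oh : Subgroup O3 := grp {rotZ (π / 2), -rotK (2 * π / 3)}

/-! Cylindrical. -/
def Cinf : Subgroup O3 := grp allZ
def CinfH : Subgroup O3 := grp ({-1} ∪ allZ)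
def Dinf : Subgroup O3 := grp (allZ ∪ {rotX π})
def CinfV : Subgroup O3 := grp (allZ ∪ {-rotX π})
def DinfH : Subgroup O3 := grp ({-1} ∪ allZ ∪ {rotX π})

/-! Spherical: `K = SO(3)` and `Kh = O(3)`. -/
def K : Subgroup O3 := grp (allZ ∪ allX)
def Kh : Subgroup O3 := grp ({-1} ∪ allZ ∪ allX)

/-! Icosahedral. -/
def I : Subgroup O3 := grp {rotG (2 * π / 5), rotP (2 * π / 3)}
def Ih : Subgroup O3 := grp {rotG (2 * π / 5), -rotP (2 * π / 3)}

end PointGroups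

/-! ### The action on symmetric second order tensors -/

/-- The Kelvin–Mandel coefficients `T^α_{ij}`: the coordinates `C_α = ∑ T^α_{ij} C_{ij}` of a
symmetric tensor are `C₁₁, C₂₂, C₃₃, √2 C₂₃, √2 C₁₃, √2 C₁₂`. -/
def kelvinCoeff : Fin 6 → Matrix (Fin 3) (Fin 3) ℝ :=
  ![!![1, 0, 0; 0, 0, 0; 0, 0, 0],
    !![0, 0, 0; 0, 1, 0; 0, 0, 0],
    !![0, 0, 0; 0, 0, 0; 0, 0, 1],
    !![0, 0, 0; 0, 0, 1 / √2; 0, 1 / √2, 0],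
    !![0, 0, 1 / √2; 0, 0, 0; 1 / √2, 0, 0],
    !![0, 1 / √2, 0; 1 / √2, 0, 0; 0, 0, 0]]

/-- The matrix `Φ(Q)` of `C ↦ Q C Qᵀ` on symmetric tensors, in Kelvin–Mandel coordinates. -/
def kelvin (Q : Matrix (Fin 3) (Fin 3) ℝ) : Matrix (Fin 6) (Fin 6) ℝ :=
  Matrix.of fun α β => ∑ i, ∑ j, ∑ k, ∑ l,
    kelvinCoeff α i k * kelvinCoeff β j l * Q i j * Q k l

/-- Real polynomials in the six Kelvin–Mandel coordinates of a symmetric tensor. -/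
abbrev Poly : Type := MvPolynomial (Fin 6) ℝ

/-- The substitution `f ↦ f ∘ M`, for a `6 × 6` matrix `M`. -/
def subst (M : Matrix (Fin 6) (Fin 6) ℝ) : Poly →ₐ[ℝ] Poly :=
  aeval fun α => ∑ β, MvPolynomial.C (M α β) * MvPolynomial.X β

/-- The ring of `G`-invariant polynomials of a symmetric second order tensor. -/
def invariantRing (G : Subgroup O3) : Subalgebra ℝ Poly where
  carrier := {f | ∀ Q ∈ G, subst (kelvin (Q : Matrix (Fin 3) (Fin 3) ℝ)) f = f}
  mul_mem' := fun ha hb Q hQ => by rw [map_mul, ha Q hQ, hb Q hQ]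
  add_mem' := fun ha hb Q hQ => by rw [map_add, ha Q hQ, hb Q hQ]
  algebraMap_mem' := fun r Q _ => AlgHom.commutes _ r

/-! ### Hilbert series and Molien series -/

/-- The dimension of the space of homogeneous invariants of degree `d`. -/
def invDim (G : Subgroup O3) (d : ℕ) : ℕ :=
  Module.finrank ℝ
    (homogeneousSubmodule (Fin 6) ℝ d ⊓ Subalgebra.toSubmodule (invariantRing G) : Submodule ℝ Poly)

/-- The Hilbert series of the invariant ring. -/
def hilbertSeries (G : Subgroup O3) : PowerSeries ℤ :=
  PowerSeries.mk fun d => (invDim G d : ℤ)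

/-- The summand `1 / det (1 - t Φ(Q))` of the Molien series. -/
def molienTerm (t : ℝ) (Q : O3) : ℝ :=
  1 / (1 - t • kelvin (Q : Matrix (Fin 3) (Fin 3) ℝ)).det

/-- `G` is finite and its Molien series `1 / |G| ∑_{Q ∈ G} 1 / det (1 - t Φ(Q))` is `M t` for
`|t| < 1`. -/
def HasFiniteMolien (G : Subgroup O3) (M : ℝ → ℝ) : Prop :=
  Finite G ∧ ∀ t ∈ Set.Ioo (-1 : ℝ) 1,
    1 / (Nat.card G : ℝ) * ∑ᶠ Q : G, molienTerm t Q = M t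

/-- `G` is infinite, and it carries a Haar probability measure `μ` (which is then unique), for which
the Molien series `∫_G 1 / det (1 - t Φ(Q)) dμ(Q)` is `M t` for `|t| < 1`. -/
def HasHaarMolien (G : Subgroup O3) (M : ℝ → ℝ) : Prop :=
  letI : MeasurableSpace G := borel G
  Infinite G ∧ CompactSpace G ∧
  ∃ μ : Measure G, μ.IsHaarMeasure ∧ IsProbabilityMeasure μ ∧
    ∀ t ∈ Set.Ioo (-1 : ℝ) 1,
      Integrable (fun Q : G => molienTerm t Q) μ ∧ ∫ Q : G, molienTerm t Q ∂μ = M t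

/-- The polynomial `∏ (1 - X ^ d)` over a list of degrees `d`. -/
def denominator (ds : List ℕ) : Polynomial ℤ :=
  (ds.map fun d => 1 - (Polynomial.X : Polynomial ℤ) ^ d).prod

/-- The rational function `num(t) / ∏ (1 - t ^ d)`. -/
def ratio (num : Polynomial ℤ) (ds : List ℕ) (t : ℝ) : ℝ :=
  Polynomial.aeval t num / Polynomial.aeval t (denominator ds)

/-! ### Fundamental, primary and secondary invariants -/

/-- Polynomially complete: every invariant is a polynomial in the elements of `s`,
which are themselves invariants. -/
def IsIntegrityBasis (G : Subgroup O3) (s : Finset Poly) : Prop :=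
  Algebra.adjoin ℝ (s : Set Poly) = invariantRing G

/-- Polynomially irreducible: no element of `s` is a polynomial in the others. -/
def IsPolyIrreducible (s : Finset Poly) : Prop :=
  ∀ f ∈ s, f ∉ Algebra.adjoin ℝ ((s : Set Poly) \ {f})

/-- `s` is a polynomially complete and irreducible set of homogeneous invariants; its elements are
then called fundamental invariants. -/
def IsFundamental (G : Subgroup O3) (s : Finset Poly) : Prop :=
  (∀ f ∈ s, ∃ n, f.IsHomogeneous n) ∧ IsIntegrityBasis G s ∧ IsPolyIrreducible s

/-- No polynomial relation (syzygy) holds between the elements of `p`. -/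
def NoSyzygy (p : Finset Poly) : Prop :=
  AlgebraicIndependent ℝ (fun f : p => (f : Poly))

/-- `p` is a set of primary invariants: a largest algebraically independent subset of a
polynomially complete and irreducible set of homogeneous invariants. -/
def IsPrimary (G : Subgroup O3) (p : Finset Poly) : Prop :=
  ∃ s, IsFundamental G s ∧ p ⊆ s ∧ NoSyzygy p ∧ ∀ q ⊆ s, NoSyzygy q → q.card ≤ p.card

/-- `η` is a set of secondary invariants for `p`: homogeneous invariants over which the invariant
ring is the direct sum `⨁_{S ∈ η} S ℝ[p]`, each `f` being uniquely `∑_{S ∈ η} c_S S`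
with coefficients `c_S` in `ℝ[p]`. -/
def IsSecondary (G : Subgroup O3) (p η : Finset Poly) : Prop :=
  (∀ S ∈ η, S ∈ invariantRing G ∧ ∃ n, S.IsHomogeneous n) ∧
  ∀ f ∈ invariantRing G,
    ∃! c : η → Algebra.adjoin ℝ (p : Set Poly), f = ∑ S : η, (c S : Poly) * (S : Poly)

/-- The multiset of the degrees of the elements of `p`. -/
def degreeMultiset (p : Finset Poly) : Multiset ℕ := p.val.map MvPolynomial.totalDegree

/-- The number of elements of degree `k` in `η`. -/
def countDegree (η : Finset Poly) (k : ℕ) : ℕ := (degreeMultiset η).count k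

/-- The numbers of fundamental, primary and secondary invariants are `F`, `P` and `S`:
* every polynomially complete and irreducible set of homogeneous invariants has `F` elements;
* every set of primary invariants has `P` elements;
* there are primary invariants of the degrees `ds` with secondary invariants (one of them `1`);
* whenever primary invariants of the degrees `ds` admit secondary invariants, there are `S` of
  these, and for each `k` exactly as many of degree `k` as the coefficient of `X ^ k` in `num`. -/
def HasCounts (G : Subgroup O3) (num : Polynomial ℤ) (ds : List ℕ) (P S F : ℕ) : Prop :=
  (∀ s, IsFundamental G s → s.card = F) ∧
  (∀ p, IsPrimary G p → p.card = P) ∧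
  (∃ p η, IsPrimary G p ∧ degreeMultiset p = (ds : Multiset ℕ) ∧ IsSecondary G p η ∧ 1 ∈ η) ∧
  (∀ p η, IsPrimary G p → degreeMultiset p = (ds : Multiset ℕ) → IsSecondary G p η →
    η.card = S ∧ ∀ k, (countDegree η k : ℤ) = num.coeff k)

/-- The Hilbert series of the invariant ring of `G` is `num / ∏ (1 - X ^ d)`, as a formal power
series and as a convergent series for `|t| < 1`, its coefficients up to degree seven are
`taylor`, and the numbers of primary, secondary and fundamental invariants are `P`, `S`, `F`. -/
def HilbertRow (G : Subgroup O3) (num : Polynomial ℤ) (ds taylor : List ℕ) (P S F : ℕ) : Prop :=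
  hilbertSeries G * (denominator ds : PowerSeries ℤ) = (num : PowerSeries ℤ) ∧
  (∀ t ∈ Set.Ioo (-1 : ℝ) 1, HasSum (fun d => (invDim G d : ℝ) * t ^ d) (ratio num ds t)) ∧
  (List.range 8).map (invDim G) = taylor ∧
  HasCounts G num ds P S F

/-- A row of the table for a finite group. -/
def FiniteRow (G : Subgroup O3) (num : Polynomial ℤ) (ds taylor : List ℕ) (P S F : ℕ) : Prop :=
  HasFiniteMolien G (ratio num ds) ∧ HilbertRow G num ds taylor P S F

/-- A row of the table for an infinite group. -/
def InfiniteRow (G : Subgroup O3) (num : Polynomial ℤ) (ds taylor : List ℕ) (P S F : ℕ) : Prop :=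
  HasHaarMolien G (ratio num ds) ∧ HilbertRow G num ds taylor P S F

end

end TensorInvariants

/-!
For each group, the ring `A` of invariants is shown to be a free module, with an explicit homogeneous basis
`S_j`, over the ring of polynomials in explicit, algebraically independent homogeneous invariants `p_i`
(`IsFreeBasis`). All assertions on a row of the table follow from this.

*Hilbert series.* The products `p^a S_j` of degree `d` form a basis of `A_d`, hence the Hilbert series is
`∑ t ^ deg S_j / ∏ (1 - t ^ deg p_i)` (`hilbertSeries_of_basis`). Conversely, the degrees of any secondary
invariants are determined by the Hilbert series and the degrees of the primary invariants
(`secondary_degrees`).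

*Molien series.* Over `ℂ`, the matrix `Φ(Q)` is diagonalizable with eigenvalues of modulus one
(`exists_diag_kelvin`), so that `1 / det (1 - t Φ(Q))` is the generating function of the traces of `Q` on the
spaces of homogeneous polynomials (`hasSum_molienTerm`). The average of the action over the group is a
projection onto the invariants, and its trace is `dim A_d` (`trace_eq_invDim`). For the infinite groups the
average is an integral, which is exchanged with the sum by dominated convergence.

*Numbers of invariants.* The number of fundamental invariants is the dimension of `𝔪 / 𝔪²`, where `𝔪` consists of
the invariants without constant term (`card_of_isFundamental`), and the number of primary invariants is the rank
of a generating set in the algebraic matroid (`eRk_eq_card_of_maximal`). Hence one set of each kind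
determines them, and it remains to see that none of the proposed generators is a polynomial in the others. In
degrees below twice the least degree of the nontrivial secondary invariants, a polynomial in the generators is
linear in the latter (`exists_coords_of_mem_adjoin`), and freeness excludes a relation; the generators of higher
degree are separated from the others by pairs of points (`notMem_adjoin_of_separated`).

*Freeness for the finite groups.* Here the Hilbert series is computed first. In suitable coordinates the group
acts by integer matrices, and the generating function of an element depends only on the traces of `Φ(Q)` and
`Φ(Q)²`, so that Molien's formula becomes integer arithmetic (`hilbertSeries_of_molienCheck`). If the `S_j` are
linearly independent over `ℝ[p]`, then the free module with this basis has the same Hilbert series as `A`, and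
is therefore all of `A` (`spans_of_hilbertSeries`). The independence is verified on a single fibre of the map
`p` (`eq_zero_of_fiber`): at as many regular points of this fibre as there are `S_j`, the matrix of their values
has to be nonsingular. The points have integer or Eisenstein integer coordinates, up to a scalar factor for the
icosahedral groups, so that this too is a finite computation (`fiberCheck`, `scaledFiberCheck`).

*Freeness for the infinite groups.* The invariants of the rotations about the `z`-axis are spanned over `ℂ` by the
monomials of weight zero in the eigenvectors (`weight_eq_zero`, `mem_adjoin_of_fixed_rotZ`), and the half turn about
the `x`-axis changes the sign of one of the generators (`linSubst_rotX_chiralCyl`). For the spherical groups, the restriction to diagonal matrices identifies the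
invariants with the symmetric polynomials in three variables (`exists_of_isIsotropic`).
-/

namespace TensorInvariants

open MvPolynomial Matrix MeasureTheory

noncomputable section

/-! ### Linear substitutions on homogeneous polynomials -/

section LinSubst
variable {R : Type*} [CommRing R]

/-- The substitution `f ↦ f ∘ M` over an arbitrary commutative ring. -/
def linSubst (M : Matrix (Fin 6) (Fin 6) R) :
    MvPolynomial (Fin 6) R →ₐ[R] MvPolynomial (Fin 6) R :=
  aeval fun α => ∑ β, MvPolynomial.C (M α β) * MvPolynomial.X β

theorem linSubst_X (M : Matrix (Fin 6) (Fin 6) R) (α : Fin 6) :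
    linSubst M (MvPolynomial.X α) = ∑ β, MvPolynomial.C (M α β) * MvPolynomial.X β := by
  simp [linSubst]

theorem linSubst_mul (A B : Matrix (Fin 6) (Fin 6) R) (f : MvPolynomial (Fin 6) R) :
    linSubst (A * B) f = linSubst B (linSubst A f) := by
  have hC : ∀ (M : Matrix (Fin 6) (Fin 6) R) (r : R),
      linSubst M (MvPolynomial.C r) = MvPolynomial.C r := fun M r => AlgHom.commutes _ r
  have hX : ∀ α, linSubst (A * B) (MvPolynomial.X α) = linSubst B (linSubst A (MvPolynomial.X α)) := by
    intro α
    simp only [linSubst_X, map_sum, map_mul, Matrix.mul_apply, hC, Finset.sum_mul, Finset.mul_sum]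
    rw [Finset.sum_comm]
    simp only [mul_assoc]
  induction f using MvPolynomial.induction_on with
  | C a => simp only [hC]
  | add p q hp hq => simp only [map_add, hp, hq]
  | mul_X p n hp => simp only [map_mul, hp, hX]

theorem linSubst_one (f : MvPolynomial (Fin 6) R) : linSubst (1 : Matrix (Fin 6) (Fin 6) R) f = f := by
  have : linSubst (1 : Matrix (Fin 6) (Fin 6) R) = AlgHom.id R _ := by
    ext1 α
    simp [linSubst_X, Matrix.one_apply]
  rw [this]; rfl

theorem linSubst_isHomogeneous (M : Matrix (Fin 6) (Fin 6) R) {f : MvPolynomial (Fin 6) R} {d : ℕ}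
    (hf : f.IsHomogeneous d) : (linSubst M f).IsHomogeneous d := by
  have := hf.aeval (g := fun α => ∑ β, MvPolynomial.C (M α β) * MvPolynomial.X β) (n := 1) (fun α => by
    refine IsHomogeneous.sum _ _ _ fun β _ => ?_
    simpa using (isHomogeneous_C (Fin 6) (M α β)).mul (isHomogeneous_X R β))
  simpa [linSubst] using this

theorem eval_linSubst (M : Matrix (Fin 6) (Fin 6) R) (x : Fin 6 → R) (f : MvPolynomial (Fin 6) R) :
    eval x (linSubst M f) = eval (M.mulVec x) f := by
  rw [linSubst, ← coe_aeval_eq_eval, ← coe_aeval_eq_eval]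
  simp only [RingHom.coe_coe]
  rw [← AlgHom.comp_apply]
  congr 1
  ext1 α
  simp [Matrix.mulVec, dotProduct]

theorem map_linSubst {S : Type*} [CommRing S] (φ : R →+* S) (M : Matrix (Fin 6) (Fin 6) R)
    (f : MvPolynomial (Fin 6) R) :
    MvPolynomial.map φ (linSubst M f) = linSubst (M.map φ) (MvPolynomial.map φ f) := by
  induction f using MvPolynomial.induction_on with
  | C a =>
    have h : linSubst M (MvPolynomial.C a) = MvPolynomial.C a := AlgHom.commutes _ a
    have h' : linSubst (M.map φ) (MvPolynomial.C (φ a)) = MvPolynomial.C (φ a) :=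
      AlgHom.commutes _ _
    rw [h, map_C, h']
  | add p q hp hq => simp [hp, hq]
  | mul_X p n hp => simp [hp, linSubst_X]

/-- Exponent vectors of total degree `d`. -/
abbrev Idx (d : ℕ) : Type := {a : Fin 6 →₀ ℕ // a ∈ (Finset.univ : Finset (Fin 6)).finsuppAntidiag d}

theorem mem_idx {d : ℕ} {a : Fin 6 →₀ ℕ} :
    a ∈ (Finset.univ : Finset (Fin 6)).finsuppAntidiag d ↔ a.degree = d := by
  simp [Finset.mem_finsuppAntidiag, Finsupp.degree_eq_sum]

theorem eq_sum_idx {f : MvPolynomial (Fin 6) R} {d : ℕ} (hf : f.IsHomogeneous d) :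
    f = ∑ b : Idx d, coeff b.1 f • monomial b.1 (1 : R) := by
  ext a
  simp only [coeff_sum, coeff_smul, coeff_monomial, smul_eq_mul, mul_ite, mul_one, mul_zero]
  by_cases ha : a.degree = d
  · rw [Finset.sum_eq_single (⟨a, mem_idx.2 ha⟩ : Idx d)]
    · simp
    · intro b _ hb
      rw [if_neg]
      intro h
      exact hb (Subtype.ext h)
    · simp
  · rw [Finset.sum_eq_zero]
    · exact hf.coeff_eq_zero ha
    · intro b _
      rw [if_neg]
      rintro rfl
      exact ha (mem_idx.1 b.2)

theorem isHomogeneous_idx_monomial {d : ℕ} (b : Idx d) (r : R) :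
    (monomial b.1 r).IsHomogeneous d :=
  isHomogeneous_monomial _ (mem_idx.1 b.2)

/-- The matrix of `f ↦ f ∘ M` on homogeneous polynomials of degree `d`, in the monomial basis. -/
def symMat (M : Matrix (Fin 6) (Fin 6) R) (d : ℕ) : Matrix (Idx d) (Idx d) R :=
  Matrix.of fun a b => coeff a.1 (linSubst M (monomial b.1 1))

theorem coeff_linSubst (M : Matrix (Fin 6) (Fin 6) R) {d : ℕ} {f : MvPolynomial (Fin 6) R}
    (hf : f.IsHomogeneous d) (a : Fin 6 →₀ ℕ) :
    coeff a (linSubst M f) = ∑ b : Idx d, coeff a (linSubst M (monomial b.1 1)) * coeff b.1 f := by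
  conv_lhs => rw [eq_sum_idx hf]
  simp [coeff_sum, mul_comm]

theorem symMat_mul (A B : Matrix (Fin 6) (Fin 6) R) (d : ℕ) :
    symMat (A * B) d = symMat B d * symMat A d := by
  ext a b
  simp only [symMat, Matrix.of_apply, Matrix.mul_apply, linSubst_mul]
  exact coeff_linSubst B (linSubst_isHomogeneous A (isHomogeneous_idx_monomial b 1)) a.1

theorem symMat_one (d : ℕ) : symMat (1 : Matrix (Fin 6) (Fin 6) R) d = 1 := by
  ext a b
  simp only [symMat, Matrix.of_apply, linSubst_one, coeff_monomial, Matrix.one_apply, Subtype.ext_iff]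
  exact if_congr eq_comm rfl rfl

theorem symMat_map {S : Type*} [CommRing S] (φ : R →+* S) (M : Matrix (Fin 6) (Fin 6) R) (d : ℕ) :
    symMat (M.map φ) d = (symMat M d).map φ := by
  ext a b
  simp only [symMat, Matrix.of_apply, Matrix.map_apply]
  rw [← coeff_map, map_linSubst, map_monomial, _root_.map_one φ]

theorem linSubst_diagonal_monomial (l : Fin 6 → R) (a : Fin 6 →₀ ℕ) :
    linSubst (Matrix.diagonal l) (monomial a 1) = monomial a (∏ i, l i ^ a i) := by
  rw [linSubst, aeval_monomial]
  have : ∀ α : Fin 6, ∑ β, MvPolynomial.C (Matrix.diagonal l α β) * MvPolynomial.X β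
      = MvPolynomial.C (l α) * (MvPolynomial.X α : MvPolynomial (Fin 6) R) := by
    intro α
    rw [Finset.sum_eq_single α]
    · simp
    · intro b _ hb
      simp [Matrix.diagonal_apply_ne' _ hb]
    · simp
  simp only [this]
  rw [Finsupp.prod_fintype _ _ (by simp), monomial_eq, Finsupp.prod_fintype _ _ (by simp)]
  simp [mul_pow, Finset.prod_mul_distrib]

/-- The generating function of the traces on the symmetric powers, for a diagonal matrix. -/
theorem trace_symMat_diagonal (l : Fin 6 → R) :
    (PowerSeries.mk fun d => (symMat (Matrix.diagonal l) d).trace)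
      * ∏ i, (1 - PowerSeries.C (l i) * PowerSeries.X) = 1 := by
  have h1 : (PowerSeries.mk fun d => (symMat (Matrix.diagonal l) d).trace)
      = ∏ i, PowerSeries.mk fun n => l i ^ n := by
    ext d
    rw [PowerSeries.coeff_prod, PowerSeries.coeff_mk, Matrix.trace,
      Finset.sum_subtype (p := fun a => a ∈ (Finset.univ : Finset (Fin 6)).finsuppAntidiag d) _ (fun _ => Iff.rfl)]
    refine Finset.sum_congr rfl fun a _ => ?_
    simp [symMat, linSubst_diagonal_monomial, PowerSeries.coeff_mk]
  rw [h1, ← Finset.prod_mul_distrib]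
  refine Finset.prod_eq_one fun i _ => ?_
  ext n
  cases n with
  | zero => simp [mul_sub]
  | succ n =>
    rw [mul_sub, mul_one, map_sub, PowerSeries.coeff_mk, ← mul_assoc, PowerSeries.coeff_succ_mul_X, mul_comm,
      PowerSeries.coeff_C_mul, PowerSeries.coeff_mk, PowerSeries.coeff_one]
    simp [pow_succ']

theorem trace_symMat_conj {A D P P' : Matrix (Fin 6) (Fin 6) R} (hP : P' * P = 1)
    (h : A = P * D * P') (d : ℕ) : (symMat A d).trace = (symMat D d).trace := by
  rw [h, symMat_mul, symMat_mul, ← Matrix.mul_assoc, Matrix.trace_mul_comm, ← Matrix.mul_assoc,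
    ← symMat_mul, hP, symMat_one, Matrix.one_mul]

/-- The generating function of the traces on the symmetric powers, for a diagonalizable matrix. -/
theorem trace_symMat_of_diag {A P P' : Matrix (Fin 6) (Fin 6) R} {l : Fin 6 → R} (hP : P' * P = 1)
    (h : A = P * Matrix.diagonal l * P') :
    (PowerSeries.mk fun d => (symMat A d).trace)
      * ∏ i, (1 - PowerSeries.C (l i) * PowerSeries.X) = 1 := by
  simp only [trace_symMat_conj hP h]
  exact trace_symMat_diagonal l

end LinSubst

/-! ### The matrices `Φ(Q)` and their eigenvalues -/

theorem kelvinCoeff_transpose (α : Fin 6) : (kelvinCoeff α)ᵀ = kelvinCoeff α := by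
  ext i j
  fin_cases α <;> fin_cases i <;> fin_cases j <;> simp [kelvinCoeff]

theorem kelvin_eq_trace (Q : Matrix (Fin 3) (Fin 3) ℝ) (α β : Fin 6) :
    kelvin Q α β = (kelvinCoeff α * (Q * kelvinCoeff β * Qᵀ)).trace := by
  have h : ∀ k i, kelvinCoeff α k i = kelvinCoeff α i k := fun k i =>
    congrFun (congrFun (kelvinCoeff_transpose α) i) k
  simp only [kelvin, Matrix.of_apply, Matrix.trace, Matrix.diag, Matrix.mul_apply, Matrix.transpose_apply,
    Finset.sum_mul, Finset.mul_sum]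
  simp only [Fin.sum_univ_three, h]
  ring

/-- The tensors `T^α` form an orthonormal basis of the symmetric matrices. -/
theorem sum_trace_smul_kelvinCoeff {C : Matrix (Fin 3) (Fin 3) ℝ} (hC : Cᵀ = C) :
    ∑ α, (kelvinCoeff α * C).trace • kelvinCoeff α = C := by
  have h : ∀ i j, C i j = C j i := fun i j => congrFun (congrFun hC j) i
  have h2 : (√2)⁻¹ * (√2)⁻¹ = (1 : ℝ) / 2 := by
    rw [← mul_inv, Real.mul_self_sqrt (by norm_num)]; norm_num
  ext i j
  simp only [Matrix.sum_apply, Matrix.smul_apply, Fin.sum_univ_six, smul_eq_mul, Matrix.trace,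
    Matrix.diag, Matrix.mul_apply, Fin.sum_univ_three]
  fin_cases i <;> fin_cases j <;> simp [kelvinCoeff, h 1 0, h 2 0, h 2 1]
  · linear_combination 2 * C 0 1 * h2
  · linear_combination 2 * C 0 2 * h2
  · linear_combination 2 * C 0 1 * h2
  · linear_combination 2 * C 1 2 * h2
  · linear_combination 2 * C 0 2 * h2
  · linear_combination 2 * C 1 2 * h2

theorem trace_kelvinCoeff_mul (α β : Fin 6) :
    (kelvinCoeff α * kelvinCoeff β).trace = if α = β then 1 else 0 := by
  have h2 : (√2)⁻¹ * (√2)⁻¹ = (1 : ℝ) / 2 := by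
    rw [← mul_inv, Real.mul_self_sqrt (by norm_num)]; norm_num
  fin_cases α <;> fin_cases β <;>
    simp [kelvinCoeff, Matrix.trace, Fin.sum_univ_three, h2] <;> norm_num

/-- The coordinates of a symmetric matrix with respect to the tensors `T^α` separate. -/
theorem sum_trace_mul_trace {B C : Matrix (Fin 3) (Fin 3) ℝ} (hC : Cᵀ = C) :
    ∑ α, (B * kelvinCoeff α).trace * (kelvinCoeff α * C).trace = (B * C).trace := by
  conv_rhs => rw [← sum_trace_smul_kelvinCoeff hC]
  simp [Finset.mul_sum, Matrix.trace_sum, mul_comm]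

theorem isSymm_conj {Q C : Matrix (Fin 3) (Fin 3) ℝ} (hC : Cᵀ = C) : (Q * C * Qᵀ)ᵀ = Q * C * Qᵀ := by
  simp [Matrix.transpose_mul, hC, Matrix.mul_assoc]

theorem kelvin_mul (A B : Matrix (Fin 3) (Fin 3) ℝ) : kelvin (A * B) = kelvin A * kelvin B := by
  ext α β
  simp only [Matrix.mul_apply (M := kelvin A), kelvin_eq_trace]
  have h1 : ∀ γ, (kelvinCoeff α * (A * kelvinCoeff γ * Aᵀ)).trace
      = ((Aᵀ * kelvinCoeff α * A) * kelvinCoeff γ).trace := fun γ => by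
    rw [← Matrix.mul_assoc, Matrix.trace_mul_comm]
    simp only [Matrix.mul_assoc]
  simp only [h1]
  rw [sum_trace_mul_trace (isSymm_conj (kelvinCoeff_transpose β))]
  rw [Matrix.transpose_mul]
  simp only [Matrix.mul_assoc]
  rw [Matrix.trace_mul_comm (Aᵀ)]
  simp only [Matrix.mul_assoc]

theorem kelvin_neg (A : Matrix (Fin 3) (Fin 3) ℝ) : kelvin (-A) = kelvin A := by
  ext α β
  simp [kelvin_eq_trace]

theorem kelvin_one : kelvin (1 : Matrix (Fin 3) (Fin 3) ℝ) = 1 := by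
  ext α β
  simp [kelvin_eq_trace, trace_kelvinCoeff_mul, Matrix.one_apply]

theorem kelvin_explicit (Q : Matrix (Fin 3) (Fin 3) ℝ) : kelvin Q =
    !![Q 0 0 ^ 2, Q 0 1 ^ 2, Q 0 2 ^ 2, √2 * (Q 0 1 * Q 0 2), √2 * (Q 0 0 * Q 0 2), √2 * (Q 0 0 * Q 0 1);
      Q 1 0 ^ 2, Q 1 1 ^ 2, Q 1 2 ^ 2, √2 * (Q 1 1 * Q 1 2), √2 * (Q 1 0 * Q 1 2), √2 * (Q 1 0 * Q 1 1);
      Q 2 0 ^ 2, Q 2 1 ^ 2, Q 2 2 ^ 2, √2 * (Q 2 1 * Q 2 2), √2 * (Q 2 0 * Q 2 2), √2 * (Q 2 0 * Q 2 1);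
      √2 * (Q 1 0 * Q 2 0), √2 * (Q 1 1 * Q 2 1), √2 * (Q 1 2 * Q 2 2),
        Q 1 1 * Q 2 2 + Q 1 2 * Q 2 1, Q 1 0 * Q 2 2 + Q 1 2 * Q 2 0, Q 1 0 * Q 2 1 + Q 1 1 * Q 2 0;
      √2 * (Q 0 0 * Q 2 0), √2 * (Q 0 1 * Q 2 1), √2 * (Q 0 2 * Q 2 2),
        Q 0 1 * Q 2 2 + Q 0 2 * Q 2 1, Q 0 0 * Q 2 2 + Q 0 2 * Q 2 0, Q 0 0 * Q 2 1 + Q 0 1 * Q 2 0;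
      √2 * (Q 0 0 * Q 1 0), √2 * (Q 0 1 * Q 1 1), √2 * (Q 0 2 * Q 1 2),
        Q 0 1 * Q 1 2 + Q 0 2 * Q 1 1, Q 0 0 * Q 1 2 + Q 0 2 * Q 1 0, Q 0 0 * Q 1 1 + Q 0 1 * Q 1 0] := by
  have h1 : (√2)⁻¹ = √2 / 2 := by
    rw [inv_eq_one_div, div_eq_div_iff (by positivity) (by norm_num), one_mul,
      Real.mul_self_sqrt (by norm_num)]
  have h2 : √2 ^ 2 = 2 := Real.sq_sqrt (by norm_num)
  ext α β
  fin_cases α <;> fin_cases β <;>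
    simp [kelvin, kelvinCoeff, Fin.sum_univ_three, h1] <;> ring_nf <;> (try rw [h2]) <;> ring

theorem rotZ_coe (φ : ℝ) : (rotZ φ : Matrix (Fin 3) (Fin 3) ℝ) =
    !![Real.cos φ, -Real.sin φ, 0; Real.sin φ, Real.cos φ, 0; 0, 0, 1] := by
  ext i j
  fin_cases i <;> fin_cases j <;> simp [rotZ, rot, rotMatrix]

theorem rotX_coe (φ : ℝ) : (rotX φ : Matrix (Fin 3) (Fin 3) ℝ) =
    !![1, 0, 0; 0, Real.cos φ, -Real.sin φ; 0, Real.sin φ, Real.cos φ] := by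
  ext i j
  fin_cases i <;> fin_cases j <;> simp [rotX, rot, rotMatrix]

theorem neg_coe (Q : O3) : ((-Q : O3) : Matrix (Fin 3) (Fin 3) ℝ) = -(Q : Matrix (Fin 3) (Fin 3) ℝ) := rfl

theorem exists_angle {x y : ℝ} (h : x ^ 2 + y ^ 2 = 1) :
    ∃ φ ∈ Set.Ico 0 (2 * Real.pi), Real.cos φ = x ∧ Real.sin φ = y := by
  have hz : ‖(⟨x, y⟩ : ℂ)‖ = 1 := by
    rw [Complex.norm_def, Complex.normSq_mk, ← sq, ← sq, h, Real.sqrt_one]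
  have hz0 : (⟨x, y⟩ : ℂ) ≠ 0 := fun h0 => by simp [h0] at hz
  set θ := Complex.arg ⟨x, y⟩ with hθ
  have hc : Real.cos θ = x := by rw [hθ, Complex.cos_arg hz0, hz]; simp
  have hs : Real.sin θ = y := by rw [hθ, Complex.sin_arg, hz]; simp
  have h1 := Complex.neg_pi_lt_arg ⟨x, y⟩
  have h2 := Complex.arg_le_pi ⟨x, y⟩
  rw [← hθ] at h1 h2
  have hpi := Real.pi_pos
  by_cases h0 : 0 ≤ θ
  · exact ⟨θ, ⟨h0, by linarith⟩, hc, hs⟩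
  · exact ⟨θ + 2 * Real.pi, ⟨by linarith, by linarith⟩, by rw [Real.cos_add_two_pi, hc],
      by rw [Real.sin_add_two_pi, hs]⟩

theorem rotZ_mem_allZ (φ : ℝ) : rotZ φ ∈ allZ := by
  obtain ⟨ψ, hψ, hc, hs⟩ := exists_angle (Real.cos_sq_add_sin_sq φ)
  refine ⟨ψ, hψ, Subtype.ext ?_⟩
  rw [rotZ_coe, rotZ_coe, hc, hs]

theorem rotX_mem_allX (φ : ℝ) : rotX φ ∈ allX := by
  obtain ⟨ψ, hψ, hc, hs⟩ := exists_angle (Real.cos_sq_add_sin_sq φ)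
  refine ⟨ψ, hψ, Subtype.ext ?_⟩
  rw [rotX_coe, rotX_coe, hc, hs]

theorem O3_transpose_mul (Q : O3) :
    (Q : Matrix (Fin 3) (Fin 3) ℝ)ᵀ * (Q : Matrix (Fin 3) (Fin 3) ℝ) = 1 :=
  (Matrix.mem_orthogonalGroup_iff' (A := (Q : Matrix (Fin 3) (Fin 3) ℝ))).1 Q.2

theorem O3_mul_transpose (Q : O3) :
    (Q : Matrix (Fin 3) (Fin 3) ℝ) * (Q : Matrix (Fin 3) (Fin 3) ℝ)ᵀ = 1 :=
  (Matrix.mem_orthogonalGroup_iff (A := (Q : Matrix (Fin 3) (Fin 3) ℝ))).1 Q.2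

theorem O3_det (Q : O3) : (Q : Matrix (Fin 3) (Fin 3) ℝ).det = 1 ∨
    (Q : Matrix (Fin 3) (Fin 3) ℝ).det = -1 := by
  have h := congrArg Matrix.det (O3_mul_transpose Q)
  rw [Matrix.det_mul, Matrix.det_transpose, Matrix.det_one] at h
  exact mul_self_eq_one_iff.1 h

theorem det_rotZ (φ : ℝ) : (rotZ φ : Matrix (Fin 3) (Fin 3) ℝ).det = 1 := by
  rw [rotZ_coe, Matrix.det_fin_three]
  simp
  linear_combination Real.cos_sq_add_sin_sq φ

theorem det_rotX (φ : ℝ) : (rotX φ : Matrix (Fin 3) (Fin 3) ℝ).det = 1 := by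
  rw [rotX_coe, Matrix.det_fin_three]
  simp
  linear_combination Real.cos_sq_add_sin_sq φ

/-- Every unit vector is moved to the `z`-axis by a rotation about `z` followed by one about `x`. -/
theorem exists_rot_to_e3 {v : Fin 3 → ℝ} (hv : v 0 ^ 2 + v 1 ^ 2 + v 2 ^ 2 = 1) :
    ∃ α β : ℝ, ((rotX β * rotZ α : O3) : Matrix (Fin 3) (Fin 3) ℝ) *ᵥ v = ![0, 0, 1] := by
  obtain ⟨α, r, h0, h1⟩ : ∃ α r : ℝ, Real.cos α * v 0 - Real.sin α * v 1 = 0 ∧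
      Real.sin α * v 0 + Real.cos α * v 1 = r := by
    by_cases hr : v 0 ^ 2 + v 1 ^ 2 = 0
    · have h0 : v 0 = 0 := by nlinarith [sq_nonneg (v 0), sq_nonneg (v 1)]
      have h1 : v 1 = 0 := by nlinarith [sq_nonneg (v 0), sq_nonneg (v 1)]
      exact ⟨0, 0, by simp [h0], by simp [h1]⟩
    · have hp : 0 < v 0 ^ 2 + v 1 ^ 2 := lt_of_le_of_ne (by positivity) (Ne.symm hr)
      have hs := Real.sq_sqrt hp.le
      have hs0 : √(v 0 ^ 2 + v 1 ^ 2) ≠ 0 := (Real.sqrt_pos.2 hp).ne'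
      obtain ⟨α, -, hc, hsn⟩ := exists_angle (x := v 1 / √(v 0 ^ 2 + v 1 ^ 2))
        (y := v 0 / √(v 0 ^ 2 + v 1 ^ 2)) (by
          rw [div_pow, div_pow, hs, ← add_div, add_comm, div_self hr])
      refine ⟨α, _, ?_, rfl⟩
      rw [hc, hsn]
      ring
  have hr : v 2 ^ 2 + r ^ 2 = 1 := by
    rw [← hv, ← h1]
    linear_combination (-v 0 ^ 2 - v 1 ^ 2) * (-Real.cos_sq_add_sin_sq α) - (Real.cos α * v 0 - Real.sin α * v 1) * h0
  obtain ⟨β, -, hc, hs⟩ := exists_angle hr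
  refine ⟨α, β, ?_⟩
  have : ((rotX β * rotZ α : O3) : Matrix (Fin 3) (Fin 3) ℝ)
      = (rotX β : Matrix (Fin 3) (Fin 3) ℝ) * (rotZ α : Matrix (Fin 3) (Fin 3) ℝ) := rfl
  rw [this, ← Matrix.mulVec_mulVec, rotX_coe, rotZ_coe, hc, hs]
  ext i
  fin_cases i
  · simp [Matrix.mulVec, dotProduct, Fin.sum_univ_three]
    linear_combination h0
  · simp [Matrix.mulVec, dotProduct, Fin.sum_univ_three]
    linear_combination v 2 * h1
  · simp [Matrix.mulVec, dotProduct, Fin.sum_univ_three]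
    linear_combination r * h1 + hr

/-- A rotation that fixes the `z`-axis pointwise is a rotation about it. -/
theorem O3_fix_e3 (Q : O3) (h : (Q : Matrix (Fin 3) (Fin 3) ℝ) *ᵥ ![0, 0, 1] = ![0, 0, 1])
    (hd : (Q : Matrix (Fin 3) (Fin 3) ℝ).det = 1) : ∃ φ, Q = rotZ φ := by
  have h' : (Q : Matrix (Fin 3) (Fin 3) ℝ)ᵀ *ᵥ ![0, 0, 1] = ![0, 0, 1] := by
    conv_lhs => rw [← h]
    rw [Matrix.mulVec_mulVec, O3_transpose_mul, Matrix.one_mulVec]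
  have hc : ∀ i, (Q : Matrix (Fin 3) (Fin 3) ℝ) i 2 = (![0, 0, 1] : Fin 3 → ℝ) i := fun i => by
    rw [← congrFun h i]; simp [Matrix.mulVec, dotProduct, Fin.sum_univ_three]
  have hr : ∀ i, (Q : Matrix (Fin 3) (Fin 3) ℝ) 2 i = (![0, 0, 1] : Fin 3 → ℝ) i := fun i => by
    rw [← congrFun h' i]; simp [Matrix.mulVec, dotProduct, Fin.sum_univ_three]
  have hm := O3_mul_transpose Q
  set q := (Q : Matrix (Fin 3) (Fin 3) ℝ) with hq
  have c0 : q 0 2 = 0 := hc 0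
  have c1 : q 1 2 = 0 := hc 1
  have c2 : q 2 2 = 1 := hc 2
  have r0 : q 2 0 = 0 := hr 0
  have r1 : q 2 1 = 0 := hr 1
  have m00 := congrFun (congrFun hm 0) 0
  have m01 := congrFun (congrFun hm 0) 1
  simp only [Matrix.mul_apply, Matrix.transpose_apply, Fin.sum_univ_three, c0, c1, Matrix.one_apply] at m00 m01
  simp at m00 m01
  rw [Matrix.det_fin_three, c0, c1, c2, r0, r1] at hd
  have e1 : q 1 1 = q 0 0 := by linear_combination (-q 1 1) * m00 + q 0 0 * hd + q 0 1 * m01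
  have e2 : q 0 1 = -q 1 0 := by linear_combination (-q 1 0) * m00 + q 0 0 * m01 - q 0 1 * hd
  obtain ⟨φ, -, hcos, hsin⟩ := exists_angle (x := q 0 0) (y := q 1 0) (by
    rw [e2] at m00; linear_combination m00)
  refine ⟨φ, Subtype.ext ?_⟩
  rw [← hq, rotZ_coe, hcos, hsin]
  ext i j
  fin_cases i <;> fin_cases j <;> simp [c0, c1, c2, r0, r1, e1, e2]

/-- Euler's decomposition of a rotation. -/
theorem exists_euler (Q : O3) (hd : (Q : Matrix (Fin 3) (Fin 3) ℝ).det = 1) :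
    ∃ α β φ : ℝ, Q = (rotX β * rotZ α)⁻¹ * rotZ φ := by
  have hu := O3_transpose_mul Q
  have h22 := congrFun (congrFun hu 2) 2
  simp [Matrix.mul_apply, Fin.sum_univ_three] at h22
  obtain ⟨α, β, hg⟩ := exists_rot_to_e3 (v := (Q : Matrix (Fin 3) (Fin 3) ℝ) *ᵥ ![0, 0, 1]) (by
    simp [Matrix.mulVec, dotProduct, Fin.sum_univ_three]
    linear_combination h22)
  obtain ⟨φ, hφ⟩ := O3_fix_e3 (rotX β * rotZ α * Q) (by
    refine Eq.trans ?_ hg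
    rw [Matrix.mulVec_mulVec]; rfl) (by
      change ((rotX β : Matrix (Fin 3) (Fin 3) ℝ) * (rotZ α : Matrix (Fin 3) (Fin 3) ℝ) * (Q : Matrix (Fin 3) (Fin 3) ℝ)).det = 1
      rw [Matrix.det_mul, Matrix.det_mul, det_rotX, det_rotZ, hd]; norm_num)
  exact ⟨α, β, φ, by rw [← hφ]; group⟩

/-- Euler's theorem: every rotation is conjugate to a rotation about the `z`-axis. -/
theorem exists_conj_rotZ (Q : O3) (hd : (Q : Matrix (Fin 3) (Fin 3) ℝ).det = 1) :
    ∃ (g : O3) (φ : ℝ), Q = g⁻¹ * rotZ φ * g := by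
  set q := (Q : Matrix (Fin 3) (Fin 3) ℝ) with hq
  -- in odd dimension, `1` is an eigenvalue of a rotation
  have hdet : (q - 1).det = 0 := by
    have h1 : q - 1 = q * (1 - q)ᵀ := by
      rw [Matrix.transpose_sub, Matrix.mul_sub, Matrix.transpose_one, O3_mul_transpose Q, Matrix.mul_one]
    have h2 : (q - 1).det = -(q - 1).det := by
      conv_lhs => rw [h1, Matrix.det_mul, hd, one_mul, Matrix.det_transpose, ← neg_sub, Matrix.det_neg]
      rw [Fintype.card_fin]; ring
    linarith
  obtain ⟨w, hw0, hw⟩ := Matrix.exists_mulVec_eq_zero_iff.2 hdet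
  have hwp : 0 < w 0 ^ 2 + w 1 ^ 2 + w 2 ^ 2 := by
    refine lt_of_le_of_ne (by positivity) fun h => hw0 ?_
    ext i
    fin_cases i <;> simp <;> nlinarith [sq_nonneg (w 0), sq_nonneg (w 1), sq_nonneg (w 2)]
  have hs := Real.sq_sqrt hwp.le
  have hs0 : √(w 0 ^ 2 + w 1 ^ 2 + w 2 ^ 2) ≠ 0 := (Real.sqrt_pos.2 hwp).ne'
  set r := √(w 0 ^ 2 + w 1 ^ 2 + w 2 ^ 2)
  have hqw : q *ᵥ (r⁻¹ • w) = r⁻¹ • w := by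
    rw [Matrix.sub_mulVec, Matrix.one_mulVec, sub_eq_zero] at hw
    rw [Matrix.mulVec_smul, hw]
  obtain ⟨α, β, hg⟩ := exists_rot_to_e3 (v := r⁻¹ • w) (by
    simp only [Pi.smul_apply, smul_eq_mul, mul_pow]
    rw [← mul_add, ← mul_add, ← hs, inv_pow, inv_mul_cancel₀ (pow_ne_zero 2 hs0)])
  set g := rotX β * rotZ α with hgdef
  have hginv : ((g⁻¹ : O3) : Matrix (Fin 3) (Fin 3) ℝ) *ᵥ ![0, 0, 1] = r⁻¹ • w := by
    rw [← hg, Matrix.mulVec_mulVec]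
    have : ((g⁻¹ : O3) : Matrix (Fin 3) (Fin 3) ℝ) * (g : Matrix (Fin 3) (Fin 3) ℝ) = 1 :=
      O3_transpose_mul g
    rw [this, Matrix.one_mulVec]
  have hdetg : (g : Matrix (Fin 3) (Fin 3) ℝ).det = 1 := by
    change ((rotX β : Matrix (Fin 3) (Fin 3) ℝ) * (rotZ α : Matrix (Fin 3) (Fin 3) ℝ)).det = 1
    rw [Matrix.det_mul, det_rotX, det_rotZ, one_mul]
  have hdetg' : ((g⁻¹ : O3) : Matrix (Fin 3) (Fin 3) ℝ).det = 1 := by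
    change ((g : Matrix (Fin 3) (Fin 3) ℝ)ᵀ).det = 1
    rw [Matrix.det_transpose, hdetg]
  obtain ⟨φ, hφ⟩ := O3_fix_e3 (g * Q * g⁻¹) (by
      change ((g : Matrix (Fin 3) (Fin 3) ℝ) * q * ((g⁻¹ : O3) : Matrix (Fin 3) (Fin 3) ℝ)) *ᵥ _ = _
      rw [← Matrix.mulVec_mulVec, hginv, ← Matrix.mulVec_mulVec, hqw, hg])
    (by
      change ((g : Matrix (Fin 3) (Fin 3) ℝ) * q * ((g⁻¹ : O3) : Matrix (Fin 3) (Fin 3) ℝ)).det = 1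
      rw [Matrix.det_mul, Matrix.det_mul, hdetg, hdetg', hd]; norm_num)
  exact ⟨g, φ, by rw [← hφ]; group⟩

/-- The eigenvalues of `Φ(Q)` for a rotation by the angle `φ`. -/
def kelvinEigenvalues (φ : ℝ) : Fin 6 → ℂ :=
  ![1, 1, Real.cos φ + Real.sin φ * Complex.I, Real.cos φ - Real.sin φ * Complex.I,
    (Real.cos φ + Real.sin φ * Complex.I) ^ 2, (Real.cos φ - Real.sin φ * Complex.I) ^ 2]

/-- The eigenvectors of `Φ` on rotations about the `z`-axis, as columns. -/
def weightBasis : Matrix (Fin 6) (Fin 6) ℂ :=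
  !![1, 0, 0, 0, 1, 1; 1, 0, 0, 0, -1, -1; 0, 1, 0, 0, 0, 0;
    0, 0, -Complex.I, Complex.I, 0, 0; 0, 0, 1, 1, 0, 0;
    0, 0, 0, 0, -Complex.I * √2, Complex.I * √2]

/-- The inverse of `weightBasis`. -/
def weightBasisInv : Matrix (Fin 6) (Fin 6) ℂ :=
  !![1 / 2, 1 / 2, 0, 0, 0, 0; 0, 0, 1, 0, 0, 0; 0, 0, 0, Complex.I / 2, 1 / 2, 0;
    0, 0, 0, -Complex.I / 2, 1 / 2, 0; 1 / 4, -1 / 4, 0, 0, 0, Complex.I * √2 / 4;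
    1 / 4, -1 / 4, 0, 0, 0, -Complex.I * √2 / 4]

theorem csqrt_two_sq : ((√2 : ℝ) : ℂ) ^ 2 = 2 := by
  rw [← Complex.ofReal_pow, Real.sq_sqrt (by norm_num)]; norm_num

theorem weightBasisInv_mul : weightBasisInv * weightBasis = 1 := by
  have h2 := csqrt_two_sq
  have hI := Complex.I_sq
  ext i j
  fin_cases i <;> fin_cases j <;>
    simp [weightBasisInv, weightBasis, Matrix.mul_apply, Fin.sum_univ_six] <;>
    first
    | done
    | ring1
    | linear_combination (1 / 2 : ℂ) * -hI
    | linear_combination (1 / 4 : ℂ) * (-hI) * (√2 : ℂ) ^ 2 + (1 / 4 : ℂ) * h2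
    | linear_combination (1 / 4 : ℂ) * hI * (√2 : ℂ) ^ 2 - (1 / 4 : ℂ) * h2
    | linear_combination (1 / 2 : ℂ) * hI

theorem weightBasis_mul_inv : weightBasis * weightBasisInv = 1 :=
  mul_eq_one_comm.1 weightBasisInv_mul

theorem kelvin_rotZ_mul_weightBasis (φ : ℝ) :
    (kelvin (rotZ φ)).map Complex.ofRealHom * weightBasis
      = weightBasis * Matrix.diagonal (kelvinEigenvalues φ) := by
  have h2 := csqrt_two_sq
  have hI := Complex.I_sq
  have hsc : ((Real.sin φ : ℝ) : ℂ) ^ 2 + ((Real.cos φ : ℝ) : ℂ) ^ 2 = 1 := by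
    rw [← Complex.ofReal_pow, ← Complex.ofReal_pow, ← Complex.ofReal_add, Real.sin_sq_add_cos_sq]
    simp
  rw [kelvin_explicit, rotZ_coe, kelvinEigenvalues]
  generalize Real.sin φ = s at *
  generalize Real.cos φ = c at *
  ext i j
  fin_cases i <;> fin_cases j <;>
    simp [weightBasis, Matrix.mul_apply, Fin.sum_univ_six, Matrix.diagonal] <;> grind

/-- Over `ℂ`, `Φ(Q)` is diagonalizable with eigenvalues `1, 1, z, z̄, z², z̄²`, `|z| = 1`. -/
theorem exists_diag_kelvin (Q : O3) : ∃ (φ : ℝ) (P P' : Matrix (Fin 6) (Fin 6) ℂ), P' * P = 1 ∧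
    (kelvin Q).map Complex.ofRealHom = P * Matrix.diagonal (kelvinEigenvalues φ) * P' := by
  obtain ⟨Q', hk, hd⟩ : ∃ Q' : O3, kelvin (Q : Matrix (Fin 3) (Fin 3) ℝ) = kelvin Q' ∧
      (Q' : Matrix (Fin 3) (Fin 3) ℝ).det = 1 := by
    rcases O3_det Q with h | h
    · exact ⟨Q, rfl, h⟩
    · exact ⟨-Q, by rw [neg_coe, kelvin_neg], by rw [neg_coe, Matrix.det_neg, h, Fintype.card_fin]; norm_num⟩
  obtain ⟨g, φ, rfl⟩ := exists_conj_rotZ Q' hd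
  refine ⟨φ, (kelvin (g⁻¹ : O3)).map Complex.ofRealHom * weightBasis,
    weightBasisInv * (kelvin g).map Complex.ofRealHom, ?_, ?_⟩
  · have h1 : (kelvin g) * kelvin ((g⁻¹ : O3) : Matrix (Fin 3) (Fin 3) ℝ) = 1 := by
      rw [← kelvin_mul]
      have : (g : Matrix (Fin 3) (Fin 3) ℝ) * ((g⁻¹ : O3) : Matrix (Fin 3) (Fin 3) ℝ) = 1 :=
        O3_mul_transpose g
      rw [this, kelvin_one]
    rw [Matrix.mul_assoc, ← Matrix.mul_assoc (Matrix.map _ _), ← Matrix.map_mul, h1,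
      Matrix.map_one _ (map_zero _) (map_one _), Matrix.one_mul, weightBasisInv_mul]
  · have h2 : (kelvin ((g⁻¹ * rotZ φ * g : O3) : Matrix (Fin 3) (Fin 3) ℝ))
        = kelvin (g⁻¹ : O3) * kelvin (rotZ φ) * kelvin g := by
      rw [← kelvin_mul, ← kelvin_mul]; rfl
    rw [hk, h2, Matrix.map_mul, Matrix.map_mul]
    have h3 : (kelvin (rotZ φ)).map Complex.ofRealHom
        = weightBasis * Matrix.diagonal (kelvinEigenvalues φ) * weightBasisInv := by
      rw [← kelvin_rotZ_mul_weightBasis, Matrix.mul_assoc, weightBasis_mul_inv, Matrix.mul_one]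
    rw [h3]
    simp only [Matrix.mul_assoc]

/-! ### The trace of a projection onto the invariants -/

/-- The coefficient vector of the part of degree `d`. -/
def coeffVec (d : ℕ) : Poly →ₗ[ℝ] (Idx d → ℝ) where
  toFun f a := coeff a.1 f
  map_add' f g := by ext a; simp
  map_smul' r f := by ext a; simp

/-- The homogeneous polynomial of degree `d` with given coefficients. -/
def ofCoeffVec (d : ℕ) : (Idx d → ℝ) →ₗ[ℝ] Poly where
  toFun v := ∑ a : Idx d, v a • monomial a.1 (1 : ℝ)
  map_add' f g := by simp [add_smul, Finset.sum_add_distrib]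
  map_smul' r f := by simp [mul_smul, Finset.smul_sum]

theorem ofCoeffVec_coeffVec {d : ℕ} {f : Poly} (hf : f.IsHomogeneous d) :
    ofCoeffVec d (coeffVec d f) = f := (eq_sum_idx hf).symm

theorem isHomogeneous_ofCoeffVec {d : ℕ} (v : Idx d → ℝ) : (ofCoeffVec d v).IsHomogeneous d := by
  refine IsHomogeneous.sum _ _ _ fun a _ => ?_
  rw [smul_monomial]
  exact isHomogeneous_idx_monomial a _

theorem coeffVec_ofCoeffVec {d : ℕ} (v : Idx d → ℝ) : coeffVec d (ofCoeffVec d v) = v := by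
  ext a
  change coeff a.1 (∑ b : Idx d, v b • monomial b.1 (1 : ℝ)) = v a
  simp only [coeff_sum, coeff_smul, coeff_monomial]
  rw [Finset.sum_eq_single a]
  · simp
  · intro b _ hb
    rw [if_neg fun h => hb (Subtype.ext h), smul_zero]
  · simp

theorem coeffVec_linSubst (M : Matrix (Fin 6) (Fin 6) ℝ) {d : ℕ} {f : Poly} (hf : f.IsHomogeneous d) :
    coeffVec d (linSubst M f) = symMat M d *ᵥ coeffVec d f := by
  ext a
  exact coeff_linSubst M hf a.1

theorem mem_invariantRing {G : Subgroup O3} {f : Poly} :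
    f ∈ invariantRing G ↔ ∀ Q ∈ G, linSubst (kelvin (Q : Matrix (Fin 3) (Fin 3) ℝ)) f = f := Iff.rfl

/-- The space of homogeneous invariants of degree `d`. -/
def invSpace (G : Subgroup O3) (d : ℕ) : Submodule ℝ Poly :=
  homogeneousSubmodule (Fin 6) ℝ d ⊓ Subalgebra.toSubmodule (invariantRing G)

theorem invDim_eq (G : Subgroup O3) (d : ℕ) : invDim G d = Module.finrank ℝ (invSpace G d) := rfl

theorem coeffVec_injOn (d : ℕ) {f g : Poly} (hf : f.IsHomogeneous d) (hg : g.IsHomogeneous d)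
    (h : coeffVec d f = coeffVec d g) : f = g := by
  rw [← ofCoeffVec_coeffVec hf, ← ofCoeffVec_coeffVec hg, h]

theorem finrank_map_coeffVec (G : Subgroup O3) (d : ℕ) :
    Module.finrank ℝ ((invSpace G d).map (coeffVec d)) = invDim G d := by
  have hinj : Function.Injective ((coeffVec d).domRestrict (invSpace G d)) := by
    intro f g h
    exact Subtype.ext (coeffVec_injOn d f.2.1 g.2.1 h)
  rw [invDim_eq, ← LinearMap.range_domRestrict]
  exact LinearMap.finrank_range_of_inj hinj

instance finite_invSpace (G : Subgroup O3) (d : ℕ) : Module.Finite ℝ (invSpace G d) := by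
  have hinj : Function.Injective ((coeffVec d).domRestrict (invSpace G d)) := by
    intro f g h
    exact Subtype.ext (coeffVec_injOn d f.2.1 g.2.1 h)
  exact Module.Finite.of_injective _ hinj

/-- A matrix that fixes the invariants of degree `d` and whose range consists of invariants has the
dimension of the space of these invariants as its trace. -/
theorem trace_eq_invDim {G : Subgroup O3} {𝒢 : Set (Matrix (Fin 6) (Fin 6) ℝ)}
    (hA : ∀ f, (∀ M ∈ 𝒢, linSubst M f = f) → f ∈ invariantRing G) {d : ℕ}
    {E : Matrix (Idx d) (Idx d) ℝ}
    (h1 : ∀ f ∈ invariantRing G, f.IsHomogeneous d → E *ᵥ coeffVec d f = coeffVec d f)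
    (h2 : ∀ M ∈ 𝒢, symMat M d * E = E) : E.trace = invDim G d := by
  have hp : LinearMap.IsProj ((invSpace G d).map (coeffVec d)) (Matrix.toLin' E) := by
    refine ⟨fun v => ?_, ?_⟩
    · refine ⟨ofCoeffVec d (E *ᵥ v), ⟨isHomogeneous_ofCoeffVec _, hA _ fun M hM => ?_⟩, ?_⟩
      · refine coeffVec_injOn d (linSubst_isHomogeneous M (isHomogeneous_ofCoeffVec _))
          (isHomogeneous_ofCoeffVec _) ?_
        rw [coeffVec_linSubst M (isHomogeneous_ofCoeffVec _), coeffVec_ofCoeffVec,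
          Matrix.mulVec_mulVec, h2 M hM]
      · rw [coeffVec_ofCoeffVec, Matrix.toLin'_apply]
    · rintro _ ⟨f, hf, rfl⟩
      rw [Matrix.toLin'_apply]
      exact h1 f hf.2 hf.1
  have := hp.trace
  rw [Matrix.trace_toLin'_eq, finrank_map_coeffVec] at this
  exact this

/-- The averaging formula for the number of invariants of degree `d`, for a finite family of
matrices that is permuted by right multiplication with generators. -/
theorem sum_trace_symMat {G : Subgroup O3} {ι : Type*} [Fintype ι] [Nonempty ι]
    {𝒢 : Set (Matrix (Fin 6) (Fin 6) ℝ)} (M : ι → Matrix (Fin 6) (Fin 6) ℝ)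
    (hA : ∀ f, (∀ N ∈ 𝒢, linSubst N f = f) → f ∈ invariantRing G)
    (hM : ∀ i, ∀ f ∈ invariantRing G, linSubst (M i) f = f)
    (hσ : ∀ N ∈ 𝒢, ∃ σ : Equiv.Perm ι, ∀ i, M (σ i) = M i * N) (d : ℕ) :
    ∑ i, (symMat (M i) d).trace = Fintype.card ι * invDim G d := by
  have hc : (Fintype.card ι : ℝ) ≠ 0 := by positivity
  have key := trace_eq_invDim (G := G) (d := d) (E := (Fintype.card ι : ℝ)⁻¹ • ∑ i, symMat (M i) d)
    hA ?_ ?_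
  · rw [← key, Matrix.trace_smul, Matrix.trace_sum, smul_eq_mul, mul_inv_cancel_left₀ hc]
  · intro f hf hd
    rw [Matrix.smul_mulVec, Matrix.sum_mulVec]
    have : ∀ i, symMat (M i) d *ᵥ coeffVec d f = coeffVec d f := fun i => by
      rw [← coeffVec_linSubst (M i) hd, hM i f hf]
    simp only [this, Finset.sum_const, Finset.card_univ]
    rw [← Nat.cast_smul_eq_nsmul ℝ, smul_smul, inv_mul_cancel₀ hc, one_smul]
  · intro N hN
    obtain ⟨σ, h⟩ := hσ N hN
    rw [Matrix.mul_smul, Finset.mul_sum]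
    congr 1
    rw [← Equiv.sum_comp σ (fun i => symMat (M i) d)]
    exact Finset.sum_congr rfl fun i _ => by rw [h, symMat_mul]

/-! ### Traces of symmetric powers of `Φ(Q)` -/

theorem ofReal_trace_symMat (M : Matrix (Fin 6) (Fin 6) ℝ) (d : ℕ) :
    (((symMat M d).trace : ℝ) : ℂ) = (symMat (M.map Complex.ofRealHom) d).trace := by
  rw [symMat_map]
  exact (AddMonoidHom.map_trace (Complex.ofRealHom : ℝ →+ ℂ) _)

theorem norm_kelvinEigenvalues (φ : ℝ) (i : Fin 6) : ‖kelvinEigenvalues φ i‖ = 1 := by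
  have h : ‖(Real.cos φ : ℂ) + Real.sin φ * Complex.I‖ = 1 := by
    rw [Complex.ofReal_cos, Complex.ofReal_sin, ← Complex.exp_mul_I, Complex.norm_exp_ofReal_mul_I]
  have h' : ‖(Real.cos φ : ℂ) - Real.sin φ * Complex.I‖ = 1 := by
    have := Complex.norm_exp_ofReal_mul_I (-φ)
    rw [Complex.exp_mul_I, ← Complex.ofReal_cos, ← Complex.ofReal_sin, Real.cos_neg, Real.sin_neg] at this
    rw [← this]; push_cast; ring_nf
  fin_cases i
  · simp [kelvinEigenvalues]
  · simp [kelvinEigenvalues]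
  · exact h
  · exact h'
  · change ‖_ ^ 2‖ = 1
    rw [norm_pow, h, one_pow]
  · change ‖_ ^ 2‖ = 1
    rw [norm_pow, h', one_pow]

theorem abs_trace_symMat_kelvin_le (Q : O3) (d : ℕ) :
    |(symMat (kelvin (Q : Matrix (Fin 3) (Fin 3) ℝ)) d).trace| ≤ ((d + 1 : ℕ) : ℝ) ^ 6 := by
  obtain ⟨φ, P, P', hP, h⟩ := exists_diag_kelvin Q
  rw [← Real.norm_eq_abs, ← Complex.norm_real, ofReal_trace_symMat, trace_symMat_conj hP h, Matrix.trace]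
  refine (norm_sum_le _ _).trans ?_
  have h1 : ∀ a : Idx d, ‖Matrix.diag (symMat (Matrix.diagonal (kelvinEigenvalues φ)) d) a‖ = 1 := by
    intro a
    simp [symMat, linSubst_diagonal_monomial, norm_kelvinEigenvalues]
  simp only [h1, Finset.sum_const, Finset.card_univ, nsmul_eq_mul, mul_one]
  have hcard : Fintype.card (Idx d) ≤ Fintype.card (Fin 6 → Fin (d + 1)) := by
    refine Fintype.card_le_of_injective (fun a i => ⟨a.1 i, ?_⟩) ?_
    · have := mem_idx.1 a.2
      rw [Finsupp.degree_eq_sum] at this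
      have h2 : a.1 i ≤ ∑ j, a.1 j :=
        Finset.single_le_sum (f := fun j => a.1 j) (fun _ _ => Nat.zero_le _) (Finset.mem_univ i)
      omega
    · intro a b hab
      refine Subtype.ext (Finsupp.ext fun i => ?_)
      simpa using congrFun hab i
  rw [Fintype.card_fun, Fintype.card_fin, Fintype.card_fin] at hcard
  exact_mod_cast hcard

theorem trace_symMat_kelvin_inv (Q : O3) (d : ℕ) :
    (symMat (kelvin ((Q⁻¹ : O3) : Matrix (Fin 3) (Fin 3) ℝ)) d).trace
      = (symMat (kelvin (Q : Matrix (Fin 3) (Fin 3) ℝ)) d).trace := by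
  obtain ⟨φ, P, P', hP, h⟩ := exists_diag_kelvin Q
  have ht : kelvin ((Q⁻¹ : O3) : Matrix (Fin 3) (Fin 3) ℝ) = (kelvin (Q : Matrix (Fin 3) (Fin 3) ℝ))ᵀ := by
    have : ((Q⁻¹ : O3) : Matrix (Fin 3) (Fin 3) ℝ) = (Q : Matrix (Fin 3) (Fin 3) ℝ)ᵀ := rfl
    rw [this]
    ext α β
    simp only [kelvin_eq_trace, Matrix.transpose_apply, Matrix.transpose_transpose, Matrix.mul_assoc]
    rw [← Matrix.mul_assoc (kelvinCoeff α), Matrix.trace_mul_comm]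
    simp only [Matrix.mul_assoc]
  have h' : ((kelvin (Q : Matrix (Fin 3) (Fin 3) ℝ))ᵀ).map Complex.ofRealHom
      = P'ᵀ * Matrix.diagonal (kelvinEigenvalues φ) * Pᵀ := by
    rw [Matrix.transpose_map, h]
    simp [Matrix.transpose_mul, Matrix.mul_assoc]
  have hP' : Pᵀ * P'ᵀ = 1 := by rw [← Matrix.transpose_mul, hP, Matrix.transpose_one]
  apply Complex.ofReal_injective
  rw [ofReal_trace_symMat, ofReal_trace_symMat, ht, trace_symMat_conj hP' h', trace_symMat_conj hP h]

/-- If a power series times a polynomial is a polynomial, the same holds for its values. -/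
theorem tsum_mul_eval {𝕜 : Type*} [RCLike 𝕜] {a : ℕ → 𝕜} {P N : Polynomial 𝕜} {t : 𝕜}
    (h : PowerSeries.mk a * (P : PowerSeries 𝕜) = N) (ha : Summable fun n => ‖a n * t ^ n‖) :
    (∑' n, a n * t ^ n) * P.eval t = N.eval t := by
  have hs : ∀ Q : Polynomial 𝕜, HasSum (fun n => Q.coeff n * t ^ n) (Q.eval t) := by
    intro Q
    rw [Polynomial.eval_eq_sum_range]
    refine hasSum_sum_of_ne_finset_zero fun n hn => ?_
    rw [Polynomial.coeff_eq_zero_of_natDegree_lt (by simpa using hn), zero_mul]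
  have hP : Summable fun n => ‖P.coeff n * t ^ n‖ :=
    summable_of_ne_finset_zero (s := Finset.range (P.natDegree + 1)) fun n hn => by
      rw [Polynomial.coeff_eq_zero_of_natDegree_lt (by simpa using hn), zero_mul, norm_zero]
  rw [← (hs P).tsum_eq, ← (hs N).tsum_eq, tsum_mul_tsum_eq_tsum_sum_antidiagonal_of_summable_norm ha hP]
  refine tsum_congr fun n => ?_
  have hn := congrArg (PowerSeries.coeff n) h
  rw [PowerSeries.coeff_mul, Polynomial.coeff_coe] at hn
  rw [← hn, Finset.sum_mul]
  refine Finset.sum_congr rfl fun x hx => ?_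
  rw [PowerSeries.coeff_mk, Polynomial.coeff_coe, ← Finset.HasAntidiagonal.mem_antidiagonal.1 hx, pow_add]
  ring

theorem summable_bound {t : ℝ} (ht : |t| < 1) : Summable fun d : ℕ => ((d + 1 : ℕ) : ℝ) ^ 6 * |t| ^ d := by
  by_cases h0 : t = 0
  · refine summable_of_ne_finset_zero (s := {0}) fun n hn => ?_
    rw [h0, abs_zero, zero_pow (by simpa using hn), mul_zero]
  · have h1 := summable_pow_mul_geometric_of_norm_lt_one (R := ℝ) 6 (r := |t|) (by simpa using ht)
    have h2 := (summable_nat_add_iff 1).2 h1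
    refine (h2.mul_left |t|⁻¹).congr fun d => ?_
    have : |t| ≠ 0 := abs_ne_zero.2 h0
    field_simp
    exact pow_succ' _ _

theorem summable_trace_symMat_kelvin (Q : O3) {t : ℝ} (ht : |t| < 1) :
    Summable fun d => ‖(symMat (kelvin (Q : Matrix (Fin 3) (Fin 3) ℝ)) d).trace * t ^ d‖ := by
  refine Summable.of_nonneg_of_le (fun _ => norm_nonneg _) (fun d => ?_) (summable_bound ht)
  rw [norm_mul, norm_pow, Real.norm_eq_abs, Real.norm_eq_abs]
  gcongr
  exact abs_trace_symMat_kelvin_le Q d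

/-- The Molien term of `Q` is the generating function of the traces on the symmetric powers. -/
theorem hasSum_molienTerm (Q : O3) {t : ℝ} (ht : |t| < 1) :
    (1 - t • kelvin (Q : Matrix (Fin 3) (Fin 3) ℝ)).det ≠ 0 ∧
    HasSum (fun d => (symMat (kelvin (Q : Matrix (Fin 3) (Fin 3) ℝ)) d).trace * t ^ d) (molienTerm t Q) := by
  obtain ⟨φ, P, P', hP, h⟩ := exists_diag_kelvin Q
  have hsum := summable_trace_symMat_kelvin Q ht
  -- both sides are computed from the eigenvalues of `Φ(Q)`
  have hdet : (((1 - t • kelvin (Q : Matrix (Fin 3) (Fin 3) ℝ)).det : ℝ) : ℂ)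
      = ∏ i, (1 - kelvinEigenvalues φ i * t) := by
    have h1 : (1 - t • kelvin (Q : Matrix (Fin 3) (Fin 3) ℝ)).map Complex.ofRealHom
        = P * Matrix.diagonal (fun i => 1 - kelvinEigenvalues φ i * t) * P' := by
      have h2 : Matrix.diagonal (fun i => 1 - kelvinEigenvalues φ i * (t : ℂ))
          = 1 - (t : ℂ) • Matrix.diagonal (kelvinEigenvalues φ) := by
        ext i j
        by_cases hij : i = j
        · subst hij; simp [mul_comm]
        · simp [hij]
      rw [h2, Matrix.mul_sub, Matrix.sub_mul, Matrix.mul_one, mul_eq_one_comm.1 hP, Matrix.mul_smul,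
        Matrix.smul_mul, ← h]
      ext i j
      by_cases hij : i = j
      · subst hij; simp
      · simp [hij]
    change Complex.ofRealHom _ = _
    rw [RingHom.map_det]
    change ((1 - t • kelvin (Q : Matrix (Fin 3) (Fin 3) ℝ)).map Complex.ofRealHom).det = _
    rw [h1, Matrix.det_mul, Matrix.det_mul, Matrix.det_diagonal, mul_comm, ← mul_assoc, ← Matrix.det_mul,
      hP, Matrix.det_one, one_mul]
  have hps := trace_symMat_of_diag hP h
  have hpoly : (∏ i, (1 - PowerSeries.C (kelvinEigenvalues φ i) * PowerSeries.X) : PowerSeries ℂ)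
      = ((∏ i, (1 - Polynomial.C (kelvinEigenvalues φ i) * Polynomial.X) : Polynomial ℂ) : PowerSeries ℂ) := by
    have := map_prod (Polynomial.coeToPowerSeries.ringHom (R := ℂ))
      (fun i => 1 - Polynomial.C (kelvinEigenvalues φ i) * Polynomial.X) Finset.univ
    simp only [Polynomial.coeToPowerSeries.ringHom_apply] at this
    rw [this]
    simp
  rw [hpoly, show (1 : PowerSeries ℂ) = ((1 : Polynomial ℂ) : PowerSeries ℂ) by simp] at hps
  have hv := tsum_mul_eval (t := (t : ℂ)) hps (by
    refine hsum.congr fun d => ?_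
    rw [← ofReal_trace_symMat, ← Complex.ofReal_pow, ← Complex.ofReal_mul, Complex.norm_real])
  rw [Polynomial.eval_prod] at hv
  simp only [Polynomial.eval_sub, Polynomial.eval_one, Polynomial.eval_mul, Polynomial.eval_C,
    Polynomial.eval_X] at hv
  rw [← hdet] at hv
  have hv' : (∑' d, (symMat (kelvin (Q : Matrix (Fin 3) (Fin 3) ℝ)) d).trace * t ^ d)
      * (1 - t • kelvin (Q : Matrix (Fin 3) (Fin 3) ℝ)).det = 1 := by
    apply Complex.ofReal_injective
    rw [Complex.ofReal_mul, Complex.ofReal_tsum, ← (by simpa using hv : _ = ((1 : ℝ) : ℂ))]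
    congr 1
    refine tsum_congr fun d => ?_
    rw [← ofReal_trace_symMat]; simp
  have hne := right_ne_zero_of_mul (a := (∑' d, (symMat (kelvin (Q : Matrix (Fin 3) (Fin 3) ℝ)) d).trace * t ^ d))
    (by rw [hv']; exact one_ne_zero)
  refine ⟨hne, ?_⟩
  rw [molienTerm, one_div, ← eq_inv_of_mul_eq_one_left hv']
  exact hsum.of_norm.hasSum

/-- Molien's theorem for finite groups. -/
theorem hasFiniteMolien_of_hasSum {G : Subgroup O3} (hG : Finite G) {F : ℝ → ℝ}
    (hF : ∀ t ∈ Set.Ioo (-1 : ℝ) 1, HasSum (fun d => (invDim G d : ℝ) * t ^ d) (F t)) :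
    HasFiniteMolien G F := by
  refine ⟨hG, fun t ht => ?_⟩
  have := Fintype.ofFinite G
  have ht' : |t| < 1 := abs_lt.2 ht
  have hsum : ∀ d, ∑ Q : G, (symMat (kelvin ((Q : O3) : Matrix (Fin 3) (Fin 3) ℝ)) d).trace
      = Fintype.card G * invDim G d := fun d => by
    refine sum_trace_symMat (𝒢 := Set.range fun Q : G => kelvin ((Q : O3) : Matrix (Fin 3) (Fin 3) ℝ))
      (fun Q : G => kelvin ((Q : O3) : Matrix (Fin 3) (Fin 3) ℝ))
      (fun f hf Q hQ => hf _ ⟨⟨Q, hQ⟩, rfl⟩) (fun Q f hf => hf Q Q.2) ?_ d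
    rintro _ ⟨g, rfl⟩
    exact ⟨Equiv.mulRight g, fun Q => by rw [← kelvin_mul]; rfl⟩
  have h1 : HasSum (fun d => ∑ Q : G, (symMat (kelvin ((Q : O3) : Matrix (Fin 3) (Fin 3) ℝ)) d).trace * t ^ d)
      (∑ Q : G, molienTerm t Q) := hasSum_sum fun Q _ => (hasSum_molienTerm (Q : O3) ht').2
  have h2 : HasSum (fun d => ∑ Q : G, (symMat (kelvin ((Q : O3) : Matrix (Fin 3) (Fin 3) ℝ)) d).trace * t ^ d)
      (Fintype.card G * F t) := by
    refine ((hF t ht).mul_left (Fintype.card G : ℝ)).congr_fun fun d => ?_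
    rw [← Finset.sum_mul, hsum d, mul_assoc]
  rw [finsum_eq_sum_of_fintype, h1.unique h2, Nat.card_eq_fintype_card]
  have : (Fintype.card G : ℝ) ≠ 0 := by positivity
  field_simp

theorem continuous_coeff_linSubst {X : Type*} [TopologicalSpace X] {M : X → Matrix (Fin 6) (Fin 6) ℝ}
    (hM : Continuous M) (f : Poly) (a : Fin 6 →₀ ℕ) : Continuous fun x => coeff a (linSubst (M x) f) := by
  induction f using MvPolynomial.induction_on generalizing a with
  | C r =>
    have : ∀ x, linSubst (M x) (MvPolynomial.C r) = MvPolynomial.C r := fun x => AlgHom.commutes _ r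
    simp only [this]
    exact continuous_const
  | add p q hp hq =>
    simp only [map_add, coeff_add]
    exact (hp a).add (hq a)
  | mul_X p n hp =>
    simp only [map_mul, linSubst_X, Finset.mul_sum, coeff_sum]
    refine continuous_finsetSum _ fun β _ => ?_
    simp only [mul_left_comm _ (MvPolynomial.C _) _, coeff_C_mul, coeff_mul_X']
    refine Continuous.mul (hM.matrix_elem n β) ?_
    by_cases h : β ∈ a.support
    · simp only [h, if_true]; exact hp _
    · simp only [h, if_false]; exact continuous_const

theorem continuous_kelvin : Continuous fun Q : Matrix (Fin 3) (Fin 3) ℝ => kelvin Q := by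
  refine continuous_matrix fun α β => ?_
  simp only [kelvin, Matrix.of_apply]
  fun_prop

theorem integrable_of_continuous_compact {X : Type*} [TopologicalSpace X] [CompactSpace X] [MeasurableSpace X]
    [BorelSpace X] {μ : Measure X} [IsFiniteMeasure μ] {f : X → ℝ} (hf : Continuous f) : Integrable f μ := by
  obtain ⟨C, hC⟩ := (isCompact_range hf).isBounded.exists_norm_le
  exact Integrable.of_bound hf.measurable.aestronglyMeasurable C
    (Filter.Eventually.of_forall fun x => hC _ ⟨x, rfl⟩)

/-- Molien's theorem for infinite compact groups. -/
theorem hasHaarMolien_of_hasSum {G : Subgroup O3} (hi : Infinite G) (hG : CompactSpace G) {F : ℝ → ℝ}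
    (hF : ∀ t ∈ Set.Ioo (-1 : ℝ) 1, HasSum (fun d => (invDim G d : ℝ) * t ^ d) (F t)) :
    HasHaarMolien G F := by
  let : MeasurableSpace G := borel G
  have : BorelSpace G := ⟨rfl⟩
  refine ⟨hi, hG, ?_⟩
  let μ : Measure G := Measure.haarMeasure ⊤
  have hμ : μ.IsHaarMeasure := inferInstance
  have hp : IsProbabilityMeasure μ := ⟨Measure.haarMeasure_self (K₀ := (⊤ : TopologicalSpace.PositiveCompacts G))⟩
  refine ⟨μ, hμ, hp, fun t ht => ?_⟩
  have ht' : |t| < 1 := abs_lt.2 ht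
  have hcont : Continuous fun Q : G => kelvin ((Q : O3) : Matrix (Fin 3) (Fin 3) ℝ) :=
    continuous_kelvin.comp (continuous_subtype_val.comp continuous_subtype_val)
  have hcont' : Continuous fun Q : G => kelvin (((Q⁻¹ : G) : O3) : Matrix (Fin 3) (Fin 3) ℝ) :=
    hcont.comp continuous_inv
  -- the average over the group, taken over inverses so that left invariance suffices
  have hdim : ∀ d, ∫ Q : G, (symMat (kelvin ((Q : O3) : Matrix (Fin 3) (Fin 3) ℝ)) d).trace ∂μ = invDim G d := by
    intro d
    have hci : ∀ a b : Idx d, Integrable (fun Q : G => symMat (kelvin (((Q⁻¹ : G) : O3) : Matrix (Fin 3) (Fin 3) ℝ)) d a b) μ :=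
      fun a b => integrable_of_continuous_compact (continuous_coeff_linSubst hcont' _ _)
    have key := trace_eq_invDim (G := G) (d := d)
      (𝒢 := Set.range fun Q : G => kelvin ((Q : O3) : Matrix (Fin 3) (Fin 3) ℝ))
      (E := Matrix.of fun a b => ∫ Q : G, symMat (kelvin (((Q⁻¹ : G) : O3) : Matrix (Fin 3) (Fin 3) ℝ)) d a b ∂μ)
      (fun f hf Q hQ => hf _ ⟨⟨Q, hQ⟩, rfl⟩) ?_ ?_
    · rw [← key, Matrix.trace]
      simp only [Matrix.diag, Matrix.of_apply]
      rw [← integral_finsetSum _ fun a _ => hci a a]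
      refine integral_congr_ae (Filter.Eventually.of_forall fun Q => ?_)
      exact (trace_symMat_kelvin_inv (Q : O3) d).symm
    · intro f hf hd
      ext a
      simp only [Matrix.mulVec, dotProduct, Matrix.of_apply]
      simp only [← integral_mul_const]
      rw [← integral_finsetSum _ fun b _ => (hci a b).mul_const _]
      have : ∀ Q : G, ∑ b, symMat (kelvin (((Q⁻¹ : G) : O3) : Matrix (Fin 3) (Fin 3) ℝ)) d a b * coeffVec d f b
          = coeffVec d f a := fun Q => by
        have h1 := coeffVec_linSubst (kelvin (((Q⁻¹ : G) : O3) : Matrix (Fin 3) (Fin 3) ℝ)) hd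
        rw [mem_invariantRing.1 hf _ (Q⁻¹).2] at h1
        exact (congrFun h1 a).symm
      simp only [this, integral_const, probReal_univ, one_smul]
    · rintro _ ⟨g, rfl⟩
      ext a b
      simp only [Matrix.mul_apply, Matrix.of_apply]
      simp only [← integral_const_mul]
      rw [← integral_finsetSum _ fun c _ => (hci c b).const_mul _]
      rw [← integral_mul_left_eq_self
        (fun Q : G => symMat (kelvin (((Q⁻¹ : G) : O3) : Matrix (Fin 3) (Fin 3) ℝ)) d a b) g⁻¹]
      refine integral_congr_ae (Filter.Eventually.of_forall fun Q => ?_)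
      have h2 : (g⁻¹ * Q)⁻¹ = Q⁻¹ * g := by group
      have h3 : kelvin (((Q⁻¹ * g : G) : O3) : Matrix (Fin 3) (Fin 3) ℝ)
          = kelvin (((Q⁻¹ : G) : O3) : Matrix (Fin 3) (Fin 3) ℝ) * kelvin ((g : O3) : Matrix (Fin 3) (Fin 3) ℝ) := by
        rw [← kelvin_mul]; rfl
      simp only [h2, h3, symMat_mul, Matrix.mul_apply]
  have hmc : Continuous fun Q : G => molienTerm t (Q : O3) := by
    unfold molienTerm
    refine Continuous.div continuous_const ?_ fun Q => (hasSum_molienTerm (Q : O3) ht').1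
    exact Continuous.matrix_det (continuous_const.sub (hcont.const_smul t))
  refine ⟨integrable_of_continuous_compact hmc, ?_⟩
  have htc : ∀ d, Continuous fun Q : G => (symMat (kelvin ((Q : O3) : Matrix (Fin 3) (Fin 3) ℝ)) d).trace * t ^ d :=
    fun d => (Continuous.mul (continuous_finsetSum _ fun a _ => continuous_coeff_linSubst hcont _ _) continuous_const)
  -- the eigenvalues have modulus one, so the traces are bounded by the number of monomials
  have h1 := hasSum_integral_of_dominated_convergence (μ := μ)
    (F := fun d (Q : G) => (symMat (kelvin ((Q : O3) : Matrix (Fin 3) (Fin 3) ℝ)) d).trace * t ^ d)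
    (f := fun Q : G => molienTerm t (Q : O3))
    (fun d _ => ((d + 1 : ℕ) : ℝ) ^ 6 * |t| ^ d)
    (fun d => (htc d).measurable.aestronglyMeasurable)
    (fun d => Filter.Eventually.of_forall fun Q => by
      rw [norm_mul, norm_pow, Real.norm_eq_abs, Real.norm_eq_abs]
      gcongr
      exact abs_trace_symMat_kelvin_le Q d)
    (Filter.Eventually.of_forall fun Q => summable_bound ht')
    (integrable_const _)
    (Filter.Eventually.of_forall fun Q => (hasSum_molienTerm (Q : O3) ht').2)
  refine h1.unique ((hF t ht).congr_fun fun d => ?_)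
  rw [integral_mul_const, hdim d]

/-! ### Hilbert series of free graded modules -/

section Free

set_option linter.unusedSectionVars false

variable {κ ι : Type*} [Fintype κ] [DecidableEq κ] [Fintype ι]

/-- Exponents of the monomials of degree `n` in variables of degrees `dp`, scaled by the degrees. -/
def scaledExps (dp : κ → ℕ) (n : ℕ) : Finset (κ →₀ ℕ) :=
  ((Finset.univ : Finset κ).finsuppAntidiag n).filter fun l => ∀ i, dp i ∣ l i

/-- Exponents of the elements `p^a S_j` of degree `n` of a free module, for fixed `j`. -/
def shiftedExps (dp : κ → ℕ) (e n : ℕ) : Finset (κ →₀ ℕ) :=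
  if e ≤ n then scaledExps dp (n - e) else ∅

/-- The index set for the elements `p^a S_j` of degree `n`. -/
abbrev FreeIdx (dp : κ → ℕ) (dS : ι → ℕ) (n : ℕ) : Type _ :=
  Σ j : ι, {l : κ →₀ ℕ // l ∈ shiftedExps dp (dS j) n}

theorem mk_card_scaledExps (dp : κ → ℕ) (hd : ∀ i, 1 ≤ dp i) :
    (PowerSeries.mk fun n => ((scaledExps dp n).card : ℤ)) * ∏ i, (1 - PowerSeries.X ^ dp i) = 1 := by
  have h1 : (PowerSeries.mk fun n => ((scaledExps dp n).card : ℤ))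
      = ∏ i, PowerSeries.mk fun n => if dp i ∣ n then (1 : ℤ) else 0 := by
    ext n
    rw [PowerSeries.coeff_prod, PowerSeries.coeff_mk, scaledExps, Finset.card_filter, Nat.cast_sum]
    refine Finset.sum_congr rfl fun l _ => ?_
    simp only [PowerSeries.coeff_mk, Finset.prod_ite_zero, Finset.prod_const_one, Finset.mem_univ,
      true_implies]
    split_ifs <;> simp
  rw [h1, ← Finset.prod_mul_distrib]
  refine Finset.prod_eq_one fun i _ => ?_
  ext n
  rw [mul_sub, mul_one, map_sub, PowerSeries.coeff_mk, PowerSeries.coeff_mul_X_pow', PowerSeries.coeff_one]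
  have hi := hd i
  by_cases hn : n = 0
  · subst hn
    simp [show dp i ≠ 0 by omega]
  · rw [if_neg hn]
    by_cases hle : dp i ≤ n
    · rw [if_pos hle, PowerSeries.coeff_mk]
      have : dp i ∣ n - dp i ↔ dp i ∣ n := by rw [Nat.dvd_sub_iff_left hle dvd_rfl]
      simp only [this, sub_self]
    · rw [if_neg hle, if_neg, sub_zero]
      exact fun h => hle (Nat.le_of_dvd (Nat.pos_of_ne_zero hn) h)

theorem mk_card_freeIdx (dp : κ → ℕ) (hd : ∀ i, 1 ≤ dp i) (dS : ι → ℕ) :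
    (PowerSeries.mk fun n => (Fintype.card (FreeIdx dp dS n) : ℤ)) * ∏ i, (1 - PowerSeries.X ^ dp i)
      = ∑ j, PowerSeries.X ^ dS j := by
  have h1 : (PowerSeries.mk fun n => (Fintype.card (FreeIdx dp dS n) : ℤ))
      = (∑ j, PowerSeries.X ^ dS j) * PowerSeries.mk fun n => ((scaledExps dp n).card : ℤ) := by
    ext n
    rw [PowerSeries.coeff_mk, Finset.sum_mul, map_sum, Fintype.card_sigma, Nat.cast_sum]
    refine Finset.sum_congr rfl fun j _ => ?_
    rw [PowerSeries.coeff_X_pow_mul', Fintype.card_coe, shiftedExps]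
    split_ifs <;> simp
  rw [h1, mul_assoc, mk_card_scaledExps dp hd, mul_one]

theorem mem_shiftedExps {dp : κ → ℕ} {e n : ℕ} {l : κ →₀ ℕ} :
    l ∈ shiftedExps dp e n ↔ (∑ i, l i) + e = n ∧ ∀ i, dp i ∣ l i := by
  unfold shiftedExps scaledExps
  split_ifs with h
  · simp only [Finset.mem_filter, Finset.mem_finsuppAntidiag, Finset.subset_univ, and_true]
    have key : ∀ s : ℕ, s = n - e ↔ s + e = n := by intro s; omega
    exact and_congr_left fun _ => key _
  · simp only [Finset.notMem_empty, false_iff, not_and]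
    intro h'; omega

/-- The exponent `a` encoded by a scaled exponent. -/
def unscale (dp : κ → ℕ) (l : κ →₀ ℕ) : κ →₀ ℕ := Finsupp.equivFunOnFinite.symm fun i => l i / dp i

/-- The element `p^a S_j`. -/
def freeElt (p : κ → Poly) (S : ι → Poly) (j : ι) (a : κ →₀ ℕ) : Poly :=
  aeval p (monomial a (1 : ℝ)) * S j

theorem freeElt_isHomogeneous {p : κ → Poly} {S : ι → Poly} {dp : κ → ℕ} {dS : ι → ℕ}
    (hp : ∀ i, (p i).IsHomogeneous (dp i)) (hS : ∀ j, (S j).IsHomogeneous (dS j)) (j : ι) (a : κ →₀ ℕ) :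
    (freeElt p S j a).IsHomogeneous ((∑ i, dp i * a i) + dS j) := by
  refine IsHomogeneous.mul ?_ (hS j)
  rw [aeval_monomial, map_one, one_mul, Finsupp.prod_fintype _ _ (by simp)]
  exact IsHomogeneous.prod _ _ _ fun i _ => (hp i).pow (a i)

theorem sum_aeval_eq_sum_freeElt (p : κ → Poly) (S : ι → Poly) (c : ι → MvPolynomial κ ℝ) :
    ∑ j, aeval p (c j) * S j = ∑ j, ∑ a ∈ (c j).support, coeff a (c j) • freeElt p S j a := by
  refine Finset.sum_congr rfl fun j _ => ?_
  conv_lhs => rw [(c j).as_sum]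
  rw [map_sum, Finset.sum_mul]
  refine Finset.sum_congr rfl fun a _ => ?_
  rw [freeElt, ← smul_mul_assoc, ← map_smul, smul_monomial, smul_eq_mul, mul_one]

variable {p : κ → Poly} {S : ι → Poly} {dp : κ → ℕ} {dS : ι → ℕ}

/-- The family `p^a S_j` of degree `n`. -/
def freeFamily (p : κ → Poly) (S : ι → Poly) (dp : κ → ℕ) (dS : ι → ℕ) (n : ℕ) (x : FreeIdx dp dS n) : Poly :=
  freeElt p S x.1 (unscale dp x.2.1)

theorem linearIndependent_freeFamily (n : ℕ)
    (hind : ∀ c : ι → MvPolynomial κ ℝ, ∑ j, aeval p (c j) * S j = 0 → c = 0) :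
    LinearIndependent ℝ (freeFamily p S dp dS n) := by
  classical
  rw [Fintype.linearIndependent_iff]
  intro g hg x
  have h1 := hind (fun j => ∑ l : {l // l ∈ shiftedExps dp (dS j) n}, monomial (unscale dp l.1) (g ⟨j, l⟩)) (by
    rw [← hg, Fintype.sum_sigma]
    refine Finset.sum_congr rfl fun j _ => ?_
    rw [map_sum, Finset.sum_mul]
    refine Finset.sum_congr rfl fun l _ => ?_
    rw [freeFamily, freeElt, ← smul_mul_assoc, ← map_smul, smul_monomial, smul_eq_mul, mul_one])
  have h2 := congrArg (coeff (unscale dp x.2.1)) (congrFun h1 x.1)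
  simp only [coeff_sum, coeff_monomial, Pi.zero_apply, coeff_zero] at h2
  rw [Finset.sum_eq_single x.2] at h2
  · simpa using h2
  · intro l _ hl
    rw [if_neg]
    intro h
    refine hl (Subtype.ext (Finsupp.ext fun i => ?_))
    have h3 := DFunLike.congr_fun h i
    simp only [unscale, Finsupp.equivFunOnFinite_symm_apply_apply] at h3
    exact (Nat.div_left_inj ((mem_shiftedExps.1 l.2).2 i) ((mem_shiftedExps.1 x.2.2).2 i)).1 h3
  · simp

theorem freeFamily_isHomogeneous (hp : ∀ i, (p i).IsHomogeneous (dp i)) (hS : ∀ j, (S j).IsHomogeneous (dS j))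
    (n : ℕ) (x : FreeIdx dp dS n) : (freeFamily p S dp dS n x).IsHomogeneous n := by
  have h := freeElt_isHomogeneous hp hS x.1 (unscale dp x.2.1)
  obtain ⟨h1, h2⟩ := mem_shiftedExps.1 x.2.2
  have : (∑ i, dp i * unscale dp x.2.1 i) + dS x.1 = n := by
    refine Eq.trans ?_ h1
    congr 1
    refine Finset.sum_congr rfl fun i _ => ?_
    simp only [unscale, Finsupp.equivFunOnFinite_symm_apply_apply]
    exact Nat.mul_div_cancel' (h2 i)
  rwa [this] at h

theorem mem_span_freeFamily (hd : ∀ i, 1 ≤ dp i) (hp : ∀ i, (p i).IsHomogeneous (dp i))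
    (hS : ∀ j, (S j).IsHomogeneous (dS j)) {n : ℕ} {f : Poly} (hf : f.IsHomogeneous n)
    {c : ι → MvPolynomial κ ℝ} (hc : f = ∑ j, aeval p (c j) * S j) :
    f ∈ Submodule.span ℝ (Set.range (freeFamily p S dp dS n)) := by
  have h1 : f = homogeneousComponent n f := by
    rw [homogeneousComponent_of_mem hf, if_pos rfl]
  rw [h1, hc, sum_aeval_eq_sum_freeElt]
  simp only [map_sum, map_smul]
  refine Submodule.sum_mem _ fun j _ => Submodule.sum_mem _ fun a _ => Submodule.smul_mem _ _ ?_
  rw [homogeneousComponent_of_mem (freeElt_isHomogeneous hp hS j a)]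
  split_ifs with h
  · refine Submodule.subset_span ⟨⟨j, Finsupp.equivFunOnFinite.symm fun i => dp i * a i, ?_⟩, ?_⟩
    · rw [mem_shiftedExps]
      simp [h]
    · rw [freeFamily]
      congr 1
      ext i
      simp [unscale, Nat.mul_div_cancel_left _ (hd i)]
  · exact Submodule.zero_mem _

end Free

section Graded

theorem homogeneousComponent_linSubst (M : Matrix (Fin 6) (Fin 6) ℝ) (n : ℕ) (f : Poly) :
    homogeneousComponent n (linSubst M f) = linSubst M (homogeneousComponent n f) := by
  conv_lhs => rw [← sum_homogeneousComponent f, map_sum, map_sum]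
  by_cases hn : n ∈ Finset.range (f.totalDegree + 1)
  · rw [Finset.sum_eq_single_of_mem n hn]
    · rw [homogeneousComponent_of_mem
        (linSubst_isHomogeneous M (homogeneousComponent_isHomogeneous n f)), if_pos rfl]
    · intro m _ hm
      rw [homogeneousComponent_of_mem
        (linSubst_isHomogeneous M (homogeneousComponent_isHomogeneous m f)), if_neg hm.symm]
  · rw [Finset.sum_eq_zero, homogeneousComponent_eq_zero, map_zero]
    · rw [Finset.mem_range, not_lt] at hn
      exact hn
    · intro m hm
      rw [homogeneousComponent_of_mem
        (linSubst_isHomogeneous M (homogeneousComponent_isHomogeneous m f)), if_neg]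
      rintro rfl
      exact hn hm

theorem homogeneousComponent_mem_invariantRing {G : Subgroup O3} {f : Poly} (hf : f ∈ invariantRing G) (n : ℕ) :
    homogeneousComponent n f ∈ invariantRing G := by
  refine mem_invariantRing.2 fun Q hQ => ?_
  have h := mem_invariantRing.1 hf Q hQ
  rw [← homogeneousComponent_linSubst, h]

variable {κ ι : Type*} [Fintype κ] [DecidableEq κ] [Fintype ι] {G : Subgroup O3}
  {p : κ → Poly} {S : ι → Poly} {dp : κ → ℕ} {dS : ι → ℕ}

theorem freeFamily_mem (hpA : ∀ i, p i ∈ invariantRing G) (hSA : ∀ j, S j ∈ invariantRing G)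
    (hp : ∀ i, (p i).IsHomogeneous (dp i)) (hS : ∀ j, (S j).IsHomogeneous (dS j)) (n : ℕ) (x : FreeIdx dp dS n) :
    freeFamily p S dp dS n x ∈ invSpace G n := by
  refine ⟨freeFamily_isHomogeneous hp hS n x, ?_⟩
  change _ ∈ invariantRing G
  rw [freeFamily, freeElt, aeval_monomial, map_one, one_mul, Finsupp.prod]
  exact Subalgebra.mul_mem _ (Subalgebra.prod_mem _ fun i _ => Subalgebra.pow_mem _ (hpA i) _) (hSA _)

/-- The Hilbert series of a free graded module over a polynomial ring. -/
theorem hilbertSeries_of_basis (hd : ∀ i, 1 ≤ dp i) (hpA : ∀ i, p i ∈ invariantRing G)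
    (hSA : ∀ j, S j ∈ invariantRing G)
    (hp : ∀ i, (p i).IsHomogeneous (dp i)) (hS : ∀ j, (S j).IsHomogeneous (dS j))
    (hind : ∀ c : ι → MvPolynomial κ ℝ, ∑ j, aeval p (c j) * S j = 0 → c = 0)
    (hspan : ∀ f ∈ invariantRing G, ∃ c : ι → MvPolynomial κ ℝ, f = ∑ j, aeval p (c j) * S j) :
    hilbertSeries G * ∏ i, (1 - PowerSeries.X ^ dp i) = ∑ j, PowerSeries.X ^ dS j := by
  rw [← mk_card_freeIdx dp hd dS]
  congr 1
  ext n
  rw [hilbertSeries, PowerSeries.coeff_mk, PowerSeries.coeff_mk, invDim_eq]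
  have : invSpace G n = Submodule.span ℝ (Set.range (freeFamily p S dp dS n)) := by
    refine le_antisymm (fun f hf => ?_) (Submodule.span_le.2 ?_)
    · obtain ⟨c, hc⟩ := hspan f hf.2
      exact mem_span_freeFamily hd hp hS hf.1 hc
    · rintro _ ⟨x, rfl⟩
      exact freeFamily_mem hpA hSA hp hS n x
  rw [this, finrank_span_eq_card (linearIndependent_freeFamily n hind)]

/-- A free graded submodule with the right Hilbert series is everything. -/
theorem spans_of_hilbertSeries (hd : ∀ i, 1 ≤ dp i) (hpA : ∀ i, p i ∈ invariantRing G)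
    (hSA : ∀ j, S j ∈ invariantRing G)
    (hp : ∀ i, (p i).IsHomogeneous (dp i)) (hS : ∀ j, (S j).IsHomogeneous (dS j))
    (hind : ∀ c : ι → MvPolynomial κ ℝ, ∑ j, aeval p (c j) * S j = 0 → c = 0)
    (hH : hilbertSeries G * ∏ i, (1 - PowerSeries.X ^ dp i) = ∑ j, PowerSeries.X ^ dS j) :
    ∀ f ∈ invariantRing G, ∃ c : ι → MvPolynomial κ ℝ, f = ∑ j, aeval p (c j) * S j := by
  have hne : (∏ i, (1 - PowerSeries.X ^ dp i) : PowerSeries ℤ) ≠ 0 := by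
    intro h0
    have := mk_card_scaledExps dp hd
    rw [h0, mul_zero] at this
    exact zero_ne_one this
  -- in each degree, there are as many elements `p^a S_j` as the space of invariants has dimensions
  have hcard : ∀ n, invDim G n = Fintype.card (FreeIdx dp dS n) := by
    intro n
    have h1 := mul_right_cancel₀ hne (hH.trans (mk_card_freeIdx dp hd dS).symm)
    have h2 := congrArg (PowerSeries.coeff n) h1
    rw [hilbertSeries, PowerSeries.coeff_mk, PowerSeries.coeff_mk] at h2
    exact_mod_cast h2
  let M : Submodule ℝ Poly := LinearMap.range
    (∑ j, (LinearMap.mulRight ℝ (S j)) ∘ₗ (aeval p).toLinearMap ∘ₗ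
      (LinearMap.proj j : (ι → MvPolynomial κ ℝ) →ₗ[ℝ] MvPolynomial κ ℝ))
  have hM : ∀ f, f ∈ M ↔ ∃ c : ι → MvPolynomial κ ℝ, f = ∑ j, aeval p (c j) * S j := by
    intro f
    simp only [M, LinearMap.mem_range, LinearMap.sum_apply]
    exact ⟨fun ⟨c, h⟩ => ⟨c, h.symm⟩, fun ⟨c, h⟩ => ⟨c, h.symm⟩⟩
  intro f hf
  rw [← hM, ← sum_homogeneousComponent f]
  refine Submodule.sum_mem _ fun n _ => ?_
  have h1 : homogeneousComponent n f ∈ invSpace G n :=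
    ⟨homogeneousComponent_isHomogeneous n f, homogeneousComponent_mem_invariantRing hf n⟩
  have h2 : Submodule.span ℝ (Set.range (freeFamily p S dp dS n)) = invSpace G n := by
    refine Submodule.eq_of_le_of_finrank_eq (Submodule.span_le.2 ?_) ?_
    · rintro _ ⟨x, rfl⟩
      exact freeFamily_mem hpA hSA hp hS n x
    · rw [finrank_span_eq_card (linearIndependent_freeFamily n hind), ← hcard, invDim_eq]
  rw [← h2] at h1
  refine Submodule.span_le.2 ?_ h1
  rintro _ ⟨x, rfl⟩
  classical
  refine (hM _).2 ⟨Pi.single x.1 (monomial (unscale dp x.2.1) 1), ?_⟩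
  rw [Finset.sum_eq_single x.1]
  · rw [Pi.single_eq_same]; rfl
  · intro j _ hj
    rw [Pi.single_eq_of_ne hj, map_zero, zero_mul]
  · simp

end Graded

/-! ### Minimal systems of generators -/

section Fundamental
variable {G : Subgroup O3} {s : Finset Poly}

/-- The invariants without constant term. -/
def augIdeal (G : Subgroup O3) : Submodule ℝ Poly :=
  Subalgebra.toSubmodule (invariantRing G) ⊓ LinearMap.ker (lcoeff ℝ (0 : Fin 6 →₀ ℕ))

theorem degree_pos_of_isFundamental (hs : IsFundamental G s) {f : Poly} (hf : f ∈ s) {n : ℕ}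
    (hn : f.IsHomogeneous n) : 1 ≤ n := by
  by_contra h
  obtain rfl : n = 0 := by omega
  have h1 : f = MvPolynomial.C (coeff 0 f) := totalDegree_eq_zero_iff_eq_C.1 (Nat.le_zero.1 hn.totalDegree_le)
  refine hs.2.2 f hf ?_
  rw [h1]
  exact Subalgebra.algebraMap_mem _ _

theorem coeff_zero_of_homogeneous {f : Poly} {n : ℕ} (hn : f.IsHomogeneous n) (h1 : 1 ≤ n) : coeff 0 f = 0 :=
  hn.coeff_eq_zero (by simp; omega)

theorem mem_augIdeal_of_mem (hs : IsFundamental G s) {f : Poly} (hf : f ∈ s) : f ∈ augIdeal G := by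
  obtain ⟨n, hn⟩ := hs.1 f hf
  refine ⟨?_, coeff_zero_of_homogeneous hn (degree_pos_of_isFundamental hs hf hn)⟩
  rw [← hs.2.1]
  exact Algebra.subset_adjoin hf

theorem augIdeal_mul_le : augIdeal G * augIdeal G ≤ augIdeal G := by
  rw [Submodule.mul_le]
  intro a ha b hb
  refine ⟨Subalgebra.mul_mem _ ha.1 hb.1, ?_⟩
  have h1 : constantCoeff a = 0 := ha.2
  change constantCoeff (a * b) = 0
  rw [map_mul, h1, zero_mul]

/-- The span of `1` and a space without constant terms: an element without constant term lies in
the latter. -/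
theorem mem_of_mem_span_one_sup {N : Submodule ℝ Poly} (hN : ∀ x ∈ N, coeff 0 x = 0) {f : Poly}
    (hf : f ∈ Submodule.span ℝ {(1 : Poly)} ⊔ N) (h0 : coeff 0 f = 0) : f ∈ N := by
  obtain ⟨a, ha, b, hb, rfl⟩ := Submodule.mem_sup.1 hf
  obtain ⟨r, rfl⟩ := Submodule.mem_span_singleton.1 ha
  have : r = 0 := by simpa [hN b hb] using h0
  simpa [this] using hb

/-- Fundamental invariants span `𝔪 / 𝔪²`. -/
theorem augIdeal_le_span (hs : IsFundamental G s) :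
    augIdeal G ≤ Submodule.span ℝ (s : Set Poly) ⊔ augIdeal G * augIdeal G := by
  intro f hf
  have hN : ∀ x ∈ Submodule.span ℝ (s : Set Poly) ⊔ augIdeal G * augIdeal G, coeff 0 x = 0 := by
    have : Submodule.span ℝ (s : Set Poly) ⊔ augIdeal G * augIdeal G ≤ augIdeal G :=
      sup_le (Submodule.span_le.2 fun x hx => mem_augIdeal_of_mem hs hx) augIdeal_mul_le
    exact fun x hx => (this hx).2
  refine mem_of_mem_span_one_sup hN ?_ hf.2
  have h1 : f ∈ Subalgebra.toSubmodule (Algebra.adjoin ℝ (s : Set Poly)) := by rw [hs.2.1]; exact hf.1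
  rw [Algebra.adjoin_eq_span] at h1
  refine Submodule.span_le.2 ?_ h1
  intro x hx
  have key : x = 1 ∨ x ∈ s ∨ x ∈ augIdeal G * augIdeal G := by
    induction hx using Submonoid.closure_induction with
    | mem x hx => exact Or.inr (Or.inl hx)
    | one => exact Or.inl rfl
    | mul x y _ _ hx hy =>
      have hm : ∀ {z}, z ∈ s ∨ z ∈ augIdeal G * augIdeal G → z ∈ augIdeal G := fun hz =>
        hz.elim (fun h => mem_augIdeal_of_mem hs h) fun h => augIdeal_mul_le h
      rcases hx with rfl | hx
      · rwa [one_mul]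
      · rcases hy with rfl | hy
        · rw [mul_one]; exact Or.inr hx
        · exact Or.inr (Or.inr (Submodule.mul_mem_mul (hm hx) (hm hy)))
  rcases key with rfl | h | h
  · exact Submodule.mem_sup_left (Submodule.mem_span_singleton_self _)
  · exact Submodule.mem_sup_right (Submodule.mem_sup_left (Submodule.subset_span h))
  · exact Submodule.mem_sup_right (Submodule.mem_sup_right h)

open scoped Pointwise in
/-- In degree `deg f₀`, products of two invariants without constant term do not involve `f₀`. -/
theorem component_mem_adjoin_of_mem_mul (hs : IsFundamental G s) {f₀ : Poly} {d : ℕ}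
    (hd : f₀.IsHomogeneous d) {x : Poly} (hx : x ∈ augIdeal G * augIdeal G) :
    homogeneousComponent d x ∈ Algebra.adjoin ℝ ((s : Set Poly) \ {f₀}) := by
  set B := Algebra.adjoin ℝ ((s : Set Poly) \ {f₀}) with hB
  -- homogeneous elements of positive degree that do not involve `f₀` if their degree is less than `d`
  let N : Set Poly := {x | ∃ n, 1 ≤ n ∧ x.IsHomogeneous n ∧ (n < d → x ∈ B)}
  have hcl : ∀ x ∈ Submonoid.closure (s : Set Poly), x = 1 ∨ x ∈ N := by
    intro x hx
    induction hx using Submonoid.closure_induction with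
    | mem x hx =>
      obtain ⟨n, hn⟩ := hs.1 x hx
      refine Or.inr ⟨n, degree_pos_of_isFundamental hs hx hn, hn, fun hnd => ?_⟩
      by_cases h : x = f₀
      · subst h
        by_cases h0 : x = 0
        · rw [h0]; exact Subalgebra.zero_mem _
        · exact absurd (hn.inj_right hd h0) hnd.ne
      · exact Algebra.subset_adjoin ⟨hx, h⟩
    | one => exact Or.inl rfl
    | mul x y _ _ hx hy =>
      rcases hx with rfl | ⟨n, h1, h2, h3⟩
      · rwa [one_mul]
      · rcases hy with rfl | ⟨n', h1', h2', h3'⟩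
        · rw [mul_one]; exact Or.inr ⟨n, h1, h2, h3⟩
        · exact Or.inr ⟨n + n', by omega, h2.mul h2', fun h =>
            Subalgebra.mul_mem _ (h3 (by omega)) (h3' (by omega))⟩
  have hN0 : ∀ x ∈ Submodule.span ℝ N, coeff 0 x = 0 := by
    have : Submodule.span ℝ N ≤ LinearMap.ker (lcoeff ℝ (0 : Fin 6 →₀ ℕ)) := by
      refine Submodule.span_le.2 ?_
      rintro x ⟨n, h1, h2, -⟩
      exact coeff_zero_of_homogeneous h2 h1
    exact fun x hx => this hx
  have hle : augIdeal G ≤ Submodule.span ℝ N := by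
    intro f hf
    refine mem_of_mem_span_one_sup hN0 ?_ hf.2
    have h1 : f ∈ Subalgebra.toSubmodule (Algebra.adjoin ℝ (s : Set Poly)) := by rw [hs.2.1]; exact hf.1
    rw [Algebra.adjoin_eq_span] at h1
    refine Submodule.span_le.2 ?_ h1
    intro x hx
    rcases hcl x hx with rfl | h
    · exact Submodule.mem_sup_left (Submodule.mem_span_singleton_self _)
    · exact Submodule.mem_sup_right (Submodule.subset_span h)
  have hx' := mul_le_mul' hle hle hx
  rw [Submodule.span_mul_span] at hx'
  have : Submodule.span ℝ (N * N) ≤ (Subalgebra.toSubmodule B).comap (homogeneousComponent d) := by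
    refine Submodule.span_le.2 ?_
    rintro _ ⟨a, ⟨m, h1, h2, h3⟩, b, ⟨n, h1', h2', h3'⟩, rfl⟩
    change homogeneousComponent d (a * b) ∈ B
    rw [homogeneousComponent_of_mem (h2.mul h2')]
    split_ifs with h
    · exact Subalgebra.mul_mem _ (h3 (by omega)) (h3' (by omega))
    · exact Subalgebra.zero_mem _
  exact this hx'

/-- Fundamental invariants are linearly independent modulo `𝔪²`: a relation that involves `f₀` would, in degree
`deg f₀`, express `f₀` by the others. -/
theorem isFundamental_independent (hs : IsFundamental G s) (g : s → ℝ)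
    (hg : ∑ f : s, g f • (f : Poly) ∈ augIdeal G * augIdeal G) : g = 0 := by
  by_contra hne
  obtain ⟨f₀, hf₀⟩ := Function.ne_iff.1 hne
  obtain ⟨d, hd⟩ := hs.1 f₀ f₀.2
  have h1 := component_mem_adjoin_of_mem_mul hs hd hg
  rw [map_sum, ← Finset.add_sum_erase _ _ (Finset.mem_univ f₀)] at h1
  have h2 : ∑ x ∈ Finset.univ.erase f₀, homogeneousComponent d (g x • (x : Poly))
      ∈ Algebra.adjoin ℝ ((s : Set Poly) \ {(f₀ : Poly)}) := by
    refine Subalgebra.sum_mem _ fun x hx => ?_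
    obtain ⟨n, hn⟩ := hs.1 x x.2
    rw [map_smul, homogeneousComponent_of_mem hn]
    split_ifs
    · have hx' : (x : Poly) ∈ (s : Set Poly) \ {(f₀ : Poly)} :=
        ⟨x.2, fun h => (Finset.ne_of_mem_erase hx) (Subtype.ext h)⟩
      exact Subalgebra.smul_mem _ (Algebra.subset_adjoin hx') _
    · rw [smul_zero]; exact Subalgebra.zero_mem _
  have h3 := (add_mem_cancel_right h2).1 h1
  rw [map_smul, homogeneousComponent_of_mem hd, if_pos rfl] at h3
  refine hs.2.2 f₀ f₀.2 ?_
  have h4 := Subalgebra.smul_mem _ h3 (g f₀)⁻¹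
  rwa [smul_smul, inv_mul_cancel₀ hf₀, one_smul] at h4

/-- The number of fundamental invariants is the dimension of `𝔪/𝔪²`. -/
theorem card_of_isFundamental (hs : IsFundamental G s) :
    s.card = Module.finrank ℝ ((augIdeal G).map (augIdeal G * augIdeal G).mkQ) := by
  set D := augIdeal G * augIdeal G
  have hli : LinearIndependent ℝ fun f : s => D.mkQ (f : Poly) := by
    rw [Fintype.linearIndependent_iff]
    intro g hg
    have : ∑ f : s, g f • (f : Poly) ∈ D := by
      rw [← Submodule.Quotient.mk_eq_zero, ← Submodule.mkQ_apply, map_sum, ← hg]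
      simp
    exact congrFun (isFundamental_independent hs g this)
  have hsp : Submodule.span ℝ (Set.range fun f : s => D.mkQ (f : Poly)) = (augIdeal G).map D.mkQ := by
    have h1 : (Set.range fun f : s => D.mkQ (f : Poly)) = D.mkQ '' (s : Set Poly) := by
      ext y; simp
    rw [h1, Submodule.span_image]
    refine le_antisymm (Submodule.map_mono (Submodule.span_le.2 fun x hx => mem_augIdeal_of_mem hs hx)) ?_
    refine (Submodule.map_mono (augIdeal_le_span hs)).trans ?_
    rw [Submodule.map_sup]
    refine sup_le le_rfl ?_
    rintro _ ⟨x, hx, rfl⟩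
    rw [Submodule.mkQ_apply, (Submodule.Quotient.mk_eq_zero D).2 hx]
    exact Submodule.zero_mem _
  rw [← hsp, finrank_span_eq_card hli, Fintype.card_coe]

end Fundamental

section Primary
variable {G : Subgroup O3}

theorem noSyzygy_iff (q : Finset Poly) :
    NoSyzygy q ↔ (AlgebraicIndependent.matroid ℝ Poly).Indep (q : Set Poly) := by
  rw [AlgebraicIndependent.matroid_indep_iff]; rfl

/-- The number of primary invariants is the rank of a generating set in the algebraic matroid. -/
theorem eRk_eq_card_of_maximal {s p : Finset Poly} (hps : p ⊆ s) (hp : NoSyzygy p)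
    (hmax : ∀ q ⊆ s, NoSyzygy q → q.card ≤ p.card) :
    (AlgebraicIndependent.matroid ℝ Poly).eRk (s : Set Poly) = p.card := by
  set Mt := AlgebraicIndependent.matroid ℝ Poly
  refine le_antisymm ?_ ?_
  · obtain ⟨I, hI⟩ := Mt.exists_isBasis (s : Set Poly) (Set.subset_univ _)
    have hfin : I.Finite := s.finite_toSet.subset hI.subset
    have h1 := hmax hfin.toFinset (by intro x hx; exact hI.subset (hfin.mem_toFinset.1 hx))
      ((noSyzygy_iff _).2 (by simpa using hI.indep))
    rw [hI.eRk_eq_encard, hfin.encard_eq_coe_toFinset_card]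
    exact_mod_cast h1
  · rw [← Set.encard_coe_eq_coe_finsetCard]
    exact ((noSyzygy_iff p).1 hp).encard_le_eRk_of_subset (by exact_mod_cast hps)

theorem eRk_eq_of_adjoin_eq {s s' : Set Poly} (h : Algebra.adjoin ℝ s = Algebra.adjoin ℝ s') :
    (AlgebraicIndependent.matroid ℝ Poly).eRk s = (AlgebraicIndependent.matroid ℝ Poly).eRk s' := by
  rw [← Matroid.eRk_closure_eq, ← Matroid.eRk_closure_eq _ s', AlgebraicIndependent.matroid_closure_eq,
    AlgebraicIndependent.matroid_closure_eq, h]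

theorem card_eq_of_isPrimary {p p' : Finset Poly} (hp : IsPrimary G p) (hp' : IsPrimary G p') :
    p.card = p'.card := by
  obtain ⟨s, hs, hps, hn, hm⟩ := hp
  obtain ⟨s', hs', hps', hn', hm'⟩ := hp'
  have h1 := eRk_eq_card_of_maximal hps hn hm
  rw [eRk_eq_of_adjoin_eq (hs.2.1.trans hs'.2.1.symm), eRk_eq_card_of_maximal hps' hn' hm'] at h1
  exact_mod_cast h1.symm

/-- If the invariant ring is a finite module over the polynomials in the independent set `p`, then
`p` is a largest independent set. -/
theorem card_le_of_finite {p s q : Finset Poly} (hps : p ⊆ s) (hs : IsIntegrityBasis G s)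
    {ι : Type*} [Finite ι] (S : ι → Poly) (hS : ∀ j, S j ∈ invariantRing G)
    (hspan : ∀ f ∈ invariantRing G, f ∈ Submodule.span (Algebra.adjoin ℝ (p : Set Poly)) (Set.range S))
    (hq : q ⊆ s) (hqn : NoSyzygy q) : q.card ≤ p.card := by
  set Mt := AlgebraicIndependent.matroid ℝ Poly
  have hpA : Algebra.adjoin ℝ (p : Set Poly) ≤ invariantRing G := by
    rw [← hs]; exact Algebra.adjoin_mono (by exact_mod_cast hps)
  let A' : Subalgebra (Algebra.adjoin ℝ (p : Set Poly)) Poly :=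
    { (invariantRing G).toSubsemiring with algebraMap_mem' := fun r => hpA r.2 }
  have hfg : (Subalgebra.toSubmodule A').FG := by
    refine (Submodule.fg_def).2 ⟨Set.range S, Set.finite_range S, le_antisymm ?_ ?_⟩
    · refine Submodule.span_le.2 ?_
      rintro _ ⟨j, rfl⟩
      exact hS j
    · intro f hf
      exact hspan f hf
  -- invariants are integral, hence algebraic, over the polynomials in `p`
  have h1 : (s : Set Poly) ⊆ Mt.closure (p : Set Poly) := by
    intro f hf
    rw [AlgebraicIndependent.matroid_closure_eq]
    have hfA : f ∈ A' := by
      change f ∈ invariantRing G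
      rw [← hs]
      exact Algebra.subset_adjoin hf
    have := (IsIntegral.of_mem_of_fg A' hfg f hfA).isAlgebraic
    exact this
  have h2 : Mt.eRk (s : Set Poly) ≤ p.card := by
    refine (Mt.eRk_mono h1).trans ?_
    rw [Matroid.eRk_closure_eq, ← Set.encard_coe_eq_coe_finsetCard]
    exact Mt.eRk_le_encard _
  have h3 : (q.card : ℕ∞) ≤ Mt.eRk (s : Set Poly) := by
    rw [← Set.encard_coe_eq_coe_finsetCard]
    exact ((noSyzygy_iff q).1 hqn).encard_le_eRk_of_subset (by exact_mod_cast hq)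
  exact_mod_cast h3.trans h2

end Primary

/-! ### Irreducibility of generators -/

section Irreducible

/-- Polynomials all of whose terms have degree at least `N`. -/
def orderGe (N : ℕ) : Submodule ℝ Poly where
  carrier := {f | ∀ a, a.degree < N → coeff a f = 0}
  add_mem' := fun hf hg a ha => by rw [coeff_add, hf a ha, hg a ha, add_zero]
  zero_mem' := fun a _ => coeff_zero a
  smul_mem' := fun r f hf a ha => by rw [coeff_smul, hf a ha, smul_zero]

theorem mul_mem_orderGe {N : ℕ} (g : Poly) {f : Poly} (hf : f ∈ orderGe N) : g * f ∈ orderGe N := by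
  classical
  intro a ha
  rw [coeff_mul]
  refine Finset.sum_eq_zero fun x hx => ?_
  rw [hf x.2, mul_zero]
  have := Finset.HasAntidiagonal.mem_antidiagonal.1 hx
  have h2 : x.1.degree + x.2.degree = a.degree := by rw [← this, map_add]
  omega

theorem mem_orderGe_of_isHomogeneous {N n : ℕ} {f : Poly} (hf : f.IsHomogeneous n) (h : N ≤ n) : f ∈ orderGe N :=
  fun a ha => hf.coeff_eq_zero (by omega)

theorem homogeneousComponent_of_mem_orderGe {N n : ℕ} {f : Poly} (hf : f ∈ orderGe N) (h : n < N) :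
    homogeneousComponent n f = 0 := by
  ext a
  rw [coeff_homogeneousComponent, coeff_zero]
  split_ifs with h1
  · exact hf a (by omega)
  · rfl

variable {κ ι : Type*} [Fintype κ] [DecidableEq κ] [Fintype ι] [DecidableEq ι]
  {p : κ → Poly} {S : ι → Poly} {dp : κ → ℕ} {dS : ι → ℕ}

set_option linter.unusedSectionVars false in
theorem exists_homogeneousComponent_coords (hp : ∀ i, (p i).IsHomogeneous (dp i))
    (hS : ∀ j, (S j).IsHomogeneous (dS j)) (n : ℕ) (c : ι → MvPolynomial κ ℝ) :
    ∃ c' : ι → MvPolynomial κ ℝ,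
      homogeneousComponent n (∑ j, aeval p (c j) * S j) = ∑ j, aeval p (c' j) * S j ∧
      ∀ j a, coeff a (c j) = 0 → coeff a (c' j) = 0 := by
  refine ⟨fun j => ∑ a ∈ (c j).support,
    if (∑ i, dp i * a i) + dS j = n then monomial a (coeff a (c j)) else 0, ?_, ?_⟩
  · rw [sum_aeval_eq_sum_freeElt, map_sum]
    refine Finset.sum_congr rfl fun j _ => ?_
    rw [map_sum, map_sum, Finset.sum_mul]
    refine Finset.sum_congr rfl fun a _ => ?_
    rw [map_smul, homogeneousComponent_of_mem (freeElt_isHomogeneous hp hS j a)]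
    by_cases h : (∑ i, dp i * a i) + dS j = n
    · rw [if_pos h.symm, if_pos h, freeElt, ← smul_mul_assoc, ← map_smul, smul_monomial, smul_eq_mul, mul_one]
    · rw [if_neg (Ne.symm h), if_neg h, smul_zero, map_zero, zero_mul]
  · intro j a ha
    rw [coeff_sum]
    refine Finset.sum_eq_zero fun b _ => ?_
    split_ifs
    · rw [coeff_monomial]
      split_ifs with h
      · rw [h, ha]
      · rfl
    · exact coeff_zero a

/-- In degrees below twice the least degree of the `S j`, the algebra generated by some of the `p i`
and some of the `S j` contains only combinations that are linear in the `S j`. -/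
theorem exists_coords_of_mem_adjoin (hp : ∀ i, (p i).IsHomogeneous (dp i))
    (hS : ∀ j, (S j).IsHomogeneous (dS j)) {j₀ : ι} (h0 : S j₀ = 1) (U : Set κ) (F : Finset ι)
    (hF : j₀ ∉ F) {e : ℕ} (he : ∀ j ∈ F, e ≤ dS j) {f : Poly} {n : ℕ} (hf : f.IsHomogeneous n)
    (hn : n < 2 * e) (hmem : f ∈ Algebra.adjoin ℝ (p '' U ∪ S '' (F : Set ι))) :
    ∃ c : ι → MvPolynomial κ ℝ, f = ∑ j, aeval p (c j) * S j ∧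
      (∀ i ∉ U, coeff (Finsupp.single i 1) (c j₀) = 0) ∧ ∀ j ∉ F, j ≠ j₀ → c j = 0 := by
  -- the subalgebra of all `a + ∑ c_j S_j` modulo terms of degree at least `2 e`
  let M : Submodule ℝ Poly :=
    (Submodule.map (∑ j ∈ F, (LinearMap.mulRight ℝ (S j)) ∘ₗ (aeval p).toLinearMap ∘ₗ
      (LinearMap.proj j : (ι → MvPolynomial κ ℝ) →ₗ[ℝ] MvPolynomial κ ℝ)) ⊤) ⊔ orderGe (2 * e)
  have hM : ∀ x, x ∈ M ↔ ∃ c : ι → MvPolynomial κ ℝ, ∃ z ∈ orderGe (2 * e),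
      x = ∑ j ∈ F, aeval p (c j) * S j + z := by
    intro x
    simp only [M, Submodule.mem_sup, Submodule.mem_map, Submodule.mem_top, true_and, LinearMap.sum_apply]
    constructor
    · rintro ⟨_, ⟨c, rfl⟩, z, hz, rfl⟩
      exact ⟨c, z, hz, rfl⟩
    · rintro ⟨c, z, hz, rfl⟩
      exact ⟨_, ⟨c, rfl⟩, z, hz, rfl⟩
  have hPM : ∀ a : MvPolynomial κ ℝ, ∀ x ∈ M, aeval p a * x ∈ M := by
    intro a x hx
    obtain ⟨c, z, hz, rfl⟩ := (hM x).1 hx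
    refine (hM _).2 ⟨fun j => a * c j, aeval p a * z, mul_mem_orderGe _ hz, ?_⟩
    simp only [map_mul, mul_add, Finset.mul_sum, mul_assoc]
  have hMM : ∀ x ∈ M, ∀ y ∈ M, x * y ∈ M := by
    intro x hx y hy
    obtain ⟨c, z, hz, rfl⟩ := (hM x).1 hx
    obtain ⟨c', z', hz', rfl⟩ := (hM y).1 hy
    refine Submodule.mem_sup_right ?_
    rw [mul_add, add_mul]
    refine Submodule.add_mem _ (Submodule.add_mem _ ?_ ?_) (mul_mem_orderGe _ hz')
    · rw [Finset.sum_mul_sum]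
      refine Submodule.sum_mem _ fun i hi => Submodule.sum_mem _ fun j hj => ?_
      rw [show aeval p (c i) * S i * (aeval p (c' j) * S j)
        = (aeval p (c i) * aeval p (c' j)) * (S i * S j) by ring]
      refine mul_mem_orderGe _ (mem_orderGe_of_isHomogeneous ((hS i).mul (hS j)) ?_)
      have := he i hi
      have := he j hj
      omega
    · rw [mul_comm z]
      exact mul_mem_orderGe _ hz
  have hone : (1 : Poly) ∈ Subalgebra.toSubmodule ((supported ℝ U).map (aeval p)) := Subalgebra.one_mem _
  -- adding the polynomials in the `p i` with `i ∈ U` makes it an algebra that contains the generators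
  let V : Subalgebra ℝ Poly := Submodule.toSubalgebra
    (Subalgebra.toSubmodule ((supported ℝ U).map (aeval p)) ⊔ M) (Submodule.mem_sup_left hone) (by
      intro x y hx hy
      obtain ⟨_, ⟨a, ha, rfl⟩, m, hm, rfl⟩ := Submodule.mem_sup.1 hx
      obtain ⟨_, ⟨b, hb, rfl⟩, m', hm', rfl⟩ := Submodule.mem_sup.1 hy
      refine Submodule.mem_sup.2 ⟨aeval p (a * b), ⟨a * b, Subalgebra.mul_mem _ ha hb, rfl⟩,
        aeval p a * m' + aeval p b * m + m * m', ?_, ?_⟩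
      · exact M.add_mem (M.add_mem (hPM _ _ hm') (hPM _ _ hm)) (hMM _ hm _ hm')
      · change aeval p (a * b) + _ = (aeval p a + m) * (aeval p b + m')
        rw [map_mul]; ring)
  have hV : Algebra.adjoin ℝ (p '' U ∪ S '' (F : Set ι)) ≤ V := by
    refine Algebra.adjoin_le ?_
    rintro _ (⟨i, hi, rfl⟩ | ⟨j, hj, rfl⟩)
    · exact Submodule.mem_sup_left ⟨X i, X_mem_supported.2 hi, aeval_X p i⟩
    · refine Submodule.mem_sup_right ((hM _).2 ⟨Pi.single j 1, 0, Submodule.zero_mem _, ?_⟩)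
      rw [Finset.sum_eq_single_of_mem j hj]
      · simp
      · intro i _ hi
        simp [Pi.single_eq_of_ne hi]
  obtain ⟨_, ⟨a, ha, rfl⟩, m, hm, hfm⟩ := Submodule.mem_sup.1 (hV hmem)
  obtain ⟨c, z, hz, rfl⟩ := (hM m).1 hm
  let c₁ : ι → MvPolynomial κ ℝ := fun j => if j = j₀ then a else if j ∈ F then c j else 0
  have hc₁ : aeval p a + ∑ j ∈ F, aeval p (c j) * S j = ∑ j, aeval p (c₁ j) * S j := by
    rw [← Finset.add_sum_erase _ _ (Finset.mem_univ j₀)]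
    congr 1
    · simp [c₁, h0]
    · have h1 : ∑ j ∈ F, aeval p (c₁ j) * S j = ∑ j ∈ Finset.univ.erase j₀, aeval p (c₁ j) * S j := by
        refine Finset.sum_subset ?_ ?_
        · intro j hj
          exact Finset.mem_erase.2 ⟨fun h => hF (h ▸ hj), Finset.mem_univ _⟩
        · intro j hj hjF
          simp [c₁, hjF, Finset.ne_of_mem_erase hj]
      rw [← h1]
      refine Finset.sum_congr rfl fun j hj => ?_
      have : j ≠ j₀ := fun h => hF (h ▸ hj)
      simp [c₁, this, hj]
  obtain ⟨c', h1, h2⟩ := exists_homogeneousComponent_coords hp hS n c₁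
  refine ⟨c', ?_, ?_, ?_⟩
  · rw [← h1, ← hc₁]
    have h3 : homogeneousComponent n f = f := by rw [homogeneousComponent_of_mem hf, if_pos rfl]
    have h4 : homogeneousComponent n z = 0 := homogeneousComponent_of_mem_orderGe hz hn
    rw [← h3, ← hfm]
    change homogeneousComponent n (aeval p a + _) = _
    rw [← add_assoc, map_add _ _ z, h4, add_zero]
  · intro i hi
    refine h2 _ _ ?_
    have h5 : c₁ j₀ = a := by simp [c₁]
    rw [h5]
    by_contra hne
    refine hi (mem_supported.1 ha ?_)
    rw [Finset.mem_coe, mem_vars_iff_mem_support]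
    exact ⟨_, mem_support_iff.2 hne, by simp⟩
  · intro j hj hj0
    ext b
    rw [coeff_zero]
    exact h2 _ _ (by simp [c₁, hj, hj0])

/-- A primary invariant of small degree is no polynomial in the other generators: by freeness, the part of
degree one in `p i` would be missing on one side. -/
theorem primary_notMem_adjoin (hp : ∀ i, (p i).IsHomogeneous (dp i))
    (hS : ∀ j, (S j).IsHomogeneous (dS j)) {j₀ : ι} (h0 : S j₀ = 1) {F : Finset ι}
    (hind : ∀ c : ι → MvPolynomial κ ℝ, ∑ j, aeval p (c j) * S j = 0 → c = 0)
    (hF : j₀ ∉ F) {e : ℕ} (he : ∀ j ∈ F, e ≤ dS j) (i : κ) (hn : dp i < 2 * e) :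
    p i ∉ Algebra.adjoin ℝ ((Set.range p ∪ S '' (F : Set ι)) \ {p i}) := by
  intro hmem
  have hsub : (Set.range p ∪ S '' (F : Set ι)) \ {p i} ⊆ p '' {i}ᶜ ∪ S '' (F : Set ι) := by
    rintro x ⟨⟨l, rfl⟩ | h, hx⟩
    · exact Or.inl ⟨l, fun h => hx (by rw [h]; rfl), rfl⟩
    · exact Or.inr h
  obtain ⟨c, h1, h2, -⟩ := exists_coords_of_mem_adjoin hp hS h0 {i}ᶜ F hF he (hp i) hn
    (Algebra.adjoin_mono hsub hmem)
  have h3 := hind (c - Pi.single j₀ (X i)) (by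
    simp only [Pi.sub_apply, map_sub, sub_mul, Finset.sum_sub_distrib]
    rw [← h1, Finset.sum_eq_single j₀]
    · simp [h0]
    · intro j _ hj; simp [Pi.single_eq_of_ne hj]
    · simp)
  have h4 := congrArg (coeff (Finsupp.single i 1)) (congrFun h3 j₀)
  simp [h2 i (by simp)] at h4

/-- A secondary invariant of small degree is no polynomial in the other generators: by freeness, its
coefficient would be both one and zero. -/
theorem secondary_notMem_adjoin (hp : ∀ i, (p i).IsHomogeneous (dp i))
    (hS : ∀ j, (S j).IsHomogeneous (dS j)) {j₀ : ι} (h0 : S j₀ = 1) {F : Finset ι}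
    (hind : ∀ c : ι → MvPolynomial κ ℝ, ∑ j, aeval p (c j) * S j = 0 → c = 0)
    (hF : j₀ ∉ F) {e : ℕ} (he : ∀ j ∈ F, e ≤ dS j) {j : ι} (hj : j ∈ F) (hn : dS j < 2 * e) :
    S j ∉ Algebra.adjoin ℝ ((Set.range p ∪ S '' (F : Set ι)) \ {S j}) := by
  intro hmem
  have hsub : (Set.range p ∪ S '' (F : Set ι)) \ {S j} ⊆ p '' Set.univ ∪ S '' ((F.erase j : Finset ι) : Set ι) := by
    rintro x ⟨⟨l, rfl⟩ | ⟨l, hl, rfl⟩, hx⟩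
    · exact Or.inl ⟨l, trivial, rfl⟩
    · refine Or.inr ⟨l, ?_, rfl⟩
      rw [Finset.mem_coe, Finset.mem_erase]
      exact ⟨fun h => hx (by rw [h]; rfl), hl⟩
  obtain ⟨c, h1, -, h2⟩ := exists_coords_of_mem_adjoin hp hS h0 Set.univ (F.erase j)
    (fun h => hF (Finset.mem_of_mem_erase h)) (fun i hi => he i (Finset.mem_of_mem_erase hi)) (hS j) hn
    (Algebra.adjoin_mono hsub hmem)
  have h3 := hind (c - Pi.single j 1) (by
    simp only [Pi.sub_apply, map_sub, sub_mul, Finset.sum_sub_distrib]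
    rw [← h1, Finset.sum_eq_single j]
    · simp
    · intro i _ hi; simp [Pi.single_eq_of_ne hi]
    · simp)
  have hne : j ≠ j₀ := fun h => hF (h ▸ hj)
  have h4 := congrArg (coeff 0) (congrFun h3 j)
  simp [h2 j (Finset.notMem_erase _ _) hne] at h4

/-- Two points separated by `f` but not by the set `s` show that `f` is no polynomial in `s`. -/
theorem notMem_adjoin_of_separated {s : Set Poly} {f : Poly} (φ ψ : Poly →ₐ[ℝ] ℂ)
    (hs : ∀ g ∈ s, φ g = ψ g) (hf : φ f ≠ ψ f) : f ∉ Algebra.adjoin ℝ s := fun h =>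
  hf (Algebra.adjoin_le (S := AlgHom.equalizer φ ψ) hs h)

end Irreducible

/-! ### Rows of the table from free bases of the invariant ring -/

section Row

theorem invDim_le (G : Subgroup O3) (d : ℕ) : invDim G d ≤ (d + 1) ^ 6 := by
  rw [← finrank_map_coeffVec]
  refine (Submodule.finrank_le _).trans ?_
  rw [Module.finrank_fintype_fun_eq_card]
  have h := Fintype.card_le_of_injective
    (fun (a : Idx d) (i : Fin 6) => (⟨a.1 i, by
      have := mem_idx.1 a.2
      have h2 := Finsupp.le_degree i a.1
      omega⟩ : Fin (d + 1))) (by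
    intro a b hab
    refine Subtype.ext (Finsupp.ext fun i => ?_)
    simpa using congrFun hab i)
  simpa using h

theorem aeval_denominator_ne_zero {ds : List ℕ} (hds : ∀ d ∈ ds, 1 ≤ d) {t : ℝ} (ht : |t| < 1) :
    Polynomial.aeval t (denominator ds) ≠ 0 := by
  rw [denominator, map_list_prod, List.map_map]
  refine List.prod_ne_zero ?_
  rw [List.mem_map]
  rintro ⟨d, hd, h⟩
  simp only [Function.comp_apply, map_sub, map_one, map_pow, Polynomial.aeval_X] at h
  have h1 : |t| ^ d < 1 := pow_lt_one₀ (abs_nonneg t) ht (by have := hds d hd; omega)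
  rw [← abs_pow, ← sub_eq_zero.1 h, abs_one] at h1
  exact lt_irrefl _ h1

theorem hasSum_invDim {G : Subgroup O3} {num : Polynomial ℤ} {ds : List ℕ} (hds : ∀ d ∈ ds, 1 ≤ d)
    (h : hilbertSeries G * (denominator ds : PowerSeries ℤ) = (num : PowerSeries ℤ)) {t : ℝ}
    (ht : t ∈ Set.Ioo (-1 : ℝ) 1) : HasSum (fun d => (invDim G d : ℝ) * t ^ d) (ratio num ds t) := by
  have ht' : |t| < 1 := abs_lt.2 ht
  have hs : Summable fun d => ‖(invDim G d : ℝ) * t ^ d‖ := by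
    refine Summable.of_nonneg_of_le (fun _ => norm_nonneg _) (fun d => ?_) (summable_bound ht')
    rw [norm_mul, norm_pow, Real.norm_eq_abs, Real.norm_eq_abs, Nat.abs_cast]
    gcongr
    exact_mod_cast invDim_le G d
  have h1 : PowerSeries.mk (fun d => (invDim G d : ℝ))
      * (((denominator ds).map (Int.castRingHom ℝ) : Polynomial ℝ) : PowerSeries ℝ)
      = ((num.map (Int.castRingHom ℝ) : Polynomial ℝ) : PowerSeries ℝ) := by
    rw [Polynomial.polynomial_map_coe, Polynomial.polynomial_map_coe, ← h, map_mul]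
    congr 1
  have h2 := tsum_mul_eval h1 hs
  have h3 := aeval_denominator_ne_zero hds ht'
  rw [ratio]
  have h4 : ∑' d, (invDim G d : ℝ) * t ^ d
      = Polynomial.aeval t num / Polynomial.aeval t (denominator ds) := by
    rw [eq_div_iff h3]
    simpa [Polynomial.aeval_def, Polynomial.eval_map] using h2
  rw [← h4]
  exact hs.of_norm.hasSum

/-- Multiplication of a sequence of coefficients by `1 - X ^ d`. -/
def mulFactor (d : ℕ) (a : ℕ → ℤ) (n : ℕ) : ℤ := a n - if d ≤ n then a (n - d) else 0

theorem mk_foldr_mulFactor (ds : List ℕ) (a : ℕ → ℤ) :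
    PowerSeries.mk (ds.foldr mulFactor a) = PowerSeries.mk a * (denominator ds : PowerSeries ℤ) := by
  induction ds with
  | nil => simp [denominator]
  | cons d ds ih =>
    have h1 : denominator (d :: ds) = (1 - Polynomial.X ^ d) * denominator ds := by simp [denominator]
    rw [h1, Polynomial.coe_mul, mul_left_comm, ← ih]
    ext n
    rw [Polynomial.coe_sub, Polynomial.coe_one, Polynomial.coe_pow, Polynomial.coe_X, sub_mul, one_mul,
      map_sub, PowerSeries.coeff_X_pow_mul', PowerSeries.coeff_mk, PowerSeries.coeff_mk, List.foldr_cons, mulFactor]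
    simp only [PowerSeries.coeff_mk]

theorem map_invDim_eq {G : Subgroup O3} {num : Polynomial ℤ} {ds taylor : List ℕ} (hds : ∀ d ∈ ds, 1 ≤ d)
    (h : hilbertSeries G * (denominator ds : PowerSeries ℤ) = (num : PowerSeries ℤ))
    (hlen : taylor.length = 8)
    (ht : ∀ n < 8, ds.foldr mulFactor (fun n => (taylor.getD n 0 : ℕ)) n = num.coeff n) :
    (List.range 8).map (invDim G) = taylor := by
  set a : ℕ → ℤ := fun n => (taylor.getD n 0 : ℕ)
  have h1 : (PowerSeries.X ^ 8 : PowerSeries ℤ) ∣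
      (hilbertSeries G - PowerSeries.mk a) * (denominator ds : PowerSeries ℤ) := by
    rw [PowerSeries.X_pow_dvd_iff]
    intro n hn
    rw [sub_mul, h, ← mk_foldr_mulFactor, map_sub, PowerSeries.coeff_mk, ht n hn, Polynomial.coeff_coe, sub_self]
  have h2 : IsUnit (denominator ds : PowerSeries ℤ) := by
    rw [PowerSeries.isUnit_iff_constantCoeff]
    have : PowerSeries.constantCoeff (denominator ds : PowerSeries ℤ) = 1 := by
      rw [← PowerSeries.coeff_zero_eq_constantCoeff_apply, Polynomial.coeff_coe, Polynomial.coeff_zero_eq_eval_zero, denominator,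
        Polynomial.eval_list_prod, List.map_map]
      refine List.prod_eq_one ?_
      intro x hx
      obtain ⟨d, hd, rfl⟩ := List.mem_map.1 hx
      have := hds d hd
      simp [show d ≠ 0 by omega]
    rw [this]; exact isUnit_one
  rw [h2.dvd_mul_right, PowerSeries.X_pow_dvd_iff] at h1
  refine List.ext_getElem (by simp [hlen]) fun n hn hn' => ?_
  have h3 := h1 n (by simpa using hn)
  rw [map_sub, hilbertSeries, PowerSeries.coeff_mk, PowerSeries.coeff_mk, sub_eq_zero] at h3
  have h4 : taylor.getD n 0 = taylor[n] := by simp [hn']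
  have h5 : invDim G n = taylor.getD n 0 := Int.natCast_inj.1 h3
  rw [List.getElem_map, List.getElem_range, h5, h4]

/-- The invariant ring is free with basis `S` over the polynomial ring in the `p i`; all these
invariants are homogeneous, of degrees `dS` and `dp`. -/
structure IsFreeBasis (G : Subgroup O3) {k m : ℕ} (p : Fin k → Poly) (S : Fin m → Poly)
    (dp : Fin k → ℕ) (dS : Fin m → ℕ) : Prop where
  one_le : ∀ i, 1 ≤ dp i
  memP : ∀ i, p i ∈ invariantRing G
  memS : ∀ j, S j ∈ invariantRing G
  homP : ∀ i, (p i).IsHomogeneous (dp i)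
  homS : ∀ j, (S j).IsHomogeneous (dS j)
  ind : ∀ c : Fin m → MvPolynomial (Fin k) ℝ, ∑ j, aeval p (c j) * S j = 0 → c = 0
  span : ∀ f ∈ invariantRing G, ∃ c : Fin m → MvPolynomial (Fin k) ℝ, f = ∑ j, aeval p (c j) * S j

variable {G : Subgroup O3} {k m : ℕ} {p : Fin k → Poly} {S : Fin m → Poly}
    {dp : Fin k → ℕ} {dS : Fin m → ℕ}

theorem denominator_eq_prod {k : ℕ} {dp : Fin k → ℕ} {ds : List ℕ}
    (hds : (ds : Multiset ℕ) = Finset.univ.val.map dp) :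
    (denominator ds : PowerSeries ℤ) = ∏ i, (1 - PowerSeries.X ^ dp i) := by
  have h1 : denominator ds = ∏ i, (1 - Polynomial.X ^ dp i) := by
    rw [denominator, ← Multiset.prod_coe, ← Multiset.map_coe, hds, Multiset.map_map]
    rfl
  rw [h1, ← Polynomial.coeToPowerSeries.ringHom_apply, map_prod]
  simp [Polynomial.coeToPowerSeries.ringHom_apply]

theorem coe_sum_X_pow {ι : Type*} [Fintype ι] (dS : ι → ℕ) :
    ((∑ j, Polynomial.X ^ dS j : Polynomial ℤ) : PowerSeries ℤ) = ∑ j, PowerSeries.X ^ dS j := by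
  rw [← Polynomial.coeToPowerSeries.ringHom_apply, map_sum]
  simp [Polynomial.coeToPowerSeries.ringHom_apply]

theorem IsFreeBasis.hilbertSeries (h : IsFreeBasis G p S dp dS) {ds : List ℕ}
    (hds : (ds : Multiset ℕ) = Finset.univ.val.map dp) :
    hilbertSeries G * (denominator ds : PowerSeries ℤ)
      = ((∑ j, Polynomial.X ^ dS j : Polynomial ℤ) : PowerSeries ℤ) := by
  rw [denominator_eq_prod hds, coe_sum_X_pow]
  exact hilbertSeries_of_basis h.one_le h.memP h.memS h.homP h.homS h.ind h.span

theorem IsFreeBasis.injective_left (h : IsFreeBasis G p S dp dS) (j₀ : Fin m) :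
    Function.Injective p := by
  intro i l hil
  have h1 := h.ind (Pi.single j₀ (X i - X l)) (by
    rw [Finset.sum_eq_single j₀]
    · simp [hil]
    · intro j _ hj; simp [Pi.single_eq_of_ne hj]
    · simp)
  have h2 := congrFun h1 j₀
  rw [Pi.single_eq_same, Pi.zero_apply, sub_eq_zero] at h2
  exact X_injective h2

theorem IsFreeBasis.injective_right (h : IsFreeBasis G p S dp dS) : Function.Injective S := by
  intro i l hil
  have h1 := h.ind (Pi.single i 1 - Pi.single l 1) (by
    simp only [Pi.sub_apply, map_sub, sub_mul, Finset.sum_sub_distrib]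
    rw [Finset.sum_eq_single i, Finset.sum_eq_single l]
    · simp [hil]
    · intro j _ hj; simp [Pi.single_eq_of_ne hj]
    · simp
    · intro j _ hj; simp [Pi.single_eq_of_ne hj]
    · simp)
  by_contra hne
  have h2 := congrFun h1 i
  rw [Pi.sub_apply, Pi.single_eq_same, Pi.single_eq_of_ne hne, sub_zero] at h2
  exact one_ne_zero h2

theorem IsFreeBasis.ne (h : IsFreeBasis G p S dp dS) {j₀ : Fin m} (h0 : S j₀ = 1) (i : Fin k) {j : Fin m}
    (hj : j ≠ j₀) : p i ≠ S j := by
  intro hij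
  have h1 := h.ind (Pi.single j₀ (X i) - Pi.single j 1) (by
    simp only [Pi.sub_apply, map_sub, sub_mul, Finset.sum_sub_distrib]
    rw [Finset.sum_eq_single j₀, Finset.sum_eq_single j]
    · simp [hij, h0]
    · intro l _ hl; simp [Pi.single_eq_of_ne hl]
    · simp
    · intro l _ hl; simp [Pi.single_eq_of_ne hl]
    · simp)
  have h2 := congrFun h1 j
  simp [Pi.single_eq_of_ne hj] at h2

theorem IsFreeBasis.algebraicIndependent (h : IsFreeBasis G p S dp dS) (j₀ : Fin m) :
    AlgebraicIndependent ℝ p := by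
  rw [algebraicIndependent_iff]
  intro f hf
  have h1 := h.ind (Pi.single j₀ f) (by
    rw [Finset.sum_eq_single j₀]
    · rw [Pi.single_eq_same, hf, zero_mul]
    · intro j _ hj; simp [Pi.single_eq_of_ne hj]
    · simp)
  have h2 := congrFun h1 j₀
  rwa [Pi.single_eq_same] at h2

theorem IsFreeBasis.totalDegree_left (h : IsFreeBasis G p S dp dS) (j₀ : Fin m) (i : Fin k) :
    (p i).totalDegree = dp i :=
  (h.homP i).totalDegree ((h.algebraicIndependent j₀).ne_zero i)

theorem noSyzygy_image (h : IsFreeBasis G p S dp dS) (j₀ : Fin m) :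
    NoSyzygy (Finset.univ.image p) := by
  have h1 := (h.algebraicIndependent j₀).coe_range
  rw [NoSyzygy]
  refine (algebraicIndependent_equiv' (Equiv.setCongr (s := ((Finset.univ.image p : Finset Poly) : Set Poly))
    (t := Set.range p) (by simp)) ?_).2 h1
  rfl

/-- The ring `ℝ[p]` consists of the values of polynomials at `p`. -/
theorem mem_adjoin_range_iff {κ : Type*} (p : κ → Poly) {x : Poly} :
    x ∈ Algebra.adjoin ℝ (Set.range p) ↔ ∃ c : MvPolynomial κ ℝ, x = aeval p c := by
  rw [Algebra.adjoin_range_eq_range_aeval]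
  exact ⟨fun ⟨c, hc⟩ => ⟨c, hc.symm⟩, fun ⟨c, hc⟩ => ⟨c, hc.symm⟩⟩

theorem isSecondary_image (h : IsFreeBasis G p S dp dS) : IsSecondary G (Finset.univ.image p) (Finset.univ.image S) := by
  set P := Finset.univ.image p
  set η := Finset.univ.image S with hη
  have hP : (P : Set Poly) = Set.range p := by simp [P]
  refine ⟨?_, ?_⟩
  · intro s hs
    obtain ⟨j, -, rfl⟩ := Finset.mem_image.1 hs
    exact ⟨h.memS j, _, h.homS j⟩
  · let e : Fin m ≃ η := Equiv.ofBijective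
      (fun j => ⟨S j, Finset.mem_image_of_mem S (Finset.mem_univ j)⟩)
      ⟨fun i j hij => h.injective_right (congrArg Subtype.val hij), fun x => by
        obtain ⟨j, -, hj⟩ := Finset.mem_image.1 x.2
        exact ⟨j, Subtype.ext hj⟩⟩
    have key : ∀ c : η → Algebra.adjoin ℝ (P : Set Poly),
        ∃ b : Fin m → MvPolynomial (Fin k) ℝ, ∀ j, (c (e j) : Poly) = aeval p (b j) := by
      intro c
      have : ∀ j, ∃ b : MvPolynomial (Fin k) ℝ, (c (e j) : Poly) = aeval p b := fun j => by
        rw [← mem_adjoin_range_iff, ← hP]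
        exact (c (e j)).2
      choose b hb using this
      exact ⟨b, hb⟩
    have hsum : ∀ c : η → Algebra.adjoin ℝ (P : Set Poly),
        ∀ b : Fin m → MvPolynomial (Fin k) ℝ, (∀ j, (c (e j) : Poly) = aeval p (b j)) →
        ∑ s, (c s : Poly) * (s : Poly) = ∑ j, aeval p (b j) * S j := by
      intro c b hb
      rw [← Equiv.sum_comp e]
      exact Finset.sum_congr rfl fun j _ => by rw [hb j]; rfl
    intro f hf
    obtain ⟨b, hb⟩ := h.span f hf
    refine ⟨fun s => ⟨aeval p (b (e.symm s)), ?_⟩, ?_, ?_⟩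
    · rw [hP, mem_adjoin_range_iff]; exact ⟨_, rfl⟩
    · change f = _
      rw [hsum _ b (fun j => by simp)]
      exact hb
    · intro c hc
      obtain ⟨b', hb'⟩ := key c
      change f = _ at hc
      rw [hsum c b' hb', hb] at hc
      have h1 := h.ind (b - b') (by
        simp only [Pi.sub_apply, map_sub, sub_mul, Finset.sum_sub_distrib]
        rw [hc, sub_self])
      rw [sub_eq_zero] at h1
      funext s
      obtain ⟨j, rfl⟩ := e.surjective s
      refine Subtype.ext ?_
      rw [hb' j, ← h1]
      simp

end Row

section Counts

variable {G : Subgroup O3} {k m : ℕ} {p : Fin k → Poly} {S : Fin m → Poly}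
    {dp : Fin k → ℕ} {dS : Fin m → ℕ}

/-- The degrees of secondary invariants are determined by those of the primary invariants. -/
theorem secondary_degrees {p' η' : Finset Poly} {ds : List ℕ} {num : Polynomial ℤ}
    (hH : hilbertSeries G * (denominator ds : PowerSeries ℤ) = (num : PowerSeries ℤ))
    (hp : IsPrimary G p') (hd : degreeMultiset p' = (ds : Multiset ℕ)) (hη : IsSecondary G p' η') :
    num = ∑ s : η', Polynomial.X ^ (s : Poly).totalDegree := by
  obtain ⟨s, hs, hps, hn, -⟩ := hp
  have hrange : Set.range (fun f : p' => (f : Poly)) = (p' : Set Poly) := by simp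
  have hhom : ∀ f : p', (f : Poly).IsHomogeneous (f : Poly).totalDegree := fun f => by
    obtain ⟨n, h1⟩ := hs.1 f (hps f.2)
    rwa [h1.totalDegree (hn.ne_zero f)]
  have hone : ∀ f : p', 1 ≤ (f : Poly).totalDegree := fun f =>
    degree_pos_of_isFundamental hs (hps f.2) (hhom f)
  have hA : ∀ f : p', (f : Poly) ∈ invariantRing G := fun f => by
    rw [← hs.2.1]; exact Algebra.subset_adjoin (hps f.2)
  have hmem : ∀ c : MvPolynomial p' ℝ, aeval (fun f : p' => (f : Poly)) c ∈ Algebra.adjoin ℝ (p' : Set Poly) :=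
    fun c => by rw [← hrange, mem_adjoin_range_iff]; exact ⟨c, rfl⟩
  have hind : ∀ c : η' → MvPolynomial p' ℝ,
      ∑ j, aeval (fun f : p' => (f : Poly)) (c j) * (j : Poly) = 0 → c = 0 := by
    intro c hc
    obtain ⟨b, -, hb⟩ := hη.2 0 (Subalgebra.zero_mem _)
    have h1 := hb (fun j => ⟨aeval (fun f : p' => (f : Poly)) (c j), hmem _⟩) hc.symm
    have h2 := hb 0 (by simp)
    funext j
    have h3 := congrArg Subtype.val (congrFun (h1.trans h2.symm) j)
    exact (algebraicIndependent_iff.1 hn) (c j) h3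
  have hspan : ∀ f ∈ invariantRing G, ∃ c : η' → MvPolynomial p' ℝ,
      f = ∑ j, aeval (fun f : p' => (f : Poly)) (c j) * (j : Poly) := by
    intro f hf
    obtain ⟨b, hb, -⟩ := hη.2 f hf
    have : ∀ j, ∃ c : MvPolynomial p' ℝ, (b j : Poly) = aeval (fun f : p' => (f : Poly)) c := fun j => by
      rw [← mem_adjoin_range_iff, hrange]; exact (b j).2
    choose c hc using this
    exact ⟨c, by simpa only [hc] using hb⟩
  have hhS : ∀ j : η', (j : Poly).IsHomogeneous (j : Poly).totalDegree := fun j => by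
    obtain ⟨n, h1⟩ := (hη.1 j j.2).2
    by_cases h0 : (j : Poly) = 0
    · rw [h0]; exact isHomogeneous_zero _ _ _
    · rwa [h1.totalDegree h0]
  have h1 := hilbertSeries_of_basis (G := G) (p := fun f : p' => (f : Poly)) (S := fun j : η' => (j : Poly))
    hone hA (fun j => (hη.1 j j.2).1) hhom hhS hind hspan
  have h2 : (denominator ds : PowerSeries ℤ) = ∏ f : p', (1 - PowerSeries.X ^ (f : Poly).totalDegree) := by
    have h3 : denominator ds = ∏ f ∈ p', (1 - Polynomial.X ^ f.totalDegree) := by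
      rw [denominator, ← Multiset.prod_coe, ← Multiset.map_coe, ← hd, degreeMultiset, Multiset.map_map]
      rfl
    rw [h3, ← Finset.prod_coe_sort, ← Polynomial.coeToPowerSeries.ringHom_apply, map_prod]
    simp [Polynomial.coeToPowerSeries.ringHom_apply]
  rw [← h2, hH, ← coe_sum_X_pow] at h1
  exact Polynomial.coe_injective ℤ h1

theorem countDegree_eq_coeff (η : Finset Poly) (l : ℕ) :
    (countDegree η l : ℤ) = (∑ s : η, Polynomial.X ^ (s : Poly).totalDegree : Polynomial ℤ).coeff l := by
  rw [Polynomial.finsetSum_coeff, countDegree, degreeMultiset, Multiset.count_map]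
  simp only [Polynomial.coeff_X_pow]
  rw [Finset.sum_coe_sort η (fun s => if l = s.totalDegree then (1 : ℤ) else 0), Finset.sum_boole]
  rfl

/-- A free basis, together with the selection `E` of those secondary invariants that are irreducible,
determines the numbers of fundamental, primary and secondary invariants. -/
theorem IsFreeBasis.hasCounts (h : IsFreeBasis G p S dp dS) {j₀ : Fin m} (h0 : S j₀ = 1) (E : Finset (Fin m))
    (hE : j₀ ∉ E) (hgen : ∀ j, S j ∈ Algebra.adjoin ℝ (Set.range p ∪ S '' (E : Set (Fin m))))
    (hirr : ∀ f ∈ Set.range p ∪ S '' (E : Set (Fin m)),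
      f ∉ Algebra.adjoin ℝ ((Set.range p ∪ S '' (E : Set (Fin m))) \ {f}))
    {num : Polynomial ℤ} {ds : List ℕ} (hnum : num = ∑ j, Polynomial.X ^ dS j)
    (hds : (ds : Multiset ℕ) = Finset.univ.val.map dp) : HasCounts G num ds k m (k + E.card) := by
  have hH := h.hilbertSeries hds
  rw [← hnum] at hH
  set P := Finset.univ.image p with hP
  set s := P ∪ E.image S with hs
  have hPc : (P : Set Poly) = Set.range p := by simp [hP]
  have hsc : (s : Set Poly) = Set.range p ∪ S '' (E : Set (Fin m)) := by simp [hs, hPc]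
  have hcardP : P.card = k := by
    rw [hP, Finset.card_image_of_injective _ (h.injective_left j₀), Finset.card_univ, Fintype.card_fin]
  have hcards : s.card = k + E.card := by
    rw [hs, Finset.card_union_of_disjoint, hcardP, Finset.card_image_of_injective _ h.injective_right]
    rw [Finset.disjoint_left]
    intro x hx hx'
    obtain ⟨i, -, rfl⟩ := Finset.mem_image.1 hx
    obtain ⟨j, hj, hij⟩ := Finset.mem_image.1 hx'
    exact h.ne h0 i (fun h' => hE (h' ▸ hj)) hij.symm
  have hadj : Algebra.adjoin ℝ (s : Set Poly) = invariantRing G := by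
    refine le_antisymm (Algebra.adjoin_le ?_) fun f hf => ?_
    · rw [hsc]
      rintro _ (⟨i, rfl⟩ | ⟨j, -, rfl⟩)
      · exact h.memP i
      · exact h.memS j
    · obtain ⟨c, rfl⟩ := h.span f hf
      refine Subalgebra.sum_mem _ fun j _ => Subalgebra.mul_mem _ ?_ ?_
      · have : aeval p (c j) ∈ Algebra.adjoin ℝ (Set.range p) := (mem_adjoin_range_iff p).2 ⟨_, rfl⟩
        rw [hsc]
        exact Algebra.adjoin_mono Set.subset_union_left this
      · rw [hsc]; exact hgen j
  -- the `p i` together with the selected `S j` are fundamental invariants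
  have hfund : IsFundamental G s := by
    refine ⟨fun f hf => ?_, hadj, fun f hf => ?_⟩
    · have hf' : f ∈ (s : Set Poly) := hf
      rw [hsc] at hf'
      obtain ⟨i, rfl⟩ | ⟨j, -, rfl⟩ := hf'
      · exact ⟨_, h.homP i⟩
      · exact ⟨_, h.homS j⟩
    · have hf' : f ∈ (s : Set Poly) := hf
      rw [hsc] at hf' ⊢
      exact hirr f hf'
  have hprim : IsPrimary G P := by
    refine ⟨s, hfund, Finset.subset_union_left, noSyzygy_image h j₀, fun q hq hqn => ?_⟩
    refine card_le_of_finite (S := S) (G := G) Finset.subset_union_left hadj h.memS (fun f hf => ?_) hq hqn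
    obtain ⟨c, rfl⟩ := h.span f hf
    refine Submodule.sum_mem _ fun j _ => ?_
    have : aeval p (c j) ∈ Algebra.adjoin ℝ (P : Set Poly) := by
      rw [hPc]; exact (mem_adjoin_range_iff p).2 ⟨_, rfl⟩
    exact Submodule.smul_mem _ (⟨_, this⟩ : Algebra.adjoin ℝ (P : Set Poly))
      (Submodule.subset_span (Set.mem_range_self j))
  have hdeg : degreeMultiset P = (ds : Multiset ℕ) := by
    rw [hds, degreeMultiset, hP, Finset.image_val_of_injOn (h.injective_left j₀).injOn, Multiset.map_map]
    exact Multiset.map_congr rfl fun i _ => h.totalDegree_left j₀ i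
  refine ⟨fun s' hs' => ?_, fun p' hp' => ?_, ⟨P, Finset.univ.image S, hprim, hdeg, isSecondary_image h, ?_⟩, ?_⟩
  · rw [card_of_isFundamental hs', ← card_of_isFundamental hfund, hcards]
  · rw [card_eq_of_isPrimary hp' hprim, hcardP]
  · exact Finset.mem_image.2 ⟨j₀, Finset.mem_univ _, h0⟩
  · intro p' η' hp' hd' hη'
    have h1 := secondary_degrees hH hp' hd' hη'
    refine ⟨?_, fun l => ?_⟩
    · -- the number of secondary invariants is the value of the numerator at `1`
      have h2 := congrArg (Polynomial.eval 1) (hnum.symm.trans h1)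
      simp only [Polynomial.eval_finsetSum, Polynomial.eval_pow, Polynomial.eval_X, one_pow,
        Finset.sum_const, Finset.card_univ, Fintype.card_fin, Fintype.card_coe] at h2
      simpa using h2.symm
    · rw [countDegree_eq_coeff, h1]

/-- A row of the table follows from a free basis of the invariant ring. The three last hypotheses
assert the irreducibility of the fundamental invariants, each either for reasons of degree or by a pair
of points. -/
theorem IsFreeBasis.hilbertRow (h : IsFreeBasis G p S dp dS) {j₀ : Fin m} (h0 : S j₀ = 1) (E : Finset (Fin m))
    (hE : j₀ ∉ E) (hgen : ∀ j, S j ∈ Algebra.adjoin ℝ (Set.range p ∪ S '' (E : Set (Fin m))))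
    {num : Polynomial ℤ} {ds taylor : List ℕ} (hnum : num = ∑ j, Polynomial.X ^ dS j)
    (hds : (ds : Multiset ℕ) = Finset.univ.val.map dp) (hlen : taylor.length = 8)
    (ht : ∀ n < 8, ds.foldr mulFactor (fun n => (taylor.getD n 0 : ℕ)) n = ∑ j, if n = dS j then 1 else 0)
    {e F : ℕ} (hF : k + E.card = F) (he : ∀ j ∈ E, e ≤ dS j)
    (hp : ∀ i, dp i < 2 * e ∨ ∃ φ ψ : Poly →ₐ[ℝ] ℂ,
      (∀ l, l ≠ i → φ (p l) = ψ (p l)) ∧ (∀ j ∈ E, φ (S j) = ψ (S j)) ∧ φ (p i) ≠ ψ (p i))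
    (hS : ∀ i ∈ E, dS i < 2 * e ∨ ∃ φ ψ : Poly →ₐ[ℝ] ℂ,
      (∀ l, φ (p l) = ψ (p l)) ∧ (∀ j ∈ E, j ≠ i → φ (S j) = ψ (S j)) ∧ φ (S i) ≠ ψ (S i)) :
    HilbertRow G num ds taylor k m F := by
  have hH := h.hilbertSeries hds
  rw [← hnum] at hH
  have hone : ∀ d ∈ ds, 1 ≤ d := by
    intro d hd
    have : d ∈ (ds : Multiset ℕ) := hd
    rw [hds, Multiset.mem_map] at this
    obtain ⟨i, -, rfl⟩ := this
    exact h.one_le i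
  refine ⟨hH, fun t ht => hasSum_invDim hone hH ht, map_invDim_eq hone hH hlen ?_, ?_⟩
  · intro n hn
    rw [ht n hn, hnum, Polynomial.finsetSum_coeff]
    simp only [Polynomial.coeff_X_pow]
  · rw [← hF]
    refine h.hasCounts h0 E hE hgen ?_ hnum hds
    rintro _ (⟨i, rfl⟩ | ⟨j, hj, rfl⟩)
    · rcases hp i with hd | ⟨φ, ψ, h1, h2, h3⟩
      · exact primary_notMem_adjoin h.homP h.homS h0 h.ind hE he i hd
      · refine notMem_adjoin_of_separated φ ψ ?_ h3
        rintro _ ⟨⟨l, rfl⟩ | ⟨l, hl, rfl⟩, hne⟩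
        · exact h1 l fun h => hne (by rw [h]; rfl)
        · exact h2 l hl
    · rcases hS j hj with hd | ⟨φ, ψ, h1, h2, h3⟩
      · exact secondary_notMem_adjoin h.homP h.homS h0 h.ind hE he hj hd
      · refine notMem_adjoin_of_separated φ ψ ?_ h3
        rintro _ ⟨⟨l, rfl⟩ | ⟨l, hl, rfl⟩, hne⟩
        · exact h1 l
        · exact h2 l hl fun h => hne (by rw [h]; rfl)

end Counts

/-! ### A fibre criterion for linear independence over a ring of polynomials -/

section Fiber

open Topology Filter

/-- The gradient of a polynomial at a complex point. -/
def gradient (y : Fin 6 → ℂ) (f : Poly) : (Fin 6 → ℂ) →L[ℂ] ℂ :=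
  ∑ l, aeval y (pderiv l f) • ContinuousLinearMap.proj l

theorem gradient_apply (y : Fin 6 → ℂ) (f : Poly) (v : Fin 6 → ℂ) :
    gradient y f v = ∑ l, aeval y (pderiv l f) * v l := by
  simp [gradient]

theorem hasStrictFDerivAt_aeval (f : Poly) (y : Fin 6 → ℂ) :
    HasStrictFDerivAt (fun z : Fin 6 → ℂ => aeval z f) (gradient y f) y := by
  induction f using MvPolynomial.induction_on with
  | C a =>
    have h : gradient y (MvPolynomial.C a) = 0 := by ext v; simp [gradient_apply]
    rw [h]
    simpa using hasStrictFDerivAt_const (𝕜 := ℂ) (algebraMap ℝ ℂ a) y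
  | add p q hp hq =>
    have h : gradient y (p + q) = gradient y p + gradient y q := by
      ext v; simp [gradient_apply, add_mul, Finset.sum_add_distrib]
    rw [h]
    refine (hp.add hq).congr_of_eventuallyEq (Eventually.of_forall fun z => ?_)
    simp
  | mul_X p n hp =>
    have h : gradient y (p * X n) = aeval y p • ContinuousLinearMap.proj n + y n • gradient y p := by
      ext v
      simp only [gradient_apply, pderiv_mul, pderiv_X, map_add, map_mul, aeval_X,
        _root_.add_apply, _root_.smul_apply, ContinuousLinearMap.proj_apply, smul_eq_mul,
        add_mul, Finset.sum_add_distrib, Finset.mul_sum]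
      rw [add_comm]
      congr 1
      · rw [Finset.sum_eq_single n]
        · simp
        · intro b _ hb; simp [Pi.single_eq_of_ne' hb]
        · simp
      · exact Finset.sum_congr rfl fun l _ => by ring
    rw [h]
    have h1 := hp.mul (ContinuousLinearMap.proj (R := ℂ) (φ := fun _ : Fin 6 => ℂ) n).hasStrictFDerivAt (x := y)
    refine h1.congr_of_eventuallyEq (Eventually.of_forall fun z => ?_)
    simp

/-- A polynomial map whose differential at `y` has independent rows is open at `y`. -/
theorem map_nhds_aeval {k : ℕ} (p : Fin k → Poly) (y : Fin 6 → ℂ)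
    (hJ : ∀ a : Fin k → ℂ, (∀ l, ∑ i, a i * aeval y (pderiv l (p i)) = 0) → a = 0) :
    map (fun z : Fin 6 → ℂ => fun i => aeval z (p i)) (𝓝 y) = 𝓝 fun i => aeval y (p i) := by
  have h1 : HasStrictFDerivAt (fun z : Fin 6 → ℂ => fun i => aeval z (p i))
      (ContinuousLinearMap.pi fun i => gradient y (p i)) y :=
    hasStrictFDerivAt_pi.2 fun i => hasStrictFDerivAt_aeval (p i) y
  refine h1.map_nhds_eq_of_surj ?_
  let A : Matrix (Fin k) (Fin 6) ℂ := Matrix.of fun i l => aeval y (pderiv l (p i))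
  have hrow : LinearIndependent ℂ A.row := by
    rw [Fintype.linearIndependent_iff]
    intro a ha i
    refine congrFun (hJ a fun l => ?_) i
    simpa [A] using congrFun ha l
  have hr : A.rank = k := by simpa using hrow.rank_matrix
  have h2 : LinearMap.range A.mulVecLin = ⊤ := by
    apply Submodule.eq_top_of_finrank_eq
    rw [← Matrix.rank, hr]; simp
  rw [eq_top_iff]
  intro w _
  have h3 : w ∈ LinearMap.range A.mulVecLin := h2 ▸ Submodule.mem_top
  obtain ⟨v, hv⟩ := h3
  refine ⟨v, ?_⟩
  rw [← hv]
  funext i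
  change gradient y (p i) v = _
  rw [gradient_apply]
  rfl

/-- If a fibre of the map `p` contains as many points as there are `S j`, all of them regular, and the
matrix of the values of the `S j` at these points is nonsingular, then the `S j` are linearly independent
over `ℝ[p]`: near the given value the fibres vary analytically, and the coefficients of a relation
solve a nonsingular homogeneous linear system there. -/
theorem eq_zero_of_fiber {k m : ℕ} (p : Fin k → Poly) (S : Fin m → Poly) (y : Fin m → Fin 6 → ℂ)
    (b : Fin k → ℂ) (hy : ∀ κ i, aeval (y κ) (p i) = b i)
    (hJ : ∀ κ, ∀ a : Fin k → ℂ, (∀ l, ∑ i, a i * aeval (y κ) (pderiv l (p i)) = 0) → a = 0)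
    (hS : ∀ v : Fin m → ℂ, (∀ κ, ∑ j, aeval (y κ) (S j) * v j = 0) → v = 0)
    (c : Fin m → MvPolynomial (Fin k) ℝ) (hc : ∑ j, aeval p (c j) * S j = 0) : c = 0 := by
  classical
  let A : (Fin m → Fin 6 → ℂ) → Matrix (Fin m) (Fin m) ℂ := fun z => Matrix.of fun κ j => aeval (z κ) (S j)
  have hdet : (A y).det ≠ 0 := by
    intro h
    obtain ⟨v, hv, h1⟩ := Matrix.exists_mulVec_eq_zero_iff.2 h
    exact hv (hS v fun κ => congrFun h1 κ)
  have hcont : Continuous fun z => (A z).det := by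
    refine Continuous.matrix_det (continuous_matrix fun κ j => ?_)
    have h1 : Continuous fun w : Fin 6 → ℂ => aeval w (S j) :=
      continuous_iff_continuousAt.2 fun w => (hasStrictFDerivAt_aeval (S j) w).hasFDerivAt.continuousAt
    exact h1.comp (continuous_apply κ)
  have hev : ∀ᶠ z in 𝓝 y, (A z).det ≠ 0 := hcont.continuousAt.eventually_ne hdet
  rw [nhds_pi, Filter.eventually_iff, Filter.mem_pi'] at hev
  obtain ⟨I, t, ht, hsub⟩ := hev
  -- every value close to `b` is taken at points close to each `y κ`
  have hV : ∀ κ, (fun z : Fin 6 → ℂ => fun i => aeval z (p i)) '' t κ ∈ 𝓝 b := by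
    intro κ
    have h1 := map_nhds_aeval p (y κ) (hJ κ)
    rw [show (fun i => aeval (y κ) (p i)) = b from funext fun i => hy κ i] at h1
    rw [← h1]
    exact image_mem_map (ht κ)
  have hall : (⋂ κ, (fun z : Fin 6 → ℂ => fun i => aeval z (p i)) '' t κ) ∈ 𝓝 b := Filter.iInter_mem.2 hV
  rw [nhds_pi, Filter.mem_pi'] at hall
  obtain ⟨I', s, hs, hsub'⟩ := hall
  -- at these values the coefficients of the relation solve a nonsingular homogeneous system
  have hzero : ∀ w ∈ Set.pi Set.univ s, ∀ j, eval w (MvPolynomial.map (algebraMap ℝ ℂ) (c j)) = 0 := by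
    intro w hw
    have hw' := hsub' (fun i _ => hw i trivial : w ∈ Set.pi (I' : Set (Fin k)) s)
    rw [Set.mem_iInter] at hw'
    choose z hz hzw using hw'
    have hdz : (A z).det ≠ 0 := hsub fun κ _ => hz κ
    have hv : A z *ᵥ (fun j => aeval w (c j)) = 0 := by
      funext κ
      have h1 := congrArg (aeval (z κ)) hc
      rw [map_sum, map_zero] at h1
      rw [Pi.zero_apply, ← h1]
      simp only [Matrix.mulVec, dotProduct, A, Matrix.of_apply]
      refine Finset.sum_congr rfl fun j _ => ?_
      rw [map_mul, mul_comm, ← AlgHom.comp_apply, ← hzw κ]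
      congr 1
      congr 1
      ext i
      simp
    have h2 := Matrix.eq_zero_of_mulVec_eq_zero hdz hv
    intro j
    rw [eval_map, ← aeval_def]
    exact congrFun h2 j
  funext j
  refine MvPolynomial.map_injective _ (algebraMap ℝ ℂ).injective ?_
  rw [Pi.zero_apply, map_zero]
  refine MvPolynomial.funext_set s (fun i => infinite_of_mem_nhds (b i) (hs i)) fun w hw => ?_
  rw [hzero w hw j, map_zero]

end Fiber

/-! ### Eisenstein integers and polynomial expressions -/

section Expressions

/-- The pair `(a, b)` stands for the Eisenstein integer `a + b ω`, where `ω ^ 2 + ω + 1 = 0`. -/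
abbrev Eis : Type := ℤ × ℤ

/-- A primitive third root of unity. -/
def omega : ℂ := ⟨-1 / 2, √3 / 2⟩

theorem omega_sq : omega ^ 2 = -omega - 1 := by
  have h : √3 * √3 = (3 : ℝ) := Real.mul_self_sqrt (by norm_num)
  apply Complex.ext
  · simp only [omega, sq, Complex.mul_re, Complex.sub_re, Complex.neg_re, Complex.one_re]
    nlinarith
  · simp only [omega, sq, Complex.mul_im, Complex.sub_im, Complex.neg_im, Complex.one_im]
    ring

/-- Addition of Eisenstein integers. -/
def Eis.add (x y : Eis) : Eis := (x.1 + y.1, x.2 + y.2)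

/-- Multiplication of Eisenstein integers. -/
def Eis.mul (x y : Eis) : Eis := (x.1 * y.1 - x.2 * y.2, x.1 * y.2 + x.2 * y.1 - x.2 * y.2)

/-- The complex number represented by a pair. -/
def Eis.toC (x : Eis) : ℂ := x.1 + x.2 * omega

theorem Eis.toC_zero : Eis.toC (0, 0) = 0 := by simp [Eis.toC]

theorem Eis.toC_int (n : ℤ) : Eis.toC (n, 0) = n := by simp [Eis.toC]

theorem Eis.toC_add (x y : Eis) : (Eis.add x y).toC = x.toC + y.toC := by
  simp only [Eis.toC, Eis.add]; push_cast; ring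

theorem Eis.toC_mul (x y : Eis) : (Eis.mul x y).toC = x.toC * y.toC := by
  simp only [Eis.toC, Eis.mul]; push_cast
  linear_combination (-(x.2 : ℂ) * y.2) * omega_sq

theorem Eis.toC_eq_zero {x : Eis} (h : x.toC = 0) : x = (0, 0) := by
  have h3 : √3 ≠ 0 := by positivity
  have h1 := congrArg Complex.im h
  have h2 := congrArg Complex.re h
  simp [Eis.toC, omega, h3] at h1
  simp [Eis.toC, omega, h1] at h2
  exact Prod.ext h2 h1

/-- Expressions for polynomials with integer coefficients in six variables. -/
inductive Expr where
  | var (i : Fin 6)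
  | int (n : ℤ)
  | add (a b : Expr)
  | mul (a b : Expr)

namespace Expr

/-- The polynomial denoted by an expression. -/
def toPoly : Expr → Poly
  | var i => X i
  | int n => (n : Poly)
  | add a b => toPoly a + toPoly b
  | mul a b => toPoly a * toPoly b

/-- The value at a point with Eisenstein coordinates. -/
def ev (y : List Eis) : Expr → Eis
  | var i => y.getD i.val (0, 0)
  | int n => (n, 0)
  | add a b => Eis.add (ev y a) (ev y b)
  | mul a b => Eis.mul (ev y a) (ev y b)

/-- The value of the `l`-th partial derivative at a point with Eisenstein coordinates. -/
def evd (y : List Eis) (l : ℕ) : Expr → Eis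
  | var i => bif i.val == l then (1, 0) else (0, 0)
  | int _ => (0, 0)
  | add a b => Eis.add (evd y l a) (evd y l b)
  | mul a b => Eis.add (Eis.mul (evd y l a) (ev y b)) (Eis.mul (ev y a) (evd y l b))

/-- The point of `ℂ⁶` with the given coordinates. -/
def _root_.TensorInvariants.toPoint (y : List Eis) (i : Fin 6) : ℂ := (y.getD i.val (0, 0)).toC

theorem aeval_toPoly (y : List Eis) (e : Expr) : aeval (toPoint y) e.toPoly = (e.ev y).toC := by
  induction e with
  | var i => simp [toPoly, ev, toPoint]
  | int n => rw [toPoly, ev, Eis.toC_int, map_intCast]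
  | add a b ha hb => rw [toPoly, ev, Eis.toC_add, map_add, ha, hb]
  | mul a b ha hb => rw [toPoly, ev, Eis.toC_mul, map_mul, ha, hb]

theorem aeval_pderiv_toPoly (y : List Eis) (l : Fin 6) (e : Expr) :
    aeval (toPoint y) (pderiv l e.toPoly) = (e.evd y l).toC := by
  induction e with
  | var i =>
    rw [toPoly, evd, pderiv_X]
    by_cases h : i = l
    · subst h; simp [Eis.toC_int]
    · have : (i.val == l.val) = false := by simpa [Fin.ext_iff] using h
      rw [this, Pi.single_eq_of_ne h, map_zero]; exact Eis.toC_zero.symm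
  | int n => rw [toPoly, evd, Eis.toC_zero, Derivation.map_intCast, map_zero]
  | add a b ha hb => rw [toPoly, evd, Eis.toC_add, map_add, map_add, ha, hb]
  | mul a b ha hb =>
    rw [toPoly, evd, Eis.toC_add, Eis.toC_mul, Eis.toC_mul, pderiv_mul, map_add, map_mul, map_mul, ha, hb,
      aeval_toPoly, aeval_toPoly]

/-- The degree of an expression, if it is visibly homogeneous. -/
def deg : Expr → Option ℕ
  | var _ => some 1
  | int _ => some 0
  | add a b => match deg a, deg b with
    | some m, some n => bif m == n then some m else none
    | _, _ => none
  | mul a b => match deg a, deg b with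
    | some m, some n => some (m + n)
    | _, _ => none

theorem isHomogeneous_of_deg {e : Expr} : ∀ {n : ℕ}, e.deg = some n → e.toPoly.IsHomogeneous n := by
  induction e with
  | var i => intro n h; cases h; exact isHomogeneous_X ℝ i
  | int m =>
    intro n h; cases h
    have : (int m).toPoly = MvPolynomial.C (m : ℝ) := by rw [toPoly]; simp
    rw [this]; exact isHomogeneous_C _ _
  | add a b ha hb =>
    intro n h
    rw [deg] at h
    split at h
    · next m m' h1 h2 =>
      by_cases hm : m = m'
      · subst hm
        simp only [beq_self_eq_true, cond_true, Option.some.injEq] at h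
        subst h
        exact (ha h1).add (hb h2)
      · have : (m == m') = false := by simpa using hm
        rw [this] at h; cases h
    · cases h
  | mul a b ha hb =>
    intro n h
    rw [deg] at h
    split at h
    · next m m' h1 h2 =>
      cases h
      exact (ha h1).mul (hb h2)
    · cases h

/-- Equality of expressions. -/
def same : Expr → Expr → Bool
  | var i, var j => i.val == j.val
  | int m, int n => m == n
  | add a b, add a' b' => same a a' && same b b'
  | mul a b, mul a' b' => same a a' && same b b'
  | _, _ => false

theorem eq_of_same {a : Expr} : ∀ {b : Expr}, same a b = true → a = b := by
  induction a with
  | var i =>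
    intro b h
    cases b <;> simp [same] at h
    rw [Fin.ext h]
  | int m =>
    intro b h
    cases b <;> simp [same] at h
    rw [h]
  | add a a' h1 h2 =>
    intro b h
    cases b <;> simp [same] at h
    rw [h1 h.1, h2 h.2]
  | mul a a' h1 h2 =>
    intro b h
    cases b <;> simp [same] at h
    rw [h1 h.1, h2 h.2]

/-- Whether an expression is built from members of `l`. -/
def builtFrom (l : List Expr) : Expr → Bool
  | var i => l.any (same (var i))
  | int _ => true
  | add a b => l.any (same (add a b)) || (builtFrom l a && builtFrom l b)
  | mul a b => l.any (same (mul a b)) || (builtFrom l a && builtFrom l b)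

theorem mem_of_any_same {l : List Expr} {a : Expr} (h : l.any (same a) = true) : a ∈ l := by
  obtain ⟨b, hb, h1⟩ := List.any_eq_true.1 h
  rwa [eq_of_same h1]

theorem mem_of_builtFrom {l : List Expr} {B : Subalgebra ℝ Poly} (hB : ∀ a ∈ l, toPoly a ∈ B) {e : Expr}
    (h : builtFrom l e = true) : toPoly e ∈ B := by
  induction e with
  | var i => exact hB _ (mem_of_any_same h)
  | int n => exact intCast_mem B n
  | add a b ha hb =>
    rw [builtFrom, Bool.or_eq_true, Bool.and_eq_true] at h
    rcases h with h | h
    · exact hB _ (mem_of_any_same h)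
    · exact B.add_mem (ha h.1) (hb h.2)
  | mul a b ha hb =>
    rw [builtFrom, Bool.or_eq_true, Bool.and_eq_true] at h
    rcases h with h | h
    · exact hB _ (mem_of_any_same h)
    · exact B.mul_mem (ha h.1) (hb h.2)

end Expr

/-- Sparse polynomials: lists of exponent lists and coefficients. -/
abbrev Sparse : Type := List (List ℕ × ℤ)

namespace Sparse

/-- The variable with index `i`, or `1` when there is none. -/
def varOrOne (i : ℕ) : Poly := if h : i < 6 then X ⟨i, h⟩ else 1

/-- The monomial with the given exponents, starting from the variable with index `i`. -/
def mon : List ℕ → ℕ → Poly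
  | [], _ => 1
  | e :: es, i => varOrOne i ^ e * mon es (i + 1)

/-- The polynomial denoted by a sparse polynomial. -/
def toPoly : Sparse → Poly
  | [] => 0
  | t :: l => (t.2 : Poly) * mon t.1 0 + toPoly l

/-- Equality of exponent lists. -/
def keyEq : List ℕ → List ℕ → Bool
  | [], [] => true
  | a :: as, b :: bs => a == b && keyEq as bs
  | _, _ => false

/-- Lexicographic order of exponent lists. -/
def keyLt : List ℕ → List ℕ → Bool
  | [], [] => false
  | [], _ :: _ => true
  | _ :: _, [] => false
  | a :: as, b :: bs => Nat.blt a b || (a == b && keyLt as bs)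

/-- Sum of exponent lists. -/
def keyAdd : List ℕ → List ℕ → List ℕ
  | [], b => b
  | a, [] => a
  | a :: as, b :: bs => (a + b) :: keyAdd as bs

theorem eq_of_keyEq : ∀ {a b : List ℕ}, keyEq a b = true → a = b
  | [], [], _ => rfl
  | a :: as, b :: bs, h => by
    rw [keyEq, Bool.and_eq_true] at h
    rw [eq_of_keyEq h.2, eq_of_beq h.1]
  | [], _ :: _, h => by simp [keyEq] at h
  | _ :: _, [], h => by simp [keyEq] at h

theorem mon_keyAdd : ∀ (a b : List ℕ) (i : ℕ), mon (keyAdd a b) i = mon a i * mon b i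
  | [], b, i => by rw [keyAdd, mon, one_mul]
  | a :: as, [], i => by rw [keyAdd, mon, mul_one]; simp
  | a :: as, b :: bs, i => by
    rw [keyAdd, mon, mon, mon, mon_keyAdd as bs, pow_add]; ring

/-- Add a term to a sorted sparse polynomial. -/
def insertTerm (k : List ℕ) (c : ℤ) : Sparse → Sparse
  | [] => bif c == 0 then [] else [(k, c)]
  | t :: l => bif keyEq k t.1 then (bif c + t.2 == 0 then l else (k, c + t.2) :: l)
      else bif keyLt k t.1 then (bif c == 0 then t :: l else (k, c) :: t :: l) else t :: insertTerm k c l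

theorem toPoly_insertTerm (k : List ℕ) (c : ℤ) (l : Sparse) :
    toPoly (insertTerm k c l) = (c : Poly) * mon k 0 + toPoly l := by
  induction l with
  | nil =>
    rw [insertTerm]
    cases h : (c == 0)
    · rfl
    · rw [eq_of_beq h]; simp [toPoly]
  | cons t l ih =>
    rw [insertTerm]
    cases h : keyEq k t.1
    · simp only [cond_false]
      cases keyLt k t.1
      · rw [cond_false, toPoly, ih, toPoly]; ring
      · cases h : (c == 0)
        · rfl
        · rw [eq_of_beq h]; simp
    · simp only [cond_true]
      have hk := eq_of_keyEq h
      cases h2 : (c + t.2 == 0)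
      · rw [cond_false, toPoly, toPoly, hk]; push_cast; ring
      · rw [cond_true, toPoly, hk, ← add_assoc, ← add_mul, ← Int.cast_add, eq_of_beq h2]; simp

/-- Sum of sparse polynomials. -/
def add : Sparse → Sparse → Sparse
  | [], b => b
  | t :: a, b => insertTerm t.1 t.2 (add a b)

theorem toPoly_add (a b : Sparse) : toPoly (add a b) = toPoly a + toPoly b := by
  induction a with
  | nil => rw [add, toPoly, zero_add]
  | cons t a ih => rw [add, toPoly_insertTerm, ih, toPoly, add_assoc]

/-- Add the product of a term and a sparse polynomial. -/
def addMulTerm (k : List ℕ) (c : ℤ) : Sparse → Sparse → Sparse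
  | [], b => b
  | t :: a, b => insertTerm (keyAdd k t.1) (c * t.2) (addMulTerm k c a b)

theorem toPoly_addMulTerm (k : List ℕ) (c : ℤ) (a b : Sparse) :
    toPoly (addMulTerm k c a b) = (c : Poly) * mon k 0 * toPoly a + toPoly b := by
  induction a with
  | nil => rw [addMulTerm, toPoly, mul_zero, zero_add]
  | cons t a ih => rw [addMulTerm, toPoly_insertTerm, ih, toPoly, mon_keyAdd]; push_cast; ring

/-- Product of sparse polynomials. -/
def mul : Sparse → Sparse → Sparse
  | [], _ => []
  | t :: a, b => addMulTerm t.1 t.2 b (mul a b)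

theorem toPoly_mul (a b : Sparse) : toPoly (mul a b) = toPoly a * toPoly b := by
  induction a with
  | nil => rw [mul, toPoly, zero_mul]
  | cons t a ih => rw [mul, toPoly_addMulTerm, ih, toPoly, add_mul]

/-- The linear form with the given coefficients. -/
def linear (r : List ℤ) : Sparse :=
  insertTerm [1] (r.getD 0 0) <| insertTerm [0, 1] (r.getD 1 0) <| insertTerm [0, 0, 1] (r.getD 2 0) <|
  insertTerm [0, 0, 0, 1] (r.getD 3 0) <| insertTerm [0, 0, 0, 0, 1] (r.getD 4 0) <|
  insertTerm [0, 0, 0, 0, 0, 1] (r.getD 5 0) []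

theorem toPoly_linear (r : List ℤ) : toPoly (linear r) = ∑ β : Fin 6, ((r.getD β.val 0 : ℤ) : Poly) * X β := by
  simp only [linear, toPoly_insertTerm, Fin.sum_univ_six, toPoly, mon, varOrOne]
  simp
  ring

end Sparse

/-- The normal form of an expression after a substitution. -/
def Expr.norm (env : List Sparse) : Expr → Sparse
  | .var i => env.getD i.val []
  | .int n => Sparse.insertTerm [] n []
  | .add a b => Sparse.add (norm env a) (norm env b)
  | .mul a b => Sparse.mul (norm env a) (norm env b)

theorem Expr.toPoly_norm (env : List Sparse) (e : Expr) :
    Sparse.toPoly (e.norm env) = aeval (fun i : Fin 6 => Sparse.toPoly (env.getD i.val [])) e.toPoly := by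
  induction e with
  | var i => rw [norm, toPoly, aeval_X]
  | int n => rw [norm, toPoly, Sparse.toPoly_insertTerm, Sparse.mon, map_intCast]; simp [Sparse.toPoly]
  | add a b ha hb => rw [norm, toPoly, Sparse.toPoly_add, ha, hb, map_add]
  | mul a b ha hb => rw [norm, toPoly, Sparse.toPoly_mul, ha, hb, map_mul]

/-- Integer matrices as lists of rows. -/
abbrev IMat : Type := List (List ℤ)

/-- The real matrix with the given rows. -/
def IMat.toReal (N : IMat) : Matrix (Fin 6) (Fin 6) ℝ := Matrix.of fun i j => ((N.getD i.val []).getD j.val 0 : ℤ)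

/-- The identity matrix. -/
def IMat.one : IMat :=
  [[1, 0, 0, 0, 0, 0], [0, 1, 0, 0, 0, 0], [0, 0, 1, 0, 0, 0], [0, 0, 0, 1, 0, 0], [0, 0, 0, 0, 1, 0],
    [0, 0, 0, 0, 0, 1]]

theorem IMat.toReal_one : IMat.one.toReal = 1 := by
  ext i j
  fin_cases i <;> fin_cases j <;> simp [IMat.toReal, IMat.one]

theorem Expr.toPoly_norm_linear (N : IMat) (e : Expr) :
    Sparse.toPoly (e.norm (N.map Sparse.linear)) = linSubst N.toReal e.toPoly := by
  rw [Expr.toPoly_norm, linSubst]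
  congr 2
  funext i
  have h : (N.map Sparse.linear).getD i.val [] = Sparse.linear (N.getD i.val []) := by
    rw [List.getD_eq_getElem?_getD, List.getElem?_map, List.getD_eq_getElem?_getD]
    cases N[i.val]? <;> rfl
  rw [h, Sparse.toPoly_linear]
  refine Finset.sum_congr rfl fun β _ => ?_
  simp [IMat.toReal]

/-- Invariance of the polynomial of `e` under an integer matrix, decided by comparing normal forms. -/
def Expr.fixedBy (e : Expr) (N : IMat) : Bool :=
  e.norm (N.map Sparse.linear) == e.norm (IMat.one.map Sparse.linear)

theorem Expr.linSubst_of_fixedBy {e : Expr} {N : IMat} (h : e.fixedBy N = true) :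
    linSubst N.toReal e.toPoly = e.toPoly := by
  rw [← Expr.toPoly_norm_linear, eq_of_beq h, Expr.toPoly_norm_linear, IMat.toReal_one, linSubst_one]

end Expressions

/-! ### Linear independence by elimination -/

section Elimination

/-- Linear combination of rows with Eisenstein entries. -/
def comb : List (List Eis) → (ℕ → ℂ) → ℕ → ℂ
  | [], _, _ => 0
  | r :: rs, a, i => a 0 * (r.getD i (0, 0)).toC + comb rs (fun n => a (n + 1)) i

/-- Linear independence of rows. -/
def RowsIndependent (rs : List (List Eis)) : Prop :=
  ∀ a : ℕ → ℂ, (∀ i, comb rs a i = 0) → ∀ n < rs.length, a n = 0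

/-- The row `α • r - β • s`. -/
def subRow (α β : Eis) : List Eis → List Eis → List Eis
  | [], _ => []
  | x :: r, [] => Eis.mul α x :: subRow α β r []
  | x :: r, y :: s => Eis.add (Eis.mul α x) (Eis.mul (Eis.mul (-1, 0) β) y) :: subRow α β r s

theorem toC_getD_subRow (α β : Eis) : ∀ (r s : List Eis) (i : ℕ), s.length ≤ r.length →
    ((subRow α β r s).getD i (0, 0)).toC
      = α.toC * (r.getD i (0, 0)).toC - β.toC * (s.getD i (0, 0)).toC
  | [], [], i, _ => by simp [subRow, Eis.toC_zero]
  | [], _ :: _, _, h => by simp at h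
  | x :: r, [], 0, _ => by simp [subRow, Eis.toC_mul, Eis.toC_zero]
  | x :: r, [], i + 1, _ => by simpa [subRow] using toC_getD_subRow α β r [] i (by simp)
  | x :: r, y :: s, 0, _ => by
    have h : Eis.toC (-1, 0) = -1 := by rw [Eis.toC_int]; simp
    simp only [subRow, List.getD_cons_zero, Eis.toC_add, Eis.toC_mul, h]; ring
  | x :: r, y :: s, i + 1, h => by
    simpa [subRow] using toC_getD_subRow α β r s i (by simpa using h)

/-- Greatest common divisor of the entries of a row. -/
def rowGcd : List Eis → ℕ
  | [] => 0
  | x :: r => Nat.gcd (Nat.gcd x.1.natAbs x.2.natAbs) (rowGcd r)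

/-- Divide a row by an integer. -/
def rowDiv (g : ℕ) (r : List Eis) : List Eis := r.map fun x => (x.1 / g, x.2 / g)

/-- Multiply a row by an integer. -/
def rowMul (g : ℕ) (r : List Eis) : List Eis := r.map fun x => (x.1 * g, x.2 * g)

/-- Divide a row by its content. -/
def reduceRow (r : List Eis) : List Eis :=
  let g := rowGcd r
  let q := rowDiv g r
  bif !(g == 0) && rowMul g q == r then q else r

theorem exists_toC_reduceRow (r : List Eis) : ∃ g : ℂ, g ≠ 0 ∧ ∀ i,
    (r.getD i (0, 0)).toC = g * ((reduceRow r).getD i (0, 0)).toC := by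
  rw [reduceRow]
  cases h : (!(rowGcd r == 0) && rowMul (rowGcd r) (rowDiv (rowGcd r) r) == r)
  · exact ⟨1, one_ne_zero, fun i => by simp⟩
  · rw [Bool.and_eq_true] at h
    refine ⟨(rowGcd r : ℂ), by simpa using h.1, fun i => ?_⟩
    simp only [cond_true]
    conv_lhs => rw [← eq_of_beq h.2, rowMul]
    rw [List.getD_eq_getElem?_getD, List.getElem?_map, List.getD_eq_getElem?_getD]
    cases (rowDiv (rowGcd r) r)[i]?
    · simp [Eis.toC_zero]
    · simp [Eis.toC]; ring

/-- A column in which the row has a nonzero entry. -/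
def findPivot : List Eis → ℕ
  | [] => 0
  | x :: r => bif x == (0, 0) then findPivot r + 1 else 0

/-- Gaussian elimination; the first argument bounds the number of steps. -/
def elimination : ℕ → List (List Eis) → Bool
  | _, [] => true
  | 0, _ :: _ => false
  | n + 1, r :: rs =>
    let c := findPivot r
    let α := r.getD c (0, 0)
    !(α == (0, 0)) && rs.all (fun s => Nat.ble r.length s.length) &&
      elimination n (rs.map fun s => reduceRow (subRow α (s.getD c (0, 0)) s r))

theorem exists_comb_map (α : Eis) (c : ℕ) (r : List Eis) : ∀ (rs : List (List Eis)),
    (∀ s ∈ rs, r.length ≤ s.length) → ∀ a : ℕ → ℂ,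
    ∃ b : ℕ → ℂ, (∀ i, comb (rs.map fun s => reduceRow (subRow α (s.getD c (0, 0)) s r)) b i
      = α.toC * comb rs a i - comb rs a c * (r.getD i (0, 0)).toC) ∧ ∀ n, b n = 0 → a n = 0
  | [], _, a => ⟨a, fun i => by simp [comb], fun n h => h⟩
  | s :: rs, hlen, a => by
    obtain ⟨b, hb, hb'⟩ := exists_comb_map α c r rs (fun t ht => hlen t (List.mem_cons_of_mem _ ht))
      (fun n => a (n + 1))
    obtain ⟨g, hg, hg'⟩ := exists_toC_reduceRow (subRow α (s.getD c (0, 0)) s r)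
    refine ⟨fun n => Nat.casesOn n (a 0 * g) b, fun i => ?_, fun n => ?_⟩
    · rw [List.map_cons, comb, hb, comb, comb]
      have h1 := hg' i
      rw [toC_getD_subRow _ _ _ _ _ (hlen s List.mem_cons_self)] at h1
      change a 0 * g * _ + _ = _
      linear_combination (-(a 0)) * h1
    · cases n with
      | zero => intro h; exact (mul_eq_zero.1 h).resolve_right hg
      | succ n => exact hb' n

theorem comb_eq_zero : ∀ (rs : List (List Eis)) (a : ℕ → ℂ), (∀ n < rs.length, a n = 0) → ∀ i, comb rs a i = 0
  | [], _, _, _ => rfl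
  | r :: rs, a, h, i => by
    rw [comb, h 0 (by simp), zero_mul, zero_add]
    exact comb_eq_zero rs _ (fun n hn => h (n + 1) (by simpa using hn)) i

theorem rowsIndependent_of_elimination : ∀ (n : ℕ) (rs : List (List Eis)), elimination n rs = true →
    RowsIndependent rs
  | _, [], _ => fun _ _ n hn => by simp at hn
  | 0, _ :: _, h => by simp [elimination] at h
  | n + 1, r :: rs, h => by
    simp only [elimination, Bool.and_eq_true, Bool.not_eq_true', List.all_eq_true, Nat.ble_eq] at h
    obtain ⟨⟨h1, h2⟩, h3⟩ := h
    set α := r.getD (findPivot r) (0, 0) with hα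
    have hα0 : α.toC ≠ 0 := fun h => by
      rw [Eis.toC_eq_zero h] at h1
      simp at h1
    have ih := rowsIndependent_of_elimination n _ h3
    intro a ha
    obtain ⟨b, hb, hb'⟩ := exists_comb_map α (findPivot r) r rs h2 fun n => a (n + 1)
    have hc : ∀ i, comb rs (fun n => a (n + 1)) i = -(a 0 * (r.getD i (0, 0)).toC) := fun i => by
      have := ha i
      rw [comb] at this
      linear_combination this
    have h4 := ih b fun i => by rw [hb, hc, hc, ← hα]; ring
    have h5 : ∀ n < rs.length, a (n + 1) = 0 := fun n hn => hb' n (h4 n (by simpa using hn))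
    have h6 : a 0 = 0 := by
      have := hc (findPivot r)
      rw [comb_eq_zero rs _ h5, ← hα] at this
      simpa [hα0] using this
    intro m hm
    cases m with
    | zero => exact h6
    | succ m => exact h5 m (by simpa using hm)

theorem comb_map_eq_sum {β : Type*} (f : β → List Eis) : ∀ (l : List β) (a : ℕ → ℂ) (i : ℕ),
    comb (l.map f) a i = ∑ x : Fin l.length, a x * ((f (l.get x)).getD i (0, 0)).toC
  | [], _, _ => by simp [comb]
  | b :: l, a, i => by
    rw [List.map_cons, comb, comb_map_eq_sum f l]
    exact (Fin.sum_univ_succ (n := l.length)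
      fun x : Fin (l.length + 1) => a x * ((f ((b :: l).get x)).getD i (0, 0)).toC).symm

/-- Rows certified by elimination are linearly independent. -/
theorem eq_zero_of_elimination {β : Type*} {f : β → List Eis} {l : List β} {n : ℕ}
    (h : elimination n (l.map f) = true) (a : Fin l.length → ℂ)
    (ha : ∀ i : ℕ, ∑ x, a x * ((f (l.get x)).getD i (0, 0)).toC = 0) : a = 0 := by
  have h1 := rowsIndependent_of_elimination n _ h (fun m => if hm : m < l.length then a ⟨m, hm⟩ else 0)
    (fun i => by
      rw [comb_map_eq_sum, ← ha i]
      refine Finset.sum_congr rfl fun x _ => ?_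
      simp)
  funext x
  have h2 := h1 x (by simp)
  simpa using h2

end Elimination

/-! ### Hilbert series of finite groups given by integer matrices -/

section ListPolynomials

/-- The polynomial with the given coefficients. -/
def ofCoeffs : List ℤ → Polynomial ℤ
  | [] => 0
  | a :: l => Polynomial.C a + Polynomial.X * ofCoeffs l

/-- Sum of coefficient lists. -/
def addCoeffs : List ℤ → List ℤ → List ℤ
  | [], l => l
  | a :: k, [] => a :: k
  | a :: k, b :: l => (a + b) :: addCoeffs k l

/-- Product of coefficient lists. -/
def mulCoeffs : List ℤ → List ℤ → List ℤ
  | [], _ => []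
  | a :: k, l => addCoeffs (l.map fun b => a * b) (0 :: mulCoeffs k l)

/-- Division of power series, for a divisor with constant coefficient one. -/
def divCoeffs : ℕ → List ℤ → List ℤ → List ℤ
  | 0, _, _ => []
  | _, [], _ => []
  | n + 1, a :: k, l => a :: divCoeffs n (addCoeffs (a :: k) (l.map fun b => -a * b)).tail l

/-- Equality up to trailing zeros. -/
def eqCoeffs : List ℤ → List ℤ → Bool
  | [], l => l.all fun b => b == 0
  | a :: k, [] => a == 0 && k.all fun b => b == 0
  | a :: k, b :: l => a == b && eqCoeffs k l

theorem ofCoeffs_add : ∀ k l : List ℤ, ofCoeffs (addCoeffs k l) = ofCoeffs k + ofCoeffs l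
  | [], l => by rw [addCoeffs, ofCoeffs, zero_add]
  | a :: k, [] => by rw [addCoeffs, ofCoeffs, ofCoeffs, add_zero]
  | a :: k, b :: l => by
    rw [addCoeffs, ofCoeffs, ofCoeffs, ofCoeffs, ofCoeffs_add k l, map_add]; ring

theorem ofCoeffs_map_mul (a : ℤ) : ∀ l : List ℤ, ofCoeffs (l.map fun b => a * b) = Polynomial.C a * ofCoeffs l
  | [] => by simp [ofCoeffs]
  | b :: l => by rw [List.map_cons, ofCoeffs, ofCoeffs, ofCoeffs_map_mul a l, map_mul]; ring

theorem ofCoeffs_mul : ∀ k l : List ℤ, ofCoeffs (mulCoeffs k l) = ofCoeffs k * ofCoeffs l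
  | [], l => by rw [mulCoeffs, ofCoeffs, zero_mul]
  | a :: k, l => by
    rw [mulCoeffs, ofCoeffs_add, ofCoeffs_map_mul, ofCoeffs, ofCoeffs, ofCoeffs_mul k l, map_zero]; ring

theorem ofCoeffs_eq_zero : ∀ {l : List ℤ}, (l.all fun b => b == 0) = true → ofCoeffs l = 0
  | [], _ => rfl
  | b :: l, h => by
    rw [List.all_cons, Bool.and_eq_true] at h
    rw [ofCoeffs, ofCoeffs_eq_zero h.2, eq_of_beq h.1, map_zero]; simp

theorem ofCoeffs_eq_of_eqCoeffs : ∀ {k l : List ℤ}, eqCoeffs k l = true → ofCoeffs k = ofCoeffs l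
  | [], l, h => by rw [eqCoeffs] at h; rw [ofCoeffs_eq_zero h, ofCoeffs]
  | a :: k, [], h => by
    rw [eqCoeffs, Bool.and_eq_true] at h
    rw [ofCoeffs, ofCoeffs, ofCoeffs_eq_zero h.2, eq_of_beq h.1]; simp
  | a :: k, b :: l, h => by
    rw [eqCoeffs, Bool.and_eq_true] at h
    rw [ofCoeffs, ofCoeffs, ofCoeffs_eq_of_eqCoeffs h.2, eq_of_beq h.1]

/-- The coefficients of `X ^ d`. -/
def powCoeffs (d : ℕ) : List ℤ := List.replicate d 0 ++ [1]

theorem ofCoeffs_pow (d : ℕ) : ofCoeffs (powCoeffs d) = Polynomial.X ^ d := by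
  induction d with
  | zero => simp [powCoeffs, ofCoeffs]
  | succ d ih =>
    have : powCoeffs (d + 1) = 0 :: powCoeffs d := rfl
    rw [this, ofCoeffs, ih, pow_succ']; simp

/-- The coefficients of `∏ (1 - X ^ d)`. -/
def denCoeffs : List ℕ → List ℤ
  | [] => [1]
  | d :: ds => mulCoeffs (addCoeffs [1] ((powCoeffs d).map fun b => -1 * b)) (denCoeffs ds)

theorem ofCoeffs_den (ds : List ℕ) : ofCoeffs (denCoeffs ds) = denominator ds := by
  induction ds with
  | nil => simp [denCoeffs, ofCoeffs, denominator]
  | cons d ds ih =>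
    have h1 : denominator (d :: ds) = (1 - Polynomial.X ^ d) * denominator ds := by simp [denominator]
    rw [denCoeffs, ofCoeffs_mul, ofCoeffs_add, ofCoeffs_map_mul, ofCoeffs_pow, ih, h1]
    simp [ofCoeffs]
    left; ring

/-- The coefficients of `∑ X ^ d`. -/
def numCoeffs : List ℕ → List ℤ
  | [] => []
  | d :: ds => addCoeffs (powCoeffs d) (numCoeffs ds)

theorem ofCoeffs_num (ds : List ℕ) : ofCoeffs (numCoeffs ds) = (ds.map fun d => Polynomial.X ^ d).sum := by
  induction ds with
  | nil => simp [numCoeffs, ofCoeffs]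
  | cons d ds ih => rw [numCoeffs, ofCoeffs_add, ofCoeffs_pow, ih, List.map_cons, List.sum_cons]

end ListPolynomials

section Classes

/-- The reciprocal of the generating function of the traces of the symmetric powers, for a rotation by
the angle `φ` with `a = 2 cos φ`. -/
def rotationPoly (a : ℝ) : Polynomial ℝ :=
  (1 - Polynomial.X) ^ 2 * (1 - Polynomial.C a * Polynomial.X + Polynomial.X ^ 2)
    * (1 - Polynomial.C (a ^ 2 - 2) * Polynomial.X + Polynomial.X ^ 2)

/-- The traces of `Φ(Q)` and `Φ(Q)²`, and the generating function of the traces on the symmetric powers, in terms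
of `a = 2 cos φ`, where `φ` is the angle of the rotation `Q` or `-Q`. -/
theorem exists_rotationPoly (Q : O3) : ∃ a : ℝ, |a| ≤ 2 ∧
    (kelvin (Q : Matrix (Fin 3) (Fin 3) ℝ)).trace = a ^ 2 + a ∧
    (kelvin (Q : Matrix (Fin 3) (Fin 3) ℝ) * kelvin (Q : Matrix (Fin 3) (Fin 3) ℝ)).trace
      = a ^ 4 - 3 * a ^ 2 + 2 ∧
    (PowerSeries.mk fun d => (symMat (kelvin (Q : Matrix (Fin 3) (Fin 3) ℝ)) d).trace)
      * (rotationPoly a : PowerSeries ℝ) = 1 := by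
  obtain ⟨φ, P, P', hP, h⟩ := exists_diag_kelvin Q
  set M := kelvin (Q : Matrix (Fin 3) (Fin 3) ℝ)
  have hz : (Real.cos φ + Real.sin φ * Complex.I : ℂ) * (Real.cos φ - Real.sin φ * Complex.I) = 1 := by
    have h1 : (Real.sin φ : ℂ) ^ 2 + (Real.cos φ : ℂ) ^ 2 = 1 := by exact_mod_cast Real.sin_sq_add_cos_sq φ
    linear_combination h1 - (Real.sin φ : ℂ) ^ 2 * Complex.I_sq
  have hs : (Real.cos φ + Real.sin φ * Complex.I : ℂ) + (Real.cos φ - Real.sin φ * Complex.I)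
      = ((2 * Real.cos φ : ℝ) : ℂ) := by push_cast; ring
  have htr : ∀ N : Matrix (Fin 6) (Fin 6) ℝ, ((N.trace : ℝ) : ℂ) = (N.map Complex.ofRealHom).trace := fun N =>
    AddMonoidHom.map_trace (Complex.ofRealHom : ℝ →+ ℂ) N
  have hconj : ∀ D : Matrix (Fin 6) (Fin 6) ℂ, (P * D * P').trace = D.trace := fun D => by
    rw [Matrix.trace_mul_comm, ← Matrix.mul_assoc, hP, Matrix.one_mul]
  have hprod := trace_symMat_of_diag hP h
  have hlam : kelvinEigenvalues φ = ![1, 1, Real.cos φ + Real.sin φ * Complex.I,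
    Real.cos φ - Real.sin φ * Complex.I, (Real.cos φ + Real.sin φ * Complex.I) ^ 2,
    (Real.cos φ - Real.sin φ * Complex.I) ^ 2] := rfl
  rw [hlam] at h hprod
  generalize (Real.cos φ + Real.sin φ * Complex.I : ℂ) = z at hz hs h hprod
  generalize (Real.cos φ - Real.sin φ * Complex.I : ℂ) = w at hz hs h hprod
  refine ⟨2 * Real.cos φ, ?_, ?_, ?_, ?_⟩
  · rw [abs_mul, abs_two]
    linarith [Real.abs_cos_le_one φ]
  · apply Complex.ofReal_injective
    rw [htr, h, hconj, Matrix.trace_diagonal]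
    simp only [Fin.sum_univ_six, Complex.ofReal_add, Complex.ofReal_pow, ← hs]
    simp
    linear_combination (-2) * hz
  · apply Complex.ofReal_injective
    rw [htr, Matrix.map_mul, h]
    have h2 : ∀ D : Matrix (Fin 6) (Fin 6) ℂ, P * D * P' * (P * D * P') = P * (D * D) * P' := fun D => by
      simp only [Matrix.mul_assoc]
      rw [← Matrix.mul_assoc P', hP, Matrix.one_mul]
    rw [h2, hconj, Matrix.diagonal_mul_diagonal, Matrix.trace_diagonal]
    have h3 : ((((2 * Real.cos φ) ^ 4 - 3 * (2 * Real.cos φ) ^ 2 + 2 : ℝ)) : ℂ)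
        = (z + w) ^ 4 - 3 * (z + w) ^ 2 + 2 := by
      rw [hs]; push_cast; ring
    rw [h3]
    simp only [Fin.sum_univ_six]
    simp
    linear_combination (-4 * z ^ 2 - 4 * w ^ 2 - 6 * (z * w + 1) + 6) * hz
  · have hinj : Function.Injective (PowerSeries.map Complex.ofRealHom) := by
      intro f g hfg
      ext n
      have := congrArg (PowerSeries.coeff n) hfg
      rw [PowerSeries.coeff_map, PowerSeries.coeff_map] at this
      exact Complex.ofReal_injective this
    apply hinj
    rw [map_mul, map_one, ← hprod]
    congr 1
    · ext n
      simp only [PowerSeries.coeff_map, PowerSeries.coeff_mk]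
      exact ofReal_trace_symMat _ _
    · have h4 : PowerSeries.map Complex.ofRealHom (rotationPoly (2 * Real.cos φ) : PowerSeries ℝ)
          = (1 - PowerSeries.X) ^ 2 * (1 - PowerSeries.C (z + w) * PowerSeries.X + PowerSeries.X ^ 2)
            * (1 - PowerSeries.C ((z + w) ^ 2 - 2) * PowerSeries.X + PowerSeries.X ^ 2) := by
        rw [← Polynomial.polynomial_map_coe, rotationPoly, hs]
        simp only [Polynomial.map_mul, Polynomial.map_add, Polynomial.map_sub, Polynomial.map_pow,
          Polynomial.map_one, Polynomial.map_X, Polynomial.map_C, Polynomial.coe_mul, Polynomial.coe_add,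
          Polynomial.coe_sub, Polynomial.coe_pow, Polynomial.coe_one, Polynomial.coe_X, Polynomial.coe_C]
        simp
      rw [h4]
      have h5 : PowerSeries.C z * PowerSeries.C w = (1 : PowerSeries ℂ) := by rw [← map_mul, hz, map_one]
      simp only [Fin.prod_univ_six, map_add, map_sub, map_pow]
      simp
      generalize PowerSeries.C z = Z at h5
      generalize PowerSeries.C w = W at h5
      generalize (PowerSeries.X : PowerSeries ℂ) = T
      have h6 : (PowerSeries.C 2 : PowerSeries ℂ) = 2 := map_ofNat _ 2
      try rw [h6]
      linear_combination (-(1 - T) ^ 2 * ((1 - (Z + W) * T + T ^ 2) * (2 * T + (Z * W + 1) * T ^ 2)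
        + T ^ 2 * (1 - (Z ^ 2 + W ^ 2) * T + Z ^ 2 * W ^ 2 * T ^ 2))) * h5

end Classes

section IntegerMatrices

/-- The coefficients of the reciprocal of the generating function of the traces of the symmetric powers
for a rotation of order `1`, `2`, `3`, `4`, `6` or `5`, recognized by the traces of its matrix and of
the square; the two classes of rotations of order five share their traces and the polynomial. -/
def classCoeffs (s t : ℤ) : List ℤ :=
  bif s == 6 && t == 6 then [1, -6, 15, -20, 15, -6, 1]
  else bif s == 2 && t == 6 then [1, -2, -1, 4, -1, -2, 1]
  else bif s == 0 && t == 0 then [1, 0, 0, -2, 0, 0, 1]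
  else bif s == 0 && t == 2 then [1, 0, -1, 0, -1, 0, 1]
  else bif s == 2 && t == 0 then [1, -2, 2, -2, 2, -2, 1]
  else bif s == 1 && t == 1 then [1, -1, 0, 0, 0, -1, 1]
  else []

/-- The two traces determine the generating function: they determine `a = 2 cos φ`, except for the rotations of
order five, where they determine the quadratic equation `a ^ 2 = 1 - a`. -/
theorem trace_series_of_classCoeffs (Q : O3) {s t : ℤ}
    (hs : (kelvin (Q : Matrix (Fin 3) (Fin 3) ℝ)).trace = s)
    (ht : (kelvin (Q : Matrix (Fin 3) (Fin 3) ℝ) * kelvin (Q : Matrix (Fin 3) (Fin 3) ℝ)).trace = t)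
    (hne : classCoeffs s t ≠ []) :
    (PowerSeries.mk fun d => (symMat (kelvin (Q : Matrix (Fin 3) (Fin 3) ℝ)) d).trace)
      * PowerSeries.map (Int.castRingHom ℝ) (ofCoeffs (classCoeffs s t) : PowerSeries ℤ) = 1 := by
  obtain ⟨a, ha, h1, h2, h3⟩ := exists_rotationPoly Q
  rw [hs] at h1
  rw [ht] at h2
  rw [← h3]
  congr 1
  rw [← Polynomial.polynomial_map_coe]
  congr 1
  obtain ⟨ha1, ha2⟩ := abs_le.1 ha
  have key : ∀ b : ℝ, a = b → ∀ l : List ℤ, (ofCoeffs l).map (Int.castRingHom ℝ) = rotationPoly b →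
      (ofCoeffs l).map (Int.castRingHom ℝ) = rotationPoly a := fun b hb l hl => by rw [hl, hb]
  have h5 : (Polynomial.C 2 : Polynomial ℝ) = 2 := map_ofNat _ 2
  simp only [classCoeffs] at hne ⊢
  cases c1 : (s == 6 && t == 6)
  · cases c2 : (s == 2 && t == 6)
    · cases c3 : (s == 0 && t == 0)
      · cases c4 : (s == 0 && t == 2)
        · cases c5 : (s == 2 && t == 0)
          · cases c6 : (s == 1 && t == 1)
            · simp [c1, c2, c3, c4, c5, c6] at hne
            · simp only [Bool.and_eq_true, beq_iff_eq] at c6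
              obtain ⟨rfl, rfl⟩ := c6
              simp only [cond_false, cond_true, ofCoeffs, rotationPoly]
              simp
              have h4 : Polynomial.C a ^ 2 = 1 - Polynomial.C a := by
                rw [← map_pow, ← map_one Polynomial.C, ← map_sub]
                congr 1
                push_cast at h1
                linarith
              rw [h5]
              linear_combination (-(1 - Polynomial.X) ^ 2 * (-Polynomial.X + 1 * Polynomial.X ^ 2 * (Polynomial.C a) - Polynomial.X ^ 3 - Polynomial.X ^ 2)) * h4
          · simp only [Bool.and_eq_true, beq_iff_eq] at c5
            obtain ⟨rfl, rfl⟩ := c5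
            push_cast at h1 h2
            refine key 1 (by nlinarith) _ ?_
            simp [ofCoeffs, rotationPoly]
            try simp only [h5]
            ring
        · simp only [Bool.and_eq_true, beq_iff_eq] at c4
          obtain ⟨rfl, rfl⟩ := c4
          push_cast at h1 h2
          refine key 0 (by nlinarith) _ ?_
          simp [ofCoeffs, rotationPoly]
          try simp only [h5]
          ring
      · simp only [Bool.and_eq_true, beq_iff_eq] at c3
        obtain ⟨rfl, rfl⟩ := c3
        push_cast at h1 h2
        refine key (-1) (by nlinarith) _ ?_
        simp [ofCoeffs, rotationPoly]
        try simp only [h5]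
        ring
    · simp only [Bool.and_eq_true, beq_iff_eq] at c2
      obtain ⟨rfl, rfl⟩ := c2
      push_cast at h1 h2
      refine key (-2) (by nlinarith) _ ?_
      simp [ofCoeffs, rotationPoly]
      try simp only [h5]
      ring
  · simp only [Bool.and_eq_true, beq_iff_eq] at c1
    obtain ⟨rfl, rfl⟩ := c1
    push_cast at h1 h2
    refine key 2 (by nlinarith) _ ?_
    simp [ofCoeffs, rotationPoly]
    try simp only [h5]
    ring

/-- The row `c • r + s`. -/
def addMulRow (c : ℤ) : List ℤ → List ℤ → List ℤ
  | [], s => s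
  | x :: r, [] => c * x :: addMulRow c r []
  | x :: r, y :: s => (c * x + y) :: addMulRow c r s

/-- The product of a row vector and a matrix. -/
def rowMulMat : List ℤ → IMat → List ℤ
  | [], _ => []
  | _ :: _, [] => []
  | c :: cs, r :: rs => bif c == 0 then rowMulMat cs rs else addMulRow c r (rowMulMat cs rs)

theorem getD_addMulRow (c : ℤ) : ∀ (r s : List ℤ) (i : ℕ),
    (addMulRow c r s).getD i 0 = c * r.getD i 0 + s.getD i 0
  | [], s, i => by simp [addMulRow]
  | x :: r, [], 0 => by simp [addMulRow]
  | x :: r, [], i + 1 => by simpa [addMulRow] using getD_addMulRow c r [] i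
  | x :: r, y :: s, 0 => by simp [addMulRow]
  | x :: r, y :: s, i + 1 => by simpa [addMulRow] using getD_addMulRow c r s i

theorem getD_rowMulMat : ∀ (n : ℕ) (cs : List ℤ) (rs : IMat) (j : ℕ), cs.length ≤ n →
    (rowMulMat cs rs).getD j 0 = ∑ k ∈ Finset.range n, cs.getD k 0 * (rs.getD k []).getD j 0
  | n, [], rs, j, _ => by simp [rowMulMat]
  | n, c :: cs, [], j, _ => by simp [rowMulMat]
  | 0, c :: cs, _ :: _, j, h => by simp at h
  | n + 1, c :: cs, r :: rs, j, h => by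
    have ih := getD_rowMulMat n cs rs j (by simpa using h)
    rw [Finset.sum_range_succ', rowMulMat]
    cases hc : (c == 0)
    · rw [cond_false, getD_addMulRow, ih]
      simp [add_comm]
    · rw [cond_true, ih, eq_of_beq hc]
      simp

theorem length_addMulRow (c : ℤ) : ∀ {r s : List ℤ} {n : ℕ}, r.length ≤ n → s.length ≤ n →
    (addMulRow c r s).length ≤ n
  | [], s, _, _, h => h
  | x :: r, [], 0, h, _ => by simp at h
  | x :: r, [], n + 1, h, _ => by
    have := length_addMulRow c (r := r) (s := []) (n := n) (by simpa using h) (by simp)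
    simpa [addMulRow] using this
  | x :: r, y :: s, 0, h, _ => by simp at h
  | x :: r, y :: s, n + 1, h, h' => by
    have := length_addMulRow c (r := r) (s := s) (n := n) (by simpa using h) (by simpa using h')
    simpa [addMulRow] using this

theorem length_rowMulMat {n : ℕ} : ∀ (cs : List ℤ) (rs : IMat), (∀ r ∈ rs, r.length ≤ n) →
    (rowMulMat cs rs).length ≤ n
  | [], _, _ => by simp [rowMulMat]
  | _ :: _, [], _ => by simp [rowMulMat]
  | c :: cs, r :: rs, h => by
    have ih := length_rowMulMat cs rs fun s hs => h s (List.mem_cons_of_mem _ hs)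
    rw [rowMulMat]
    cases c == 0
    · exact length_addMulRow c (h r List.mem_cons_self) ih
    · exact ih

/-- Matrix product. -/
def IMat.mul (A B : IMat) : IMat := A.map fun r => rowMulMat r B

/-- All rows have at most six entries. -/
def IMat.WellFormed (A : IMat) : Prop := ∀ r ∈ A, r.length ≤ 6

theorem IMat.wellFormed_mul {A B : IMat} (hB : B.WellFormed) : (A.mul B).WellFormed := by
  intro r hr
  obtain ⟨s, -, rfl⟩ := List.mem_map.1 hr
  exact length_rowMulMat s B hB

theorem IMat.toReal_mul {A : IMat} (hA : A.WellFormed) (B : IMat) : (A.mul B).toReal = A.toReal * B.toReal := by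
  ext i j
  rw [Matrix.mul_apply]
  simp only [IMat.toReal, Matrix.of_apply]
  have h1 : (A.mul B).getD i.val [] = rowMulMat (A.getD i.val []) B := by
    rw [IMat.mul, List.getD_eq_getElem?_getD, List.getElem?_map, List.getD_eq_getElem?_getD]
    cases A[i.val]? <;> rfl
  have h2 : (A.getD i.val []).length ≤ 6 := by
    rw [List.getD_eq_getElem?_getD]
    cases h : A[i.val]? with
    | none => simp
    | some r => exact hA r (List.mem_of_getElem? h)
  rw [h1, getD_rowMulMat 6 _ _ _ h2, Finset.sum_range]
  push_cast
  rfl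

/-- The trace. -/
def IMat.trace (A : IMat) : ℤ :=
  (A.getD 0 []).getD 0 0 + (A.getD 1 []).getD 1 0 + (A.getD 2 []).getD 2 0 + (A.getD 3 []).getD 3 0
    + (A.getD 4 []).getD 4 0 + (A.getD 5 []).getD 5 0

theorem IMat.trace_toReal (A : IMat) : A.toReal.trace = A.trace := by
  simp [Matrix.trace, Fin.sum_univ_six, IMat.toReal, IMat.trace]

/-- Those matrices of a list that are not in `acc`, without repetition, in front of `new`. -/
def fresh (acc : List IMat) : List IMat → List IMat → List IMat
  | [], new => new
  | M :: l, new => fresh acc l (bif acc.contains M || new.contains M then new else M :: new)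

/-- Close a list of matrices under multiplication by generators from the right, starting from those
matrices `front` in `acc` that have not been multiplied yet. -/
def grow (gens : List (IMat × IMat)) : ℕ → List IMat → List IMat → List IMat
  | 0, _, acc => acc
  | n + 1, front, acc =>
    let new := fresh acc (front.flatMap fun M => gens.map fun g => M.mul g.1) []
    grow gens n new (new ++ acc)

theorem fresh_induction {P : IMat → Prop} (acc : List IMat) : ∀ (l new : List IMat), (∀ M ∈ l, P M) →
    (∀ M ∈ new, P M) → ∀ M ∈ fresh acc l new, P M
  | [], _, _, h => h
  | N :: l, new, h, h' => by
    rw [fresh]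
    refine fresh_induction acc l _ (fun M hM => h M (List.mem_cons_of_mem _ hM)) ?_
    cases acc.contains N || new.contains N
    · intro M hM
      rcases List.mem_cons.1 hM with rfl | hM
      · exact h M List.mem_cons_self
      · exact h' M hM
    · exact h'

theorem grow_induction {P : IMat → Prop} {gens : List (IMat × IMat)}
    (hP : ∀ M, P M → ∀ g ∈ gens, P (M.mul g.1)) : ∀ (n : ℕ) (front acc : List IMat), (∀ M ∈ front, P M) →
    (∀ M ∈ acc, P M) → ∀ M ∈ grow gens n front acc, P M
  | 0, _, _, _, h => h
  | n + 1, front, acc, h, h' => by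
    rw [grow]
    have h1 : ∀ M ∈ fresh acc (front.flatMap fun M => gens.map fun g => M.mul g.1) [], P M := by
      refine fresh_induction acc _ [] (fun M hM => ?_) (by simp)
      obtain ⟨N, hN, hM⟩ := List.mem_flatMap.1 hM
      obtain ⟨g, hg, rfl⟩ := List.mem_map.1 hM
      exact hP N (h N hN) g hg
    refine grow_induction hP n _ _ h1 fun M hM => ?_
    rcases List.mem_append.1 hM with hM | hM
    · exact h1 M hM
    · exact h' M hM

/-- All entries are different. -/
def distinct : List IMat → Bool
  | [] => true
  | M :: l => !(l.contains M) && distinct l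

theorem nodup_of_distinct : ∀ {l : List IMat}, distinct l = true → l.Nodup
  | [], _ => List.nodup_nil
  | M :: l, h => by
    rw [distinct, Bool.and_eq_true] at h
    refine List.nodup_cons.2 ⟨?_, nodup_of_distinct h.2⟩
    simpa using h.1

/-- Sum of coefficient lists. -/
def sumCoeffs : List (List ℤ) → List ℤ
  | [] => []
  | l :: ls => addCoeffs l (sumCoeffs ls)

theorem ofCoeffs_sum (ls : List (List ℤ)) : ofCoeffs (sumCoeffs ls) = (ls.map ofCoeffs).sum := by
  induction ls with
  | nil => rfl
  | cons l ls ih => rw [sumCoeffs, ofCoeffs_add, ih, List.map_cons, List.sum_cons]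

end IntegerMatrices

section FiniteGroups

/-- In the coordinates `L`, the orthogonal transformation `Q` acts by the integer matrix `N`. -/
def ActsAs (L : Matrix (Fin 6) (Fin 6) ℝ) (N : IMat) (Q : O3) : Prop :=
  L * kelvin (Q : Matrix (Fin 3) (Fin 3) ℝ) = N.toReal * L

theorem mem_invariantRing_grp {S : Set O3} {f : Poly} :
    f ∈ invariantRing (grp S) ↔ ∀ Q ∈ S, linSubst (kelvin (Q : Matrix (Fin 3) (Fin 3) ℝ)) f = f := by
  refine ⟨fun h Q hQ => h Q (Subgroup.subset_closure hQ), fun h => mem_invariantRing.2 fun Q hQ => ?_⟩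
  induction hQ using Subgroup.closure_induction with
  | mem Q hQ => exact h Q hQ
  | one =>
    change linSubst (kelvin (1 : Matrix (Fin 3) (Fin 3) ℝ)) f = f
    rw [kelvin_one, linSubst_one]
  | mul A B _ _ hA hB =>
    change linSubst (kelvin ((A : Matrix (Fin 3) (Fin 3) ℝ) * B)) f = f
    rw [kelvin_mul, linSubst_mul, hA, hB]
  | inv A _ hA =>
    have h1 : kelvin (A : Matrix (Fin 3) (Fin 3) ℝ) * kelvin ((A⁻¹ : O3) : Matrix (Fin 3) (Fin 3) ℝ) = 1 := by
      rw [← kelvin_mul, ← kelvin_one]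
      congr 1
      exact congrArg Subtype.val (mul_inv_cancel A)
    conv_lhs => rw [← hA, ← linSubst_mul, h1, linSubst_one]

/-- The matrices of all elements of the group with the given generators. -/
def elements (gens : List (IMat × IMat)) (n : ℕ) : List IMat := grow gens n [IMat.one] [IMat.one]

/-- The second matrix of each pair inverts the first one, and the list `elements gens n` is closed under
multiplication by both. -/
def isClosed (gens : List (IMat × IMat)) (Γ : List IMat) : Bool :=
  distinct Γ && Γ.contains IMat.one &&
  gens.all (fun g => g.1.all (fun r => Nat.ble r.length 6) && g.2.all (fun r => Nat.ble r.length 6) &&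
    IMat.mul g.1 g.2 == IMat.one) &&
  Γ.all fun M => gens.all fun g => Γ.contains (M.mul g.1) && Γ.contains (M.mul g.2) &&
    (M.mul g.1).mul g.2 == M && (M.mul g.2).mul g.1 == M

/-- The numerator over `D` of the generating function belonging to the class of a matrix. -/
def classNumerator (D : List ℤ) (M : IMat) : List ℤ :=
  divCoeffs D.length D (classCoeffs M.trace (M.mul M).trace)

/-- Molien's formula for the Hilbert series, decided by integer arithmetic. -/
def molienCheck (Γ : List IMat) (dp dS : List ℕ) : Bool :=
  let D := denCoeffs dp
  Γ.all (fun M => !(classCoeffs M.trace (M.mul M).trace == []) &&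
    eqCoeffs (mulCoeffs (classCoeffs M.trace (M.mul M).trace) (classNumerator D M)) D) &&
  eqCoeffs (sumCoeffs (Γ.map (classNumerator D))) ((numCoeffs dS).map fun b => (Γ.length : ℤ) * b)

variable {S : Set O3} {L L' : Matrix (Fin 6) (Fin 6) ℝ} {gens : List (IMat × IMat)} {n : ℕ}

theorem exists_actsAs_of_mem_elements (hg : ∀ g ∈ gens, g.1.WellFormed)
    (h : ∀ g ∈ gens, ∃ Q ∈ grp S, ActsAs L g.1 Q) :
    ∀ M ∈ elements gens n, M.WellFormed ∧ ∃ Q ∈ grp S, ActsAs L M Q := by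
  have h1 : ∀ M ∈ [IMat.one], M.WellFormed ∧ ∃ Q ∈ grp S, ActsAs L M Q := by
    intro M hM
    rw [List.mem_singleton] at hM
    subst hM
    refine ⟨by simp [IMat.WellFormed, IMat.one], 1, Subgroup.one_mem _, ?_⟩
    rw [ActsAs, IMat.toReal_one]
    change L * kelvin (1 : Matrix (Fin 3) (Fin 3) ℝ) = 1 * L
    rw [kelvin_one, Matrix.mul_one, Matrix.one_mul]
  refine grow_induction (fun M hM g hg' => ?_) n _ _ h1 h1
  obtain ⟨hw, Q, hQ, hMQ⟩ := hM
  obtain ⟨Q', hQ', hg''⟩ := h g hg'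
  refine ⟨IMat.wellFormed_mul (hg g hg'), Q * Q', Subgroup.mul_mem _ hQ hQ', ?_⟩
  rw [ActsAs] at hMQ hg'' ⊢
  change L * kelvin ((Q : Matrix (Fin 3) (Fin 3) ℝ) * Q') = _
  rw [kelvin_mul, ← Matrix.mul_assoc, hMQ, Matrix.mul_assoc, hg'', IMat.toReal_mul hw, Matrix.mul_assoc]

theorem actsAs_inv {g : IMat × IMat} {Q : O3} (hw : g.1.WellFormed) (hi : g.1.mul g.2 = IMat.one)
    (h : ActsAs L g.1 Q) : ActsAs L g.2 Q⁻¹ := by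
  have h1 : g.1.toReal * g.2.toReal = 1 := by rw [← IMat.toReal_mul hw, hi, IMat.toReal_one]
  have h2 : g.2.toReal * g.1.toReal = 1 := mul_eq_one_comm.1 h1
  have h3 : kelvin (Q : Matrix (Fin 3) (Fin 3) ℝ) * kelvin ((Q⁻¹ : O3) : Matrix (Fin 3) (Fin 3) ℝ) = 1 := by
    rw [← kelvin_mul, ← kelvin_one]
    congr 1
    exact congrArg Subtype.val (mul_inv_cancel Q)
  rw [ActsAs] at h ⊢
  calc L * kelvin ((Q⁻¹ : O3) : Matrix (Fin 3) (Fin 3) ℝ)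
      = g.2.toReal * (g.1.toReal * L) * kelvin ((Q⁻¹ : O3) : Matrix (Fin 3) (Fin 3) ℝ) := by
        rw [← Matrix.mul_assoc, h2, Matrix.one_mul]
    _ = g.2.toReal * L := by rw [← h, Matrix.mul_assoc, Matrix.mul_assoc, h3, Matrix.mul_one]

/-- A group all of whose elements act, in suitable coordinates, by one of finitely many matrices is
finite: the matrix `Φ(Q)` contains the squares of the entries of `Q`. -/
theorem finite_of_actsAs {G : Subgroup O3} (hL : L' * L = 1) (Γ : List IMat)
    (h : ∀ Q ∈ G, ∃ M ∈ Γ, ActsAs L M Q) : Finite G := by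
  have hfin : (Set.range fun Q : G => kelvin ((Q : O3) : Matrix (Fin 3) (Fin 3) ℝ)).Finite := by
    refine ((Γ.map fun M => L' * (M.toReal * L)).finite_toSet).subset ?_
    rintro _ ⟨Q, rfl⟩
    obtain ⟨M, hM, hMQ⟩ := h Q Q.2
    rw [Set.mem_ofPred_eq, List.mem_map]
    refine ⟨M, hM, ?_⟩
    rw [← hMQ, ← Matrix.mul_assoc, hL, Matrix.one_mul]
  -- the squares of the entries and their signs determine `Q`
  have hinj : Function.Injective fun Q : G =>
      ((⟨kelvin ((Q : O3) : Matrix (Fin 3) (Fin 3) ℝ), Set.mem_range_self Q⟩ :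
        Set.range fun Q : G => kelvin ((Q : O3) : Matrix (Fin 3) (Fin 3) ℝ)),
        fun i j : Fin 3 => SignType.sign (((Q : O3) : Matrix (Fin 3) (Fin 3) ℝ) i j)) := by
    intro A B hAB
    have h1 : kelvin ((A : O3) : Matrix (Fin 3) (Fin 3) ℝ) = kelvin ((B : O3) : Matrix (Fin 3) (Fin 3) ℝ) :=
      congrArg (fun x => x.1.1) hAB
    refine Subtype.ext (Subtype.ext ?_)
    ext i j
    have h3 : SignType.sign (((A : O3) : Matrix (Fin 3) (Fin 3) ℝ) i j)
        = SignType.sign (((B : O3) : Matrix (Fin 3) (Fin 3) ℝ) i j) := congrArg (fun x => x.2 i j) hAB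
    have h4 : (((A : O3) : Matrix (Fin 3) (Fin 3) ℝ) i j) ^ 2 = (((B : O3) : Matrix (Fin 3) (Fin 3) ℝ) i j) ^ 2 := by
      rw [kelvin_explicit, kelvin_explicit] at h1
      have h5 := fun a b => congrFun (congrFun h1 a) b
      fin_cases i <;> fin_cases j
      · simpa using h5 0 0
      · simpa using h5 0 1
      · simpa using h5 0 2
      · simpa using h5 1 0
      · simpa using h5 1 1
      · simpa using h5 1 2
      · simpa using h5 2 0
      · simpa using h5 2 1
      · simpa using h5 2 2
    rw [← sign_mul_abs (((A : O3) : Matrix (Fin 3) (Fin 3) ℝ) i j), ← sign_mul_abs (((B : O3) : Matrix (Fin 3) (Fin 3) ℝ) i j),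
      h3, (sq_eq_sq_iff_abs_eq_abs _ _).1 h4]
  have := hfin.to_subtype
  exact Finite.of_injective _ hinj

theorem isClosed_spec {Γ : List IMat} (hc : isClosed gens Γ = true) :
    Γ.Nodup ∧ IMat.one ∈ Γ ∧ (∀ g ∈ gens, g.1.WellFormed ∧ g.2.WellFormed ∧ g.1.mul g.2 = IMat.one) ∧
    ∀ M ∈ Γ, ∀ g ∈ gens, M.mul g.1 ∈ Γ ∧ M.mul g.2 ∈ Γ ∧ (M.mul g.1).mul g.2 = M ∧ (M.mul g.2).mul g.1 = M := by
  simp only [isClosed, Bool.and_eq_true, List.all_eq_true, List.contains_iff_mem, beq_iff_eq, Nat.ble_eq] at hc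
  obtain ⟨⟨⟨h1, h2⟩, h3⟩, h4⟩ := hc
  exact ⟨nodup_of_distinct h1, h2, fun g hg => ⟨(h3 g hg).1.1, (h3 g hg).1.2, (h3 g hg).2⟩,
    fun M hM g hg => ⟨(h4 M hM g hg).1.1.1, (h4 M hM g hg).1.1.2, (h4 M hM g hg).1.2, (h4 M hM g hg).2⟩⟩

theorem exists_mem_elements (h1 : ∀ Q ∈ S, ∃ g ∈ gens, ActsAs L g.1 Q)
    (h2 : ∀ g ∈ gens, ∃ Q ∈ grp S, ActsAs L g.1 Q) (hc : isClosed gens (elements gens n) = true) :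
    ∀ Q ∈ grp S, ∃ M ∈ elements gens n, ActsAs L M Q := by
  obtain ⟨-, hone, hw, hcl⟩ := isClosed_spec hc
  have hE := exists_actsAs_of_mem_elements (n := n) (fun g hg => (hw g hg).1) h2
  have hstep : ∀ A B : O3, ∀ M N : IMat, M.WellFormed → ActsAs L M A → ActsAs L N B → ActsAs L (M.mul N) (A * B) := by
    intro A B M N hM hA hB
    rw [ActsAs] at hA hB ⊢
    change L * kelvin ((A : Matrix (Fin 3) (Fin 3) ℝ) * B) = _
    rw [kelvin_mul, ← Matrix.mul_assoc, hA, Matrix.mul_assoc, hB, IMat.toReal_mul hM, Matrix.mul_assoc]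
  intro Q hQ
  induction hQ using Subgroup.closure_induction_right with
  | one =>
    refine ⟨IMat.one, hone, ?_⟩
    rw [ActsAs, IMat.toReal_one]
    change L * kelvin (1 : Matrix (Fin 3) (Fin 3) ℝ) = 1 * L
    rw [kelvin_one, Matrix.mul_one, Matrix.one_mul]
  | mul_right A _ B hB ih =>
    obtain ⟨M, hM, hA⟩ := ih
    obtain ⟨g, hg, hgB⟩ := h1 B hB
    exact ⟨M.mul g.1, (hcl M hM g hg).1, hstep _ _ _ _ (hE M hM).1 hA hgB⟩
  | mul_inv_cancel A _ B hB ih =>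
    obtain ⟨M, hM, hA⟩ := ih
    obtain ⟨g, hg, hgB⟩ := h1 B hB
    exact ⟨M.mul g.2, (hcl M hM g hg).2.1, hstep _ _ _ _ (hE M hM).1 hA
      (actsAs_inv (hw g hg).1 (hw g hg).2.2 hgB)⟩

theorem hilbertSeries_of_molienCheck (hL : L * L' = 1) (h1 : ∀ Q ∈ S, ∃ g ∈ gens, ActsAs L g.1 Q)
    (h2 : ∀ g ∈ gens, ∃ Q ∈ grp S, ActsAs L g.1 Q) (hc : isClosed gens (elements gens n) = true)
    {dp dS : List ℕ} (hm : molienCheck (elements gens n) dp dS = true) :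
    hilbertSeries (grp S) * (denominator dp : PowerSeries ℤ)
      = ((dS.map fun d => Polynomial.X ^ d).sum : Polynomial ℤ) := by
  set Γ := elements gens n with hΓ
  obtain ⟨hnd, hone, hw, hcl⟩ := isClosed_spec hc
  have hE := exists_actsAs_of_mem_elements (n := n) (fun g hg => (hw g hg).1) h2
  rw [← hΓ] at hE
  have hL' : L' * L = 1 := mul_eq_one_comm.1 hL
  have hact : ∀ {M : IMat} {Q : O3}, ActsAs L M Q → L' * M.toReal * L = kelvin (Q : Matrix (Fin 3) (Fin 3) ℝ) := by
    intro M Q h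
    rw [Matrix.mul_assoc, ← h, ← Matrix.mul_assoc, hL', Matrix.one_mul]
  have hne : Nonempty {M // M ∈ Γ} := ⟨⟨_, hone⟩⟩
  -- averaging over the list of matrices computes the dimensions of the spaces of invariants
  have hsum : ∀ d, ∑ M : {M // M ∈ Γ}, (symMat (L' * M.1.toReal * L) d).trace
      = Fintype.card {M // M ∈ Γ} * invDim (grp S) d := by
    intro d
    refine sum_trace_symMat (𝒢 := (fun Q : O3 => kelvin (Q : Matrix (Fin 3) (Fin 3) ℝ)) '' S) _ ?_ ?_ ?_ d
    · intro f hf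
      exact mem_invariantRing_grp.2 fun Q hQ => hf _ ⟨Q, hQ, rfl⟩
    · intro M f hf
      obtain ⟨-, Q, hQ, hMQ⟩ := hE M.1 M.2
      rw [hact hMQ]
      exact mem_invariantRing.1 hf Q hQ
    · rintro _ ⟨Q, hQ, rfl⟩
      obtain ⟨g, hg, hgQ⟩ := h1 Q hQ
      refine ⟨⟨fun M => ⟨M.1.mul g.1, (hcl M.1 M.2 g hg).1⟩, fun M => ⟨M.1.mul g.2, (hcl M.1 M.2 g hg).2.1⟩,
        fun M => Subtype.ext (hcl M.1 M.2 g hg).2.2.1, fun M => Subtype.ext (hcl M.1 M.2 g hg).2.2.2⟩, fun M => ?_⟩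
      change L' * (M.1.mul g.1).toReal * L = L' * M.1.toReal * L * kelvin (Q : Matrix (Fin 3) (Fin 3) ℝ)
      rw [IMat.toReal_mul (hE M.1 M.2).1, Matrix.mul_assoc _ L, hgQ]
      simp only [Matrix.mul_assoc]
  set ρ := PowerSeries.map (Int.castRingHom ℝ) with hρ
  simp only [molienCheck, Bool.and_eq_true, List.all_eq_true, Bool.not_eq_true', beq_eq_false_iff_ne] at hm
  obtain ⟨hm1, hm2⟩ := hm
  have hterm : ∀ M ∈ Γ, (PowerSeries.mk fun d => (symMat (L' * M.toReal * L) d).trace)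
      * ρ (denominator dp : PowerSeries ℤ)
      = ρ (ofCoeffs (classNumerator (denCoeffs dp) M) : PowerSeries ℤ) := by
    intro M hM
    obtain ⟨hMw, Q, hQ, hMQ⟩ := hE M hM
    obtain ⟨ha, hb⟩ := hm1 M hM
    have htr : ∀ N : Matrix (Fin 6) (Fin 6) ℝ, (L' * N * L).trace = N.trace := fun N => by
      rw [Matrix.trace_mul_comm, ← Matrix.mul_assoc, hL, Matrix.one_mul]
    have h3 : (kelvin (Q : Matrix (Fin 3) (Fin 3) ℝ)).trace = M.trace := by
      rw [← hact hMQ, htr, IMat.trace_toReal]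
    have h4 : (kelvin (Q : Matrix (Fin 3) (Fin 3) ℝ) * kelvin (Q : Matrix (Fin 3) (Fin 3) ℝ)).trace
        = (M.mul M).trace := by
      rw [← IMat.trace_toReal, IMat.toReal_mul hMw, ← htr (M.toReal * M.toReal), ← hact hMQ]
      congr 1
      simp only [Matrix.mul_assoc]
      rw [← Matrix.mul_assoc L L', hL, Matrix.one_mul]
    have h5 := trace_series_of_classCoeffs Q h3 h4 ha
    have h6 := ofCoeffs_eq_of_eqCoeffs hb
    rw [ofCoeffs_mul, ofCoeffs_den] at h6
    rw [hact hMQ, ← h6, Polynomial.coe_mul, map_mul, ← mul_assoc, h5, one_mul]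
  have hcard : Fintype.card {M // M ∈ Γ} = Γ.length := by
    rw [Fintype.card_of_subtype Γ.toFinset (fun M => List.mem_toFinset), List.toFinset_card_of_nodup hnd]
  have hinj : Function.Injective ρ := by
    intro f g hfg
    ext m
    have := congrArg (PowerSeries.coeff m) hfg
    rw [hρ, PowerSeries.coeff_map, PowerSeries.coeff_map] at this
    exact Int.cast_injective this
  have hlen : (Γ.length : PowerSeries ℤ) ≠ 0 := by
    have : 0 < Γ.length := List.length_pos_of_mem hone
    intro h0
    have h1 := congrArg (PowerSeries.constantCoeff) h0
    rw [map_natCast, map_zero] at h1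
    have : Γ.length = 0 := by exact_mod_cast h1
    omega
  refine mul_left_cancel₀ hlen (hinj ?_)
  rw [map_mul, map_mul]
  have h7 : ρ (Γ.length : PowerSeries ℤ) * ρ (hilbertSeries (grp S))
      = ∑ M : {M // M ∈ Γ}, PowerSeries.mk fun d => (symMat (L' * M.1.toReal * L) d).trace := by
    ext d
    rw [map_sum]
    simp only [PowerSeries.coeff_mk]
    rw [hsum d, hcard, ← map_mul, hρ, PowerSeries.coeff_map, ← nsmul_eq_mul, map_nsmul, hilbertSeries, PowerSeries.coeff_mk]
    simp
  rw [← mul_assoc, h7, Finset.sum_mul, Finset.sum_congr rfl fun M _ => hterm M.1 M.2]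
  have h8 : ∑ M : {M // M ∈ Γ}, ρ (ofCoeffs (classNumerator (denCoeffs dp) M.1) : PowerSeries ℤ)
      = ρ (ofCoeffs (sumCoeffs (Γ.map (classNumerator (denCoeffs dp)))) : PowerSeries ℤ) := by
    have h9 : ∀ F : IMat → PowerSeries ℝ, ∑ M : {M // M ∈ Γ}, F M.1 = (Γ.map F).sum := fun F => by
      rw [← List.sum_toFinset F hnd]
      exact (Finset.sum_subtype Γ.toFinset (fun M => List.mem_toFinset) F).symm
    rw [h9 fun M => ρ (ofCoeffs (classNumerator (denCoeffs dp) M) : PowerSeries ℤ), ofCoeffs_sum, List.map_map,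
      ← Polynomial.coeToPowerSeries.ringHom_apply, map_list_sum, map_list_sum, List.map_map, List.map_map]
    rfl
  rw [h8, ofCoeffs_eq_of_eqCoeffs hm2, ofCoeffs_map_mul, ofCoeffs_num, Polynomial.coe_mul, map_mul]
  rw [Polynomial.coe_C]
  simp

end FiniteGroups

/-! ### Rows of the table from computable certificates -/

section Certificates

theorem Eis.toC_injective {x y : Eis} (h : x.toC = y.toC) : x = y := by
  have h1 : (Eis.add x (Eis.mul (-1, 0) y)).toC = 0 := by
    have h2 : Eis.toC (-1, 0) = -1 := by rw [Eis.toC_int]; simp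
    rw [Eis.toC_add, Eis.toC_mul, h, h2]; ring
  have h3 := Eis.toC_eq_zero h1
  simp only [Eis.add, Eis.mul, Prod.mk.injEq] at h3
  refine Prod.ext ?_ ?_
  · linarith [h3.1]
  · linarith [h3.2]

/-- The points `pts` lie in one fibre of `P`, the gradients of `P` are independent there, and the
vectors of values of the members of `S` are independent. -/
def fiberCheck (P S : List Expr) (pts : List (List Eis)) : Bool :=
  (pts.length == S.length) &&
  pts.all (fun y => P.all (fun e => e.ev y == e.ev (pts.getD 0 [])) &&
    elimination P.length (P.map fun e => (List.range 6).map fun l => e.evd y l)) &&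
  elimination S.length (S.map fun e => pts.map fun y => e.ev y)

/-- Row `i` of the eliminated matrix is the gradient of the `i`-th member of `P` at the point `y`. -/
theorem gradients_independent {P : List Expr} {y : List Eis}
    (h : elimination P.length (P.map fun e => (List.range 6).map fun l => e.evd y l) = true)
    (a : Fin P.length → ℂ) (ha : ∀ l, ∑ i, a i * aeval (toPoint y) (pderiv l (P.get i).toPoly) = 0) : a = 0 := by
  refine eq_zero_of_elimination h a fun l => ?_
  by_cases hl : l < 6
  · rw [← ha ⟨l, hl⟩]
    refine Finset.sum_congr rfl fun i _ => ?_
    rw [Expr.aeval_pderiv_toPoly]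
    simp [hl]
  · refine Finset.sum_eq_zero fun i _ => ?_
    have : ((List.range 6).map fun l => (P.get i).evd y l).getD l (0, 0) = (0, 0) := by
      rw [List.getD_eq_default]
      simpa using hl
    rw [this, Eis.toC_zero, mul_zero]

theorem eq_zero_of_fiberCheck {P S : List Expr} {pts : List (List Eis)} (h : fiberCheck P S pts = true)
    (c : Fin S.length → MvPolynomial (Fin P.length) ℝ)
    (hc : ∑ j, aeval (fun i => (P.get i).toPoly) (c j) * (S.get j).toPoly = 0) : c = 0 := by
  simp only [fiberCheck, Bool.and_eq_true, List.all_eq_true, beq_iff_eq] at h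
  obtain ⟨⟨hlen, h1⟩, h2⟩ := h
  have hmem : ∀ κ : Fin S.length, pts.getD κ.val [] ∈ pts := fun κ => by
    have hκ : κ.val < pts.length := by rw [hlen]; exact κ.2
    rw [List.getD_eq_getElem _ _ hκ]
    exact List.getElem_mem _
  refine eq_zero_of_fiber _ _ (fun κ => toPoint (pts.getD κ.val []))
    (fun i => ((P.get i).ev (pts.getD 0 [])).toC) (fun κ i => ?_) (fun κ a ha => ?_) (fun v hv => ?_) c hc
  · rw [Expr.aeval_toPoly, (h1 _ (hmem κ)).1 _ (List.get_mem P i)]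
  · exact gradients_independent (h1 _ (hmem κ)).2 a ha
  · refine eq_zero_of_elimination h2 v fun i => ?_
    by_cases hi : i < S.length
    · rw [← hv ⟨i, hi⟩]
      refine Finset.sum_congr rfl fun j _ => ?_
      have hi' : i < pts.length := by rw [hlen]; exact hi
      rw [Expr.aeval_toPoly, mul_comm]
      simp [hi']
    · refine Finset.sum_eq_zero fun j _ => ?_
      have : (pts.map fun y => (S.get j).ev y).getD i (0, 0) = (0, 0) := by
        rw [List.getD_eq_default]
        simpa [hlen] using hi
      rw [this, Eis.toC_zero, mul_zero]

/-- The selected members of a list. -/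
def selected (S : List Expr) (sel : List Bool) : Finset (Fin S.length) :=
  Finset.univ.filter fun j => sel.getD j.val false = true

/-- The values of the members of `P` and of the selected members of `S` agree at `y` and `y'`, apart
from those for which `ex` holds. -/
def agreeExcept (P S : List Expr) (sel : List Bool) (y y' : List Eis) (ex : ℕ → Bool) : Bool :=
  ((List.finRange P.length).all fun i => ex i.val || (P.get i).ev y == (P.get i).ev y') &&
  (List.finRange S.length).all fun j => !(sel.getD j.val false) || ex (P.length + j.val) ||
    (S.get j).ev y == (S.get j).ev y'

/-- Certificate for the irreducibility of the members of `P` and the selected members of `S`: each of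
them has degree less than `2 e`, or is separated from all others by a pair of points in `sep`, which
is labelled by the position in the list `P ++ S`. -/
def irreducibleCheck (P S : List Expr) (sel : List Bool) (e : ℕ) (sep : List (ℕ × List Eis × List Eis)) : Bool :=
  ((List.finRange S.length).all fun j => !(sel.getD j.val false) || Nat.ble e ((S.get j).deg.getD 0)) &&
  ((List.finRange P.length).all fun i => Nat.blt ((P.get i).deg.getD 0) (2 * e) ||
    sep.any fun x => x.1 == i.val && !((P.get i).ev x.2.1 == (P.get i).ev x.2.2) &&
      agreeExcept P S sel x.2.1 x.2.2 fun n => n == i.val) &&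
  ((List.finRange S.length).all fun j => !(sel.getD j.val false) || Nat.blt ((S.get j).deg.getD 0) (2 * e) ||
    sep.any fun x => x.1 == P.length + j.val && !((S.get j).ev x.2.1 == (S.get j).ev x.2.2) &&
      agreeExcept P S sel x.2.1 x.2.2 fun n => n == P.length + j.val)

theorem agreeExcept_spec {P S : List Expr} {sel : List Bool} {y y' : List Eis} {ex : ℕ → Bool}
    (h : agreeExcept P S sel y y' ex = true) :
    (∀ i : Fin P.length, ex i.val = false → (P.get i).ev y = (P.get i).ev y') ∧
    ∀ j ∈ selected S sel, ex (P.length + j.val) = false → (S.get j).ev y = (S.get j).ev y' := by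
  simp only [agreeExcept, Bool.and_eq_true, List.all_eq_true, Bool.or_eq_true, beq_iff_eq,
    Bool.not_eq_true', List.mem_finRange, true_implies] at h
  refine ⟨fun i hi => (h.1 i).resolve_left (by simp [hi]), fun j hj hj' => ?_⟩
  rcases h.2 j with (h1 | h1) | h1
  · have h3 := (Finset.mem_filter.1 hj).2
    rw [h1] at h3
    cases h3
  · rw [hj'] at h1; cases h1
  · exact h1

variable {T : Set O3} {L L' : Matrix (Fin 6) (Fin 6) ℝ} {gens : List (IMat × IMat)} {n : ℕ}

/-- A finite group given by integer matrices in the coordinates `L`, with certificates for the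
invariance, the irreducibility and the independence of the proposed invariants. -/
theorem hilbertRow_of_certificates (hL : L * L' = 1) (h1 : ∀ Q ∈ T, ∃ g ∈ gens, ActsAs L g.1 Q)
    (h2 : ∀ g ∈ gens, ∃ Q ∈ grp T, ActsAs L g.1 Q) (hc : isClosed gens (elements gens n) = true)
    (P : List Expr) {m : ℕ} (S : List Expr) (sel : List Bool) {num : Polynomial ℤ} {ds taylor : List ℕ} (dS : List ℕ)
    (hm : molienCheck (elements gens n) ds dS = true)
    (hP : P.map Expr.deg = ds.map some) (hS : S.map Expr.deg = dS.map some)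
    (hds : (ds.all fun d => Nat.ble 1 d) = true)
    (hnum : num = (dS.map fun d => Polynomial.X ^ d).sum)
    (htay : (taylor.length == 8 && (List.range 8).all fun n =>
      ds.foldr mulFactor (fun n => (taylor.getD n 0 : ℕ)) n == dS.count n) = true)
    (hinv : (gens.all fun g => (P.all fun e => e.fixedBy g.1) && (List.finRange S.length).all fun j =>
      !(sel.getD j.val false) || (S.get j).fixedBy g.1) = true)
    (hgen : (S.all fun e => e.builtFrom (P ++ ((List.finRange S.length).filter
      fun j => sel.getD j.val false).map S.get)) = true)
    (hone : S[0]? = some (Expr.int 1)) (hsel : sel.getD 0 false = false)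
    {e : ℕ} {sep : List (ℕ × List Eis × List Eis)} (hirr : irreducibleCheck P S sel e sep = true)
    (hind : ∀ c : Fin S.length → MvPolynomial (Fin P.length) ℝ,
      ∑ j, aeval (fun i => (P.get i).toPoly) (c j) * (S.get j).toPoly = 0 → c = 0)
    {k F : ℕ} (hk : P.length = k) (hSm : S.length = m) (hF : k + (selected S sel).card = F) :
    HilbertRow (grp T) num ds taylor k m F := by
  subst hk hSm
  obtain ⟨hnd, hid, hw, hcl⟩ := isClosed_spec hc
  have hlenS : 0 < S.length := by
    rcases S with _ | ⟨a, S⟩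
    · simp at hone
    · simp
  set j₀ : Fin S.length := ⟨0, hlenS⟩
  have hj₀ : S.get j₀ = Expr.int 1 := by
    have : S[0]? = some (S.get j₀) := by simp [j₀, hlenS]
    rw [hone] at this
    exact (Option.some.inj this).symm
  set p : Fin P.length → Poly := fun i => linSubst L (P.get i).toPoly with hp
  set s : Fin S.length → Poly := fun j => linSubst L (S.get j).toPoly with hs
  have hdP : ∀ i : Fin P.length, (P.get i).deg = some ((P.get i).deg.getD 0) := by
    intro i
    have hi : (P.get i).deg ∈ ds.map some := by rw [← hP]; exact List.mem_map_of_mem (List.get_mem P i)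
    obtain ⟨d, -, hd⟩ := List.mem_map.1 hi
    rw [← hd]; rfl
  have hdS : ∀ j : Fin S.length, (S.get j).deg = some ((S.get j).deg.getD 0) := by
    intro j
    have hj : (S.get j).deg ∈ dS.map some := by rw [← hS]; exact List.mem_map_of_mem (List.get_mem S j)
    obtain ⟨d, -, hd⟩ := List.mem_map.1 hj
    rw [← hd]; rfl
  have hofP : ds = List.ofFn fun i : Fin P.length => (P.get i).deg.getD 0 := by
    have : ds = P.map fun e => e.deg.getD 0 := by
      have h3 := congrArg (List.map fun o : Option ℕ => o.getD 0) hP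
      simpa [List.map_map, Function.comp_def] using h3.symm
    rw [this]
    conv_lhs => rw [← List.ofFn_get P, List.map_ofFn]
    rfl
  have hofS : dS = List.ofFn fun j : Fin S.length => (S.get j).deg.getD 0 := by
    have : dS = S.map fun e => e.deg.getD 0 := by
      have h3 := congrArg (List.map fun o : Option ℕ => o.getD 0) hS
      simpa [List.map_map, Function.comp_def] using h3.symm
    rw [this]
    conv_lhs => rw [← List.ofFn_get S, List.map_ofFn]
    rfl
  have hdsm : (ds : Multiset ℕ) = Finset.univ.val.map fun i : Fin P.length => (P.get i).deg.getD 0 := by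
    rw [Fin.univ_val_map, ← hofP]
  have hnum' : num = ∑ j : Fin S.length, Polynomial.X ^ ((S.get j).deg.getD 0) := by
    rw [hnum, hofS, List.map_ofFn, List.sum_ofFn]
    rfl
  have hinj : Function.Injective (linSubst L) := by
    intro f g hfg
    have h3 := congrArg (linSubst L') hfg
    rwa [← linSubst_mul, ← linSubst_mul, hL, linSubst_one, linSubst_one] at h3
  -- invariance
  have hfix : ∀ e : Expr, (∀ g ∈ gens, e.fixedBy g.1 = true) → linSubst L e.toPoly ∈ invariantRing (grp T) := by
    intro e he
    refine mem_invariantRing_grp.2 fun Q hQ => ?_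
    obtain ⟨g, hg, hgQ⟩ := h1 Q hQ
    rw [← linSubst_mul, hgQ, linSubst_mul, Expr.linSubst_of_fixedBy (he g hg)]
  simp only [List.all_eq_true, Bool.and_eq_true, Bool.or_eq_true, Bool.not_eq_true', List.mem_finRange,
    true_implies] at hinv
  have hpA : ∀ i, p i ∈ invariantRing (grp T) := fun i => hfix _ fun g hg => (hinv g hg).1 _ (List.get_mem P i)
  have hselA : ∀ j, sel.getD j.val false = true → s j ∈ invariantRing (grp T) := fun j hj =>
    hfix _ fun g hg => ((hinv g hg).2 j).resolve_left fun h => by rw [hj] at h; cases h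
  -- the remaining secondary invariants are polynomials in the selected generators
  have hbuilt : ∀ B : Subalgebra ℝ Poly, (∀ i, p i ∈ B) → (∀ j ∈ selected S sel, s j ∈ B) → ∀ j, s j ∈ B := by
    intro B hB1 hB2 j
    have h3 := List.all_eq_true.1 hgen _ (List.get_mem S j)
    refine Expr.mem_of_builtFrom (B := B.comap (linSubst L)) (fun a ha => ?_) h3
    rcases List.mem_append.1 ha with ha | ha
    · obtain ⟨i, rfl⟩ := List.get_of_mem ha
      exact hB1 i
    · obtain ⟨l, hl, rfl⟩ := List.mem_map.1 ha
      refine hB2 l (Finset.mem_filter.2 ⟨Finset.mem_univ _, ?_⟩)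
      simpa using (List.mem_filter.1 hl).2
  have hsA : ∀ j, s j ∈ invariantRing (grp T) :=
    hbuilt _ hpA fun j hj => hselA j (Finset.mem_filter.1 hj).2
  have hind' : ∀ c : Fin S.length → MvPolynomial (Fin P.length) ℝ, ∑ j, aeval p (c j) * s j = 0 → c = 0 := by
    intro c hc'
    refine hind c (hinj ?_)
    rw [map_zero, map_sum, ← hc']
    refine Finset.sum_congr rfl fun j _ => ?_
    rw [map_mul, ← AlgHom.comp_apply]
    congr 2
    ext i
    simp [hp]
  have hhomP : ∀ i, (p i).IsHomogeneous ((P.get i).deg.getD 0) := fun i =>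
    linSubst_isHomogeneous L (Expr.isHomogeneous_of_deg (hdP i))
  have hhomS : ∀ j, (s j).IsHomogeneous ((S.get j).deg.getD 0) := fun j =>
    linSubst_isHomogeneous L (Expr.isHomogeneous_of_deg (hdS j))
  have hle : ∀ i : Fin P.length, 1 ≤ (P.get i).deg.getD 0 := by
    intro i
    have h3 := List.all_eq_true.1 hds ((P.get i).deg.getD 0) (by
      rw [hofP]; exact (List.mem_ofFn' _ _).2 ⟨i, rfl⟩)
    exact Nat.le_of_ble_eq_true h3
  -- freeness, from linear independence and the Hilbert series
  have hH := hilbertSeries_of_molienCheck hL h1 h2 hc hm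
  rw [← hnum, hnum', denominator_eq_prod hdsm, coe_sum_X_pow] at hH
  have hbasis : IsFreeBasis (grp T) p s (fun i => (P.get i).deg.getD 0) (fun j => (S.get j).deg.getD 0) :=
    ⟨hle, hpA, hsA, hhomP, hhomS, hind', spans_of_hilbertSeries hle hpA hsA hhomP hhomS hind' hH⟩
  -- irreducibility
  have hφ : ∀ (y : List Eis) (e : Expr), ((aeval (toPoint y)).comp (linSubst L')) (linSubst L e.toPoly)
      = (e.ev y).toC := by
    intro y e
    rw [AlgHom.comp_apply, ← linSubst_mul, hL, linSubst_one, Expr.aeval_toPoly]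
  simp only [irreducibleCheck, Bool.and_eq_true, List.all_eq_true, Bool.or_eq_true, beq_iff_eq,
    Bool.not_eq_true', List.mem_finRange, true_implies, List.any_eq_true, Nat.blt_eq, Nat.ble_eq,
    beq_eq_false_iff_ne] at hirr
  obtain ⟨⟨hirr1, hirr2⟩, hirr3⟩ := hirr
  simp only [Bool.and_eq_true, List.all_eq_true, beq_iff_eq, List.mem_range] at htay
  refine hbasis.hilbertRow (j₀ := j₀) ?_ (selected S sel) ?_ ?_ hnum' hdsm htay.1 ?_ (e := e) hF ?_ ?_ ?_
  · simp only [hs, hj₀, Expr.toPoly, Int.cast_one, map_one]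
  · intro hmem
    have h3 := (Finset.mem_filter.1 hmem).2
    rw [hsel] at h3
    cases h3
  · exact hbuilt _ (fun i => Algebra.subset_adjoin (Or.inl ⟨i, rfl⟩))
      fun j hj => Algebra.subset_adjoin (Or.inr ⟨j, hj, rfl⟩)
  · intro n hn
    rw [htay.2 n hn]
    have h3 : (dS : Multiset ℕ) = Finset.univ.val.map fun j : Fin S.length => (S.get j).deg.getD 0 := by
      rw [Fin.univ_val_map, ← hofS]
    rw [← Multiset.coe_count, h3, Multiset.count_map, Finset.sum_boole]
    rfl
  · intro j hj
    exact (hirr1 j).resolve_left fun h => by rw [(Finset.mem_filter.1 hj).2] at h; cases h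
  · intro i
    refine (hirr2 i).imp_right ?_
    rintro ⟨x, -, ⟨⟨-, hne⟩, hag⟩⟩
    obtain ⟨ha, hb⟩ := agreeExcept_spec hag
    refine ⟨(aeval (toPoint x.2.1)).comp (linSubst L'), (aeval (toPoint x.2.2)).comp (linSubst L'), ?_, ?_, ?_⟩
    · intro l hl
      rw [hφ, hφ, ha l (by simpa [Fin.ext_iff] using hl)]
    · intro j hj
      rw [hφ, hφ, hb j hj (by have := i.2; simp; omega)]
    · rw [hφ, hφ]
      exact fun h => hne (Eis.toC_injective h)
  · intro i hi
    rcases hirr3 i with (h3 | h3) | h3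
    · have := (Finset.mem_filter.1 hi).2
      rw [h3] at this; cases this
    · exact Or.inl h3
    · obtain ⟨x, -, ⟨⟨-, hne⟩, hag⟩⟩ := h3
      obtain ⟨ha, hb⟩ := agreeExcept_spec hag
      refine Or.inr ⟨(aeval (toPoint x.2.1)).comp (linSubst L'), (aeval (toPoint x.2.2)).comp (linSubst L'), ?_, ?_, ?_⟩
      · intro l
        rw [hφ, hφ, ha l (by have := l.2; simp; omega)]
      · intro j hj hji
        rw [hφ, hφ, hb j hj (by simpa [Fin.ext_iff] using hji)]
      · rw [hφ, hφ]
        exact fun h => hne (Eis.toC_injective h)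

end Certificates

/-! ### Invariants of the crystallographic groups -/

section Data

namespace Expr

instance : Add Expr := ⟨Expr.add⟩
instance : Mul Expr := ⟨Expr.mul⟩
instance : Neg Expr := ⟨fun a => Expr.mul (Expr.int (-1)) a⟩
instance : Sub Expr := ⟨fun a b => Expr.add a (Expr.mul (Expr.int (-1)) b)⟩

/-- The product of two numbers `a + b ζ` with `ζ ^ 2 = ζ - 1`, given by pairs. -/
def hexMul (z w : Expr × Expr) : Expr × Expr :=
  (z.1 * w.1 - z.2 * w.2, z.1 * w.2 + z.2 * w.1 + z.2 * w.2)

/-- Complex conjugation of `a + b ζ`, where `ζ = exp (π i / 3)`. -/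
def hexConj (z : Expr × Expr) : Expr × Expr := (z.1 + z.2, -z.2)

/-- The norm of `a + b ζ`. -/
def hexNorm (z : Expr × Expr) : Expr := z.1 * z.1 + z.1 * z.2 + z.2 * z.2

/-- Twice the real part of `a + b ζ`. -/
def hexRe (z : Expr × Expr) : Expr := z.1 + z.1 + z.2

/-- The coefficient of `ζ` in `a + b ζ`, a multiple of the imaginary part. -/
def hexIm (z : Expr × Expr) : Expr := z.2

end Expr

open TensorInvariants.Expr

/-- A point with integer coordinates. -/
def intPoint (l : List ℤ) : List Eis := l.map fun n => (n, 0)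

/-- All combinations of a beginning and an end of a point. -/
def pointProduct (k l : List (List ℤ)) : List (List Eis) := k.flatMap fun a => l.map fun b => intPoint (a ++ b)

/-! In the coordinates `C₁₁, C₂₂, C₃₃, C₂₃, C₁₃, C₁₂`, the half and quarter turns about the axes act by
signed permutations: `Z2` and `X2` are the half turns, `Z4` and `X4` the quarter turns about the `z`- and the
`x`-axis, and `K3` is the rotation by `2π/3` about the space diagonal `k`. -/

def cubicZ2 : IMat := [[1, 0, 0, 0, 0, 0], [0, 1, 0, 0, 0, 0], [0, 0, 1, 0, 0, 0], [0, 0, 0, -1, 0, 0],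
  [0, 0, 0, 0, -1, 0], [0, 0, 0, 0, 0, 1]]

def cubicX2 : IMat := [[1, 0, 0, 0, 0, 0], [0, 1, 0, 0, 0, 0], [0, 0, 1, 0, 0, 0], [0, 0, 0, 1, 0, 0],
  [0, 0, 0, 0, -1, 0], [0, 0, 0, 0, 0, -1]]

def cubicZ4 : IMat := [[0, 1, 0, 0, 0, 0], [1, 0, 0, 0, 0, 0], [0, 0, 1, 0, 0, 0], [0, 0, 0, 0, 1, 0],
  [0, 0, 0, -1, 0, 0], [0, 0, 0, 0, 0, -1]]

def cubicZ4Inv : IMat := [[0, 1, 0, 0, 0, 0], [1, 0, 0, 0, 0, 0], [0, 0, 1, 0, 0, 0], [0, 0, 0, 0, -1, 0],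
  [0, 0, 0, 1, 0, 0], [0, 0, 0, 0, 0, -1]]

def cubicX4 : IMat := [[1, 0, 0, 0, 0, 0], [0, 0, 1, 0, 0, 0], [0, 1, 0, 0, 0, 0], [0, 0, 0, -1, 0, 0],
  [0, 0, 0, 0, 0, 1], [0, 0, 0, 0, -1, 0]]

def cubicX4Inv : IMat := [[1, 0, 0, 0, 0, 0], [0, 0, 1, 0, 0, 0], [0, 1, 0, 0, 0, 0], [0, 0, 0, -1, 0, 0],
  [0, 0, 0, 0, 0, -1], [0, 0, 0, 0, 1, 0]]

def cubicK3 : IMat := [[0, 1, 0, 0, 0, 0], [0, 0, 1, 0, 0, 0], [1, 0, 0, 0, 0, 0], [0, 0, 0, 0, 1, 0],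
  [0, 0, 0, 0, 0, 1], [0, 0, 0, 1, 0, 0]]

def cubicK3Inv : IMat := [[0, 0, 1, 0, 0, 0], [1, 0, 0, 0, 0, 0], [0, 1, 0, 0, 0, 0], [0, 0, 0, 0, 0, 1],
  [0, 0, 0, 1, 0, 0], [0, 0, 0, 0, 1, 0]]

/-! In the coordinates `a, b, p, q, r, s` with `a = C₁₁ + C₂₂`, `b = C₃₃`, `C₁₃ + i C₂₃ = p + q ζ` and
`C₁₁ - C₂₂ + 2 i C₁₂ = r + s ζ`, the rotations by `π/3` (`Z6`) and `2π/3` (`Z3`) about the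
`z`-axis and the half turn about the `x`-axis (`X2`) act by integer matrices. -/

def hexZ6 : IMat := [[1, 0, 0, 0, 0, 0], [0, 1, 0, 0, 0, 0], [0, 0, 0, -1, 0, 0], [0, 0, 1, 1, 0, 0],
  [0, 0, 0, 0, -1, -1], [0, 0, 0, 0, 1, 0]]

def hexZ6Inv : IMat := [[1, 0, 0, 0, 0, 0], [0, 1, 0, 0, 0, 0], [0, 0, 1, 1, 0, 0], [0, 0, -1, 0, 0, 0],
  [0, 0, 0, 0, 0, 1], [0, 0, 0, 0, -1, -1]]

def hexZ3 : IMat := [[1, 0, 0, 0, 0, 0], [0, 1, 0, 0, 0, 0], [0, 0, -1, -1, 0, 0], [0, 0, 1, 0, 0, 0],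
  [0, 0, 0, 0, 0, 1], [0, 0, 0, 0, -1, -1]]

def hexZ3Inv : IMat := [[1, 0, 0, 0, 0, 0], [0, 1, 0, 0, 0, 0], [0, 0, 0, 1, 0, 0], [0, 0, -1, -1, 0, 0],
  [0, 0, 0, 0, -1, -1], [0, 0, 0, 0, 1, 0]]

def hexX2 : IMat := [[1, 0, 0, 0, 0, 0], [0, 1, 0, 0, 0, 0], [0, 0, -1, -1, 0, 0], [0, 0, 0, 1, 0, 0],
  [0, 0, 0, 0, 1, 1], [0, 0, 0, 0, 0, -1]]

/-! The coordinates, in either of the two systems. -/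

def x0 : Expr := var 0
def x1 : Expr := var 1
def x2 : Expr := var 2
def x3 : Expr := var 3
def x4 : Expr := var 4
def x5 : Expr := var 5

/-- `C₁₃ + i C₂₃`, of weight one for the rotations about the `z`-axis. -/
def hexU : Expr × Expr := (x2, x3)

/-- `C₁₁ - C₂₂ + 2 i C₁₂`, of weight two for the rotations about the `z`-axis. -/
def hexW : Expr × Expr := (x4, x5)

/-! Products of these numbers and of their conjugates. -/

def hexU2 : Expr × Expr := hexMul hexU hexU
def hexU3 : Expr × Expr := hexMul hexU2 hexU
def hexU4 : Expr × Expr := hexMul hexU2 hexU2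
def hexU6 : Expr × Expr := hexMul hexU3 hexU3
def hexW2 : Expr × Expr := hexMul hexW hexW
def hexW3 : Expr × Expr := hexMul hexW2 hexW
def hexUW : Expr × Expr := hexMul hexU hexW
def hexUUW : Expr × Expr := hexMul hexU2 (hexConj hexW)
def hexWWU : Expr × Expr := hexMul hexW2 (hexConj hexU)
def hexUUWW : Expr × Expr := hexMul hexU2 hexW2
def hexUUUUW : Expr × Expr := hexMul hexU4 hexW

/-- `(2 + ζ) (C₁₃ + i C₂₃)`; the sixth powers of this and of `C₁₃ + i C₂₃` have independent real parts. -/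
def hexV : Expr × Expr := (x2 + x2 - x3, x2 + x3 + x3 + x3)

def hexV3 : Expr × Expr := hexMul (hexMul hexV hexV) hexV
def hexV6 : Expr × Expr := hexMul hexV3 hexV3

/-! For each row, `prim…` and `sec…` list the primary and the secondary invariants, and `points…` the points of one
fibre of the primary invariants that serve for `fiberCheck`. The pairs of points in `separation…` serve for
`irreducibleCheck`. -/

/-! The triclinic groups. -/

def primC1 : List Expr := [x0, x1, x2, x3, x4, x5]
def secC1 : List Expr := [int 1]

/-! The monoclinic groups. -/

def primC2 : List Expr := [x0, x1, x2, x5, x3 * x3, x4 * x4]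
def secC2 : List Expr := [int 1, x3 * x4]
def pointsC2 : List (List Eis) := pointProduct [[1, 2, 3]] [[1, 2, 1], [-1, 2, 1]]

/-! The rhombic groups. -/

def primD2 : List Expr := [x0, x1, x2, x3 * x3, x4 * x4, x5 * x5]
def secD2 : List Expr := [int 1, x3 * x4 * x5]
def pointsD2 : List (List Eis) := pointProduct [[1, 2, 3]] [[1, 2, 1], [-1, 2, 1]]

/-! The tetragonal groups. Both rows share their primary invariants. -/

def primC4 : List Expr := [x0 + x1, x2, (x0 - x1) * (x0 - x1), x5 * x5, x3 * x3 + x4 * x4, x3 * x3 * (x4 * x4)]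

/-- An invariant of the quarter turn of `(C₁₃, C₂₃)`, which together with `C₁₃² C₂₃²` and the norm
generates all of them. -/
def quarticC4 : Expr :=
  (x4 + x4 - x3) * (x4 + x4 - x3) * ((x4 + x3 + x3) * (x4 + x3 + x3))

def secC4 : List Expr := [int 1, (x0 - x1) * x5, (x0 - x1) * (x4 * x4 - x3 * x3), (x0 - x1) * (x3 * x4),
  x5 * (x4 * x4 - x3 * x3), x5 * (x3 * x4), quarticC4, (x0 - x1) * x5 * quarticC4]
def pointsC4 : List (List Eis) := pointProduct [[2, 1, 1]] [[1, 2, 1], [-1, 2, 1], [2, 1, 1], [2, -1, 1],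
  [1, 2, -1], [-1, 2, -1], [2, 1, -1], [2, -1, -1]]
def separationC4 : List (ℕ × List Eis × List Eis) :=
  [(5, intPoint [0, 0, 0, 3, 4, 0], intPoint [0, 0, 0, -5, 0, 0]),
    (12, intPoint [0, 0, 0, 1, 3, 0], intPoint [0, 0, 0, -1, 3, 0])]

def secD4 : List Expr := [int 1, (x0 - x1) * (x4 * x4 - x3 * x3), x5 * (x3 * x4),
  (x0 - x1) * (x4 * x4 - x3 * x3) * (x5 * (x3 * x4))]
def pointsD4 : List (List Eis) := pointProduct [[2, 1, 1]] [[1, 2, 1], [-1, 2, 1], [2, 1, 1], [2, -1, 1]]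

/-! The trigonal groups. Both rows share their primary invariants. -/

def primC3 : List Expr := [x0, x1, hexNorm hexU, hexNorm hexW, hexIm hexU3, hexRe hexW3]
def secC3 : List Expr := [int 1, hexRe hexUW, hexIm hexUW, hexRe hexU3, hexIm hexW3, hexRe hexUUW, hexIm hexUUW,
  hexRe hexWWU, hexIm hexWWU, hexRe hexUW * hexRe hexUW, hexRe hexUW * hexIm hexUW, hexRe hexU3 * hexIm hexW3]

/-- An orbit of the dihedral group of order six in the plane, in the basis `1, ζ`. -/
def hexOrbit : List (List ℤ) := [[1, 2], [-3, 1], [2, -3], [3, -2], [-2, -1], [-1, 3]]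

def pointsC3 : List (List Eis) := pointProduct [[0, 0, 1, 3], [0, 0, -4, 3]] hexOrbit

def secD3 : List Expr := [int 1, hexIm hexUW, hexRe hexUUW, hexIm hexWWU, hexIm hexUW * hexIm hexUW,
  hexRe hexUUW * hexIm hexWWU]
def pointsD3 : List (List Eis) := pointProduct [[0, 0, 1, 3]] hexOrbit

/-! The hexagonal groups. Both rows share their primary invariants. -/

def primC6 : List Expr := [x0, x1, hexNorm hexU, hexNorm hexW, hexRe hexW3, hexRe hexU6]
def secC6 : List Expr := [int 1, hexIm hexW3, hexRe hexUUW, hexIm hexUUW, hexRe hexUUWW, hexIm hexUUWW,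
  hexRe hexUUUUW, hexIm hexUUUUW, hexRe hexV6, hexRe hexUUW * hexRe hexUUW, hexRe hexUUW * hexIm hexUUW,
  hexIm hexW3 * hexRe hexV6]
def pointsC6 : List (List Eis) := pointProduct [[0, 0, 1, 3], [0, 0, 4, -3]] hexOrbit
def separationC6 : List (ℕ × List Eis × List Eis) :=
  [(5, intPoint [0, 0, 7, 0, 0, 0], intPoint [0, 0, 8, -5, 0, 0]),
    (14, intPoint [0, 0, 1, 3, 0, 0], intPoint [0, 0, 4, -3, 0, 0])]

def secD6 : List Expr := [int 1, hexRe hexUUW, hexRe hexUUWW, hexRe hexUUUUW, hexRe hexUUW * hexRe hexUUW,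
  hexRe hexUUWW * hexRe hexUUUUW]
def pointsD6 : List (List Eis) := pointProduct [[0, 0, 1, 3]] hexOrbit
def separationD6 : List (ℕ × List Eis × List Eis) :=
  [(5, intPoint [0, 0, 7, 0, 0, 0], intPoint [0, 0, 5, 3, 0, 0])]

/-! The cubic groups. The mixed power sums in `(C₁₁, C₂₂, C₃₃)` and the squares of `(C₂₃, C₁₃, C₁₂)` are invariant
under cyclic permutations of the axes, the unprimed ones under all permutations. -/

def primT : List Expr := [x0 + x1 + x2, x0 * x1 + x1 * x2 + x2 * x0, x3 * x3 + x4 * x4 + x5 * x5, x0 * x1 * x2,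
  x3 * x4 * x5, x3 * x3 * (x4 * x4) + x4 * x4 * (x5 * x5) + x5 * x5 * (x3 * x3)]

def mixed21 : Expr := x0 * (x3 * x3) + x1 * (x4 * x4) + x2 * (x5 * x5)
def mixed21' : Expr := x0 * (x4 * x4) + x1 * (x5 * x5) + x2 * (x3 * x3)
def mixed22 : Expr := x0 * x0 * (x3 * x3) + x1 * x1 * (x4 * x4) + x2 * x2 * (x5 * x5)
def mixed22' : Expr := x0 * x0 * (x4 * x4) + x1 * x1 * (x5 * x5) + x2 * x2 * (x3 * x3)
def mixed14 : Expr := x0 * (x3 * x3 * (x3 * x3)) + x1 * (x4 * x4 * (x4 * x4)) + x2 * (x5 * x5 * (x5 * x5))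
def mixed14' : Expr := x0 * (x4 * x4 * (x4 * x4)) + x1 * (x5 * x5 * (x5 * x5)) + x2 * (x3 * x3 * (x3 * x3))
def vandermondeD : Expr := (x0 - x1) * (x1 - x2) * (x2 - x0)
def vandermondeO : Expr := (x3 * x3 - x4 * x4) * (x4 * x4 - x5 * x5) * (x5 * x5 - x3 * x3)

def secT : List Expr := [int 1, vandermondeD, mixed21, mixed21', mixed22, mixed22', mixed14, mixed14', vandermondeO,
  mixed21 * mixed21, mixed21 * mixed21', vandermondeD * vandermondeO]
/-- The permutations of three numbers, as values of `C₂₃, C₁₃, C₁₂`. -/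
def orbitT : List (List ℤ) := [[1, 2, 4], [2, 4, 1], [4, 1, 2], [2, 1, 4], [1, 4, 2], [4, 2, 1]]
def pointsT : List (List Eis) := pointProduct [[0, 1, 3], [1, 0, 3]] orbitT
def separationT : List (ℕ × List Eis × List Eis) :=
  [(14, intPoint [0, 0, 0, 1, 2, 3], intPoint [0, 0, 0, 2, 1, 3])]

def secO : List Expr := [int 1, mixed21, mixed22, mixed14, mixed21 * mixed21, mixed22 * mixed14]
def pointsO : List (List Eis) := pointProduct [[0, 1, 3]] orbitT

end Data

/-! ### Coordinates adapted to the crystallographic groups -/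

section Coordinates

/-- The linear forms `C ↦ tr (B i * C)` on symmetric tensors, in Kelvin–Mandel coordinates. -/
def coordForms (B : Fin 6 → Matrix (Fin 3) (Fin 3) ℝ) : Matrix (Fin 6) (Fin 6) ℝ :=
  Matrix.of fun i α => (B i * kelvinCoeff α).trace

/-- The symmetric tensors `B j`, in Kelvin–Mandel coordinates. -/
def coordVectors (B : Fin 6 → Matrix (Fin 3) (Fin 3) ℝ) : Matrix (Fin 6) (Fin 6) ℝ :=
  Matrix.of fun α j => (kelvinCoeff α * B j).trace

theorem coordForms_mul_coordVectors {B B' : Fin 6 → Matrix (Fin 3) (Fin 3) ℝ} (hs : ∀ j, (B' j)ᵀ = B' j)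
    (h : ∀ i j, (B i * B' j).trace = if i = j then 1 else 0) : coordForms B * coordVectors B' = 1 := by
  ext i j
  rw [Matrix.mul_apply, Matrix.one_apply, ← h i j, ← sum_trace_mul_trace (hs j)]
  rfl

theorem actsAs_coordForms {B : Fin 6 → Matrix (Fin 3) (Fin 3) ℝ} {N : IMat} {Q : O3}
    (h : ∀ i, (Q : Matrix (Fin 3) (Fin 3) ℝ)ᵀ * B i * (Q : Matrix (Fin 3) (Fin 3) ℝ) = ∑ j, N.toReal i j • B j) :
    ActsAs (coordForms B) N Q := by
  ext i α
  have h1 : (coordForms B * kelvin (Q : Matrix (Fin 3) (Fin 3) ℝ)) i α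
      = (B i * (Q * kelvinCoeff α * (Q : Matrix (Fin 3) (Fin 3) ℝ)ᵀ)).trace := by
    rw [Matrix.mul_apply, ← sum_trace_mul_trace (isSymm_conj (kelvinCoeff_transpose α))]
    simp only [kelvin_eq_trace]; rfl
  have h2 : (N.toReal * coordForms B) i α = ((∑ j, N.toReal i j • B j) * kelvinCoeff α).trace := by
    simp [Matrix.mul_apply (M := N.toReal), coordForms, Finset.sum_mul, Matrix.trace_sum]
  rw [h1, h2, ← h i, ← Matrix.mul_assoc, Matrix.trace_mul_comm]
  simp only [Matrix.mul_assoc]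

theorem actsAs_neg {L : Matrix (Fin 6) (Fin 6) ℝ} {N : IMat} {Q : O3} : ActsAs L N (-Q) ↔ ActsAs L N Q := by
  rw [ActsAs, ActsAs, neg_coe, kelvin_neg]

theorem cos_two_pi_div_three' : Real.cos (2 * Real.pi / 3) = -1 / 2 := by
  rw [show 2 * Real.pi / 3 = Real.pi - Real.pi / 3 by ring, Real.cos_pi_sub, Real.cos_pi_div_three]; norm_num

theorem sin_two_pi_div_three' : Real.sin (2 * Real.pi / 3) = √3 / 2 := by
  rw [show 2 * Real.pi / 3 = Real.pi - Real.pi / 3 by ring, Real.sin_pi_sub, Real.sin_pi_div_three]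

theorem rotK_coe : (rotK (2 * Real.pi / 3) : Matrix (Fin 3) (Fin 3) ℝ) = !![0, 1, 0; 0, 0, 1; 1, 0, 0] := by
  have h3 : √3 * √3 = (3 : ℝ) := Real.mul_self_sqrt (by norm_num)
  have h3' : √3 ≠ 0 := by positivity
  have hd : √3 / 2 * (1 / √3) = 1 / 2 := by field_simp
  have hv : -1 / √3 * (-1 / √3) = 1 / 3 := by field_simp; nlinarith
  have hd' : √3 / 2 * (-1 / √3) = -1 / 2 := by field_simp
  ext i j
  fin_cases i <;> fin_cases j <;>
    simp only [rotK, rot, rotMatrix, cos_two_pi_div_three', sin_two_pi_div_three', Matrix.add_apply, Matrix.smul_apply,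
      Matrix.of_apply, Matrix.cons_val', Matrix.cons_val_zero, Matrix.cons_val_one, Matrix.cons_val, vecMulVec_apply,
      Matrix.one_apply, smul_eq_mul, Fin.mk_zero, Fin.mk_one, Fin.isValue, Fin.reduceFinMk, hv, mul_neg, hd'] <;>
    simp <;> norm_num

theorem rotP_coe : (rotP (2 * Real.pi / 3) : Matrix (Fin 3) (Fin 3) ℝ) = !![0, 0, 1; 1, 0, 0; 0, 1, 0] := by
  have h3 : √3 * √3 = (3 : ℝ) := Real.mul_self_sqrt (by norm_num)
  have h3' : √3 ≠ 0 := by positivity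
  have hd : √3 / 2 * (1 / √3) = 1 / 2 := by field_simp
  have hv : 1 / √3 * (1 / √3) = 1 / 3 := by field_simp; nlinarith
  ext i j
  fin_cases i <;> fin_cases j <;>
    simp only [rotP, rot, rotMatrix, cos_two_pi_div_three', sin_two_pi_div_three', Matrix.add_apply, Matrix.smul_apply,
      Matrix.of_apply, Matrix.cons_val', Matrix.cons_val_zero, Matrix.cons_val_one, Matrix.cons_val, vecMulVec_apply,
      Matrix.one_apply, smul_eq_mul, Fin.mk_zero, Fin.mk_one, Fin.isValue, Fin.reduceFinMk, hv, mul_neg, hd] <;>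
    simp <;> norm_num

/-- The forms `C₁₁, C₂₂, C₃₃, C₂₃, C₁₃, C₁₂`. -/
def cubicForms : Fin 6 → Matrix (Fin 3) (Fin 3) ℝ :=
  ![!![1, 0, 0; 0, 0, 0; 0, 0, 0], !![0, 0, 0; 0, 1, 0; 0, 0, 0], !![0, 0, 0; 0, 0, 0; 0, 0, 1],
    !![0, 0, 0; 0, 0, 1 / 2; 0, 1 / 2, 0], !![0, 0, 1 / 2; 0, 0, 0; 1 / 2, 0, 0], !![0, 1 / 2, 0; 1 / 2, 0, 0; 0, 0, 0]]

/-- The basis dual to `cubicForms`. -/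
def cubicVectors : Fin 6 → Matrix (Fin 3) (Fin 3) ℝ :=
  ![!![1, 0, 0; 0, 0, 0; 0, 0, 0], !![0, 0, 0; 0, 1, 0; 0, 0, 0], !![0, 0, 0; 0, 0, 0; 0, 0, 1],
    !![0, 0, 0; 0, 0, 1; 0, 1, 0], !![0, 0, 1; 0, 0, 0; 1, 0, 0], !![0, 1, 0; 1, 0, 0; 0, 0, 0]]

theorem cubicForms_mul_cubicVectors : coordForms cubicForms * coordVectors cubicVectors = 1 := by
  refine coordForms_mul_coordVectors (fun j => ?_) fun i j => ?_
  · ext k l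
    fin_cases j <;> fin_cases k <;> fin_cases l <;> simp [cubicVectors]
  · fin_cases i <;> fin_cases j <;>
      simp [cubicForms, cubicVectors, Matrix.trace, Fin.sum_univ_three] <;> norm_num

/-- The forms `a, b, p, q, r, s` with `a = C₁₁ + C₂₂`, `b = C₃₃`, `C₁₃ + i C₂₃ = p + q ζ`
and `C₁₁ - C₂₂ + 2 i C₁₂ = r + s ζ`, where `ζ = exp (π i / 3)`. -/
def hexForms : Fin 6 → Matrix (Fin 3) (Fin 3) ℝ :=
  ![!![1, 0, 0; 0, 1, 0; 0, 0, 0], !![0, 0, 0; 0, 0, 0; 0, 0, 1],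
    !![0, 0, 1 / 2; 0, 0, -√3 / 6; 1 / 2, -√3 / 6, 0], !![0, 0, 0; 0, 0, √3 / 3; 0, √3 / 3, 0],
    !![1, -√3 / 3, 0; -√3 / 3, -1, 0; 0, 0, 0], !![0, 2 * √3 / 3, 0; 2 * √3 / 3, 0, 0; 0, 0, 0]]

/-- The basis dual to `hexForms`. -/
def hexVectors : Fin 6 → Matrix (Fin 3) (Fin 3) ℝ :=
  ![!![1 / 2, 0, 0; 0, 1 / 2, 0; 0, 0, 0], !![0, 0, 0; 0, 0, 0; 0, 0, 1],
    !![0, 0, 1; 0, 0, 0; 1, 0, 0], !![0, 0, 1 / 2; 0, 0, √3 / 2; 1 / 2, √3 / 2, 0],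
    !![1 / 2, 0, 0; 0, -1 / 2, 0; 0, 0, 0], !![1 / 4, √3 / 4, 0; √3 / 4, -1 / 4, 0; 0, 0, 0]]

theorem hexForms_mul_hexVectors : coordForms hexForms * coordVectors hexVectors = 1 := by
  have h3 : √3 * √3 = (3 : ℝ) := Real.mul_self_sqrt (by norm_num)
  refine coordForms_mul_coordVectors (fun j => ?_) fun i j => ?_
  · ext k l
    fin_cases j <;> fin_cases k <;> fin_cases l <;> simp [hexVectors]
  · fin_cases i <;> fin_cases j <;>
      simp [hexForms, hexVectors, Matrix.trace, Fin.sum_univ_three] <;> nlinarith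

theorem actsAs_cubicZ2 : ActsAs (coordForms cubicForms) cubicZ2 (rotZ Real.pi) := by
  refine actsAs_coordForms fun i => ?_
  rw [rotZ_coe, Real.cos_pi, Real.sin_pi]
  ext k l
  fin_cases i <;> fin_cases k <;> fin_cases l <;>
    simp [cubicForms, Fin.sum_univ_six, IMat.toReal, cubicZ2, Matrix.mul_apply, Fin.sum_univ_three]

theorem actsAs_cubicX2 : ActsAs (coordForms cubicForms) cubicX2 (rotX Real.pi) := by
  refine actsAs_coordForms fun i => ?_
  rw [rotX_coe, Real.cos_pi, Real.sin_pi]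
  ext k l
  fin_cases i <;> fin_cases k <;> fin_cases l <;>
    simp [cubicForms, Fin.sum_univ_six, IMat.toReal, cubicX2, Matrix.mul_apply, Fin.sum_univ_three]

theorem actsAs_cubicZ4 : ActsAs (coordForms cubicForms) cubicZ4 (rotZ (Real.pi / 2)) := by
  refine actsAs_coordForms fun i => ?_
  rw [rotZ_coe, Real.cos_pi_div_two, Real.sin_pi_div_two]
  ext k l
  fin_cases i <;> fin_cases k <;> fin_cases l <;>
    simp [cubicForms, Fin.sum_univ_six, IMat.toReal, cubicZ4, Matrix.mul_apply, Fin.sum_univ_three]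

theorem actsAs_cubicX4 : ActsAs (coordForms cubicForms) cubicX4 (rotX (Real.pi / 2)) := by
  refine actsAs_coordForms fun i => ?_
  rw [rotX_coe, Real.cos_pi_div_two, Real.sin_pi_div_two]
  ext k l
  fin_cases i <;> fin_cases k <;> fin_cases l <;>
    simp [cubicForms, Fin.sum_univ_six, IMat.toReal, cubicX4, Matrix.mul_apply, Fin.sum_univ_three]

theorem actsAs_cubicK3 : ActsAs (coordForms cubicForms) cubicK3 (rotK (2 * Real.pi / 3)) := by
  refine actsAs_coordForms fun i => ?_
  rw [rotK_coe]
  ext k l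
  fin_cases i <;> fin_cases k <;> fin_cases l <;>
    simp [cubicForms, Fin.sum_univ_six, IMat.toReal, cubicK3, Matrix.mul_apply, Fin.sum_univ_three]

theorem actsAs_hexZ6 : ActsAs (coordForms hexForms) hexZ6 (rotZ (Real.pi / 3)) := by
  have h3 : √3 * √3 = (3 : ℝ) := Real.mul_self_sqrt (by norm_num)
  refine actsAs_coordForms fun i => ?_
  rw [rotZ_coe, Real.cos_pi_div_three, Real.sin_pi_div_three]
  ext k l
  fin_cases i <;> fin_cases k <;> fin_cases l <;>
    simp [hexForms, Fin.sum_univ_six, IMat.toReal, hexZ6, Matrix.mul_apply, Fin.sum_univ_three] <;>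
    grind

theorem actsAs_hexZ3 : ActsAs (coordForms hexForms) hexZ3 (rotZ (2 * Real.pi / 3)) := by
  have h3 : √3 * √3 = (3 : ℝ) := Real.mul_self_sqrt (by norm_num)
  refine actsAs_coordForms fun i => ?_
  rw [rotZ_coe, cos_two_pi_div_three', sin_two_pi_div_three']
  ext k l
  fin_cases i <;> fin_cases k <;> fin_cases l <;>
    simp [hexForms, Fin.sum_univ_six, IMat.toReal, hexZ3, Matrix.mul_apply, Fin.sum_univ_three] <;>
    grind

theorem actsAs_hexX2 : ActsAs (coordForms hexForms) hexX2 (rotX Real.pi) := by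
  refine actsAs_coordForms fun i => ?_
  rw [rotX_coe, Real.cos_pi, Real.sin_pi]
  ext k l
  fin_cases i <;> fin_cases k <;> fin_cases l <;>
    simp [hexForms, Fin.sum_univ_six, IMat.toReal, hexX2, Matrix.mul_apply, Fin.sum_univ_three] <;>
    ring

end Coordinates

/-! ### The crystallographic groups -/

section Crystallographic

/-- In the coordinates `L`, the members of `T` act by members of `gens`, and the matrices in `gens`
come from elements of the group generated by `T`. -/
def Realizes (L : Matrix (Fin 6) (Fin 6) ℝ) (gens : List (IMat × IMat)) (T : Set O3) : Prop :=
  (∀ Q ∈ T, ∃ g ∈ gens, ActsAs L g.1 Q) ∧ ∀ g ∈ gens, ∃ Q ∈ grp T, ActsAs L g.1 Q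

/-- The computable part of the hypotheses of `hilbertRow_of_certificates`, without those on the
independence of the proposed invariants. -/
def rowCheck (gens : List (IMat × IMat)) (n : ℕ) (P S : List Expr) (sel : List Bool) (ds dS taylor : List ℕ)
    (e : ℕ) (sep : List (ℕ × List Eis × List Eis)) : Bool :=
  isClosed gens (elements gens n) && molienCheck (elements gens n) ds dS &&
  decide (P.map Expr.deg = ds.map some) && decide (S.map Expr.deg = dS.map some) &&
  (ds.all fun d => Nat.ble 1 d) &&
  (taylor.length == 8 && (List.range 8).all fun n =>
      ds.foldr mulFactor (fun n => (taylor.getD n 0 : ℕ)) n == dS.count n) &&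
  (gens.all fun g => (P.all fun e => e.fixedBy g.1) && (List.finRange S.length).all fun j =>
      !(sel.getD j.val false) || (S.get j).fixedBy g.1) &&
  (S.all fun e => e.builtFrom (P ++ ((List.finRange S.length).filter
      fun j => sel.getD j.val false).map S.get)) &&
  irreducibleCheck P S sel e sep

theorem finiteRow_of_rowCheck {T : Set O3} {L L' : Matrix (Fin 6) (Fin 6) ℝ} {gens : List (IMat × IMat)}
    (hL : L * L' = 1) (hT : Realizes L gens T) (n : ℕ) {P S : List Expr} (sel : List Bool)
    {num : Polynomial ℤ} {ds taylor : List ℕ} (dS : List ℕ) {e : ℕ} (sep : List (ℕ × List Eis × List Eis))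
    (h : rowCheck gens n P S sel ds dS taylor e sep = true)
    (hind : ∀ c : Fin S.length → MvPolynomial (Fin P.length) ℝ,
      ∑ j, aeval (fun i => (P.get i).toPoly) (c j) * (S.get j).toPoly = 0 → c = 0)
    (hnum : num = (dS.map fun d => Polynomial.X ^ d).sum)
    (hone : S[0]? = some (Expr.int 1)) (hsel : sel.getD 0 false = false)
    {k m F : ℕ} (hk : P.length = k) (hSm : S.length = m) (hF : k + (selected S sel).card = F) :
    FiniteRow (grp T) num ds taylor k m F := by
  simp only [rowCheck, Bool.and_eq_true, decide_eq_true_eq] at h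
  obtain ⟨⟨⟨⟨⟨⟨⟨⟨hc, hm⟩, hP⟩, hS⟩, hds⟩, htay⟩, hinv⟩, hgen⟩, hirr⟩ := h
  have hrow : HilbertRow (grp T) num ds taylor k m F :=
    hilbertRow_of_certificates hL hT.1 hT.2 hc P S sel dS hm hP hS hds hnum (by simpa using htay)
      (by simpa using hinv) hgen hone hsel hirr hind hk hSm hF
  exact ⟨hasFiniteMolien_of_hasSum (finite_of_actsAs (mul_eq_one_comm.1 hL) _
    (exists_mem_elements hT.1 hT.2 hc)) hrow.2.1, hrow⟩

open TensorInvariants.Expr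

section
variable {T : Set O3}

theorem finiteRow_C1 (h : Realizes (coordForms cubicForms)
      [(IMat.one, IMat.one)] T) :
    FiniteRow (grp T)
      1 [1, 1, 1, 1, 1, 1]
      [1, 6, 21, 56, 126, 252, 462, 792] 6 1 6 :=
  finiteRow_of_rowCheck cubicForms_mul_cubicVectors h 1 (P := primC1) (S := secC1)
    [] [0] (e := 1) []
    (by decide +kernel) (fun _ => eq_zero_of_fiberCheck (pts := [intPoint [1, 2, 3, 4, 5, 6]]) (by decide +kernel) _) (by simp; try ring) rfl rfl rfl rfl (by decide)

theorem finiteRow_C2 (h : Realizes (coordForms cubicForms)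
      [(IMat.one, IMat.one), (cubicZ2, cubicZ2)] T) :
    FiniteRow (grp T)
      (1 + Polynomial.X ^ 2) [1, 1, 1, 1, 2, 2]
      [1, 4, 13, 32, 70, 136, 246, 416] 6 2 7 :=
  finiteRow_of_rowCheck cubicForms_mul_cubicVectors h 1 (P := primC2) (S := secC2)
    [false, true] [0, 2] (e := 2) []
    (by decide +kernel) (fun _ => eq_zero_of_fiberCheck (pts := pointsC2) (by decide +kernel) _) (by simp; try ring) rfl rfl rfl rfl (by decide)

theorem finiteRow_D2 (h : Realizes (coordForms cubicForms)
      [(IMat.one, IMat.one), (cubicZ2, cubicZ2), (cubicX2, cubicX2)] T) :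
    FiniteRow (grp T)
      (1 + Polynomial.X ^ 3) [1, 1, 1, 2, 2, 2]
      [1, 3, 9, 20, 42, 78, 138, 228] 6 2 7 :=
  finiteRow_of_rowCheck cubicForms_mul_cubicVectors h 2 (P := primD2) (S := secD2)
    [false, true] [0, 3] (e := 3) []
    (by decide +kernel) (fun _ => eq_zero_of_fiberCheck (pts := pointsD2) (by decide +kernel) _) (by simp; try ring) rfl rfl rfl rfl (by decide)

theorem finiteRow_C4 (h : Realizes (coordForms cubicForms)
      [(IMat.one, IMat.one), (cubicZ4, cubicZ4Inv)] T) :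
    FiniteRow (grp T)
      (1 + Polynomial.X ^ 2 + 4 * Polynomial.X ^ 3 + Polynomial.X ^ 4 + Polynomial.X ^ 6) [1, 1, 2, 2, 2, 4]
      [1, 2, 7, 16, 36, 68, 124, 208] 6 8 12 :=
  finiteRow_of_rowCheck cubicForms_mul_cubicVectors h 4 (P := primC4) (S := secC4)
    [false, true, true, true, true, true, true, false] [0, 2, 3, 3, 3, 3, 4, 6] (e := 2) separationC4
    (by decide +kernel) (fun _ => eq_zero_of_fiberCheck (pts := pointsC4) (by decide +kernel) _) (by simp; try ring) rfl rfl rfl rfl (by decide)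

theorem finiteRow_D4 (h : Realizes (coordForms cubicForms)
      [(IMat.one, IMat.one), (cubicZ4, cubicZ4Inv), (cubicX2, cubicX2)] T) :
    FiniteRow (grp T)
      (1 + 2 * Polynomial.X ^ 3 + Polynomial.X ^ 6) [1, 1, 2, 2, 2, 4]
      [1, 2, 6, 12, 25, 44, 77, 124] 6 4 8 :=
  finiteRow_of_rowCheck cubicForms_mul_cubicVectors h 4 (P := primC4) (S := secD4)
    [false, true, true, false] [0, 3, 3, 6] (e := 3) []
    (by decide +kernel) (fun _ => eq_zero_of_fiberCheck (pts := pointsD4) (by decide +kernel) _) (by simp; try ring) rfl rfl rfl rfl (by decide)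

theorem finiteRow_C3 (h : Realizes (coordForms hexForms)
      [(IMat.one, IMat.one), (hexZ3, hexZ3Inv)] T) :
    FiniteRow (grp T)
      (1 + 2 * Polynomial.X ^ 2 + 6 * Polynomial.X ^ 3 + 2 * Polynomial.X ^ 4 + Polynomial.X ^ 6) [1, 1, 2, 2, 3, 3]
      [1, 2, 7, 20, 42, 84, 156, 264] 6 12 14 :=
  finiteRow_of_rowCheck hexForms_mul_hexVectors h 3 (P := primC3) (S := secC3)
    [false, true, true, true, true, true, true, true, true] [0, 2, 2, 3, 3, 3, 3, 3, 3, 4, 4, 6] (e := 2) []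
    (by decide +kernel) (fun _ => eq_zero_of_fiberCheck (pts := pointsC3) (by decide +kernel) _) (by simp; try ring) rfl rfl rfl rfl (by decide)

theorem finiteRow_D3 (h : Realizes (coordForms hexForms)
      [(IMat.one, IMat.one), (hexZ3, hexZ3Inv), (hexX2, hexX2)] T) :
    FiniteRow (grp T)
      (1 + Polynomial.X ^ 2 + 2 * Polynomial.X ^ 3 + Polynomial.X ^ 4 + Polynomial.X ^ 6) [1, 1, 2, 2, 3, 3]
      [1, 2, 6, 14, 28, 52, 93, 152] 6 6 9 :=
  finiteRow_of_rowCheck hexForms_mul_hexVectors h 3 (P := primC3) (S := secD3)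
    [false, true, true, true] [0, 2, 3, 3, 4, 6] (e := 2) []
    (by decide +kernel) (fun _ => eq_zero_of_fiberCheck (pts := pointsD3) (by decide +kernel) _) (by simp; try ring) rfl rfl rfl rfl (by decide)

theorem finiteRow_C6 (h : Realizes (coordForms hexForms)
      [(IMat.one, IMat.one), (hexZ6, hexZ6Inv)] T) :
    FiniteRow (grp T)
      (1 + 3 * Polynomial.X ^ 3 + 2 * Polynomial.X ^ 4 + 2 * Polynomial.X ^ 5 + 3 * Polynomial.X ^ 6 + Polynomial.X ^ 9) [1, 1, 2, 2, 3, 6]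
      [1, 2, 5, 12, 24, 46, 84, 140] 6 12 14 :=
  finiteRow_of_rowCheck hexForms_mul_hexVectors h 6 (P := primC6) (S := secC6)
    [false, true, true, true, true, true, true, true, true] [0, 3, 3, 3, 4, 4, 5, 5, 6, 6, 6, 9] (e := 3) separationC6
    (by decide +kernel) (fun _ => eq_zero_of_fiberCheck (pts := pointsC6) (by decide +kernel) _) (by simp; try ring) rfl rfl rfl rfl (by decide)

theorem finiteRow_D6 (h : Realizes (coordForms hexForms)
      [(IMat.one, IMat.one), (hexZ6, hexZ6Inv), (hexX2, hexX2)] T) :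
    FiniteRow (grp T)
      (1 + Polynomial.X ^ 3 + Polynomial.X ^ 4 + Polynomial.X ^ 5 + Polynomial.X ^ 6 + Polynomial.X ^ 9) [1, 1, 2, 2, 3, 6]
      [1, 2, 5, 10, 19, 33, 57, 90] 6 6 9 :=
  finiteRow_of_rowCheck hexForms_mul_hexVectors h 6 (P := primC6) (S := secD6)
    [false, true, true, true] [0, 3, 4, 5, 6, 9] (e := 3) separationD6
    (by decide +kernel) (fun _ => eq_zero_of_fiberCheck (pts := pointsD6) (by decide +kernel) _) (by simp; try ring) rfl rfl rfl rfl (by decide)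

theorem finiteRow_T (h : Realizes (coordForms cubicForms)
      [(IMat.one, IMat.one), (cubicZ2, cubicZ2), (cubicK3, cubicK3Inv)] T) :
    FiniteRow (grp T)
      (1 + 3 * Polynomial.X ^ 3 + 2 * Polynomial.X ^ 4 + 2 * Polynomial.X ^ 5 + 3 * Polynomial.X ^ 6 + Polynomial.X ^ 9) [1, 2, 2, 3, 3, 4]
      [1, 1, 3, 8, 14, 26, 48, 76] 6 12 14 :=
  finiteRow_of_rowCheck cubicForms_mul_cubicVectors h 4 (P := primT) (S := secT)
    [false, true, true, true, true, true, true, true, true] [0, 3, 3, 3, 4, 4, 5, 5, 6, 6, 6, 9] (e := 3) separationT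
    (by decide +kernel) (fun _ => eq_zero_of_fiberCheck (pts := pointsT) (by decide +kernel) _) (by simp; try ring) rfl rfl rfl rfl (by decide)

theorem finiteRow_O (h : Realizes (coordForms cubicForms)
      [(IMat.one, IMat.one), (cubicZ4, cubicZ4Inv), (cubicX4, cubicX4Inv), (cubicK3, cubicK3Inv)] T) :
    FiniteRow (grp T)
      (1 + Polynomial.X ^ 3 + Polynomial.X ^ 4 + Polynomial.X ^ 5 + Polynomial.X ^ 6 + Polynomial.X ^ 9) [1, 2, 2, 3, 3, 4]
      [1, 1, 3, 6, 11, 18, 32, 48] 6 6 9 :=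
  finiteRow_of_rowCheck cubicForms_mul_cubicVectors h 4 (P := primT) (S := secO)
    [false, true, true, true] [0, 3, 4, 5, 6, 9] (e := 3) []
    (by decide +kernel) (fun _ => eq_zero_of_fiberCheck (pts := pointsO) (by decide +kernel) _) (by simp; try ring) rfl rfl rfl rfl (by decide)

end

theorem actsAs_one {L : Matrix (Fin 6) (Fin 6) ℝ} : ActsAs L IMat.one 1 := by
  rw [ActsAs, IMat.toReal_one]
  change L * kelvin (1 : Matrix (Fin 3) (Fin 3) ℝ) = 1 * L
  rw [kelvin_one, Matrix.mul_one, Matrix.one_mul]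

theorem actsAs_mul {L : Matrix (Fin 6) (Fin 6) ℝ} {A B : O3} {M N : IMat} (hM : M.WellFormed) (hA : ActsAs L M A)
    (hB : ActsAs L N B) : ActsAs L (M.mul N) (A * B) := by
  rw [ActsAs] at hA hB ⊢
  change L * kelvin ((A : Matrix (Fin 3) (Fin 3) ℝ) * B) = _
  rw [kelvin_mul, ← Matrix.mul_assoc, hA, Matrix.mul_assoc, hB, IMat.toReal_mul hM, Matrix.mul_assoc]

section
variable {L : Matrix (Fin 6) (Fin 6) ℝ} {T : Set O3} {a b : O3} {g g' : IMat × IMat}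

/-- The central inversion acts trivially, so that generators are needed up to sign only. -/
theorem exists_actsAs_of_mem_or_neg_mem (ha : ActsAs L g.1 a) (h : a ∈ T ∨ -a ∈ T) : ∃ Q ∈ grp T, ActsAs L g.1 Q := by
  rcases h with h | h
  · exact ⟨a, Subgroup.subset_closure h, ha⟩
  · exact ⟨-a, Subgroup.subset_closure h, actsAs_neg.2 ha⟩

theorem realizes_nil (hT : ∀ Q ∈ T, Q = 1 ∨ Q = -1) : Realizes L [(IMat.one, IMat.one)] T := by
  refine ⟨fun Q hQ => ⟨_, List.mem_singleton.2 rfl, ?_⟩, ?_⟩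
  · rcases hT Q hQ with rfl | rfl
    exacts [actsAs_one, actsAs_neg.2 actsAs_one]
  · rintro g hg
    rw [List.mem_singleton.1 hg]
    exact ⟨1, Subgroup.one_mem _, actsAs_one⟩

theorem realizes_singleton (ha : ActsAs L g.1 a) (h : a ∈ T ∨ -a ∈ T)
    (hT : ∀ Q ∈ T, Q = -1 ∨ Q = a ∨ Q = -a) : Realizes L [(IMat.one, IMat.one), g] T := by
  refine ⟨fun Q hQ => ?_, ?_⟩
  · rcases hT Q hQ with rfl | rfl | rfl
    · exact ⟨(IMat.one, IMat.one), by simp, actsAs_neg.2 actsAs_one⟩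
    · exact ⟨g, by simp, ha⟩
    · exact ⟨g, by simp, actsAs_neg.2 ha⟩
  · simp only [List.forall_mem_cons, List.not_mem_nil, false_implies, implies_true, and_true]
    exact ⟨⟨1, Subgroup.one_mem _, actsAs_one⟩, exists_actsAs_of_mem_or_neg_mem ha h⟩

theorem realizes_pair (ha : ActsAs L g.1 a) (hb : ActsAs L g'.1 b) (h : a ∈ T ∨ -a ∈ T) (h' : b ∈ T ∨ -b ∈ T)
    (hT : ∀ Q ∈ T, Q = -1 ∨ (Q = a ∨ Q = -a) ∨ Q = b ∨ Q = -b) : Realizes L [(IMat.one, IMat.one), g, g'] T := by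
  refine ⟨fun Q hQ => ?_, ?_⟩
  · rcases hT Q hQ with rfl | (rfl | rfl) | rfl | rfl
    · exact ⟨(IMat.one, IMat.one), by simp, actsAs_neg.2 actsAs_one⟩
    · exact ⟨g, by simp, ha⟩
    · exact ⟨g, by simp, actsAs_neg.2 ha⟩
    · exact ⟨g', by simp, hb⟩
    · exact ⟨g', by simp, actsAs_neg.2 hb⟩
  · simp only [List.forall_mem_cons, List.not_mem_nil, false_implies, implies_true, and_true]
    exact ⟨⟨1, Subgroup.one_mem _, actsAs_one⟩, exists_actsAs_of_mem_or_neg_mem ha h,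
      exists_actsAs_of_mem_or_neg_mem hb h'⟩

end

section
variable {T : Set O3}

theorem wellFormed_of_all {N : IMat} (h : (N.all fun r => Nat.ble r.length 6) = true) : N.WellFormed := by
  simpa [IMat.WellFormed] using h

/-- The rotation by `2π/3` about a space diagonal is a product of quarter turns. -/
theorem realizes_quarterTurns (h : rotZ (Real.pi / 2) ∈ T ∨ -rotZ (Real.pi / 2) ∈ T)
    (h' : rotX (Real.pi / 2) ∈ T ∨ -rotX (Real.pi / 2) ∈ T)
    (hT : ∀ Q ∈ T, Q = -1 ∨ (Q = rotZ (Real.pi / 2) ∨ Q = -rotZ (Real.pi / 2)) ∨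
      Q = rotX (Real.pi / 2) ∨ Q = -rotX (Real.pi / 2)) :
    Realizes (coordForms cubicForms)
      [(IMat.one, IMat.one), (cubicZ4, cubicZ4Inv), (cubicX4, cubicX4Inv), (cubicK3, cubicK3Inv)] T := by
  obtain ⟨h1, h2⟩ := realizes_pair (g := (cubicZ4, cubicZ4Inv)) (g' := (cubicX4, cubicX4Inv))
    actsAs_cubicZ4 actsAs_cubicX4 h h' hT
  refine ⟨fun Q hQ => ?_, ?_⟩
  · obtain ⟨g, hg, hgQ⟩ := h1 Q hQ
    exact ⟨g, List.mem_append_left [(cubicK3, cubicK3Inv)] hg, hgQ⟩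
  · simp only [List.forall_mem_cons, List.not_mem_nil, false_implies, implies_true, and_true] at h2 ⊢
    refine ⟨h2.1, h2.2.1, h2.2.2, ?_⟩
    obtain ⟨-, ⟨A, hA, hA'⟩, B, hB, hB'⟩ := h2
    refine ⟨B⁻¹ * A⁻¹, Subgroup.mul_mem _ (Subgroup.inv_mem _ hB) (Subgroup.inv_mem _ hA), ?_⟩
    rw [show cubicK3 = cubicX4Inv.mul cubicZ4Inv by decide]
    exact actsAs_mul (wellFormed_of_all (by decide))
      (actsAs_inv (g := (cubicX4, cubicX4Inv)) (wellFormed_of_all (by decide)) (by decide) hB')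
      (actsAs_inv (g := (cubicZ4, cubicZ4Inv)) (wellFormed_of_all (by decide)) (by decide) hA')

/-- The quarter turn about the `x`-axis is a product of quarter turns about the `z`-axis and of
rotations by `2π/3` about a space diagonal. -/
theorem realizes_quarterTurn_diagonal :
    Realizes (coordForms cubicForms)
      [(IMat.one, IMat.one), (cubicZ4, cubicZ4Inv), (cubicX4, cubicX4Inv), (cubicK3, cubicK3Inv)]
      {rotZ (Real.pi / 2), -rotK (2 * Real.pi / 3)} := by
  obtain ⟨h1, h2⟩ := realizes_pair (T := {rotZ (Real.pi / 2), -rotK (2 * Real.pi / 3)})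
    (g := (cubicZ4, cubicZ4Inv)) (g' := (cubicK3, cubicK3Inv))
    actsAs_cubicZ4 actsAs_cubicK3 (by simp) (by simp) (by simp)
  refine ⟨fun Q hQ => ?_, ?_⟩
  · obtain ⟨g, hg, hgQ⟩ := h1 Q hQ
    refine ⟨g, ?_, hgQ⟩
    simp only [List.mem_cons, List.not_mem_nil, or_false] at hg ⊢
    tauto
  · simp only [List.forall_mem_cons, List.not_mem_nil, false_implies, implies_true, and_true] at h2 ⊢
    refine ⟨h2.1, h2.2.1, ?_, h2.2.2⟩
    obtain ⟨-, ⟨A, hA, hA'⟩, B, hB, hB'⟩ := h2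
    refine ⟨A⁻¹ * B⁻¹, Subgroup.mul_mem _ (Subgroup.inv_mem _ hA) (Subgroup.inv_mem _ hB), ?_⟩
    rw [show cubicX4 = cubicZ4Inv.mul cubicK3Inv by decide]
    exact actsAs_mul (wellFormed_of_all (by decide))
      (actsAs_inv (g := (cubicZ4, cubicZ4Inv)) (wellFormed_of_all (by decide)) (by decide) hA')
      (actsAs_inv (g := (cubicK3, cubicK3Inv)) (wellFormed_of_all (by decide)) (by decide) hB')

end

theorem finiteRows_C1 : ∀ G ∈ [TensorInvariants.C1, TensorInvariants.Ci], FiniteRow G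
      1 [1, 1, 1, 1, 1, 1]
      [1, 6, 21, 56, 126, 252, 462, 792] 6 1 6 := by
  simp only [List.forall_mem_cons, List.not_mem_nil, false_implies, implies_true, and_true]
  refine ⟨?_, ?_⟩ <;>
    exact finiteRow_C1 (realizes_nil (by simp))

theorem finiteRows_C2 : ∀ G ∈ [TensorInvariants.C2, TensorInvariants.C1h, TensorInvariants.C2h], FiniteRow G
      (1 + Polynomial.X ^ 2) [1, 1, 1, 1, 2, 2]
      [1, 4, 13, 32, 70, 136, 246, 416] 6 2 7 := by
  simp only [List.forall_mem_cons, List.not_mem_nil, false_implies, implies_true, and_true]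
  refine ⟨?_, ?_, ?_⟩ <;>
    exact finiteRow_C2 (realizes_singleton actsAs_cubicZ2 (by simp) (by simp))

theorem finiteRows_D2 : ∀ G ∈ [TensorInvariants.D2, TensorInvariants.C2v, TensorInvariants.D2h], FiniteRow G
      (1 + Polynomial.X ^ 3) [1, 1, 1, 2, 2, 2]
      [1, 3, 9, 20, 42, 78, 138, 228] 6 2 7 := by
  simp only [List.forall_mem_cons, List.not_mem_nil, false_implies, implies_true, and_true]
  refine ⟨?_, ?_, ?_⟩ <;>
    exact finiteRow_D2 (realizes_pair actsAs_cubicZ2 actsAs_cubicX2 (by simp) (by simp) (by simp))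

theorem finiteRows_C4 : ∀ G ∈ [TensorInvariants.C4, TensorInvariants.C2i, TensorInvariants.C4h], FiniteRow G
      (1 + Polynomial.X ^ 2 + 4 * Polynomial.X ^ 3 + Polynomial.X ^ 4 + Polynomial.X ^ 6) [1, 1, 2, 2, 2, 4]
      [1, 2, 7, 16, 36, 68, 124, 208] 6 8 12 := by
  simp only [List.forall_mem_cons, List.not_mem_nil, false_implies, implies_true, and_true]
  refine ⟨?_, ?_, ?_⟩ <;>
    exact finiteRow_C4 (realizes_singleton actsAs_cubicZ4 (by simp) (by simp))

theorem finiteRows_D4 : ∀ G ∈ [TensorInvariants.D4, TensorInvariants.C4v, TensorInvariants.D2d, TensorInvariants.D4h], FiniteRow G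
      (1 + 2 * Polynomial.X ^ 3 + Polynomial.X ^ 6) [1, 1, 2, 2, 2, 4]
      [1, 2, 6, 12, 25, 44, 77, 124] 6 4 8 := by
  simp only [List.forall_mem_cons, List.not_mem_nil, false_implies, implies_true, and_true]
  refine ⟨?_, ?_, ?_, ?_⟩ <;>
    exact finiteRow_D4 (realizes_pair actsAs_cubicZ4 actsAs_cubicX2 (by simp) (by simp) (by simp))

theorem finiteRows_C3 : ∀ G ∈ [TensorInvariants.C3, TensorInvariants.C3i], FiniteRow G
      (1 + 2 * Polynomial.X ^ 2 + 6 * Polynomial.X ^ 3 + 2 * Polynomial.X ^ 4 + Polynomial.X ^ 6) [1, 1, 2, 2, 3, 3]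
      [1, 2, 7, 20, 42, 84, 156, 264] 6 12 14 := by
  simp only [List.forall_mem_cons, List.not_mem_nil, false_implies, implies_true, and_true]
  refine ⟨?_, ?_⟩ <;>
    exact finiteRow_C3 (realizes_singleton actsAs_hexZ3 (by simp) (by simp))

theorem finiteRows_D3 : ∀ G ∈ [TensorInvariants.D3, TensorInvariants.C3v, TensorInvariants.D3d], FiniteRow G
      (1 + Polynomial.X ^ 2 + 2 * Polynomial.X ^ 3 + Polynomial.X ^ 4 + Polynomial.X ^ 6) [1, 1, 2, 2, 3, 3]
      [1, 2, 6, 14, 28, 52, 93, 152] 6 6 9 := by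
  simp only [List.forall_mem_cons, List.not_mem_nil, false_implies, implies_true, and_true]
  refine ⟨?_, ?_, ?_⟩ <;>
    exact finiteRow_D3 (realizes_pair actsAs_hexZ3 actsAs_hexX2 (by simp) (by simp) (by simp))

theorem finiteRows_C6 : ∀ G ∈ [TensorInvariants.C6, TensorInvariants.C3h, TensorInvariants.C6h], FiniteRow G
      (1 + 3 * Polynomial.X ^ 3 + 2 * Polynomial.X ^ 4 + 2 * Polynomial.X ^ 5 + 3 * Polynomial.X ^ 6 + Polynomial.X ^ 9) [1, 1, 2, 2, 3, 6]
      [1, 2, 5, 12, 24, 46, 84, 140] 6 12 14 := by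
  simp only [List.forall_mem_cons, List.not_mem_nil, false_implies, implies_true, and_true]
  refine ⟨?_, ?_, ?_⟩ <;>
    exact finiteRow_C6 (realizes_singleton actsAs_hexZ6 (by simp) (by simp))

theorem finiteRows_D6 : ∀ G ∈ [TensorInvariants.D6, TensorInvariants.C6v, TensorInvariants.D3h, TensorInvariants.D6h], FiniteRow G
      (1 + Polynomial.X ^ 3 + Polynomial.X ^ 4 + Polynomial.X ^ 5 + Polynomial.X ^ 6 + Polynomial.X ^ 9) [1, 1, 2, 2, 3, 6]
      [1, 2, 5, 10, 19, 33, 57, 90] 6 6 9 := by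
  simp only [List.forall_mem_cons, List.not_mem_nil, false_implies, implies_true, and_true]
  refine ⟨?_, ?_, ?_, ?_⟩ <;>
    exact finiteRow_D6 (realizes_pair actsAs_hexZ6 actsAs_hexX2 (by simp) (by simp) (by simp))

theorem finiteRows_T : ∀ G ∈ [TensorInvariants.T, TensorInvariants.Th], FiniteRow G
      (1 + 3 * Polynomial.X ^ 3 + 2 * Polynomial.X ^ 4 + 2 * Polynomial.X ^ 5 + 3 * Polynomial.X ^ 6 + Polynomial.X ^ 9) [1, 2, 2, 3, 3, 4]
      [1, 1, 3, 8, 14, 26, 48, 76] 6 12 14 := by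
  simp only [List.forall_mem_cons, List.not_mem_nil, false_implies, implies_true, and_true]
  refine ⟨?_, ?_⟩ <;>
    exact finiteRow_T (realizes_pair actsAs_cubicZ2 actsAs_cubicK3 (by simp) (by simp) (by simp))

theorem finiteRows_O : ∀ G ∈ [TensorInvariants.O, TensorInvariants.Td, TensorInvariants.Oh], FiniteRow G
      (1 + Polynomial.X ^ 3 + Polynomial.X ^ 4 + Polynomial.X ^ 5 + Polynomial.X ^ 6 + Polynomial.X ^ 9) [1, 2, 2, 3, 3, 4]
      [1, 1, 3, 6, 11, 18, 32, 48] 6 6 9 := by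
  simp only [List.forall_mem_cons, List.not_mem_nil, false_implies, implies_true, and_true]
  exact ⟨finiteRow_O (realizes_quarterTurns (by simp) (by simp) (by simp)),
    finiteRow_O (realizes_quarterTurns (by simp) (by simp) (by simp)), finiteRow_O realizes_quarterTurn_diagonal⟩

end Crystallographic

/-! ### The icosahedral groups -/

section Icosahedral

theorem aeval_smul_of_isHomogeneous {f : Poly} {d : ℕ} (hf : f.IsHomogeneous d) (r : ℂ) (y : Fin 6 → ℂ) :
    aeval (fun i => r * y i) f = r ^ d * aeval y f := by
  rw [aeval_def, aeval_def, eval₂_eq', eval₂_eq', Finset.mul_sum]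
  refine Finset.sum_congr rfl fun a ha => ?_
  have hd : ∑ i, a i = d := by
    have := hf (mem_support_iff.1 ha)
    simpa [Finsupp.weight_apply, Finsupp.sum_fintype] using this
  simp only [mul_pow, Finset.prod_mul_distrib, Finset.prod_pow_eq_pow_sum, hd]
  ring

/-- A variant of `fiberCheck`, in which the point `y` of a pair `(v, y)` stands for `v ^ (-1 / 3) • y`.
Values of degree `d` are multiplied by `v ^ (-d / 3)`, and remain rational if they vanish or `v = 1` whenever
`3` does not divide `d`. -/
def scaledFiberCheck (P S : List Expr) (K : ℕ) (pts : List (ℕ × List Eis)) : Bool :=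
  (pts.length == S.length) &&
  pts.all (fun y => Nat.blt 0 y.1 && P.all (fun e => match e.deg with
      | none => false
      | some d => bif d % 3 == 0 then e.ev y.2 == Eis.mul (y.1 ^ (d / 3) , 0) (e.ev (pts.getD 0 (1, [])).2)
        else e.ev y.2 == e.ev (pts.getD 0 (1, [])).2 && (y.1 == 1 || e.ev y.2 == (0, 0))) &&
    S.all (fun e => match e.deg with
      | none => false
      | some d => (d % 3 == 0 && Nat.ble (d / 3) K) || y.1 == 1 || e.ev y.2 == (0, 0)) &&
    elimination P.length (P.map fun e => (List.range 6).map fun l => e.evd y.2 l)) &&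
  elimination S.length (S.map fun e => pts.map fun y =>
    Eis.mul ((y.1 : ℤ) ^ (K - e.deg.getD 0 / 3), 0) (e.ev y.2))

theorem exists_cube_root_inv {v : ℕ} (hv : 0 < v) : ∃ r : ℂ, r ≠ 0 ∧ r ^ 3 * v = 1 ∧ (v = 1 → r = 1) := by
  by_cases h : v = 1
  · subst h
    exact ⟨1, one_ne_zero, by simp, fun _ => rfl⟩
  · have hv' : (v : ℂ) ≠ 0 := Nat.cast_ne_zero.2 hv.ne'
    obtain ⟨r, hr⟩ := IsAlgClosed.exists_pow_nat_eq ((v : ℂ)⁻¹) (n := 3) (by norm_num)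
    refine ⟨r, fun h0 => ?_, by rw [hr, inv_mul_cancel₀ hv'], fun h' => absurd h' h⟩
    rw [h0, zero_pow (by norm_num)] at hr
    exact inv_ne_zero hv' hr.symm

theorem eq_zero_of_scaledFiberCheck {P S : List Expr} {K : ℕ} {pts : List (ℕ × List Eis)}
    (h : scaledFiberCheck P S K pts = true) (c : Fin S.length → MvPolynomial (Fin P.length) ℝ)
    (hc : ∑ j, aeval (fun i => (P.get i).toPoly) (c j) * (S.get j).toPoly = 0) : c = 0 := by
  simp only [scaledFiberCheck, Bool.and_eq_true, List.all_eq_true, beq_iff_eq, Nat.blt_eq] at h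
  obtain ⟨⟨hlen, h1⟩, h2⟩ := h
  have hmem : ∀ κ : Fin S.length, pts.getD κ.val (1, []) ∈ pts := fun κ => by
    have hκ : κ.val < pts.length := by rw [hlen]; exact κ.2
    rw [List.getD_eq_getElem _ _ hκ]
    exact List.getElem_mem _
  have hr : ∀ κ : Fin S.length, ∃ r : ℂ, r ≠ 0 ∧ r ^ 3 * ((pts.getD κ.val (1, [])).1 : ℕ) = 1 ∧
      ((pts.getD κ.val (1, [])).1 = 1 → r = 1) := fun κ => exists_cube_root_inv (h1 _ (hmem κ)).1.1.1
  choose r hr0 hr3 hr1 using hr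
  have hev : ∀ (κ : Fin S.length) (e : Expr) (d : ℕ), e.deg = some d →
      aeval (fun i => r κ * toPoint (pts.getD κ.val (1, [])).2 i) e.toPoly
        = r κ ^ d * (e.ev (pts.getD κ.val (1, [])).2).toC := fun κ e d he => by
    rw [aeval_smul_of_isHomogeneous (Expr.isHomogeneous_of_deg he), Expr.aeval_toPoly]
  have hpow : ∀ (κ : Fin S.length) (d : ℕ), d % 3 = 0 →
      r κ ^ d * ((pts.getD κ.val (1, [])).1 : ℂ) ^ (d / 3) = 1 := fun κ d hd => by
    have hd' : d = 3 * (d / 3) := by omega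
    conv_lhs => rw [hd']
    rw [pow_mul, show 3 * (d / 3) / 3 = d / 3 by omega, ← mul_pow, hr3, one_pow]
  refine eq_zero_of_fiber _ _ (fun κ i => r κ * toPoint (pts.getD κ.val (1, [])).2 i)
    (fun i => ((P.get i).ev (pts.getD 0 (1, [])).2).toC) (fun κ i => ?_) (fun κ a ha => ?_) (fun v hv => ?_) c hc
  · have h3 := (h1 _ (hmem κ)).1.1.2 _ (List.get_mem P i)
    split at h3
    · cases h3
    · next d hd =>
      rw [hev κ _ d hd]
      by_cases h4 : d % 3 = 0
      · simp only [h4, beq_self_eq_true, cond_true, beq_iff_eq] at h3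
        rw [h3, Eis.toC_mul, ← mul_assoc, Eis.toC_int]
        push_cast
        rw [hpow κ d h4, one_mul]
      · rw [show (d % 3 == 0) = false by simpa using h4, cond_false] at h3
        simp only [Bool.and_eq_true, Bool.or_eq_true, beq_iff_eq] at h3
        rw [← h3.1]
        rcases h3.2 with h5 | h5
        · rw [hr1 κ h5, one_pow, one_mul]
        · rw [h5, Eis.toC_zero, mul_zero]
  · -- rescaling the point multiplies the gradients by nonzero factors
    have hd : ∀ i, (P.get i).deg = some ((P.get i).deg.getD 0) := fun i => by
      have h3 := (h1 _ (hmem κ)).1.1.2 _ (List.get_mem P i)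
      split at h3
      · cases h3
      · next d hd => rw [hd]; rfl
    have h3 := gradients_independent (h1 _ (hmem κ)).2 (fun i => r κ ^ ((P.get i).deg.getD 0 - 1) * a i)
      fun l => by
        rw [← ha l]
        refine Finset.sum_congr rfl fun i _ => ?_
        rw [aeval_smul_of_isHomogeneous (Expr.isHomogeneous_of_deg (hd i)).pderiv]
        ring
    funext i
    have h4 := congrFun h3 i
    simpa [hr0 κ] using h4
  · refine eq_zero_of_elimination h2 v fun i => ?_
    by_cases hi : i < S.length
    · have hi' : i < pts.length := by rw [hlen]; exact hi
      rw [← mul_zero (((pts.getD i (1, [])).1 : ℂ) ^ K), ← hv ⟨i, hi⟩, Finset.mul_sum]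
      refine Finset.sum_congr rfl fun j _ => ?_
      have h3 := (h1 _ (hmem ⟨i, hi⟩)).1.2 _ (List.get_mem S j)
      have hget : (pts.map fun y => Eis.mul ((y.1 : ℤ) ^ (K - (S.get j).deg.getD 0 / 3), 0) ((S.get j).ev y.2)).getD i (0, 0)
          = Eis.mul (((pts.getD i (1, [])).1 : ℤ) ^ (K - (S.get j).deg.getD 0 / 3), 0)
            ((S.get j).ev (pts.getD i (1, [])).2) := by simp [hi']
      rw [hget, Eis.toC_mul, Eis.toC_int]
      split at h3
      · cases h3
      · next d hd =>
        rw [hev ⟨i, hi⟩ _ d hd, hd]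
        simp only [Bool.and_eq_true, Bool.or_eq_true, beq_iff_eq, Nat.ble_eq] at h3
        push_cast
        rw [Option.getD_some]
        rcases h3 with (⟨h4, h5⟩ | h4) | h4
        · have h6 := hpow ⟨i, hi⟩ d h4
          have h7 : ((pts.getD i (1, [])).1 : ℂ) ^ K
              = ((pts.getD i (1, [])).1 : ℂ) ^ (K - d / 3) * ((pts.getD i (1, [])).1 : ℂ) ^ (d / 3) := by
            rw [← pow_add, Nat.sub_add_cancel h5]
          rw [h7]
          linear_combination (-((pts.getD i (1, [])).1 : ℂ) ^ (K - d / 3)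
            * ((S.get j).ev (pts.getD i (1, [])).2).toC * v j) * h6
        · rw [hr1 ⟨i, hi⟩ h4, h4]; simp; ring
        · rw [h4, Eis.toC_zero]; simp
    · refine Finset.sum_eq_zero fun j _ => ?_
      rw [List.getD_eq_default _ _ (by simpa [hlen] using hi), Eis.toC_zero, mul_zero]

open Real

/-- The axes of order five of the icosahedron, not normalized. -/
def icosahedralAxes : Fin 6 → Fin 3 → ℝ :=
  ![![1, 0, goldenRatio], ![-1, 0, goldenRatio], ![goldenRatio, 1, 0], ![goldenRatio, -1, 0],
    ![0, goldenRatio, 1], ![0, goldenRatio, -1]]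

/-- The forms `C ↦ n ⬝ C n`, for the six axes `n` of order five; the rotations of the icosahedron permute them. -/
def icosahedralForms (i : Fin 6) : Matrix (Fin 3) (Fin 3) ℝ := vecMulVec (icosahedralAxes i) (icosahedralAxes i)

/-- The dual basis: its coefficients are `1 / (4 τ ^ 2)` and `1 / (4 (τ + 2))`. -/
def icosahedralVectors (i : Fin 6) : Matrix (Fin 3) (Fin 3) ℝ :=
  ((2 - goldenRatio) / 4) • icosahedralForms i - ((3 - goldenRatio) / 20) • 1

theorem icosahedralForms_mul_icosahedralVectors :
    coordForms icosahedralForms * coordVectors icosahedralVectors = 1 := by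
  have hτ := goldenRatio_sq
  refine coordForms_mul_coordVectors (fun j => ?_) fun i j => ?_
  · simp [icosahedralVectors, icosahedralForms, Matrix.transpose_vecMulVec]
  · have h1 : (icosahedralForms i * icosahedralForms j).trace = (icosahedralAxes i ⬝ᵥ icosahedralAxes j) ^ 2 := by
      simp [icosahedralForms, Matrix.trace, Matrix.mul_apply, vecMulVec_apply, Fin.sum_univ_three, dotProduct]; ring
    have h2 : (icosahedralForms i).trace = icosahedralAxes i ⬝ᵥ icosahedralAxes i := by
      simp [icosahedralForms, Matrix.trace, vecMulVec_apply, Fin.sum_univ_three, dotProduct]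
    rw [icosahedralVectors, Matrix.mul_sub, Matrix.trace_sub, Matrix.mul_smul, Matrix.mul_smul, Matrix.trace_smul,
      Matrix.trace_smul, Matrix.mul_one, h1, h2]
    fin_cases i <;> fin_cases j <;>
      simp [icosahedralAxes, dotProduct, Fin.sum_univ_three] <;> grind

/-! The permutations of the axes by the rotations about `g` and `p`. -/

def icosahedralG : IMat := [[1, 0, 0, 0, 0, 0], [0, 0, 0, 0, 1, 0], [0, 0, 0, 1, 0, 0], [0, 0, 0, 0, 0, 1],
  [0, 0, 1, 0, 0, 0], [0, 1, 0, 0, 0, 0]]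

def icosahedralGInv : IMat := [[1, 0, 0, 0, 0, 0], [0, 0, 0, 0, 0, 1], [0, 0, 0, 0, 1, 0], [0, 0, 1, 0, 0, 0],
  [0, 1, 0, 0, 0, 0], [0, 0, 0, 1, 0, 0]]

def icosahedralP : IMat := [[0, 0, 0, 0, 1, 0], [0, 0, 0, 0, 0, 1], [1, 0, 0, 0, 0, 0], [0, 1, 0, 0, 0, 0],
  [0, 0, 1, 0, 0, 0], [0, 0, 0, 1, 0, 0]]

def icosahedralPInv : IMat := [[0, 0, 1, 0, 0, 0], [0, 0, 0, 1, 0, 0], [0, 0, 0, 0, 1, 0], [0, 0, 0, 0, 0, 1],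
  [1, 0, 0, 0, 0, 0], [0, 1, 0, 0, 0, 0]]

theorem actsAs_icosahedral {N : IMat} {Q : O3} (σ : Fin 6 → Fin 6) (ε : Fin 6 → ℝ) (hε : ∀ i, ε i * ε i = 1)
    (hN : ∀ i j, N.toReal i j = if j = σ i then 1 else 0)
    (h : ∀ i, (Q : Matrix (Fin 3) (Fin 3) ℝ)ᵀ *ᵥ icosahedralAxes i = ε i • icosahedralAxes (σ i)) :
    ActsAs (coordForms icosahedralForms) N Q := by
  refine actsAs_coordForms fun i => ?_
  simp only [hN, ite_smul, one_smul, zero_smul, Finset.sum_ite_eq', Finset.mem_univ, if_true]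
  rw [icosahedralForms, Matrix.mul_vecMulVec, Matrix.vecMulVec_mul, ← Matrix.mulVec_transpose, h i,
    Matrix.smul_vecMulVec, Matrix.vecMulVec_smul, smul_smul, hε, one_smul, icosahedralForms]

theorem rotG_coe : (rotG (2 * π / 5) : Matrix (Fin 3) (Fin 3) ℝ) =
    !![1 / 2, -goldenRatio / 2, (goldenRatio - 1) / 2; goldenRatio / 2, (goldenRatio - 1) / 2, -1 / 2;
      (goldenRatio - 1) / 2, 1 / 2, goldenRatio / 2] := by
  have hτ := goldenRatio_sq
  have hτ2 := goldenRatio_lt_two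
  have hτ1 := one_lt_goldenRatio
  have hc : cos (2 * π / 5) = (goldenRatio - 1) / 2 := by
    have h1 : cos (π / 5) = goldenRatio / 2 := by rw [cos_pi_div_five, goldenRatio]; ring
    rw [show 2 * π / 5 = 2 * (π / 5) by ring, cos_two_mul, h1]
    linear_combination (1 / 2) * hτ
  have hpos : 0 < goldenRatio ^ 2 - 2 * goldenRatio + 2 := by nlinarith
  set s := √(goldenRatio ^ 2 - 2 * goldenRatio + 2) with hs
  have hs2 : s ^ 2 = goldenRatio ^ 2 - 2 * goldenRatio + 2 := Real.sq_sqrt hpos.le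
  have hs0 : 0 < s := Real.sqrt_pos.2 hpos
  have hsin : sin (2 * π / 5) = goldenRatio / 2 * s := by
    have h1 : 0 < sin (2 * π / 5) := sin_pos_of_pos_of_lt_pi (by positivity) (by linarith [pi_pos])
    have h2 : sin (2 * π / 5) ^ 2 = (goldenRatio / 2 * s) ^ 2 := by
      rw [sin_sq, hc, mul_pow, hs2]; grind
    exact (sq_eq_sq₀ h1.le (by positivity)).1 h2
  obtain ⟨r, hr⟩ : ∃ r, r = 1 / s := ⟨_, rfl⟩
  have hsr : s * r = 1 := by rw [hr]; field_simp
  have hrr : r * r = (goldenRatio + 2) / 5 := by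
    have h1 : s ^ 2 * (r * r) = 1 := by linear_combination (s * r + 1) * hsr
    rw [hs2] at h1
    grind
  have hp : (goldenRatio - 1) / s = (goldenRatio - 1) * r := by rw [hr]; ring
  simp only [rotG, rot, rotMatrix, hc, hsin, ← hs, hp, ← hr]
  clear_value s
  ext i j
  fin_cases i <;> fin_cases j <;> simp <;> grind

theorem actsAs_icosahedralG : ActsAs (coordForms icosahedralForms) icosahedralG (rotG (2 * π / 5)) := by
  have hτ := goldenRatio_sq
  refine actsAs_icosahedral ![0, 4, 3, 5, 2, 1] ![1, 1, 1, -1, 1, -1] (fun i => ?_) (fun i j => ?_) fun i => ?_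
  · fin_cases i <;> simp
  · fin_cases i <;> fin_cases j <;> simp [icosahedralG, IMat.toReal]
  · rw [rotG_coe]
    ext k
    fin_cases i <;> fin_cases k <;>
      simp [icosahedralAxes, Matrix.mulVec, dotProduct, Fin.sum_univ_three] <;> grind

theorem actsAs_icosahedralP : ActsAs (coordForms icosahedralForms) icosahedralP (rotP (2 * π / 3)) := by
  refine actsAs_icosahedral ![4, 5, 0, 1, 2, 3] 1 (fun i => ?_) (fun i j => ?_) fun i => ?_
  · fin_cases i <;> simp
  · fin_cases i <;> fin_cases j <;> simp [icosahedralP, IMat.toReal]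
  · rw [rotP_coe]
    ext k
    fin_cases i <;> fin_cases k <;>
      simp [icosahedralAxes, Matrix.mulVec, dotProduct, Fin.sum_univ_three]

end Icosahedral

section Icosahedral

namespace Expr

/-- The sum of a list of expressions. -/
def sumList : List Expr → Expr
  | [] => int 0
  | [a] => a
  | a :: l => add a (sumList l)

/-- The product of a list of expressions. -/
def prodList : List Expr → Expr
  | [] => int 1
  | [a] => a
  | a :: l => mul a (prodList l)

end Expr

open TensorInvariants.Expr

/-- The elementary symmetric function of degree `k` of the six coordinates. -/
def esymmExpr (k : ℕ) : Expr := sumList ((List.sublistsLen k [x0, x1, x2, x3, x4, x5]).map prodList)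

/-- One of the two orbits of the icosahedral group on the triples of axes. -/
def triples₁ : List (Expr × Expr × Expr) := [(x0, x1, x2), (x0, x1, x3), (x0, x2, x5), (x0, x3, x4), (x0, x4, x5),
  (x1, x2, x4), (x1, x3, x5), (x1, x4, x5), (x2, x3, x4), (x2, x3, x5)]

/-- The other orbit of the icosahedral group on the triples of axes. -/
def triples₂ : List (Expr × Expr × Expr) := [(x0, x1, x4), (x0, x1, x5), (x0, x2, x3), (x0, x2, x4), (x0, x3, x5),
  (x1, x2, x3), (x1, x2, x5), (x1, x3, x4), (x2, x4, x5), (x3, x4, x5)]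

/-- Primary invariants of the icosahedral groups: elementary symmetric functions, the one of degree three being
split according to the orbits of triples. -/
def primI : List Expr := [esymmExpr 1, esymmExpr 2, sumList (triples₁.map fun t => t.1 * t.2.1 * t.2.2),
  sumList (triples₂.map fun t => t.1 * t.2.1 * t.2.2), esymmExpr 4, esymmExpr 5]

/-- Secondary invariants of the icosahedral groups, from the product of all coordinates and from symmetric
polynomials on the triples of one orbit. -/
def secI : List Expr := [int 1,
  sumList (triples₁.map fun t => t.1 * t.2.1 * t.2.2 * (t.1 * t.1 + t.2.1 * t.2.1 + t.2.2 * t.2.2)),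
  esymmExpr 6, sumList (triples₁.map fun t => t.1 * t.2.1 * t.2.2 * (t.1 * t.2.1 * t.2.2)),
  sumList (triples₁.map fun t => t.1 * t.2.1 * t.2.2 *
    (t.1 * t.1 * (t.1 * t.1) + t.2.1 * t.2.1 * (t.2.1 * t.2.1) + t.2.2 * t.2.2 * (t.2.2 * t.2.2))),
  esymmExpr 6 * esymmExpr 6]

/-- The sixth roots of unity. -/
def sixthRoots : List Eis := [(1, 0), (1, 1), (0, 1), (-1, 0), (-1, -1), (0, -1)]

/-- Permutations of the sixth roots of unity and their multiples. At all of them the elementary symmetric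
functions of degree at most five vanish. -/
def pointsI : List (ℕ × List Eis) :=
  let y (l : List ℕ) : List Eis := l.map fun i => sixthRoots.getD i (0, 0)
  [(1, y [0, 1, 2, 4, 3, 5]), (1, (y [0, 1, 2, 4, 3, 5]).map (Eis.mul (0, 1))),
    (1, (y [0, 1, 2, 4, 3, 5]).map (Eis.mul (-1, -1))),
    (4, y [0, 1, 2, 3, 4, 5]), (4, y [0, 1, 2, 4, 5, 3]), (5, y [0, 1, 2, 3, 5, 4])]

open Real in
theorem finiteRows_I : ∀ G ∈ [TensorInvariants.I, TensorInvariants.Ih], FiniteRow G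
      (1 + Polynomial.X ^ 5 + 2 * Polynomial.X ^ 6 + Polynomial.X ^ 7 + Polynomial.X ^ 12) [1, 2, 3, 3, 4, 5]
      [1, 1, 2, 4, 6, 10, 17, 24] 6 6 10 := by
  have key : ∀ T : Set O3, Realizes (coordForms icosahedralForms)
      [(IMat.one, IMat.one), (icosahedralG, icosahedralGInv), (icosahedralP, icosahedralPInv)] T → FiniteRow (grp T)
      (1 + Polynomial.X ^ 5 + 2 * Polynomial.X ^ 6 + Polynomial.X ^ 7 + Polynomial.X ^ 12) [1, 2, 3, 3, 4, 5]
      [1, 1, 2, 4, 6, 10, 17, 24] 6 6 10 := fun T h =>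
    finiteRow_of_rowCheck icosahedralForms_mul_icosahedralVectors h 10 (P := primI) (S := secI)
      [false, true, true, true, true, false] [0, 5, 6, 6, 7, 12] (e := 5) []
      (by decide +kernel) (fun _ => eq_zero_of_scaledFiberCheck (K := 4) (pts := pointsI) (by decide +kernel) _)
      (by simp; ring) rfl rfl rfl rfl (by decide)
  simp only [List.forall_mem_cons, List.not_mem_nil, false_implies, implies_true, and_true]
  refine ⟨?_, ?_⟩ <;>
    exact key _ (realizes_pair actsAs_icosahedralG actsAs_icosahedralP (by simp) (by simp) (by simp))

end Icosahedral

/-! ### The cylindrical groups -/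

section Cylindrical

/-- The statements on a row depend on the group only through its ring of invariants. -/
theorem HilbertRow.congr {G G' : Subgroup O3} (h : invariantRing G = invariantRing G') {num : Polynomial ℤ}
    {ds taylor : List ℕ} {P S F : ℕ} (hG : HilbertRow G num ds taylor P S F) : HilbertRow G' num ds taylor P S F := by
  have h1 : invDim G = invDim G' := by
    funext d
    rw [invDim, invDim, h]
  simpa only [HilbertRow, HasCounts, IsPrimary, IsSecondary, IsFundamental, IsIntegrityBasis, hilbertSeries, h1, h]
    using hG

/-- A group of orthogonal transformations is compact if it contains a compact set, finitely many translates of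
which cover it. -/
theorem compactSpace_of_cover {G : Subgroup O3} {C F : Set O3} (hC : IsCompact C) (hCG : C ⊆ G) (hF : F.Finite)
    (h : ∀ Q ∈ G, ∃ c ∈ C, ∃ g ∈ F, Q = c * g) : CompactSpace G := by
  have hG : (G : Set O3) = Set.image2 (fun c g => c * g) C (F ∩ G) := by
    ext Q
    constructor
    · intro hQ
      obtain ⟨c, hc, g, hg, rfl⟩ := h Q hQ
      exact ⟨c, hc, g, ⟨hg, (Subgroup.mul_mem_cancel_left G (hCG hc)).1 hQ⟩, rfl⟩
    · rintro ⟨c, hc, g, hg, rfl⟩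
      exact G.mul_mem (hCG hc) hg.2
  have : IsCompact (G : Set O3) := by
    rw [hG]
    exact hC.mul (hF.subset Set.inter_subset_left).isCompact
  exact isCompact_iff_compactSpace.1 this

theorem continuous_rotZ : Continuous rotZ := by
  refine Continuous.subtype_mk ?_ _
  unfold rotMatrix
  fun_prop

theorem continuous_rotX : Continuous rotX := by
  refine Continuous.subtype_mk ?_ _
  unfold rotMatrix
  fun_prop

theorem exists_mem_Icc_rotZ (φ : ℝ) : ∃ ψ ∈ Set.Icc 0 (2 * Real.pi), rotZ ψ = rotZ φ := by
  obtain ⟨ψ, hψ, h⟩ := rotZ_mem_allZ φ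
  exact ⟨ψ, ⟨hψ.1, hψ.2.le⟩, h⟩

theorem exists_mem_Icc_rotX (φ : ℝ) : ∃ ψ ∈ Set.Icc 0 (2 * Real.pi), rotX ψ = rotX φ := by
  obtain ⟨ψ, hψ, h⟩ := rotX_mem_allX φ
  exact ⟨ψ, ⟨hψ.1, hψ.2.le⟩, h⟩

theorem infinite_of_allZ_subset {G : Subgroup O3} (h : allZ ⊆ G) : Infinite G := by
  have hinf : Infinite (Set.Icc 0 Real.pi) := Set.Icc.infinite Real.pi_pos
  refine Infinite.of_injective (fun x : Set.Icc 0 Real.pi => (⟨rotZ x, h (rotZ_mem_allZ x)⟩ : G)) fun x y hxy => ?_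
  have h1 : (rotZ x : Matrix (Fin 3) (Fin 3) ℝ) = rotZ y := congrArg (fun Q : G => ((Q : O3) : Matrix (Fin 3) (Fin 3) ℝ)) hxy
  rw [rotZ_coe, rotZ_coe] at h1
  exact Subtype.ext (Real.injOn_cos x.2 y.2 (by simpa using congrFun (congrFun h1 0) 0))

theorem rotX_pi_mul_rotZ (φ : ℝ) : rotX Real.pi * rotZ φ = rotZ (-φ) * rotX Real.pi := by
  refine Subtype.ext ?_
  change (rotX Real.pi : Matrix (Fin 3) (Fin 3) ℝ) * rotZ φ = rotZ (-φ) * rotX Real.pi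
  rw [rotX_coe, rotZ_coe, rotZ_coe]
  ext i j
  fin_cases i <;> fin_cases j <;> simp [Matrix.mul_apply, Fin.sum_univ_three]

theorem rotZ_mul (φ ψ : ℝ) : rotZ φ * rotZ ψ = rotZ (φ + ψ) := by
  refine Subtype.ext ?_
  change (rotZ φ : Matrix (Fin 3) (Fin 3) ℝ) * rotZ ψ = rotZ (φ + ψ)
  rw [rotZ_coe, rotZ_coe, rotZ_coe]
  ext i j
  fin_cases i <;> fin_cases j <;>
    simp [Matrix.mul_apply, Fin.sum_univ_three, Real.cos_add, Real.sin_add] <;> ring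

theorem rotZ_zero : rotZ 0 = 1 := by
  refine Subtype.ext ?_
  rw [rotZ_coe]
  ext i j
  fin_cases i <;> fin_cases j <;> simp

theorem rotZ_inv (φ : ℝ) : (rotZ φ)⁻¹ = rotZ (-φ) := by
  rw [inv_eq_iff_mul_eq_one, rotZ_mul, add_neg_cancel, rotZ_zero]

theorem rotX_pi_sq : rotX Real.pi * rotX Real.pi = 1 := by
  refine Subtype.ext ?_
  change (rotX Real.pi : Matrix (Fin 3) (Fin 3) ℝ) * rotX Real.pi = 1
  rw [rotX_coe]
  ext i j
  fin_cases i <;> fin_cases j <;> simp [Matrix.mul_apply, Fin.sum_univ_three]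

/-- The normal form of the members of the largest cylindrical group. -/
theorem exists_rotZ_mul_of_mem {S : Set O3} (hS : ∀ Q ∈ S, Q ∈ allZ ∨ Q = -1 ∨ Q = rotX Real.pi ∨ Q = -rotX Real.pi)
    {Q : O3} (hQ : Q ∈ grp S) : ∃ φ, ∃ g ∈ ({1, -1, rotX Real.pi, -rotX Real.pi} : Set O3), Q = rotZ φ * g := by
  have hX := rotX_pi_sq
  have hXZ := rotX_pi_mul_rotZ
  have hXi : (rotX Real.pi)⁻¹ = rotX Real.pi := inv_eq_of_mul_eq_one_right hX
  have hni : ∀ Q : O3, (-Q)⁻¹ = -Q⁻¹ := fun Q => inv_eq_of_mul_eq_one_right (by rw [neg_mul_neg, mul_inv_cancel])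
  -- both the generators and their inverses are of this form
  have hgen : ∀ Q ∈ S, ∀ R : O3, (R = Q ∨ R = Q⁻¹) →
      (∃ φ, R = rotZ φ) ∨ R = -1 ∨ R = rotX Real.pi ∨ R = -rotX Real.pi := by
    rintro Q hQ R hR
    rcases hS Q hQ with ⟨φ, -, rfl⟩ | rfl | rfl | rfl
    · rcases hR with rfl | rfl
      exacts [Or.inl ⟨φ, rfl⟩, Or.inl ⟨-φ, rotZ_inv φ⟩]
    · rcases hR with rfl | rfl
      exacts [Or.inr (Or.inl rfl), Or.inr (Or.inl (by rw [hni, inv_one]))]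
    · rcases hR with rfl | rfl
      exacts [Or.inr (Or.inr (Or.inl rfl)), Or.inr (Or.inr (Or.inl hXi))]
    · rcases hR with rfl | rfl
      exacts [Or.inr (Or.inr (Or.inr rfl)), Or.inr (Or.inr (Or.inr (by rw [hni, hXi])))]
  have hmul : ∀ A R : O3, (∃ φ, ∃ g ∈ ({1, -1, rotX Real.pi, -rotX Real.pi} : Set O3), A = rotZ φ * g) →
      ((∃ φ, R = rotZ φ) ∨ R = -1 ∨ R = rotX Real.pi ∨ R = -rotX Real.pi) →
      ∃ φ, ∃ g ∈ ({1, -1, rotX Real.pi, -rotX Real.pi} : Set O3), A * R = rotZ φ * g := by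
    rintro A R ⟨φ, g, hg, rfl⟩ (⟨ψ, rfl⟩ | hR)
    · simp only [Set.mem_insert_iff, Set.mem_singleton_iff] at hg
      rcases hg with rfl | rfl | rfl | rfl
      · exact ⟨φ + ψ, 1, by simp, by rw [mul_one, mul_one, rotZ_mul]⟩
      · exact ⟨φ + ψ, -1, by simp, by rw [mul_assoc, neg_one_mul, mul_neg, rotZ_mul, mul_neg, mul_one]⟩
      · exact ⟨φ + -ψ, rotX Real.pi, by simp, by rw [mul_assoc, hXZ, ← mul_assoc, rotZ_mul]⟩
      · exact ⟨φ + -ψ, -rotX Real.pi, by simp, by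
          rw [mul_assoc, neg_mul, hXZ, mul_neg, ← mul_assoc, rotZ_mul, mul_neg]⟩
    · refine ⟨φ, g * R, ?_, mul_assoc _ _ _⟩
      simp only [Set.mem_insert_iff, Set.mem_singleton_iff] at hg ⊢
      rcases hg with rfl | rfl | rfl | rfl <;> rcases hR with rfl | rfl | rfl <;> simp [hX]
  induction hQ using Subgroup.closure_induction_right with
  | one => exact ⟨0, 1, by simp, by rw [rotZ_zero, mul_one]⟩
  | mul_right A _ B hB ih => exact hmul A B ih (hgen B hB B (Or.inl rfl))
  | mul_inv_cancel A _ B hB ih => exact hmul A B⁻¹ ih (hgen B hB B⁻¹ (Or.inr rfl))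

theorem compactSpace_of_cylindrical {S : Set O3} (hZ : allZ ⊆ S)
    (hS : ∀ Q ∈ S, Q ∈ allZ ∨ Q = -1 ∨ Q = rotX Real.pi ∨ Q = -rotX Real.pi) : CompactSpace (grp S) := by
  refine compactSpace_of_cover (C := rotZ '' Set.Icc 0 (2 * Real.pi))
    (F := {1, -1, rotX Real.pi, -rotX Real.pi}) (isCompact_Icc.image continuous_rotZ) ?_ (by simp) fun Q hQ => ?_
  · rintro _ ⟨φ, -, rfl⟩
    exact Subgroup.subset_closure (hZ (rotZ_mem_allZ φ))
  · obtain ⟨φ, g, hg, rfl⟩ := exists_rotZ_mul_of_mem hS hQ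
    obtain ⟨ψ, hψ, h⟩ := exists_mem_Icc_rotZ φ
    exact ⟨rotZ ψ, ⟨ψ, hψ, rfl⟩, g, hg, by rw [h]⟩

/-! Over `ℂ`, the invariants of the rotations about the `z`-axis are spanned by monomials of weight zero. -/

/-- The complex polynomials with real and imaginary part in a given algebra of real polynomials. -/
def complexify (N : Subalgebra ℝ Poly) : Subalgebra ℂ (MvPolynomial (Fin 6) ℂ) where
  carrier := {x | ∃ q ∈ N, ∃ r ∈ N, x = MvPolynomial.map Complex.ofRealHom q
    + MvPolynomial.C Complex.I * MvPolynomial.map Complex.ofRealHom r}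
  mul_mem' := by
    rintro _ _ ⟨q, hq, r, hr, rfl⟩ ⟨q', hq', r', hr', rfl⟩
    refine ⟨q * q' - r * r', N.sub_mem (N.mul_mem hq hq') (N.mul_mem hr hr'), q * r' + r * q',
      N.add_mem (N.mul_mem hq hr') (N.mul_mem hr hq'), ?_⟩
    have hI : (MvPolynomial.C Complex.I : MvPolynomial (Fin 6) ℂ) * MvPolynomial.C Complex.I = -1 := by
      rw [← MvPolynomial.C_mul, Complex.I_mul_I]; simp
    simp only [map_add, map_sub, map_mul]
    linear_combination (MvPolynomial.map Complex.ofRealHom r) * (MvPolynomial.map Complex.ofRealHom r') * hI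
  add_mem' := by
    rintro _ _ ⟨q, hq, r, hr, rfl⟩ ⟨q', hq', r', hr', rfl⟩
    refine ⟨q + q', N.add_mem hq hq', r + r', N.add_mem hr hr', ?_⟩
    simp only [map_add]; ring
  algebraMap_mem' z := by
    refine ⟨algebraMap ℝ _ z.re, N.algebraMap_mem _, algebraMap ℝ _ z.im, N.algebraMap_mem _, ?_⟩
    simp only [MvPolynomial.algebraMap_eq, MvPolynomial.map_C, ← MvPolynomial.C_mul, ← MvPolynomial.C_add]
    congr 1
    simp [mul_comm Complex.I, Complex.re_add_im]

theorem map_mem_complexify {N : Subalgebra ℝ Poly} {f : Poly} (hf : f ∈ N) :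
    MvPolynomial.map Complex.ofRealHom f ∈ complexify N := ⟨f, hf, 0, N.zero_mem, by simp⟩

theorem mem_of_map_mem_complexify {N : Subalgebra ℝ Poly} {f : Poly}
    (hf : MvPolynomial.map Complex.ofRealHom f ∈ complexify N) : f ∈ N := by
  obtain ⟨q, hq, r, -, h⟩ := hf
  have : f = q := by
    ext a
    have h1 := congrArg (fun x => (coeff a x).re) h
    simpa [MvPolynomial.coeff_map, MvPolynomial.coeff_C_mul] using h1
  rwa [this]

/-- The eigenvectors of the rotations about the `z`-axis among the complex linear forms. -/
def weightForm (i : Fin 6) : MvPolynomial (Fin 6) ℂ := linSubst weightBasisInv (X i)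

theorem linSubst_weightForm (φ : ℝ) (i : Fin 6) :
    linSubst ((kelvin (rotZ φ)).map Complex.ofRealHom) (weightForm i)
      = MvPolynomial.C (kelvinEigenvalues φ i) * weightForm i := by
  have h : weightBasisInv * (kelvin (rotZ φ)).map Complex.ofRealHom
      = Matrix.diagonal (kelvinEigenvalues φ) * weightBasisInv := by
    calc _ = weightBasisInv * ((kelvin (rotZ φ)).map Complex.ofRealHom * weightBasis) * weightBasisInv := by
          rw [Matrix.mul_assoc, Matrix.mul_assoc, weightBasis_mul_inv, Matrix.mul_one]
      _ = _ := by rw [kelvin_rotZ_mul_weightBasis, ← Matrix.mul_assoc, weightBasisInv_mul, Matrix.one_mul]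
  rw [weightForm, ← linSubst_mul, h, linSubst_mul, linSubst_X]
  simp [Matrix.diagonal, Finset.sum_ite_eq, ite_mul, apply_ite MvPolynomial.C, linSubst]

theorem kelvinEigenvalues_eq_exp (φ : ℝ) : kelvinEigenvalues φ = ![1, 1, Complex.exp (φ * Complex.I),
    (Complex.exp (φ * Complex.I))⁻¹, Complex.exp (φ * Complex.I) ^ 2, (Complex.exp (φ * Complex.I))⁻¹ ^ 2] := by
  have h1 : Complex.exp (φ * Complex.I) = Real.cos φ + Real.sin φ * Complex.I := by
    rw [Complex.exp_mul_I]; simp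
  have h2 : (Complex.exp (φ * Complex.I))⁻¹ = Real.cos φ - Real.sin φ * Complex.I := by
    rw [← Complex.exp_neg, ← neg_mul, Complex.exp_mul_I, Complex.cos_neg, Complex.sin_neg]; simp [sub_eq_add_neg]
  rw [h2, h1, kelvinEigenvalues]

/-- A monomial fixed by all rotations about the `z`-axis has weight zero. -/
theorem weight_eq_zero {a : Fin 6 →₀ ℕ} (h : ∀ φ, ∏ i, kelvinEigenvalues φ i ^ a i = 1) :
    a 2 + 2 * a 4 = a 3 + 2 * a 5 := by
  have h1 : ∀ φ : ℝ, Complex.exp (φ * Complex.I) ^ (a 2 + 2 * a 4) = Complex.exp (φ * Complex.I) ^ (a 3 + 2 * a 5) := by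
    intro φ
    have h2 := h φ
    rw [kelvinEigenvalues_eq_exp] at h2
    have hz := Complex.exp_ne_zero (φ * Complex.I)
    generalize Complex.exp (φ * Complex.I) = z at *
    simp [Fin.prod_univ_six] at h2
    rw [pow_add, pow_mul, pow_add, pow_mul]
    field_simp at h2
    linear_combination h2
  -- at `φ = π / (m - n)` the `m`-th and the `n`-th power have opposite signs
  have key : ∀ m n : ℕ, n < m → ¬ ∀ φ : ℝ, Complex.exp (φ * Complex.I) ^ m = Complex.exp (φ * Complex.I) ^ n := by
    intro m n hmn h2
    have h3 := h2 (Real.pi / (m - n : ℕ))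
    have h4 : Complex.exp ((Real.pi / (m - n : ℕ) : ℝ) * Complex.I) ^ (m - n) = -1 := by
      rw [← Complex.exp_nat_mul, ← Complex.exp_pi_mul_I]
      congr 1
      have : ((m - n : ℕ) : ℂ) ≠ 0 := Nat.cast_ne_zero.2 (by omega)
      rw [Complex.ofReal_div, Complex.ofReal_natCast]
      field_simp
    rw [← Nat.sub_add_cancel hmn.le, pow_add, Nat.sub_add_cancel hmn.le, h4] at h3
    have h5 : Complex.exp ((Real.pi / (m - n : ℕ) : ℝ) * Complex.I) ^ n ≠ 0 := pow_ne_zero _ (Complex.exp_ne_zero _)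
    exact h5 (by linear_combination (-1 / 2 : ℂ) * h3)
  rcases lt_trichotomy (a 2 + 2 * a 4) (a 3 + 2 * a 5) with h2 | h2 | h2
  · exact absurd (fun φ => (h1 φ).symm) (key _ _ h2)
  · exact h2
  · exact absurd h1 (key _ _ h2)

/-- Monomials of weight zero are products of the six of least degree. -/
theorem prod_weightForm_mem {B : Subalgebra ℂ (MvPolynomial (Fin 6) ℂ)} (h0 : weightForm 0 ∈ B)
    (h1 : weightForm 1 ∈ B) (h23 : weightForm 2 * weightForm 3 ∈ B) (h45 : weightForm 4 * weightForm 5 ∈ B)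
    (h225 : weightForm 2 ^ 2 * weightForm 5 ∈ B) (h334 : weightForm 3 ^ 2 * weightForm 4 ∈ B)
    {a : Fin 6 →₀ ℕ} (ha : a 2 + 2 * a 4 = a 3 + 2 * a 5) : ∏ i, weightForm i ^ a i ∈ B := by
  rw [Fin.prod_univ_six]
  rcases le_total (a 3) (a 2) with h | h
  · obtain ⟨r, hr⟩ : ∃ r, a 5 = a 4 + r := ⟨a 5 - a 4, by omega⟩
    have h2 : a 2 = a 3 + 2 * r := by omega
    have : weightForm 0 ^ a 0 * weightForm 1 ^ a 1 * weightForm 2 ^ a 2 * weightForm 3 ^ a 3 * weightForm 4 ^ a 4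
        * weightForm 5 ^ a 5 = weightForm 0 ^ a 0 * weightForm 1 ^ a 1 * (weightForm 2 * weightForm 3) ^ a 3
        * (weightForm 4 * weightForm 5) ^ a 4 * (weightForm 2 ^ 2 * weightForm 5) ^ r := by
      rw [h2, hr]; ring
    rw [this]
    exact mul_mem (mul_mem (mul_mem (mul_mem (pow_mem h0 _) (pow_mem h1 _)) (pow_mem h23 _)) (pow_mem h45 _))
      (pow_mem h225 _)
  · obtain ⟨r, hr⟩ : ∃ r, a 4 = a 5 + r := ⟨a 4 - a 5, by omega⟩
    have h2 : a 3 = a 2 + 2 * r := by omega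
    have : weightForm 0 ^ a 0 * weightForm 1 ^ a 1 * weightForm 2 ^ a 2 * weightForm 3 ^ a 3 * weightForm 4 ^ a 4
        * weightForm 5 ^ a 5 = weightForm 0 ^ a 0 * weightForm 1 ^ a 1 * (weightForm 2 * weightForm 3) ^ a 2
        * (weightForm 4 * weightForm 5) ^ a 5 * (weightForm 3 ^ 2 * weightForm 4) ^ r := by
      rw [h2, hr]; ring
    rw [this]
    exact mul_mem (mul_mem (mul_mem (mul_mem (pow_mem h0 _) (pow_mem h1 _)) (pow_mem h23 _)) (pow_mem h45 _))
      (pow_mem h334 _)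

/-- Invariants of the rotations about the `z`-axis lie in any algebra that contains the six monomials of weight zero
of least degree. -/
theorem map_mem_of_fixed_rotZ {B : Subalgebra ℂ (MvPolynomial (Fin 6) ℂ)} (h0 : weightForm 0 ∈ B)
    (h1 : weightForm 1 ∈ B) (h23 : weightForm 2 * weightForm 3 ∈ B) (h45 : weightForm 4 * weightForm 5 ∈ B)
    (h225 : weightForm 2 ^ 2 * weightForm 5 ∈ B) (h334 : weightForm 3 ^ 2 * weightForm 4 ∈ B) {f : Poly}
    (hf : ∀ φ, linSubst (kelvin (rotZ φ)) f = f) : MvPolynomial.map Complex.ofRealHom f ∈ B := by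
  set g := linSubst weightBasis (MvPolynomial.map Complex.ofRealHom f) with hg
  have hfg : MvPolynomial.map Complex.ofRealHom f = linSubst weightBasisInv g := by
    rw [hg, ← linSubst_mul, weightBasis_mul_inv, linSubst_one]
  have hfix : ∀ φ, linSubst (Matrix.diagonal (kelvinEigenvalues φ)) g = g := by
    intro φ
    conv_rhs => rw [hg, ← hf φ, map_linSubst, ← linSubst_mul, kelvin_rotZ_mul_weightBasis, linSubst_mul, ← hg]
  -- in the eigenvectors, the rotations multiply each monomial by a number
  have hcoeff : ∀ φ a, coeff a g = (∏ i, kelvinEigenvalues φ i ^ a i) * coeff a g := by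
    intro φ a
    conv_lhs => rw [← hfix φ, g.as_sum, map_sum, coeff_sum]
    have : ∀ b, linSubst (Matrix.diagonal (kelvinEigenvalues φ)) (monomial b (coeff b g))
        = monomial b ((∏ i, kelvinEigenvalues φ i ^ b i) * coeff b g) := by
      intro b
      have h3 : (monomial b (coeff b g)) = coeff b g • monomial b (1 : ℂ) := by rw [smul_monomial, smul_eq_mul, mul_one]
      rw [h3, map_smul, linSubst_diagonal_monomial, smul_monomial, smul_eq_mul, mul_comm]
    simp only [this, coeff_monomial]
    by_cases ha : coeff a g = 0
    · rw [ha, mul_zero]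
      refine Finset.sum_eq_zero fun b _ => ?_
      split_ifs with h4
      · rw [h4, ha, mul_zero]
      · rfl
    · rw [Finset.sum_eq_single a (fun b _ hb => if_neg hb) (fun h4 => absurd (mem_support_iff.2 ha) h4), if_pos rfl]
  rw [hfg, g.as_sum, map_sum]
  refine sum_mem fun a ha => ?_
  have ha' := mem_support_iff.1 ha
  have hw := weight_eq_zero (a := a) fun φ => by
    have h3 := hcoeff φ a
    exact (mul_right_cancel₀ ha' (by rw [one_mul]; exact h3)).symm
  rw [monomial_eq, map_mul, Finsupp.prod_fintype _ _ (by simp), map_prod]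
  refine mul_mem ?_ ?_
  · rw [show linSubst weightBasisInv (MvPolynomial.C (coeff a g)) = algebraMap ℂ _ (coeff a g) from AlgHom.commutes _ _]
    exact B.algebraMap_mem _
  · have := prod_weightForm_mem h0 h1 h23 h45 h225 h334 hw
    simpa only [map_pow, weightForm] using this

end Cylindrical

section Cylindrical

open TensorInvariants.Expr

/-- With `u = C₁₃ + i C₂₃` and `w = C₁₁ - C₂₂ + 2 i C₁₂`: the forms `C₁₁ + C₂₂` and `C₃₃`, the squared norms of `u`
and `w`, and the real part of `u² w̄`. -/
def primCyl : List Expr := [x0 + x1, x2, x3 * x3 + x4 * x4, (x0 - x1) * (x0 - x1) + int 4 * (x5 * x5),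
  (x4 * x4 - x3 * x3) * (x0 - x1) + int 4 * (x3 * x4 * x5)]

/-- The imaginary part of `u² w̄`. -/
def chiralCyl : Expr := int 2 * (x3 * x4 * (x0 - x1) - (x4 * x4 - x3 * x3) * x5)

theorem toPoly_add' (a b : Expr) : (a + b).toPoly = a.toPoly + b.toPoly := rfl

theorem toPoly_mul' (a b : Expr) : (a * b).toPoly = a.toPoly * b.toPoly := rfl

theorem toPoly_sub' (a b : Expr) : (a - b).toPoly = a.toPoly - b.toPoly := by
  change a.toPoly + ((-1 : ℤ) : Poly) * b.toPoly = _
  push_cast; ring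

theorem toPoly_int (n : ℤ) : (int n).toPoly = (n : Poly) := rfl

theorem toPoly_var (i : Fin 6) : (var i).toPoly = X i := rfl

/-- Secondary invariants of the group of rotations about the `z`-axis. -/
def secCyl : List Expr := [int 1, chiralCyl]

/-- The degrees of the primary invariants of the cylindrical groups. -/
def degCyl : Fin 5 → ℕ := ![1, 1, 2, 2, 3]

/-- The polynomial denoted by an expression in the coordinates `C₁₁, C₂₂, C₃₃, C₂₃, C₁₃, C₁₂`. -/
def cubicPoly (e : Expr) : Poly := linSubst (coordForms cubicForms) e.toPoly

/-- The primary invariants of the cylindrical groups. -/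
def cylP (i : Fin 5) : Poly := cubicPoly (primCyl.get i)

theorem coordForms_cubicForms : coordForms cubicForms = !![1, 0, 0, 0, 0, 0; 0, 1, 0, 0, 0, 0; 0, 0, 1, 0, 0, 0;
    0, 0, 0, 1 / √2, 0, 0; 0, 0, 0, 0, 1 / √2, 0; 0, 0, 0, 0, 0, 1 / √2] := by
  ext i j
  fin_cases i <;> fin_cases j <;>
    simp [coordForms, cubicForms, kelvinCoeff, Matrix.trace, Matrix.mul_apply, Fin.sum_univ_three] <;> ring

theorem eval_map_cubicPoly (x : Fin 6 → ℂ) (e : Expr) :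
    eval x (MvPolynomial.map Complex.ofRealHom (cubicPoly e))
      = aeval ![x 0, x 1, x 2, x 3 / √2, x 4 / √2, x 5 / √2] e.toPoly := by
  rw [cubicPoly, map_linSubst, eval_linSubst, eval_map, aeval_def]
  congr 1
  funext i
  rw [coordForms_cubicForms]
  fin_cases i <;> simp [Matrix.mulVec, dotProduct, Fin.sum_univ_six, div_eq_inv_mul]

theorem eval_weightForm (x : Fin 6 → ℂ) (i : Fin 6) : eval x (weightForm i) = (weightBasisInv *ᵥ x) i := by
  rw [weightForm, eval_linSubst, eval_X]

theorem weightBasisInv_mulVec (x : Fin 6 → ℂ) : weightBasisInv *ᵥ x =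
    ![(x 0 + x 1) / 2, x 2, (x 4 + Complex.I * x 3) / 2, (x 4 - Complex.I * x 3) / 2,
      (x 0 - x 1 + Complex.I * √2 * x 5) / 4, (x 0 - x 1 - Complex.I * √2 * x 5) / 4] := by
  funext i
  fin_cases i <;> simp [weightBasisInv, Matrix.mulVec, dotProduct, Fin.sum_univ_six] <;> ring

/-- The invariants of the rotations about the `z`-axis as polynomials in the forms of definite weight. -/
theorem map_cylP : MvPolynomial.map Complex.ofRealHom (cylP 0) = MvPolynomial.C 2 * weightForm 0 ∧
    MvPolynomial.map Complex.ofRealHom (cylP 1) = weightForm 1 ∧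
    MvPolynomial.map Complex.ofRealHom (cylP 2) = MvPolynomial.C 2 * (weightForm 2 * weightForm 3) ∧
    MvPolynomial.map Complex.ofRealHom (cylP 3) = MvPolynomial.C 16 * (weightForm 4 * weightForm 5) ∧
    MvPolynomial.map Complex.ofRealHom (cylP 4)
      = MvPolynomial.C 4 * (weightForm 2 ^ 2 * weightForm 5 + weightForm 3 ^ 2 * weightForm 4) ∧
    MvPolynomial.map Complex.ofRealHom (cubicPoly chiralCyl) = MvPolynomial.C (-4 * Complex.I)
      * (weightForm 2 ^ 2 * weightForm 5 - weightForm 3 ^ 2 * weightForm 4) := by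
  have hI := Complex.I_sq
  have h2 := csqrt_two_sq
  have h20 : ((√2 : ℝ) : ℂ) ≠ 0 := by
    intro h; rw [h] at h2; norm_num at h2
  refine ⟨?_, ?_, ?_, ?_, ?_, ?_⟩ <;>
  · refine MvPolynomial.funext fun x => ?_
    simp only [cylP, eval_map_cubicPoly, map_mul, map_add, map_sub, map_pow, eval_C, eval_weightForm, weightBasisInv_mulVec]
    simp [primCyl, chiralCyl, toPoly_add', toPoly_mul', toPoly_sub', toPoly_int, toPoly_var, x0, x1, x2, x3, x4, x5] <;>
      (try field_simp) <;> grind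

theorem linSubst_C {R : Type*} [CommRing R] (M : Matrix (Fin 6) (Fin 6) R) (r : R) :
    linSubst M (MvPolynomial.C r) = MvPolynomial.C r := AlgHom.commutes _ r

theorem map_ofReal_injective : Function.Injective
    (MvPolynomial.map Complex.ofRealHom : Poly → MvPolynomial (Fin 6) ℂ) :=
  MvPolynomial.map_injective _ Complex.ofReal_injective

theorem linSubst_rotZ_cylP (φ : ℝ) : (∀ i, linSubst (kelvin (rotZ φ)) (cylP i) = cylP i) ∧
    linSubst (kelvin (rotZ φ)) (cubicPoly chiralCyl) = cubicPoly chiralCyl := by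
  obtain ⟨h0, h1, h2, h3, h4, h5⟩ := map_cylP
  generalize -4 * Complex.I = k at h5
  have hz := Complex.exp_ne_zero (φ * Complex.I)
  have hl := linSubst_weightForm φ
  rw [kelvinEigenvalues_eq_exp] at hl
  set z := Complex.exp (φ * Complex.I)
  have hzz : (MvPolynomial.C z : MvPolynomial (Fin 6) ℂ) * MvPolynomial.C z⁻¹ = 1 := by
    rw [← MvPolynomial.C_mul, mul_inv_cancel₀ hz, MvPolynomial.C_1]
  have l0 : linSubst ((kelvin (rotZ φ)).map Complex.ofRealHom) (weightForm 0) = weightForm 0 := by simpa using hl 0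
  have l1 : linSubst ((kelvin (rotZ φ)).map Complex.ofRealHom) (weightForm 1) = weightForm 1 := by simpa using hl 1
  have l2 : linSubst ((kelvin (rotZ φ)).map Complex.ofRealHom) (weightForm 2) = MvPolynomial.C z * weightForm 2 := hl 2
  have l3 : linSubst ((kelvin (rotZ φ)).map Complex.ofRealHom) (weightForm 3) = MvPolynomial.C z⁻¹ * weightForm 3 := hl 3
  have l4 : linSubst ((kelvin (rotZ φ)).map Complex.ofRealHom) (weightForm 4) = MvPolynomial.C z ^ 2 * weightForm 4 := by
    rw [← MvPolynomial.C_pow]; exact hl 4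
  have l5 : linSubst ((kelvin (rotZ φ)).map Complex.ofRealHom) (weightForm 5) = MvPolynomial.C z⁻¹ ^ 2 * weightForm 5 := by
    rw [← MvPolynomial.C_pow]; exact hl 5
  refine ⟨fun i => map_ofReal_injective ?_, map_ofReal_injective ?_⟩
  · rw [map_linSubst]
    fin_cases i
    · simp only [Fin.zero_eta, h0, map_mul, linSubst_C, l0]
    · simp only [Fin.mk_one, h1, l1]
    · simp only [Fin.reduceFinMk, h2, map_mul, linSubst_C, l2, l3]
      linear_combination MvPolynomial.C 2 * (weightForm 2 * weightForm 3) * hzz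
    · simp only [Fin.reduceFinMk, h3, map_mul, linSubst_C, l4, l5]
      linear_combination MvPolynomial.C 16 * (weightForm 4 * weightForm 5)
        * (MvPolynomial.C z * MvPolynomial.C z⁻¹ + 1) * hzz
    · simp only [Fin.reduceFinMk, h4, map_mul, map_add, map_pow, linSubst_C, l2, l3, l4, l5]
      linear_combination MvPolynomial.C 4 * (weightForm 2 ^ 2 * weightForm 5 + weightForm 3 ^ 2 * weightForm 4)
        * (MvPolynomial.C z * MvPolynomial.C z⁻¹ + 1) * hzz
  · rw [map_linSubst]
    simp only [h5, map_mul, map_sub, map_pow, linSubst_C, l2, l3, l4, l5]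
    linear_combination MvPolynomial.C k
      * (weightForm 2 ^ 2 * weightForm 5 - weightForm 3 ^ 2 * weightForm 4)
      * (MvPolynomial.C z * MvPolynomial.C z⁻¹ + 1) * hzz

/-- The primary invariants and the chiral invariant generate the invariants of the rotations about the `z`-axis. -/
theorem mem_adjoin_of_fixed_rotZ {f : Poly} (hf : ∀ φ, linSubst (kelvin (rotZ φ)) f = f) :
    f ∈ Algebra.adjoin ℝ (Set.range cylP ∪ {cubicPoly chiralCyl}) := by
  obtain ⟨h0, h1, h2, h3, h4, h5⟩ := map_cylP
  set N := Algebra.adjoin ℝ (Set.range cylP ∪ {cubicPoly chiralCyl}) with hN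
  have hp : ∀ i, MvPolynomial.map Complex.ofRealHom (cylP i) ∈ complexify N := fun i =>
    map_mem_complexify (Algebra.subset_adjoin (Or.inl ⟨i, rfl⟩))
  have hI : MvPolynomial.map Complex.ofRealHom (cubicPoly chiralCyl) ∈ complexify N :=
    map_mem_complexify (Algebra.subset_adjoin (Or.inr rfl))
  have hC : ∀ (r : ℂ) {x : MvPolynomial (Fin 6) ℂ}, x ∈ complexify N → MvPolynomial.C r * x ∈ complexify N :=
    fun r x hx => (complexify N).mul_mem ((complexify N).algebraMap_mem r) hx
  have hCC : ∀ (r s : ℂ), r * s = 1 → ∀ x : MvPolynomial (Fin 6) ℂ, x = MvPolynomial.C r * (MvPolynomial.C s * x) := by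
    intro r s hrs x
    rw [← mul_assoc, ← MvPolynomial.C_mul, hrs, MvPolynomial.C_1, one_mul]
  have hII : (MvPolynomial.C Complex.I : MvPolynomial (Fin 6) ℂ) * MvPolynomial.C (-4 * Complex.I) = MvPolynomial.C 4 := by
    rw [← MvPolynomial.C_mul]; congr 1; linear_combination -4 * Complex.I_sq
  have h44 : (MvPolynomial.C 4 : MvPolynomial (Fin 6) ℂ) + MvPolynomial.C 4 = MvPolynomial.C 8 := by
    rw [← MvPolynomial.C_add]; norm_num
  refine mem_of_map_mem_complexify (map_mem_of_fixed_rotZ ?_ ?_ ?_ ?_ ?_ ?_ hf)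
  · rw [hCC (1 / 2) 2 (by norm_num) (weightForm 0), ← h0]; exact hC _ (hp 0)
  · rw [← h1]; exact hp 1
  · rw [hCC (1 / 2) 2 (by norm_num) (_ * _), ← h2]; exact hC _ (hp 2)
  · rw [hCC (1 / 16) 16 (by norm_num) (_ * _), ← h3]; exact hC _ (hp 3)
  · have : MvPolynomial.C 8 * (weightForm 2 ^ 2 * weightForm 5) = MvPolynomial.map Complex.ofRealHom (cylP 4)
        + MvPolynomial.C Complex.I * MvPolynomial.map Complex.ofRealHom (cubicPoly chiralCyl) := by
      rw [h4, h5]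
      linear_combination -(weightForm 2 ^ 2 * weightForm 5 - weightForm 3 ^ 2 * weightForm 4) * hII
        - weightForm 2 ^ 2 * weightForm 5 * h44
    rw [hCC (1 / 8) 8 (by norm_num) (_ * _), this]
    exact hC _ (add_mem (hp 4) (hC _ hI))
  · have : MvPolynomial.C 8 * (weightForm 3 ^ 2 * weightForm 4) = MvPolynomial.map Complex.ofRealHom (cylP 4)
        - MvPolynomial.C Complex.I * MvPolynomial.map Complex.ofRealHom (cubicPoly chiralCyl) := by
      rw [h4, h5]
      linear_combination (weightForm 2 ^ 2 * weightForm 5 - weightForm 3 ^ 2 * weightForm 4) * hII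
        - weightForm 3 ^ 2 * weightForm 4 * h44
    rw [hCC (1 / 8) 8 (by norm_num) (_ * _), this]
    exact hC _ (sub_mem (hp 4) (hC _ hI))

/-- The relation `(Re u² w̄)² + (Im u² w̄)² = |u|⁴ |w|²`. -/
theorem chiralCyl_sq : cubicPoly chiralCyl * cubicPoly chiralCyl = cylP 2 ^ 2 * cylP 3 - cylP 4 ^ 2 := by
  obtain ⟨-, -, h2, h3, h4, h5⟩ := map_cylP
  refine map_ofReal_injective ?_
  have hII : (MvPolynomial.C (-4 * Complex.I) : MvPolynomial (Fin 6) ℂ) ^ 2 = -16 := by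
    rw [← MvPolynomial.C_pow, mul_pow, Complex.I_sq]
    rw [show ((-4 : ℂ) ^ 2 * -1) = -16 by norm_num, map_neg]; rfl
  generalize -4 * Complex.I = k at h5 hII
  simp only [map_mul, map_sub, map_pow, h2, h3, h4, h5]
  simp only [show (MvPolynomial.C 2 : MvPolynomial (Fin 6) ℂ) = 2 from rfl,
    show (MvPolynomial.C 16 : MvPolynomial (Fin 6) ℂ) = 16 from rfl,
    show (MvPolynomial.C 4 : MvPolynomial (Fin 6) ℂ) = 4 from rfl]
  linear_combination (weightForm 2 ^ 2 * weightForm 5 - weightForm 3 ^ 2 * weightForm 4) ^ 2 * hII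

/-- By `chiralCyl_sq`, polynomials in the generators are linear in the chiral invariant. -/
theorem exists_of_fixed_rotZ {f : Poly} (hf : ∀ φ, linSubst (kelvin (rotZ φ)) f = f) :
    ∃ c d : MvPolynomial (Fin 5) ℝ, f = aeval cylP c + aeval cylP d * cubicPoly chiralCyl := by
  have h := mem_adjoin_of_fixed_rotZ hf
  clear hf
  induction h using Algebra.adjoin_induction with
  | mem x hx =>
    rcases hx with ⟨i, rfl⟩ | rfl
    · exact ⟨X i, 0, by simp⟩
    · exact ⟨0, 1, by simp⟩
  | algebraMap r => exact ⟨MvPolynomial.C r, 0, by simp⟩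
  | add x y _ _ hx hy =>
    obtain ⟨c, d, h1⟩ := hx
    obtain ⟨c', d', h2⟩ := hy
    exact ⟨c + c', d + d', by rw [h1, h2, map_add, map_add]; ring⟩
  | mul x y _ _ hx hy =>
    obtain ⟨c, d, h1⟩ := hx
    obtain ⟨c', d', h2⟩ := hy
    refine ⟨c * c' + d * d' * (X 2 ^ 2 * X 3 - X 4 ^ 2), c * d' + d * c', ?_⟩
    rw [h1, h2]
    simp only [map_add, map_mul, map_sub, map_pow, aeval_X]
    linear_combination aeval cylP d * aeval cylP d' * chiralCyl_sq

theorem independent_of_fiberCheck {L L' : Matrix (Fin 6) (Fin 6) ℝ} (hL : L * L' = 1) {P S : List Expr}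
    {pts : List (List Eis)} (h : fiberCheck P S pts = true) (c : Fin S.length → MvPolynomial (Fin P.length) ℝ)
    (hc : ∑ j, aeval (fun i => linSubst L (P.get i).toPoly) (c j) * linSubst L (S.get j).toPoly = 0) : c = 0 := by
  have hinj : Function.Injective (linSubst L) := by
    intro f g hfg
    have h3 := congrArg (linSubst L') hfg
    rwa [← linSubst_mul, ← linSubst_mul, hL, linSubst_one, linSubst_one] at h3
  refine eq_zero_of_fiberCheck h c (hinj ?_)
  rw [map_zero, map_sum, ← hc]
  refine Finset.sum_congr rfl fun j _ => ?_
  rw [map_mul, ← AlgHom.comp_apply]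
  congr 2
  ext i
  simp

theorem mem_invariantRing_Cinf {f : Poly} :
    f ∈ invariantRing Cinf ↔ ∀ φ, linSubst (kelvin (rotZ φ)) f = f := by
  rw [Cinf, mem_invariantRing_grp]
  exact ⟨fun h φ => h _ (rotZ_mem_allZ φ), fun h Q hQ => by obtain ⟨φ, -, rfl⟩ := hQ; exact h φ⟩

theorem invariantRing_CinfH : invariantRing Cinf = invariantRing CinfH := by
  ext f
  simp only [Cinf, CinfH, mem_invariantRing_grp, Set.mem_union, Set.mem_singleton_iff, or_imp, forall_and, forall_eq,
    neg_coe, kelvin_neg]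
  exact (and_iff_right (by rw [show ((1 : O3) : Matrix (Fin 3) (Fin 3) ℝ) = 1 from rfl, kelvin_one, linSubst_one])).symm

theorem invariantRing_CinfV : invariantRing Dinf = invariantRing CinfV := by
  ext f
  simp only [Dinf, CinfV, mem_invariantRing_grp, Set.mem_union, Set.mem_singleton_iff, or_imp, forall_and, forall_eq,
    neg_coe, kelvin_neg]

theorem invariantRing_DinfH : invariantRing Dinf = invariantRing DinfH := by
  ext f
  simp only [Dinf, DinfH, mem_invariantRing_grp, Set.mem_union, Set.mem_singleton_iff, or_imp, forall_and, forall_eq,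
    neg_coe, kelvin_neg]
  rw [show ((1 : O3) : Matrix (Fin 3) (Fin 3) ℝ) = 1 from rfl, kelvin_one, linSubst_one]
  simp

theorem mem_invariantRing_Dinf {f : Poly} :
    f ∈ invariantRing Dinf ↔ (∀ φ, linSubst (kelvin (rotZ φ)) f = f) ∧ linSubst (kelvin (rotX Real.pi)) f = f := by
  rw [← mem_invariantRing_Cinf]
  simp only [Dinf, Cinf, mem_invariantRing_grp, Set.mem_union, Set.mem_singleton_iff, or_imp, forall_and, forall_eq]

theorem linSubst_rotX_cubicPoly (e : Expr) :
    linSubst (kelvin (rotX Real.pi)) (cubicPoly e)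
      = linSubst (coordForms cubicForms) (linSubst cubicX2.toReal e.toPoly) := by
  rw [cubicPoly, ← linSubst_mul, actsAs_cubicX2, linSubst_mul]

theorem linSubst_rotX_cylP (i : Fin 5) : linSubst (kelvin (rotX Real.pi)) (cylP i) = cylP i := by
  have h : (primCyl.all fun e => e.fixedBy cubicX2) = true := by decide +kernel
  rw [cylP, linSubst_rotX_cubicPoly, Expr.linSubst_of_fixedBy (List.all_eq_true.1 h _ (List.get_mem primCyl i)), cubicPoly]

theorem linSubst_rotX_chiralCyl :
    linSubst (kelvin (rotX Real.pi)) (cubicPoly chiralCyl) = -cubicPoly chiralCyl := by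
  rw [linSubst_rotX_cubicPoly, cubicPoly, ← map_neg]
  congr 1
  simp [chiralCyl, toPoly_mul', toPoly_sub', toPoly_int, toPoly_var, x0, x1, x3, x4, x5, linSubst_X,
    Fin.sum_univ_six, cubicX2, IMat.toReal, map_ofNat (linSubst _) 2]
  ring

theorem isHomogeneous_cubicPoly {e : Expr} {d : ℕ} (h : e.deg = some d) : (cubicPoly e).IsHomogeneous d :=
  linSubst_isHomogeneous _ (Expr.isHomogeneous_of_deg h)

theorem isFreeBasis_Cinf : IsFreeBasis Cinf cylP ![1, cubicPoly chiralCyl] degCyl ![0, 3] where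
  one_le i := by fin_cases i <;> simp [degCyl]
  memP i := mem_invariantRing_Cinf.2 fun φ => (linSubst_rotZ_cylP φ).1 i
  memS j := by
    fin_cases j
    · exact Subalgebra.one_mem _
    · exact mem_invariantRing_Cinf.2 fun φ => (linSubst_rotZ_cylP φ).2
  homP i := isHomogeneous_cubicPoly (by fin_cases i <;> rfl)
  homS j := by
    fin_cases j
    · exact isHomogeneous_one _ _
    · exact isHomogeneous_cubicPoly rfl
  ind c hc := by
    refine independent_of_fiberCheck cubicForms_mul_cubicVectors (P := primCyl) (S := secCyl)
      (pts := [intPoint [3, 1, 0, 1, 2, 1], intPoint [3, 1, 0, -1, 2, -1]]) (by decide +kernel) c ?_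
    rw [← hc]
    refine Finset.sum_congr rfl fun j _ => ?_
    congr 1
    change Fin 2 at j
    fin_cases j
    · simp [secCyl, toPoly_int]
    · rfl
  span f hf := by
    obtain ⟨c, d, h⟩ := exists_of_fixed_rotZ (mem_invariantRing_Cinf.1 hf)
    exact ⟨![c, d], by rw [h]; simp [Fin.sum_univ_two]⟩

theorem isFreeBasis_Dinf : IsFreeBasis Dinf cylP ![1] degCyl ![0] where
  one_le := isFreeBasis_Cinf.one_le
  memP i := mem_invariantRing_Dinf.2 ⟨fun φ => (linSubst_rotZ_cylP φ).1 i, linSubst_rotX_cylP i⟩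
  memS j := by
    fin_cases j
    exact Subalgebra.one_mem _
  homP := isFreeBasis_Cinf.homP
  homS j := by
    fin_cases j
    exact isHomogeneous_one _ _
  ind c hc := by
    have h := isFreeBasis_Cinf.ind ![c 0, 0] (by rw [← hc]; simp [Fin.sum_univ_two])
    funext j
    fin_cases j
    exact congrFun h 0
  span f hf := by
    obtain ⟨hZ, hX⟩ := mem_invariantRing_Dinf.1 hf
    obtain ⟨c, d, h⟩ := exists_of_fixed_rotZ hZ
    have hfix : ∀ c : MvPolynomial (Fin 5) ℝ, linSubst (kelvin (rotX Real.pi)) (aeval cylP c) = aeval cylP c := by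
      intro c
      rw [← AlgHom.comp_apply, comp_aeval]
      simp only [linSubst_rotX_cylP]
    -- the half turn about the `x`-axis changes the sign of the chiral invariant
    have h2 : f = aeval cylP c - aeval cylP d * cubicPoly chiralCyl := by
      rw [← hX, h, map_add, map_mul, hfix, hfix, linSubst_rotX_chiralCyl]; ring
    refine ⟨![c], ?_⟩
    have h3 : (2 : ℝ) • f = (2 : ℝ) • aeval cylP c := by
      rw [two_smul, two_smul]
      nth_rewrite 1 [h]
      nth_rewrite 1 [h2]
      ring
    simpa using smul_right_injective Poly (two_ne_zero (α := ℝ)) h3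

theorem infiniteRow_of_hilbertRow {G : Subgroup O3} (hi : Infinite G) (hc : CompactSpace G) {num : Polynomial ℤ}
    {ds taylor : List ℕ} {P S F : ℕ} (h : HilbertRow G num ds taylor P S F) : InfiniteRow G num ds taylor P S F :=
  ⟨hasHaarMolien_of_hasSum hi hc h.2.1, h⟩

theorem infiniteRows_Cinf : ∀ G ∈ [TensorInvariants.Cinf, TensorInvariants.CinfH], InfiniteRow G
      (1 + Polynomial.X ^ 3) [1, 1, 2, 2, 3] [1, 2, 5, 10, 18, 30, 48, 72] 5 2 6 := by
  have h : HilbertRow Cinf (1 + Polynomial.X ^ 3) [1, 1, 2, 2, 3] [1, 2, 5, 10, 18, 30, 48, 72] 5 2 6 := by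
    refine isFreeBasis_Cinf.hilbertRow (j₀ := 0) rfl {1} (by simp) (fun j => ?_) (by simp [Fin.sum_univ_two])
      (by rfl) rfl (by decide) (e := 3) rfl (by simp) (fun i => Or.inl ?_) (fun i _ => Or.inl ?_)
    · fin_cases j
      · exact Subalgebra.one_mem _
      · exact Algebra.subset_adjoin (Or.inr ⟨1, by simp, rfl⟩)
    · fin_cases i <;> simp [degCyl]
    · fin_cases i <;> simp
  simp only [List.forall_mem_cons, List.not_mem_nil, false_implies, implies_true, and_true]
  refine ⟨infiniteRow_of_hilbertRow (infinite_of_allZ_subset Subgroup.subset_closure)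
    (compactSpace_of_cylindrical (fun _ h => h) fun Q hQ => Or.inl hQ) h,
    infiniteRow_of_hilbertRow (infinite_of_allZ_subset (Set.subset_union_right.trans Subgroup.subset_closure))
    (compactSpace_of_cylindrical Set.subset_union_right fun Q hQ => ?_) (h.congr invariantRing_CinfH)⟩
  rcases hQ with hQ | hQ
  · exact Or.inr (Or.inl hQ)
  · exact Or.inl hQ

theorem infiniteRows_Dinf : ∀ G ∈ [TensorInvariants.Dinf, TensorInvariants.CinfV, TensorInvariants.DinfH], InfiniteRow G
      1 [1, 1, 2, 2, 3] [1, 2, 5, 9, 16, 25, 39, 56] 5 1 5 := by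
  have h : HilbertRow Dinf 1 [1, 1, 2, 2, 3] [1, 2, 5, 9, 16, 25, 39, 56] 5 1 5 := by
    refine isFreeBasis_Dinf.hilbertRow (j₀ := 0) rfl ∅ (by simp) (fun j => ?_) (by simp)
      (by rfl) rfl (by decide) (e := 3) rfl (by simp) (fun i => Or.inl ?_) (fun i hi => ?_)
    · fin_cases j
      exact Subalgebra.one_mem _
    · fin_cases i <;> simp [degCyl]
    · exact absurd hi (Finset.notMem_empty i)
  simp only [List.forall_mem_cons, List.not_mem_nil, false_implies, implies_true, and_true]
  refine ⟨infiniteRow_of_hilbertRow (infinite_of_allZ_subset (Set.subset_union_left.trans Subgroup.subset_closure))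
    (compactSpace_of_cylindrical Set.subset_union_left fun Q hQ => ?_) h,
    infiniteRow_of_hilbertRow (infinite_of_allZ_subset (Set.subset_union_left.trans Subgroup.subset_closure))
    (compactSpace_of_cylindrical Set.subset_union_left fun Q hQ => ?_) (h.congr invariantRing_CinfV),
    infiniteRow_of_hilbertRow (infinite_of_allZ_subset
      (Set.subset_union_right.trans (Set.subset_union_left.trans Subgroup.subset_closure)))
    (compactSpace_of_cylindrical (Set.subset_union_right.trans Set.subset_union_left) fun Q hQ => ?_)
      (h.congr invariantRing_DinfH)⟩
  · rcases hQ with hQ | hQ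
    exacts [Or.inl hQ, Or.inr (Or.inr (Or.inl hQ))]
  · rcases hQ with hQ | hQ
    exacts [Or.inl hQ, Or.inr (Or.inr (Or.inr hQ))]
  · rcases hQ with (hQ | hQ) | hQ
    exacts [Or.inr (Or.inl hQ), Or.inl hQ, Or.inr (Or.inr (Or.inl hQ))]

end Cylindrical

/-! ### The spherical groups -/

section Spherical

open TensorInvariants.Expr

/-- The coefficients of the characteristic polynomial of `C`, up to sign, in the coordinates
`C₁₁, C₂₂, C₃₃, C₂₃, C₁₃, C₁₂`. -/
def primSph : List Expr := [x0 + x1 + x2, x0 * x1 + x1 * x2 + x2 * x0 - (x3 * x3 + x4 * x4 + x5 * x5),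
  x0 * x1 * x2 + int 2 * (x3 * x4 * x5) - (x0 * (x3 * x3) + x1 * (x4 * x4) + x2 * (x5 * x5))]

/-- The primary invariants of the spherical groups. -/
def sphP (i : Fin 3) : Poly := cubicPoly (primSph.get i)

/-- The symmetric tensor with given Kelvin–Mandel coordinates. -/
def symTensor (x : Fin 6 → ℝ) : Matrix (Fin 3) (Fin 3) ℝ := ∑ α, x α • kelvinCoeff α

theorem symTensor_transpose (x : Fin 6 → ℝ) : (symTensor x)ᵀ = symTensor x := by
  simp [symTensor, Matrix.transpose_sum, kelvinCoeff_transpose]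

theorem trace_kelvinCoeff_mul_symTensor (x : Fin 6 → ℝ) (α : Fin 6) : (kelvinCoeff α * symTensor x).trace = x α := by
  simp [symTensor, Finset.mul_sum, Matrix.trace_sum, trace_kelvinCoeff_mul]

theorem symTensor_kelvin_mulVec (Q : Matrix (Fin 3) (Fin 3) ℝ) (x : Fin 6 → ℝ) :
    symTensor (kelvin Q *ᵥ x) = Q * symTensor x * Qᵀ := by
  rw [← sum_trace_smul_kelvinCoeff (isSymm_conj (symTensor_transpose x)), symTensor]
  refine Finset.sum_congr rfl fun α _ => ?_
  congr 1
  simp only [Matrix.mulVec, dotProduct, kelvin_eq_trace, symTensor, Finset.mul_sum, Finset.sum_mul, Matrix.trace_sum]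
  refine Finset.sum_congr rfl fun β _ => ?_
  simp [mul_comm]

theorem symTensor_eq (x : Fin 6 → ℝ) : symTensor x =
    !![x 0, x 5 / √2, x 4 / √2; x 5 / √2, x 1, x 3 / √2; x 4 / √2, x 3 / √2, x 2] := by
  ext i j
  fin_cases i <;> fin_cases j <;> simp [symTensor, kelvinCoeff, Fin.sum_univ_six, div_eq_mul_inv]

theorem eval_cubicPoly (x : Fin 6 → ℝ) (e : Expr) :
    eval x (cubicPoly e) = eval ![x 0, x 1, x 2, x 3 / √2, x 4 / √2, x 5 / √2] e.toPoly := by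
  rw [cubicPoly, eval_linSubst]
  congr 2
  funext i
  rw [coordForms_cubicForms]
  fin_cases i <;> simp [Matrix.mulVec, dotProduct, Fin.sum_univ_six, div_eq_inv_mul]

theorem eval_sphP (x : Fin 6 → ℝ) : eval x (sphP 0) = (symTensor x).trace ∧
    2 * eval x (sphP 1) = (symTensor x).trace ^ 2 - (symTensor x * symTensor x).trace ∧
    eval x (sphP 2) = (symTensor x).det := by
  simp only [sphP, eval_cubicPoly, symTensor_eq]
  generalize x 3 / √2 = a, x 4 / √2 = b, x 5 / √2 = c
  refine ⟨?_, ?_, ?_⟩ <;>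
    simp [primSph, toPoly_add', toPoly_mul', toPoly_sub', toPoly_int, toPoly_var, x0, x1, x2, x3, x4, x5, Matrix.trace,
      Fin.sum_univ_three, Matrix.det_fin_three] <;> ring

/-- Polynomials fixed by all orthogonal transformations. -/
def IsIsotropic (f : Poly) : Prop := ∀ Q : O3, linSubst (kelvin (Q : Matrix (Fin 3) (Fin 3) ℝ)) f = f

theorem isIsotropic_sphP (i : Fin 3) : IsIsotropic (sphP i) := by
  intro Q
  refine MvPolynomial.funext fun x => ?_
  rw [eval_linSubst]
  obtain ⟨h0, h1, h2⟩ := eval_sphP x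
  obtain ⟨h0', h1', h2'⟩ := eval_sphP (kelvin (Q : Matrix (Fin 3) (Fin 3) ℝ) *ᵥ x)
  have hQ := O3_transpose_mul Q
  rw [symTensor_kelvin_mulVec] at h0' h1' h2'
  have htr : ∀ A : Matrix (Fin 3) (Fin 3) ℝ, ((Q : Matrix (Fin 3) (Fin 3) ℝ) * A *
      (Q : Matrix (Fin 3) (Fin 3) ℝ)ᵀ).trace = A.trace := fun A => by
    rw [Matrix.trace_mul_comm, ← Matrix.mul_assoc, hQ, Matrix.one_mul]
  have hsq : (Q : Matrix (Fin 3) (Fin 3) ℝ) * symTensor x * (Q : Matrix (Fin 3) (Fin 3) ℝ)ᵀ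
      * ((Q : Matrix (Fin 3) (Fin 3) ℝ) * symTensor x * (Q : Matrix (Fin 3) (Fin 3) ℝ)ᵀ)
      = Q * (symTensor x * symTensor x) * (Q : Matrix (Fin 3) (Fin 3) ℝ)ᵀ := by
    calc _ = (Q : Matrix (Fin 3) (Fin 3) ℝ) * symTensor x * ((Q : Matrix (Fin 3) (Fin 3) ℝ)ᵀ * Q) * symTensor x
          * (Q : Matrix (Fin 3) (Fin 3) ℝ)ᵀ := by simp only [Matrix.mul_assoc]
      _ = _ := by rw [hQ, Matrix.mul_one]; simp only [Matrix.mul_assoc]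
  rw [htr] at h0'
  rw [hsq, htr, htr] at h1'
  have hdet : (Q : Matrix (Fin 3) (Fin 3) ℝ).det * (Q : Matrix (Fin 3) (Fin 3) ℝ).det = 1 := by
    rcases O3_det Q with h | h <;> rw [h] <;> norm_num
  rw [Matrix.det_mul, Matrix.det_mul, Matrix.det_transpose, mul_right_comm, hdet, one_mul] at h2'
  fin_cases i
  · exact h0'.trans h0.symm
  · exact mul_left_cancel₀ (two_ne_zero (α := ℝ)) (h1'.trans h1.symm)
  · exact h2'.trans h2.symm

/-- The coordinates of a diagonal matrix. -/
def diagPoint (d : Fin 3 → ℝ) : Fin 6 → ℝ := ![d 0, d 1, d 2, 0, 0, 0]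

theorem symTensor_diagPoint (d : Fin 3 → ℝ) : symTensor (diagPoint d) = Matrix.diagonal d := by
  rw [symTensor_eq]
  ext i j
  fin_cases i <;> fin_cases j <;> simp [diagPoint]

theorem eq_diagPoint {x : Fin 6 → ℝ} {d : Fin 3 → ℝ} (h : symTensor x = Matrix.diagonal d) : x = diagPoint d := by
  funext α
  rw [← trace_kelvinCoeff_mul_symTensor x, h, ← symTensor_diagPoint, trace_kelvinCoeff_mul_symTensor]

/-- Every symmetric tensor is conjugate to a diagonal one. -/
theorem exists_diagPoint (x : Fin 6 → ℝ) :
    ∃ (Q : O3) (d : Fin 3 → ℝ), kelvin (Q : Matrix (Fin 3) (Fin 3) ℝ) *ᵥ x = diagPoint d := by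
  have hx : (symTensor x).IsHermitian := by
    rw [Matrix.IsHermitian, Matrix.conjTranspose_eq_transpose_of_trivial, symTensor_transpose]
  let Q : O3 := hx.eigenvectorUnitary
  have hs : ∃ d : Fin 3 → ℝ, symTensor x = (Q : Matrix (Fin 3) (Fin 3) ℝ) * Matrix.diagonal d
      * (Q : Matrix (Fin 3) (Fin 3) ℝ)ᵀ := by
    refine ⟨hx.eigenvalues, hx.spectral_theorem.trans ?_⟩
    rw [Unitary.conjStarAlgAut_apply, Matrix.star_eq_conjTranspose,
      Matrix.conjTranspose_eq_transpose_of_trivial]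
    rfl
  obtain ⟨d, hd⟩ := hs
  have hinv : ((Q⁻¹ : O3) : Matrix (Fin 3) (Fin 3) ℝ) = (Q : Matrix (Fin 3) (Fin 3) ℝ)ᵀ := rfl
  refine ⟨Q⁻¹, d, eq_diagPoint ?_⟩
  rw [symTensor_kelvin_mulVec, hinv, Matrix.transpose_transpose, hd]
  calc _ = (Q : Matrix (Fin 3) (Fin 3) ℝ)ᵀ * Q * Matrix.diagonal d
        * ((Q : Matrix (Fin 3) (Fin 3) ℝ)ᵀ * Q) := by simp only [Matrix.mul_assoc]
    _ = _ := by rw [O3_transpose_mul, Matrix.one_mul, Matrix.mul_one]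

theorem IsIsotropic.eval_kelvin {f : Poly} (hf : IsIsotropic f) (Q : O3) (x : Fin 6 → ℝ) :
    eval (kelvin (Q : Matrix (Fin 3) (Fin 3) ℝ) *ᵥ x) f = eval x f := by
  rw [← eval_linSubst, hf Q]

theorem IsIsotropic.ext {f g : Poly} (hf : IsIsotropic f) (hg : IsIsotropic g)
    (h : ∀ d, eval (diagPoint d) f = eval (diagPoint d) g) : f = g := by
  refine MvPolynomial.funext fun x => ?_
  obtain ⟨Q, d, hd⟩ := exists_diagPoint x
  rw [← hf.eval_kelvin Q, ← hg.eval_kelvin Q, hd, h]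

/-- The matrix of a permutation of the axes. -/
def permO3 (σ : Equiv.Perm (Fin 3)) : O3 :=
  ⟨(1 : Matrix (Fin 3) (Fin 3) ℝ).submatrix σ id, by
    rw [Matrix.mem_orthogonalGroup_iff]
    ext i j
    simp [Matrix.mul_apply, Matrix.one_apply]⟩

theorem kelvin_permO3_mulVec (σ : Equiv.Perm (Fin 3)) (d : Fin 3 → ℝ) :
    kelvin (permO3 σ : Matrix (Fin 3) (Fin 3) ℝ) *ᵥ diagPoint d = diagPoint (d ∘ σ) := by
  refine eq_diagPoint ?_
  rw [symTensor_kelvin_mulVec, symTensor_diagPoint]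
  ext i j
  simp [permO3, Matrix.mul_apply, Matrix.diagonal, Matrix.one_apply]
  split_ifs with h
  · rw [h]
  · rfl

/-- The restriction of a polynomial to the diagonal matrices. -/
def diagRestrict : Poly →ₐ[ℝ] MvPolynomial (Fin 3) ℝ := aeval ![X 0, X 1, X 2, 0, 0, 0]

theorem eval_diagRestrict (f : Poly) (d : Fin 3 → ℝ) : eval d (diagRestrict f) = eval (diagPoint d) f := by
  rw [diagRestrict, ← coe_aeval_eq_eval, ← coe_aeval_eq_eval]
  simp only [RingHom.coe_coe]
  rw [← AlgHom.comp_apply, comp_aeval]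
  congr 2
  funext i
  fin_cases i <;> simp [diagPoint]

theorem diagRestrict_sphP (i : Fin 3) : diagRestrict (sphP i) = esymm (Fin 3) ℝ (i + 1) := by
  have h1 : Finset.powersetCard 1 (Finset.univ : Finset (Fin 3)) = {{0}, {1}, {2}} := by decide
  have h2 : Finset.powersetCard 2 (Finset.univ : Finset (Fin 3)) = {{0, 1}, {1, 2}, {0, 2}} := by decide
  have h3 : Finset.powersetCard 3 (Finset.univ : Finset (Fin 3)) = {{0, 1, 2}} := by decide
  have hsum : ∑ s ∈ ({{0, 1}, {1, 2}, {0, 2}} : Finset (Finset (Fin 3))), ∏ i ∈ s, (X i : MvPolynomial (Fin 3) ℝ) =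
      X 0 * X 1 + (X 1 * X 2 + X 0 * X 2) := by
    rw [Finset.sum_insert (by decide), Finset.sum_insert (by decide), Finset.sum_singleton,
      Finset.prod_pair (by decide), Finset.prod_pair (by decide), Finset.prod_pair (by decide)]
  refine MvPolynomial.funext fun d => ?_
  rw [eval_diagRestrict, sphP, eval_cubicPoly]
  fin_cases i <;>
    simp [diagPoint, primSph, toPoly_add', toPoly_mul', toPoly_sub', toPoly_int, toPoly_var, x0, x1, x2, x3, x4, x5,
      esymm, h1, h2, h3, hsum, -map_sum, -map_prod, Finset.prod_insert, Finset.sum_insert] <;>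
    ring

/-- The restriction of an isotropic polynomial to the diagonal matrices is symmetric, hence a polynomial in the
elementary symmetric functions, and it determines the polynomial. -/
theorem exists_of_isIsotropic {f : Poly} (hf : IsIsotropic f) : ∃ c : MvPolynomial (Fin 3) ℝ, f = aeval sphP c := by
  have hsym : (diagRestrict f).IsSymmetric := by
    intro σ
    refine MvPolynomial.funext fun d => ?_
    rw [eval_rename, eval_diagRestrict, eval_diagRestrict, ← kelvin_permO3_mulVec, hf.eval_kelvin]
  obtain ⟨c, hc⟩ := (esymmAlgHom_fin_bijective ℝ 3).2 ⟨diagRestrict f, hsym⟩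
  have hc' : aeval (fun i : Fin 3 => esymm (Fin 3) ℝ (i + 1)) c = diagRestrict f := by
    rw [← esymmAlgHom_apply, hc]
  refine ⟨c, hf.ext (fun Q => ?_) fun d => ?_⟩
  · rw [← AlgHom.comp_apply, comp_aeval]
    simp only [isIsotropic_sphP _ Q]
  · rw [← eval_diagRestrict, ← eval_diagRestrict, ← hc']
    congr 1
    rw [← AlgHom.comp_apply, comp_aeval]
    simp only [diagRestrict_sphP]

/-- The spherical groups have the same invariants, because `-1` acts trivially. -/
theorem isIsotropic_iff_of_subset {S : Set O3} (hS : allZ ∪ allX ⊆ S) {f : Poly} :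
    f ∈ invariantRing (grp S) ↔ IsIsotropic f := by
  refine ⟨fun h Q => ?_, fun h => mem_invariantRing.2 fun Q _ => h Q⟩
  have hrot : ∀ Q : O3, (Q : Matrix (Fin 3) (Fin 3) ℝ).det = 1 →
      linSubst (kelvin (Q : Matrix (Fin 3) (Fin 3) ℝ)) f = f := by
    intro Q hQ
    obtain ⟨α, β, φ, rfl⟩ := exists_euler Q hQ
    have hZ : ∀ φ, rotZ φ ∈ grp S := fun φ => Subgroup.subset_closure (hS (Or.inl (rotZ_mem_allZ φ)))
    have hX : ∀ φ, rotX φ ∈ grp S := fun φ => Subgroup.subset_closure (hS (Or.inr (rotX_mem_allX φ)))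
    exact mem_invariantRing.1 h _ (Subgroup.mul_mem _ (Subgroup.inv_mem _ (Subgroup.mul_mem _ (hX β) (hZ α))) (hZ φ))
  rcases O3_det Q with hQ | hQ
  · exact hrot Q hQ
  · have := hrot (-Q) (by rw [neg_coe, Matrix.det_neg, hQ, Fintype.card_fin]; norm_num)
    rwa [neg_coe, kelvin_neg] at this

theorem compactSpace_of_spherical {S : Set O3} (hS : allZ ∪ allX ⊆ S) : CompactSpace (grp S) := by
  refine compactSpace_of_cover (F := {1, -1})
    (C := (fun x : ℝ × ℝ × ℝ => (rotX x.2.1 * rotZ x.1)⁻¹ * rotZ x.2.2) ''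
      (Set.Icc 0 (2 * Real.pi) ×ˢ Set.Icc 0 (2 * Real.pi) ×ˢ Set.Icc 0 (2 * Real.pi)))
    ((isCompact_Icc.prod (isCompact_Icc.prod isCompact_Icc)).image ?_) ?_ (by simp) fun Q _ => ?_
  · exact ((continuous_rotX.comp (by fun_prop)).mul (continuous_rotZ.comp (by fun_prop))).inv.mul
      (continuous_rotZ.comp (by fun_prop))
  · rintro _ ⟨x, -, rfl⟩
    have hZ : ∀ φ, rotZ φ ∈ grp S := fun φ => Subgroup.subset_closure (hS (Or.inl (rotZ_mem_allZ φ)))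
    have hX : ∀ φ, rotX φ ∈ grp S := fun φ => Subgroup.subset_closure (hS (Or.inr (rotX_mem_allX φ)))
    exact Subgroup.mul_mem _ (Subgroup.inv_mem _ (Subgroup.mul_mem _ (hX _) (hZ _))) (hZ _)
  · have hrot : ∀ Q : O3, (Q : Matrix (Fin 3) (Fin 3) ℝ).det = 1 →
        Q ∈ (fun x : ℝ × ℝ × ℝ => (rotX x.2.1 * rotZ x.1)⁻¹ * rotZ x.2.2) ''
          (Set.Icc 0 (2 * Real.pi) ×ˢ Set.Icc 0 (2 * Real.pi) ×ˢ Set.Icc 0 (2 * Real.pi)) := by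
      intro Q hQ
      obtain ⟨α, β, φ, rfl⟩ := exists_euler Q hQ
      obtain ⟨α', hα, h1⟩ := exists_mem_Icc_rotZ α
      obtain ⟨β', hβ, h2⟩ := exists_mem_Icc_rotX β
      obtain ⟨φ', hφ, h3⟩ := exists_mem_Icc_rotZ φ
      exact ⟨(α', β', φ'), ⟨hα, hβ, hφ⟩, by simp only [h1, h2, h3]⟩
    rcases O3_det Q with hQ | hQ
    · exact ⟨Q, hrot Q hQ, 1, by simp, by simp⟩
    · exact ⟨-Q, hrot (-Q) (by rw [neg_coe, Matrix.det_neg, hQ, Fintype.card_fin]; norm_num), -1, by simp, by simp⟩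

theorem isFreeBasis_of_spherical {S : Set O3} (hS : allZ ∪ allX ⊆ S) :
    IsFreeBasis (grp S) sphP ![1] ![1, 2, 3] ![0] where
  one_le i := by fin_cases i <;> simp
  memP i := (isIsotropic_iff_of_subset hS).2 (isIsotropic_sphP i)
  memS j := by
    fin_cases j
    exact Subalgebra.one_mem _
  homP i := isHomogeneous_cubicPoly (by fin_cases i <;> rfl)
  homS j := by
    fin_cases j
    exact isHomogeneous_one _ _
  ind c hc := by
    refine independent_of_fiberCheck cubicForms_mul_cubicVectors (P := primSph) (S := [int 1])
      (pts := [intPoint [1, 2, 3, 0, 0, 0]]) (by decide +kernel) c ?_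
    rw [← hc]
    refine Finset.sum_congr rfl fun j _ => ?_
    congr 1
    change Fin 1 at j
    fin_cases j
    simp [toPoly_int]
  span f hf := by
    obtain ⟨c, h⟩ := exists_of_isIsotropic ((isIsotropic_iff_of_subset hS).1 hf)
    exact ⟨![c], by rw [h]; simp⟩

theorem infiniteRow_of_spherical {S : Set O3} (hS : allZ ∪ allX ⊆ S) :
    InfiniteRow (grp S) 1 [1, 2, 3] [1, 1, 2, 3, 4, 5, 7, 8] 3 1 3 := by
  refine infiniteRow_of_hilbertRow
    (infinite_of_allZ_subset ((Set.subset_union_left.trans hS).trans Subgroup.subset_closure))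
    (compactSpace_of_spherical hS) ?_
  refine (isFreeBasis_of_spherical hS).hilbertRow (j₀ := 0) rfl ∅ (by simp) (fun j => ?_) (by simp)
      (by rfl) rfl (by decide) (e := 2) rfl (by simp) (fun i => Or.inl ?_) (fun i hi => ?_)
  · fin_cases j
    exact Subalgebra.one_mem _
  · fin_cases i <;> simp
  · exact absurd hi (Finset.notMem_empty i)

theorem infiniteRows_K : ∀ G ∈ [TensorInvariants.K, TensorInvariants.Kh], InfiniteRow G
      1 [1, 2, 3] [1, 1, 2, 3, 4, 5, 7, 8] 3 1 3 := by
  simp only [List.forall_mem_cons, List.not_mem_nil, false_implies, implies_true, and_true]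
  exact ⟨infiniteRow_of_spherical subset_rfl,
    infiniteRow_of_spherical (by rw [Set.union_assoc]; exact Set.subset_union_right)⟩

end Spherical

end

end TensorInvariants

open TensorInvariants Polynomial in
theorem mainTheorem4 :
    (∀ G ∈ [C1, Ci], FiniteRow G
      1 [1, 1, 1, 1, 1, 1]
      [1, 6, 21, 56, 126, 252, 462, 792] 6 1 6) ∧
    (∀ G ∈ [C2, C1h, C2h], FiniteRow G
      (1 + X ^ 2) [1, 1, 1, 1, 2, 2]
      [1, 4, 13, 32, 70, 136, 246, 416] 6 2 7) ∧
    (∀ G ∈ [D2, C2v, D2h], FiniteRow G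
      (1 + X ^ 3) [1, 1, 1, 2, 2, 2]
      [1, 3, 9, 20, 42, 78, 138, 228] 6 2 7) ∧
    (∀ G ∈ [C4, C2i, C4h], FiniteRow G
      (1 + X ^ 2 + 4 * X ^ 3 + X ^ 4 + X ^ 6) [1, 1, 2, 2, 2, 4]
      [1, 2, 7, 16, 36, 68, 124, 208] 6 8 12) ∧
    (∀ G ∈ [D4, C4v, D2d, D4h], FiniteRow G
      (1 + 2 * X ^ 3 + X ^ 6) [1, 1, 2, 2, 2, 4]
      [1, 2, 6, 12, 25, 44, 77, 124] 6 4 8) ∧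
    (∀ G ∈ [C3, C3i], FiniteRow G
      (1 + 2 * X ^ 2 + 6 * X ^ 3 + 2 * X ^ 4 + X ^ 6) [1, 1, 2, 2, 3, 3]
      [1, 2, 7, 20, 42, 84, 156, 264] 6 12 14) ∧
    (∀ G ∈ [D3, C3v, D3d], FiniteRow G
      (1 + X ^ 2 + 2 * X ^ 3 + X ^ 4 + X ^ 6) [1, 1, 2, 2, 3, 3]
      [1, 2, 6, 14, 28, 52, 93, 152] 6 6 9) ∧
    (∀ G ∈ [C6, C3h, C6h], FiniteRow G
      (1 + 3 * X ^ 3 + 2 * X ^ 4 + 2 * X ^ 5 + 3 * X ^ 6 + X ^ 9) [1, 1, 2, 2, 3, 6]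
      [1, 2, 5, 12, 24, 46, 84, 140] 6 12 14) ∧
    (∀ G ∈ [D6, C6v, D3h, D6h], FiniteRow G
      (1 + X ^ 3 + X ^ 4 + X ^ 5 + X ^ 6 + X ^ 9) [1, 1, 2, 2, 3, 6]
      [1, 2, 5, 10, 19, 33, 57, 90] 6 6 9) ∧
    (∀ G ∈ [T, Th], FiniteRow G
      (1 + 3 * X ^ 3 + 2 * X ^ 4 + 2 * X ^ 5 + 3 * X ^ 6 + X ^ 9) [1, 2, 2, 3, 3, 4]
      [1, 1, 3, 8, 14, 26, 48, 76] 6 12 14) ∧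
    (∀ G ∈ [O, Td, Oh], FiniteRow G
      (1 + X ^ 3 + X ^ 4 + X ^ 5 + X ^ 6 + X ^ 9) [1, 2, 2, 3, 3, 4]
      [1, 1, 3, 6, 11, 18, 32, 48] 6 6 9) ∧
    (∀ G ∈ [Cinf, CinfH], InfiniteRow G
      (1 + X ^ 3) [1, 1, 2, 2, 3]
      [1, 2, 5, 10, 18, 30, 48, 72] 5 2 6) ∧
    (∀ G ∈ [Dinf, CinfV, DinfH], InfiniteRow G
      1 [1, 1, 2, 2, 3]
      [1, 2, 5, 9, 16, 25, 39, 56] 5 1 5) ∧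
    (∀ G ∈ [K, Kh], InfiniteRow G
      1 [1, 2, 3]
      [1, 1, 2, 3, 4, 5, 7, 8] 3 1 3) ∧
    (∀ G ∈ [I, Ih], FiniteRow G
      (1 + X ^ 5 + 2 * X ^ 6 + X ^ 7 + X ^ 12) [1, 2, 3, 3, 4, 5]
      [1, 1, 2, 4, 6, 10, 17, 24] 6 6 10) := by
  refine ⟨finiteRows_C1, finiteRows_C2, finiteRows_D2, finiteRows_C4, finiteRows_D4, finiteRows_C3, finiteRows_D3,
    finiteRows_C6, finiteRows_D6, finiteRows_T, finiteRows_O, infiniteRows_Cinf, infiniteRows_Dinf, infiniteRows_K,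
    finiteRows_I⟩
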